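/- Let $\pi\colon E\to M$ be a smooth real vector bundle of finite rank over a finite-dimensional smooth manifold $M$ (Hausdorff, second countable, without boundary), $\operatorname{Ver}(E)=\ker T\pi\subseteq TE$, and $\mathfrak X_{\mathrm{ver}}^k(E)=\Gamma^\infty(\Lambda^k\operatorname{Ver}(E))$ the vertical $k$-vector fields. All functions are real valued. For a commutative algebra $A=C^\infty(N)$ let $\mathrm{HC}^k_{\mathrm{diff}}(A)$ be the space of $k$-differential operators $\phi\colon A^k\to A$ (multilinear, of finite order in each argument), with the cup product $(\phi\cup\psi)(f_1,\dots,f_{m+n})=\phi(f_1,\dots,f_m)\,\psi(f_{m+1},\dots,f_{m+n})$, the Gerstenhaber bracket $[\phi,\psi]=\phi\circ\psi-(-1)^{(m-1)(n-1)}\psi\circ\phi$, where $\phi\circ\psi=\sum_{i=0}^{m-1}(-1)^{(n-1)i}\,\phi\circ_i\psi$ and $\phi\circ_i\psi$ inserts $\psi$ into the argument of $\phi$ preceded by $i$ others, and the Hochschild differential $$(\delta\phi)(f_0,\dots,f_k)=f_0\,\phi(f_1,\dots,f_k)+\sum_{i=0}^{k-1}(-1)^{i+1}\phi(f_0,\dots,f_if_{i+1},\dots,f_k)+(-1)^{k+1}\phi(f_0,\dots,f_{k-1})f_k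 .$$ Let $\mathrm{HH}^\bullet_{\mathrm{diff}}(A)$ be its cohomology. Let $\mathrm{HC}^k_{\mathrm{diff,ver}}(C^\infty(E))\subseteq \mathrm{HC}^k_{\mathrm{diff}}(C^\infty(E))$ be the vertical cochains, i.e. those with $\phi(f_1,\dots,\pi^*u\,f_i,\dots,f_k)=\pi^*u\,\phi(f_1,\dots,f_k)$ for all $u\in C^\infty(M)$ and all $i$, and $\mathrm{HH}^\bullet_{\mathrm{diff,ver}}(C^\infty(E))$ the cohomology of this subcomplex. The HKR map sends a $k$-vector field $X$ to $$\mathrm U^{(1)}(X)(f_1,\dots,f_k)=\frac1{k!}\,\langle X,\mathrm df_1\otimes\cdots\otimes\mathrm df_k\rangle ;$$ $\mathrm U^{(1)}_{\mathrm{ver}}$ is its restriction to vertical multivector fields on $E$, and $\mathrm U^{(1)}_p$ is the HKR map of the manifold $E_p=\pi^{-1}(p)$. Both take values in (vertical, resp. all) differential cocycles. A Gerstenhaber algebra is a graded commutative associative unital algebra with a graded Lie bracket of degree $-1$ satisfying $[a b,c]=[a,c]\,b+(-1)^{|a|(|c|-1)}a\,[b,c]$. Multivector fields carry $\wedge$ and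 the Schouten bracket, in the sign convention of this Leibniz rule (the graded commutator of antisymmetric multiderivations, with $[X,f]=X(f)$ and $[X,Y]$ the Lie bracket for vector fields $X,Y$ and functions $f$). **Theorem (vertical Hochschild-Kostant-Rosenberg theorem).** 1. With $\wedge$ and the Schouten bracket $\mathfrak X^\bullet_{\mathrm{ver}}(E)$ is a Gerstenhaber algebra; $\cup$ and $[\cdot,\cdot]$ descend to $\mathrm{HH}^\bullet_{\mathrm{diff,ver}}(C^\infty(E))$ and make it a Gerstenhaber algebra; and $\mathrm U^{(1)}_{\mathrm{ver}}$ induces an isomorphism of Gerstenhaber algebras $$\mathfrak X^\bullet_{\mathrm{ver}}(E)\longrightarrow \mathrm{HH}^\bullet_{\mathrm{diff,ver}}(C^\infty(E)).$$ 2. Let $p\in M$ and let $\iota_p\colon E_p\to E$ be the inclusion. Every vertical multivector field $X$ has a unique restriction $\iota_p^*X\in\mathfrak X^\bullet(E_p)$ (equal to $X$ on $E_p$ under $T_v(E_p)\cong\operatorname{Ver}_v(E)$), and every vertical differential cochain $\phi$ has a unique restriction $\iota_p^*\phi\in \mathrm{HC}^\bullet_{\mathrm{diff}}(C^\infty(E_p))$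 with $(\iota_p^*\phi)(\iota_p^*f_1,\dots,\iota_p^*f_k)=\iota_p^*(\phi(f_1,\dots,f_k))$. These maps are linear, $\iota_p^*$ on cochains is compatible with $\delta$, $\cup$ and $[\cdot,\cdot]$, and thus induces $\iota_p^*\colon \mathrm{HH}^\bullet_{\mathrm{diff,ver}}(C^\infty(E))\to \mathrm{HH}^\bullet_{\mathrm{diff}}(C^\infty(E_p))$. One has $$\iota_p^*\circ \mathrm U^{(1)}_{\mathrm{ver}}=\mathrm U^{(1)}_p\circ\iota_p^*$$ on $\mathfrak X^\bullet_{\mathrm{ver}}(E)$, as cochains and in cohomology. Moreover $\mathfrak X^\bullet(E_p)$ and $\mathrm{HH}^\bullet_{\mathrm{diff}}(C^\infty(E_p))$ are Gerstenhaber algebras with the operations above, and all four maps of the resulting square $$\begin{array}{ccc}\mathfrak X^\bullet_{\mathrm{ver}}(E)&\xrightarrow{\ \mathrm U^{(1)}_{\mathrm{ver}}\ }&\mathrm{HH}^\bullet_{\mathrm{diff,ver}}(C^\infty(E))\\ {\scriptstyle\iota_p^*}\downarrow&&\downarrow{\scriptstyle\iota_p^*}\\ \mathfrak X^\bullet(E_p)&\xrightarrow{\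 \mathrm U^{(1)}_p\ }&\mathrm{HH}^\bullet_{\mathrm{diff}}(C^\infty(E_p))\end{array}$$ are homomorphisms of Gerstenhaber algebras. -/

import Mathlib

open scoped Manifold ContDiff DirectSum TensorProduct

noncomputable section

namespace VerticalHKR

/-! ### Gerstenhaber algebras -/

/-- A Gerstenhaber algebra structure over `ℝ` on the graded vector space `⨁ k, A k`: an associative
graded commutative unital product of degree `0` and a graded Lie bracket of degree `-1` which is a
graded derivation of the product. The signs are those of Gerstenhaber:
`[a ∧ b, c] = [a, c] ∧ b + (-1)^{|a| (|c| - 1)} a ∧ [b, c]`. -/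
structure GerstenhaberAlgebra (A : ℕ → Type*) [∀ k, AddCommGroup (A k)]
    [∀ k, Module ℝ (A k)] where
  one : A 0
  mul : (⨁ k, A k) →ₗ[ℝ] (⨁ k, A k) →ₗ[ℝ] (⨁ k, A k)
  bracket : (⨁ k, A k) →ₗ[ℝ] (⨁ k, A k) →ₗ[ℝ] (⨁ k, A k)
  mul_mem : ∀ (m n : ℕ) (a : A m) (b : A n), ∃ c : A (m + n),
    mul (DirectSum.lof ℝ ℕ A m a) (DirectSum.lof ℝ ℕ A n b) = DirectSum.lof ℝ ℕ A (m + n) c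
  bracket_mem : ∀ (m n p : ℕ), m + n = p + 1 → ∀ (a : A m) (b : A n), ∃ c : A p,
    bracket (DirectSum.lof ℝ ℕ A m a) (DirectSum.lof ℝ ℕ A n b) = DirectSum.lof ℝ ℕ A p c
  bracket_zero_zero : ∀ a b : A 0,
    bracket (DirectSum.lof ℝ ℕ A 0 a) (DirectSum.lof ℝ ℕ A 0 b) = 0
  one_mul : ∀ a, mul (DirectSum.lof ℝ ℕ A 0 one) a = a
  mul_assoc : ∀ a b c, mul (mul a b) c = mul a (mul b c)
  mul_comm : ∀ (m n : ℕ) (a : A m) (b : A n),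
    mul (DirectSum.lof ℝ ℕ A m a) (DirectSum.lof ℝ ℕ A n b) =
      (-1 : ℝ) ^ (m * n) • mul (DirectSum.lof ℝ ℕ A n b) (DirectSum.lof ℝ ℕ A m a)
  bracket_antisymm : ∀ (m n : ℕ) (a : A m) (b : A n),
    bracket (DirectSum.lof ℝ ℕ A m a) (DirectSum.lof ℝ ℕ A n b) =
      -((-1 : ℝ) ^ ((m + 1) * (n + 1)) •
        bracket (DirectSum.lof ℝ ℕ A n b) (DirectSum.lof ℝ ℕ A m a))
  jacobi : ∀ (m n : ℕ) (a : A m) (b : A n) (c : ⨁ k, A k),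
    bracket (DirectSum.lof ℝ ℕ A m a) (bracket (DirectSum.lof ℝ ℕ A n b) c) =
      bracket (bracket (DirectSum.lof ℝ ℕ A m a) (DirectSum.lof ℝ ℕ A n b)) c +
        (-1 : ℝ) ^ ((m + 1) * (n + 1)) •
          bracket (DirectSum.lof ℝ ℕ A n b) (bracket (DirectSum.lof ℝ ℕ A m a) c)
  leibniz : ∀ (m p : ℕ) (a : A m) (b : ⨁ k, A k) (c : A p),
    bracket (mul (DirectSum.lof ℝ ℕ A m a) b) (DirectSum.lof ℝ ℕ A p c) =
      mul (bracket (DirectSum.lof ℝ ℕ A m a) (DirectSum.lof ℝ ℕ A p c)) b +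
        (-1 : ℝ) ^ (m * (p + 1)) •
          mul (DirectSum.lof ℝ ℕ A m a) (bracket b (DirectSum.lof ℝ ℕ A p c))

/-- A family of linear maps `u k : A k → B k` is a homomorphism of Gerstenhaber algebras: it is
compatible with units, products and brackets. -/
structure IsGerstenhaberHom {A B : ℕ → Type*} [∀ k, AddCommGroup (A k)] [∀ k, Module ℝ (A k)]
    [∀ k, AddCommGroup (B k)] [∀ k, Module ℝ (B k)]
    (G : GerstenhaberAlgebra A) (G' : GerstenhaberAlgebra B) (u : ∀ k, A k →ₗ[ℝ] B k) : Prop where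
  map_one : u 0 G.one = G'.one
  map_mul : ∀ a b, DirectSum.lmap u (G.mul a b) =
    G'.mul (DirectSum.lmap u a) (DirectSum.lmap u b)
  map_bracket : ∀ a b, DirectSum.lmap u (G.bracket a b) =
    G'.bracket (DirectSum.lmap u a) (DirectSum.lmap u b)

/-! ### Differential Hochschild cochains of a commutative algebra -/

section Hochschild

variable {A : Type*}

/-- The arguments of `φ` in the partial composition `φ ∘ᵢ ψ`. -/
def insertArgs {m n p : ℕ} (h : m + n = p + 1) (i : Fin m) (ψ : (Fin n → A) → A)
    (f : Fin p → A) (j : Fin m) : A :=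
  if hlt : j < i then f ⟨j, by omega⟩
  else if heq : j = i then ψ (fun t => f ⟨i + t, by omega⟩)
  else f ⟨j + n - 1, by omega⟩

theorem insertArgs_update {m n p : ℕ} (h : m + n = p + 1) (i : Fin m) (ψ : (Fin n → A) → A)
    (f : Fin p → A) (s : Fin p) :
    (∃ t : Fin n, (s : ℕ) = i + t ∧ ∀ x, insertArgs h i ψ (Function.update f s x) =
      Function.update (insertArgs h i ψ f) i
        (ψ (Function.update (fun t : Fin n => f ⟨i + t, by omega⟩) t x))) ∨
    (∃ j : Fin m, j ≠ i ∧ ∀ x, insertArgs h i ψ (Function.update f s x) =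
      Function.update (insertArgs h i ψ f) j x) := by
  by_cases h1 : (s : ℕ) < i
  · refine Or.inr ⟨⟨s, by omega⟩, by simp [Fin.ext_iff]; omega, fun x => ?_⟩
    funext j
    simp only [insertArgs, Function.update_apply, Fin.ext_iff, Fin.lt_def]
    have h0 : ∀ t : Fin n, ¬ ((i : ℕ) + t = s) := fun t => by omega
    simp only [h0, if_false]
    grind
  · by_cases h2 : (s : ℕ) < i + n
    · refine Or.inl ⟨⟨s - i, by omega⟩, by simp; omega, fun x => ?_⟩
      funext j
      have h0 : ∀ t : Fin n, ((i : ℕ) + t = s) ↔ (t : ℕ) = s - i := fun t => by omega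
      simp only [insertArgs, Function.update_apply, Fin.ext_iff, Fin.lt_def]
      split_ifs <;> first | rfl | omega | skip
      congr 1
      funext t
      simp only [Function.update_apply, Fin.ext_iff, h0]
    · refine Or.inr ⟨⟨s - n + 1, by omega⟩, by simp [Fin.ext_iff]; omega, fun x => ?_⟩
      funext j
      have h0 : ∀ t : Fin n, ¬ ((i : ℕ) + t = s) := fun t => by omega
      simp only [insertArgs, Function.update_apply, Fin.ext_iff, Fin.lt_def, h0, if_false]
      split_ifs <;> first | rfl | omega

variable [CommRing A] [Algebra ℝ A]

variable (A) in
/-- `ℝ`-multilinear maps `A × ⋯ × A → A` in `k` arguments. -/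
abbrev Cochain (k : ℕ) := MultilinearMap ℝ (fun _ : Fin k => A) A

/-- `D` is a differential operator of order `≤ r` on the commutative algebra `A`: a differential
operator of order `≤ 0` commutes with all multiplication operators, and `D` is of order `≤ r + 1`
iff all its commutators with multiplication operators are of order `≤ r`. -/
def IsDiffOp : ℕ → (A →ₗ[ℝ] A) → Prop
  | 0, D => ∀ a : A, D ∘ₗ LinearMap.mulLeft ℝ a - LinearMap.mulLeft ℝ a ∘ₗ D = 0
  | r + 1, D => ∀ a : A, IsDiffOp r (D ∘ₗ LinearMap.mulLeft ℝ a - LinearMap.mulLeft ℝ a ∘ₗ D)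

/-- `φ` is a `k`-differential operator of some multi-order `R = (R 0, …, R (k - 1))`: in the `i`-th
argument, for arbitrary fixed other arguments, it is a differential operator of order `≤ R i`. -/
def IsMultiDiffOp {k : ℕ} (φ : Cochain A k) : Prop :=
  ∃ R : Fin k → ℕ, ∀ (i : Fin k) (f : Fin k → A), IsDiffOp (R i) (φ.toLinearMap f i)

/-- `φ` is linear over the elements of `S` in every argument. -/
def IsLinearOver (S : Set A) {k : ℕ} (φ : Cochain A k) : Prop :=
  ∀ s ∈ S, ∀ (i : Fin k) (f : Fin k → A), φ (Function.update f i (s * f i)) = s * φ f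

/-! #### Cup product, partial compositions, Hochschild differential, Gerstenhaber bracket -/

/-- The cup product `(φ ∪ ψ)(f₁, …, f_{m+n}) = φ(f₁, …, f_m) ψ(f_{m+1}, …, f_{m+n})`. -/
def cup {m n p : ℕ} (h : m + n = p) (φ : Cochain A m) (ψ : Cochain A n) : Cochain A p :=
  ((LinearMap.mul' ℝ A).compMultilinearMap (φ.domCoprod ψ)).domDomCongr
    (finSumFinEquiv.trans (finCongr h))

theorem cup_apply {m n p : ℕ} (h : m + n = p) (φ : Cochain A m) (ψ : Cochain A n)
    (f : Fin p → A) :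
    cup h φ ψ f = φ (fun i => f ⟨i, by omega⟩) * ψ (fun j => f ⟨m + j, by omega⟩) := rfl

/-- The partial composition
`(φ ∘ᵢ ψ)(f₀, …, f_{p-1}) = φ(f₀, …, f_{i-1}, ψ(f_i, …, f_{i+n-1}), f_{i+n}, …, f_{p-1})`. -/
def insertAt {m n p : ℕ} (h : m + n = p + 1) (i : Fin m) (φ : Cochain A m) (ψ : Cochain A n) :
    Cochain A p :=
  MultilinearMap.mk' (fun f => φ (insertArgs h i ψ f))
    (by
      intro f s x y
      rcases insertArgs_update h i ψ f s with ⟨t, -, ht⟩ | ⟨j, -, hj⟩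
      · simp only [ht, MultilinearMap.map_update_add]
      · simp only [hj, MultilinearMap.map_update_add])
    (by
      intro f s c x
      rcases insertArgs_update h i ψ f s with ⟨t, -, ht⟩ | ⟨j, -, hj⟩
      · simp only [ht, MultilinearMap.map_update_smul]
      · simp only [hj, MultilinearMap.map_update_smul])

theorem insertAt_apply {m n p : ℕ} (h : m + n = p + 1) (i : Fin m) (φ : Cochain A m)
    (ψ : Cochain A n) (f : Fin p → A) : insertAt h i φ ψ f = φ (insertArgs h i ψ f) := rfl

variable (A) in
/-- The identity as a `1`-cochain. -/
def idCochain : Cochain A 1 := MultilinearMap.ofSubsingleton ℝ A A 0 LinearMap.id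

variable (A) in
/-- The product of `A` as a `2`-cochain. -/
def mulCochain : Cochain A 2 := cup rfl (idCochain A) (idCochain A)

/-- The Hochschild differential `(δφ)(f₀, …, f_k) = f₀ φ(f₁, …, f_k)
+ ∑_{i<k} (-1)^{i+1} φ(f₀, …, f_i f_{i+1}, …, f_k) + (-1)^{k+1} φ(f₀, …, f_{k-1}) f_k`. -/
def hochschildD {k : ℕ} (φ : Cochain A k) : Cochain A (k + 1) :=
  cup (by omega) (idCochain A) φ
    + ∑ i : Fin k, (-1 : ℝ) ^ ((i : ℕ) + 1) • insertAt (by omega) i φ (mulCochain A)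
    + (-1 : ℝ) ^ (k + 1) • cup rfl φ (idCochain A)

/-- The Gerstenhaber composition `φ ∘ ψ = ∑_i (-1)^{(n-1) i} φ ∘ᵢ ψ` of an `m`-cochain and an
`n`-cochain. -/
def circ {m n p : ℕ} (h : m + n = p + 1) (φ : Cochain A m) (ψ : Cochain A n) : Cochain A p :=
  ∑ i : Fin m, (-1 : ℝ) ^ ((n + 1) * (i : ℕ)) • insertAt h i φ ψ

/-- The Gerstenhaber bracket `[φ, ψ] = φ ∘ ψ - (-1)^{(m-1)(n-1)} ψ ∘ φ`. -/
def gBracket {m n p : ℕ} (h : m + n = p + 1) (φ : Cochain A m) (ψ : Cochain A n) : Cochain A p :=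
  circ h φ ψ - (-1 : ℝ) ^ ((m + 1) * (n + 1)) • circ (by omega) ψ φ

/-! #### Closure of differential cochains under these operations -/

theorem IsDiffOp.zero (r : ℕ) : IsDiffOp r (0 : A →ₗ[ℝ] A) := by
  induction r with
  | zero => intro a; simp
  | succ r ih => intro a; simpa using ih

theorem IsDiffOp.add {r : ℕ} : ∀ {D E : A →ₗ[ℝ] A}, IsDiffOp r D → IsDiffOp r E →
    IsDiffOp r (D + E) := by
  induction r with
  | zero =>
    intro D E hD hE a
    have h := congrArg₂ (· + ·) (hD a) (hE a)
    simp only [add_zero] at h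
    rw [LinearMap.add_comp, LinearMap.comp_add, add_sub_add_comm, h]
  | succ r ih =>
    intro D E hD hE a
    rw [LinearMap.add_comp, LinearMap.comp_add, add_sub_add_comm]
    exact ih (hD a) (hE a)

theorem IsDiffOp.smul {r : ℕ} (c : ℝ) : ∀ {D : A →ₗ[ℝ] A}, IsDiffOp r D →
    IsDiffOp r (c • D) := by
  induction r with
  | zero =>
    intro D hD a
    have h : (c • D) ∘ₗ LinearMap.mulLeft ℝ a - LinearMap.mulLeft ℝ a ∘ₗ (c • D) =
        c • (D ∘ₗ LinearMap.mulLeft ℝ a - LinearMap.mulLeft ℝ a ∘ₗ D) := by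
      ext x; simp [smul_sub]
    rw [h, hD a, smul_zero]
  | succ r ih =>
    intro D hD a
    have h : (c • D) ∘ₗ LinearMap.mulLeft ℝ a - LinearMap.mulLeft ℝ a ∘ₗ (c • D) =
        c • (D ∘ₗ LinearMap.mulLeft ℝ a - LinearMap.mulLeft ℝ a ∘ₗ D) := by
      ext x; simp [smul_sub]
    rw [h]
    exact ih (hD a)

theorem IsDiffOp.succ {r : ℕ} : ∀ {D : A →ₗ[ℝ] A}, IsDiffOp r D → IsDiffOp (r + 1) D := by
  induction r with
  | zero =>
    intro D hD a
    rw [hD a]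
    exact IsDiffOp.zero 0
  | succ r ih =>
    intro D hD a
    exact ih (hD a)

theorem IsDiffOp.mono {r s : ℕ} (h : r ≤ s) {D : A →ₗ[ℝ] A} (hD : IsDiffOp r D) :
    IsDiffOp s D := by
  induction s, h using Nat.le_induction with
  | base => exact hD
  | succ s _ ih => exact ih.succ

theorem IsDiffOp.mulLeft (b : A) : IsDiffOp 0 (LinearMap.mulLeft ℝ b) := by
  intro a
  ext x
  simp only [LinearMap.sub_apply, LinearMap.comp_apply, LinearMap.mulLeft_apply,
    LinearMap.zero_apply]
  ring

theorem comp_commutator (D E : A →ₗ[ℝ] A) (a : A) :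
    (D ∘ₗ E) ∘ₗ LinearMap.mulLeft ℝ a - LinearMap.mulLeft ℝ a ∘ₗ (D ∘ₗ E) =
      D ∘ₗ (E ∘ₗ LinearMap.mulLeft ℝ a - LinearMap.mulLeft ℝ a ∘ₗ E) +
        (D ∘ₗ LinearMap.mulLeft ℝ a - LinearMap.mulLeft ℝ a ∘ₗ D) ∘ₗ E := by
  ext x
  simp

theorem IsDiffOp.comp {m n : ℕ} {D E : A →ₗ[ℝ] A} (hD : IsDiffOp m D) (hE : IsDiffOp n E) :
    IsDiffOp (m + n) (D ∘ₗ E) := by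
  induction hs : m + n generalizing m n D E with
  | zero =>
    obtain rfl : m = 0 := by omega
    obtain rfl : n = 0 := by omega
    intro a
    rw [comp_commutator, hE a, hD a]
    simp
  | succ s ih =>
    intro a
    rw [comp_commutator]
    refine IsDiffOp.add ?_ ?_
    · cases n with
      | zero => rw [hE a]; simpa using IsDiffOp.zero s
      | succ n => exact ih hD (hE a) (by omega)
    · cases m with
      | zero => rw [hD a]; simpa using IsDiffOp.zero s
      | succ m => exact ih (hD a) hE (by omega)

theorem isMultiDiffOp_iff {k : ℕ} {φ : Cochain A k} :
    IsMultiDiffOp φ ↔ ∃ N : ℕ, ∀ (i : Fin k) (f : Fin k → A), IsDiffOp N (φ.toLinearMap f i) := by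
  constructor
  · rintro ⟨R, hR⟩
    exact ⟨∑ i, R i, fun i f =>
      (hR i f).mono (Finset.single_le_sum (fun _ _ => Nat.zero_le _) (Finset.mem_univ i))⟩
  · rintro ⟨N, hN⟩
    exact ⟨fun _ => N, hN⟩

variable (A) in
/-- The differential Hochschild `k`-cochains which are linear over the elements of `S` in every
argument. For `S = ∅` these are all differential Hochschild cochains of `A`. -/
def diffCochain (S : Set A) (k : ℕ) : Submodule ℝ (Cochain A k) where
  carrier := {φ | IsMultiDiffOp φ ∧ IsLinearOver S φ}
  zero_mem' := ⟨⟨fun _ => 0, fun i f => by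
      have h : (0 : Cochain A k).toLinearMap f i = 0 := rfl
      rw [h]
      exact IsDiffOp.zero 0⟩, fun s _ i f => by simp⟩
  add_mem' := by
    rintro φ ψ ⟨h1, h2⟩ ⟨h3, h4⟩
    obtain ⟨N, hN⟩ := isMultiDiffOp_iff.1 h1
    obtain ⟨N', hN'⟩ := isMultiDiffOp_iff.1 h3
    refine ⟨isMultiDiffOp_iff.2 ⟨N + N', fun i f => ?_⟩, fun s hs i f => ?_⟩
    · exact ((hN i f).mono (by omega)).add ((hN' i f).mono (by omega))
    · simp only [_root_.add_apply, h2 s hs, h4 s hs, mul_add]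
  smul_mem' := by
    rintro c φ ⟨⟨R, hR⟩, h2⟩
    refine ⟨⟨R, fun i f => (hR i f).smul c⟩, fun s hs i f => ?_⟩
    simp only [_root_.smul_apply, h2 s hs, mul_smul_comm]

theorem cup_update {m n p : ℕ} (h : m + n = p) (φ : Cochain A m) (ψ : Cochain A n)
    (f : Fin p → A) (s : Fin p) :
    (∃ t : Fin m, f s = f ⟨t, by omega⟩ ∧ ∀ x, cup h φ ψ (Function.update f s x) =
      φ (Function.update (fun i : Fin m => f ⟨i, by omega⟩) t x) *
        ψ (fun j => f ⟨m + j, by omega⟩)) ∨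
    (∃ t : Fin n, f s = f ⟨m + t, by omega⟩ ∧ ∀ x, cup h φ ψ (Function.update f s x) =
      φ (fun i => f ⟨i, by omega⟩) *
        ψ (Function.update (fun j : Fin n => f ⟨m + j, by omega⟩) t x)) := by
  by_cases h1 : (s : ℕ) < m
  · refine Or.inl ⟨⟨s, h1⟩, rfl, fun x => ?_⟩
    rw [cup_apply]
    congr 2
    · funext j
      simp [Function.update_apply, Fin.ext_iff]
    · funext j
      have : ¬ (m + (j : ℕ) = s) := by omega
      simp [Fin.ext_iff, this]
  · refine Or.inr ⟨⟨s - m, by omega⟩, ?_, fun x => ?_⟩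
    · congr 1; ext; simp; omega
    · rw [cup_apply]
      congr 2
      · funext j
        have : ¬ ((j : ℕ) = s) := by omega
        simp [Fin.ext_iff, this]
      · funext j
        have : (m + (j : ℕ) = s) ↔ (j : ℕ) = s - m := by omega
        simp [Function.update_apply, Fin.ext_iff, this]

theorem cup_mem {S : Set A} {m n p : ℕ} (h : m + n = p) {φ : Cochain A m} {ψ : Cochain A n}
    (hφ : φ ∈ diffCochain A S m) (hψ : ψ ∈ diffCochain A S n) :
    cup h φ ψ ∈ diffCochain A S p := by
  obtain ⟨N, hN⟩ := isMultiDiffOp_iff.1 hφ.1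
  obtain ⟨N', hN'⟩ := isMultiDiffOp_iff.1 hψ.1
  refine ⟨isMultiDiffOp_iff.2 ⟨0 + N + (0 + N'), fun s f => ?_⟩, fun c hc s f => ?_⟩
  · rcases cup_update h φ ψ f s with ⟨t, -, ht⟩ | ⟨t, -, ht⟩
    · have : (cup h φ ψ).toLinearMap f s =
          LinearMap.mulLeft ℝ (ψ (fun j => f ⟨m + j, by omega⟩)) ∘ₗ
            φ.toLinearMap (fun i => f ⟨i, by omega⟩) t := by
        ext x
        simp only [MultilinearMap.toLinearMap_apply, LinearMap.comp_apply,
          LinearMap.mulLeft_apply, ht, mul_comm]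
      rw [this]
      exact ((IsDiffOp.mulLeft _).comp (hN _ _)).mono (by omega)
    · have : (cup h φ ψ).toLinearMap f s =
          LinearMap.mulLeft ℝ (φ (fun i => f ⟨i, by omega⟩)) ∘ₗ
            ψ.toLinearMap (fun j => f ⟨m + j, by omega⟩) t := by
        ext x
        simp only [MultilinearMap.toLinearMap_apply, LinearMap.comp_apply,
          LinearMap.mulLeft_apply, ht]
      rw [this]
      exact ((IsDiffOp.mulLeft _).comp (hN' _ _)).mono (by omega)
  · rcases cup_update h φ ψ f s with ⟨t, hs, ht⟩ | ⟨t, hs, ht⟩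
    · rw [ht, hs, hφ.2 c hc t (fun i => f ⟨i, by omega⟩), cup_apply, mul_assoc]
    · rw [ht, hs, hψ.2 c hc t (fun j => f ⟨m + j, by omega⟩), cup_apply, mul_left_comm]

theorem insertAt_mem {S : Set A} {m n p : ℕ} (h : m + n = p + 1) (i : Fin m) {φ : Cochain A m}
    {ψ : Cochain A n} (hφ : φ ∈ diffCochain A S m) (hψ : ψ ∈ diffCochain A S n) :
    insertAt h i φ ψ ∈ diffCochain A S p := by
  obtain ⟨N, hN⟩ := isMultiDiffOp_iff.1 hφ.1
  obtain ⟨N', hN'⟩ := isMultiDiffOp_iff.1 hψ.1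
  refine ⟨isMultiDiffOp_iff.2 ⟨N + N', fun s f => ?_⟩, fun c hc s f => ?_⟩
  · rcases insertArgs_update h i ψ f s with ⟨t, -, ht⟩ | ⟨j, -, hj⟩
    · have : (insertAt h i φ ψ).toLinearMap f s =
          φ.toLinearMap (insertArgs h i ψ f) i ∘ₗ
            ψ.toLinearMap (fun t : Fin n => f ⟨i + t, by omega⟩) t := by
        ext x
        simp only [MultilinearMap.toLinearMap_apply, LinearMap.comp_apply, insertAt_apply, ht]
      rw [this]
      exact (hN _ _).comp (hN' _ _)
    · have : (insertAt h i φ ψ).toLinearMap f s = φ.toLinearMap (insertArgs h i ψ f) j := by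
        ext x
        simp only [MultilinearMap.toLinearMap_apply, insertAt_apply, hj]
      rw [this]
      exact (hN _ _).mono (by omega)
  · rcases insertArgs_update h i ψ f s with ⟨t, hs, ht⟩ | ⟨j, -, hj⟩
    · have h1 : f s = (fun t : Fin n => f ⟨i + t, by omega⟩) t := by
        simp only [← hs]
      have h2 : ψ (fun t : Fin n => f ⟨i + t, by omega⟩) = insertArgs h i ψ f i := by
        simp [insertArgs]
      rw [insertAt_apply, ht, h1, hψ.2 c hc t, h2, hφ.2 c hc, insertAt_apply]
    · have h1 : insertArgs h i ψ f j = f s := by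
        have := congrFun (hj (f s)) j
        simpa using this
      rw [insertAt_apply, hj, ← h1, hφ.2 c hc, insertAt_apply]

theorem idCochain_mem (S : Set A) : idCochain A ∈ diffCochain A S 1 := by
  refine ⟨⟨fun _ => 0, fun i f => ?_⟩, fun c _ i f => ?_⟩
  · obtain rfl : i = 0 := Subsingleton.elim _ _
    have : (idCochain A).toLinearMap f 0 = LinearMap.mulLeft ℝ 1 := by
      ext x
      simp [idCochain]
    rw [this]
    exact IsDiffOp.mulLeft 1
  · obtain rfl : i = 0 := Subsingleton.elim _ _
    simp [idCochain]

theorem hochschildD_mem {S : Set A} {k : ℕ} {φ : Cochain A k} (hφ : φ ∈ diffCochain A S k) :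
    hochschildD φ ∈ diffCochain A S (k + 1) :=
  add_mem (add_mem (cup_mem _ (idCochain_mem S) hφ)
    (sum_mem fun _ _ => Submodule.smul_mem _ _
      (insertAt_mem _ _ hφ (cup_mem _ (idCochain_mem S) (idCochain_mem S)))))
    (Submodule.smul_mem _ _ (cup_mem _ hφ (idCochain_mem S)))

theorem circ_mem {S : Set A} {m n p : ℕ} (h : m + n = p + 1) {φ : Cochain A m}
    {ψ : Cochain A n} (hφ : φ ∈ diffCochain A S m) (hψ : ψ ∈ diffCochain A S n) :
    circ h φ ψ ∈ diffCochain A S p :=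
  sum_mem fun _ _ => Submodule.smul_mem _ _ (insertAt_mem _ _ hφ hψ)

theorem gBracket_mem {S : Set A} {m n p : ℕ} (h : m + n = p + 1) {φ : Cochain A m}
    {ψ : Cochain A n} (hφ : φ ∈ diffCochain A S m) (hψ : ψ ∈ diffCochain A S n) :
    gBracket h φ ψ ∈ diffCochain A S p :=
  sub_mem (circ_mem _ hφ hψ) (Submodule.smul_mem _ _ (circ_mem _ hψ hφ))

/-! #### The operations on differential cochains, and the differential Hochschild cohomology -/

variable {S : Set A}

/-- The cup product of differential cochains. -/
def diffCochain.cup {m n p : ℕ} (h : m + n = p) (φ : diffCochain A S m) (ψ : diffCochain A S n) :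
    diffCochain A S p :=
  ⟨VerticalHKR.cup h φ.1 ψ.1, cup_mem h φ.2 ψ.2⟩

/-- The Gerstenhaber bracket of differential cochains. -/
def diffCochain.bracket {m n p : ℕ} (h : m + n = p + 1) (φ : diffCochain A S m)
    (ψ : diffCochain A S n) : diffCochain A S p :=
  ⟨gBracket h φ.1 ψ.1, gBracket_mem h φ.2 ψ.2⟩

/-- The Hochschild differential of differential cochains. -/
def diffCochain.d (k : ℕ) : diffCochain A S k →ₗ[ℝ] diffCochain A S (k + 1) where
  toFun φ := ⟨hochschildD φ.1, hochschildD_mem φ.2⟩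
  map_add' φ ψ := by
    ext f
    simp only [hochschildD, _root_.add_apply, _root_.smul_apply,
      _root_.sum_apply, insertAt_apply, cup_apply, Submodule.coe_add, mul_add, add_mul,
      smul_add, Finset.sum_add_distrib]
    abel
  map_smul' c φ := by
    ext f
    simp only [hochschildD, _root_.add_apply, _root_.smul_apply,
      _root_.sum_apply, insertAt_apply, cup_apply, Submodule.coe_smul,
      RingHom.id_apply, smul_add, Finset.smul_sum, mul_smul_comm, smul_mul_assoc,
      smul_comm c]

instance (k : ℕ) : AddCommGroup (diffCochain A S k) := Submodule.addCommGroup _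

variable (A S) in
/-- The Hochschild `k`-cocycles among the differential cochains. -/
abbrev Cocycle (k : ℕ) : Submodule ℝ (diffCochain A S k) := LinearMap.ker (diffCochain.d k)

instance (k : ℕ) : AddCommGroup (Cocycle A S k) := Submodule.addCommGroup _

variable (A S) in
/-- The Hochschild `k`-coboundaries of differential cochains. -/
def Coboundary : ∀ k : ℕ, Submodule ℝ (diffCochain A S k)
  | 0 => ⊥
  | k + 1 => LinearMap.range (diffCochain.d k)

variable (A S) in
/-- The differential Hochschild cohomology of `A`, computed with the cochains that are linear
over `S`. -/
abbrev HH (k : ℕ) := Cocycle A S k ⧸ (Coboundary A S k).comap (Cocycle A S k).subtype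

/-- The class of a cocycle. -/
def HH.mk (k : ℕ) : Cocycle A S k →ₗ[ℝ] HH A S k := Submodule.mkQ _

/-- `G` is the Gerstenhaber algebra structure on the Hochschild cohomology that is induced by the
cup product and the Gerstenhaber bracket of cocycles. -/
structure IsHochschildGerstenhaber (G : GerstenhaberAlgebra (HH A S)) : Prop where
  one : ∃ c : Cocycle A S 0, (∀ f, c.1.1 f = 1) ∧ G.one = HH.mk 0 c
  mul : ∀ (m n : ℕ) (φ : Cocycle A S m) (ψ : Cocycle A S n),
    ∃ c : Cocycle A S (m + n), c.1 = diffCochain.cup rfl φ.1 ψ.1 ∧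
      G.mul (DirectSum.lof ℝ ℕ (HH A S) m (HH.mk m φ))
          (DirectSum.lof ℝ ℕ (HH A S) n (HH.mk n ψ)) =
        DirectSum.lof ℝ ℕ (HH A S) (m + n) (HH.mk (m + n) c)
  bracket : ∀ (m n p : ℕ) (h : m + n = p + 1) (φ : Cocycle A S m) (ψ : Cocycle A S n),
    ∃ c : Cocycle A S p, c.1 = diffCochain.bracket h φ.1 ψ.1 ∧
      G.bracket (DirectSum.lof ℝ ℕ (HH A S) m (HH.mk m φ))
          (DirectSum.lof ℝ ℕ (HH A S) n (HH.mk n ψ)) =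
        DirectSum.lof ℝ ℕ (HH A S) p (HH.mk p c)

/-! #### Multiderivations are differential cocycles -/

/-- `φ` is a derivation in every argument. -/
def IsMultiDerivation {k : ℕ} (φ : Cochain A k) : Prop :=
  ∀ (f : Fin k → A) (i : Fin k) (a b : A), φ (Function.update f i (a * b)) =
    a * φ (Function.update f i b) + b * φ (Function.update f i a)

theorem IsMultiDerivation.isMultiDiffOp {k : ℕ} {φ : Cochain A k} (h : IsMultiDerivation φ) :
    IsMultiDiffOp φ := by
  refine ⟨fun _ => 1, fun i f a => ?_⟩
  have : φ.toLinearMap f i ∘ₗ LinearMap.mulLeft ℝ a - LinearMap.mulLeft ℝ a ∘ₗ φ.toLinearMap f i =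
      LinearMap.mulLeft ℝ (φ (Function.update f i a)) := by
    ext x
    simp only [LinearMap.sub_apply, LinearMap.comp_apply, LinearMap.mulLeft_apply,
      MultilinearMap.toLinearMap_apply, h f i a x]
    ring
  rw [this]
  exact IsDiffOp.mulLeft _

theorem alternating_telescope {k : ℕ} (b : Fin (k + 1) → A) :
    b 0 + ∑ i : Fin k, (-1 : ℝ) ^ ((i : ℕ) + 1) • (b i.castSucc + b i.succ)
      + (-1 : ℝ) ^ (k + 1) • b (Fin.last k) = 0 := by
  induction k with
  | zero => simp
  | succ k ih =>
    have h := ih (fun i => b i.castSucc)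
    rw [Fin.sum_univ_castSucc]
    simp only [Fin.val_castSucc, Fin.val_last, Fin.succ_castSucc, Fin.succ_last,
      Fin.castSucc_zero] at h ⊢
    have h2 : (-1 : ℝ) ^ (k + 1 + 1) = -(-1 : ℝ) ^ (k + 1) := by ring
    rw [h2, neg_smul, smul_add]
    linear_combination h

theorem IsMultiDerivation.hochschildD_eq_zero {k : ℕ} {φ : Cochain A k}
    (h : IsMultiDerivation φ) : hochschildD φ = 0 := by
  ext f
  refine Eq.trans ?_ (?_ : (0 : A) = _)
  swap
  · rfl
  rw [← alternating_telescope (fun j : Fin (k + 1) => f j * φ (fun t => f (j.succAbove t)))]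
  simp only [hochschildD, _root_.add_apply, _root_.sum_apply, _root_.smul_apply, cup_apply,
    insertAt_apply]
  congr 1
  · congr 1
    · simp only [idCochain, MultilinearMap.ofSubsingleton_apply_apply, LinearMap.id_apply]
      congr 2
      funext j
      congr 1
      ext
      simp [add_comm]
    · refine Finset.sum_congr rfl fun i _ => ?_
      congr 1
      have h1 : insertArgs (by omega) i (mulCochain A) f = Function.update
          (insertArgs (by omega) i (mulCochain A) f) i (f i.castSucc * f i.succ) := by
        refine (Function.update_eq_self i _).symm.trans ?_
        congr 1
        simp [insertArgs, mulCochain, cup_apply, idCochain]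
        rfl
      have h2 : ∀ c : A, Function.update
          (insertArgs (by omega) i (mulCochain A) f) i c =
          Function.update (fun t : Fin k => f (i.castSucc.succAbove t)) i c := by
        intro c
        funext t
        rcases eq_or_ne t i with rfl | hne
        · simp
        · have hne' : (t : ℕ) ≠ i := fun h => hne (Fin.ext h)
          rw [Function.update_of_ne hne, Function.update_of_ne hne]
          rcases lt_or_gt_of_ne hne with hlt | hgt
          · rw [insertArgs, dif_pos hlt, Fin.succAbove_of_castSucc_lt _ _ (by simpa using hlt)]
            rfl
          · rw [insertArgs, dif_neg (not_lt.2 hgt.le), dif_neg hne,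
              Fin.succAbove_of_le_castSucc _ _ (by simpa using hgt.le)]
            rfl
      rw [h1, h2, h]
      have h3 : Function.update (fun t : Fin k => f (i.castSucc.succAbove t)) i (f i.succ) =
          fun t => f (i.castSucc.succAbove t) := by
        refine Eq.trans ?_ (Function.update_eq_self i _)
        congr 2
        simp
      have h4 : Function.update (fun t : Fin k => f (i.castSucc.succAbove t)) i (f i.castSucc) =
          fun t => f (i.succ.succAbove t) := by
        funext t
        rcases lt_trichotomy t i with hlt | rfl | hgt
        · rw [Function.update_of_ne hlt.ne,
            Fin.succAbove_of_castSucc_lt _ _ (by simpa using hlt),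
            Fin.succAbove_of_castSucc_lt _ _ (by
              simp only [Fin.lt_def, Fin.val_castSucc, Fin.val_succ] at hlt ⊢; omega)]
        · rw [Function.update_self, Fin.succAbove_of_castSucc_lt _ _ (by
            simp only [Fin.lt_def, Fin.val_castSucc, Fin.val_succ]; omega)]
        · rw [Function.update_of_ne hgt.ne',
            Fin.succAbove_of_le_castSucc _ _ (by simpa using hgt.le),
            Fin.succAbove_of_le_castSucc _ _ (by
              simp only [Fin.lt_def, Fin.le_def, Fin.val_castSucc, Fin.val_succ] at hgt ⊢; omega)]
      rw [h3, h4]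
  · congr 1
    rw [mul_comm]
    simp only [idCochain, MultilinearMap.ofSubsingleton_apply_apply, LinearMap.id_apply]
    congr 2
    funext j
    congr 1
    ext
    simp

end Hochschild

/-! ### Multivector fields on a manifold -/

section Geometry

variable {V : Type*} [NormedAddCommGroup V] [NormedSpace ℝ V] {H : Type*} [TopologicalSpace H]
  (I : ModelWithCorners ℝ V H) (N : Type*) [TopologicalSpace N] [ChartedSpace H N]

/-- The algebra `C^∞(N)` of real valued smooth functions. -/
abbrev SmoothFun := ContMDiffMap I 𝓘(ℝ, ℝ) N ℝ ∞

variable {N}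

/-- The differential `df` of a smooth function at `x`. -/
def dAt (f : SmoothFun I N) (x : N) : TangentSpace I x →L[ℝ] ℝ := mfderiv I 𝓘(ℝ, ℝ) f x

/-- The space `Λ^k T_xN` of `k`-vectors at `x`, that is, of antisymmetric contravariant tensors,
viewed as alternating `k`-linear forms on the cotangent space `T_x^*N`. The `k`-vector
`v₁ ∧ ⋯ ∧ v_k` is the form `(α₁, …, α_k) ↦ det (αᵢ (v_j))`. -/
abbrev MultivectorAt (k : ℕ) (x : N) := (TangentSpace I x →L[ℝ] ℝ) [⋀^Fin k]→ₗ[ℝ] ℝ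

variable {I}

/-- A section of `Λ^k TN` is smooth if its components with respect to all charts are smooth
functions. The components are the values on the differentials of linear coordinates of the chart. -/
def IsSmoothSection {k : ℕ} (X : ∀ x : N, MultivectorAt I k x) : Prop :=
  ∀ (x₀ : N) (α : Fin k → V →L[ℝ] ℝ), ContMDiffOn I 𝓘(ℝ, ℝ) ∞
    (fun x => X x (fun i => (α i).comp (mfderiv I 𝓘(ℝ, V) (extChartAt I x₀) x)))
    (chartAt H x₀).source

/-- The `k`-vector `a` at `x` lies in the subspace `Λ^k D_x ⊆ Λ^k T_xN`. -/
def IsTangentTo {k : ℕ} {x : N} (Dx : Submodule ℝ (TangentSpace I x)) (a : MultivectorAt I k x) :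
    Prop :=
  ∃ b : (Dx →L[ℝ] ℝ) [⋀^Fin k]→ₗ[ℝ] ℝ, ∀ α : Fin k → TangentSpace I x →L[ℝ] ℝ,
    a α = b (fun i => (α i).comp Dx.subtypeL)

/-- The smooth sections of `Λ^k D ⊆ Λ^k TN` for a family of subspaces `D_x ⊆ T_xN`. -/
def multivectorField (D : ∀ x : N, Submodule ℝ (TangentSpace I x)) (k : ℕ) :
    Submodule ℝ (∀ x : N, MultivectorAt I k x) where
  carrier := {X | IsSmoothSection X ∧ ∀ x, IsTangentTo (D x) (X x)}
  zero_mem' := ⟨fun x₀ α => contMDiffOn_const, fun x => ⟨0, fun α => rfl⟩⟩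
  add_mem' := by
    rintro X Y ⟨h1, h2⟩ ⟨h3, h4⟩
    refine ⟨fun x₀ α => (h1 x₀ α).add (h3 x₀ α), fun x => ?_⟩
    obtain ⟨a, ha⟩ := h2 x
    obtain ⟨b, hb⟩ := h4 x
    exact ⟨a + b, fun α => by simp [ha, hb]⟩
  smul_mem' := by
    rintro c X ⟨h1, h2⟩
    refine ⟨fun x₀ α => ?_, fun x => ?_⟩
    · have hc : ContMDiffOn I 𝓘(ℝ, ℝ) ∞ (fun _ : N => c) (chartAt H x₀).source := contMDiffOn_const
      exact hc.mul (h1 x₀ α)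
    · obtain ⟨a, ha⟩ := h2 x
      exact ⟨c • a, fun α => by simp [ha]⟩

/-- The wedge product of multivectors at a point,
`(a ∧ b)(α₁, …, α_{m+n}) = ∑_σ sign σ · a(α_{σ 1}, …, α_{σ m}) b(α_{σ(m+1)}, …, α_{σ(m+n)})` with
the sum over all `(m, n)`-shuffles `σ`. -/
def wedgeAt {m n p : ℕ} (h : m + n = p) {x : N} (a : MultivectorAt I m x)
    (b : MultivectorAt I n x) : MultivectorAt I p x :=
  ((LinearMap.mul' ℝ ℝ).compAlternatingMap (a.domCoprod b)).domDomCongr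
    (finSumFinEquiv.trans (finCongr h))

theorem dAt_update_comp {k : ℕ} (f : Fin k → SmoothFun I N) (i : Fin k) (g : SmoothFun I N)
    (x : N) : (fun j => dAt I (Function.update f i g j) x) =
      Function.update (fun j => dAt I (f j) x) i (dAt I g x) := by
  funext j
  rcases eq_or_ne j i with rfl | h
  · simp
  · simp [h]

theorem SmoothFun.mdifferentiableAt (f : SmoothFun I N) (x : N) :
    MDifferentiableAt I 𝓘(ℝ, ℝ) f x :=
  f.contMDiff.mdifferentiable (by simp) x

theorem dAt_add (f g : SmoothFun I N) (x : N) : dAt I (f + g) x = dAt I f x + dAt I g x :=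
  mfderiv_add (f.mdifferentiableAt x) (g.mdifferentiableAt x)

theorem dAt_smul (c : ℝ) (f : SmoothFun I N) (x : N) : dAt I (c • f) x = c • dAt I f x :=
  const_smul_mfderiv (f.mdifferentiableAt x) c

theorem dAt_mul (f g : SmoothFun I N) (x : N) :
    dAt I (f * g) x = f x • dAt I g x + g x • dAt I f x :=
  ((f.mdifferentiableAt x).hasMFDerivAt.mul (g.mdifferentiableAt x).hasMFDerivAt).mfderiv

variable [IsManifold I ∞ N] [I.Boundaryless] [FiniteDimensional ℝ V]

/-- In the chart at `x₀`, the differential of a smooth function is a combination of the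
differentials of linear coordinates with smooth coefficients. -/
theorem exists_dAt_eq_sum (f : SmoothFun I N) (x₀ : N) :
    ∃ c : Fin (Module.finrank ℝ V) → N → ℝ,
      (∀ j, ContMDiffAt I 𝓘(ℝ, ℝ) ∞ (c j) x₀) ∧
      ∀ x ∈ (chartAt H x₀).source, dAt I f x = ∑ j, c j x •
        ((LinearMap.toContinuousLinearMap ((Module.finBasis ℝ V).coord j)).comp
          (mfderiv I 𝓘(ℝ, V) (extChartAt I x₀) x)) := by
  classical
  set e := extChartAt I x₀ with he
  set g : V → ℝ := f ∘ e.symm with hg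
  have hgt : ContMDiffOn 𝓘(ℝ, V) 𝓘(ℝ, ℝ) ∞ g e.target :=
    f.contMDiff.comp_contMDiffOn (contMDiffOn_extChartAt_symm x₀)
  have hopen : IsOpen e.target := isOpen_extChartAt_target x₀
  have hgat : ∀ y ∈ e.target, ContDiffAt ℝ ∞ g y := fun y hy =>
    (contMDiffOn_iff_contDiffOn.1 hgt).contDiffAt (hopen.mem_nhds hy)
  refine ⟨fun j x => fderiv ℝ g (e x) (Module.finBasis ℝ V j), fun j => ?_, fun x hx => ?_⟩
  · have h1 : ContDiffAt ℝ ∞ (fun y => fderiv ℝ g y (Module.finBasis ℝ V j)) (e x₀) :=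
      ((hgat _ (mem_extChartAt_target x₀)).fderiv_right (m := ∞) (by simp)).clm_apply
        contDiffAt_const
    exact h1.contMDiffAt.comp x₀ contMDiffAt_extChartAt
  · have hx' : x ∈ e.source := by rwa [he, extChartAt_source]
    have hyt : e x ∈ e.target := e.map_source hx'
    have hev : (f : N → ℝ) =ᶠ[nhds x] g ∘ e := by
      filter_upwards [(isOpen_extChartAt_source (I := I) x₀).mem_nhds hx'] with z hz
      simp only [hg, Function.comp_apply]
      rw [e.left_inv hz]
    have hgd : MDifferentiableAt 𝓘(ℝ, V) 𝓘(ℝ, ℝ) g (e x) :=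
      ((hgat _ hyt).differentiableAt (by simp)).mdifferentiableAt
    have hed : MDifferentiableAt I 𝓘(ℝ, V) e x :=
      mdifferentiableAt_extChartAt hx
    have hd : dAt I f x = (fderiv ℝ g (e x)).comp (mfderiv I 𝓘(ℝ, V) e x) := by
      unfold dAt
      rw [hev.mfderiv_eq, mfderiv_comp x hgd hed, mfderiv_eq_fderiv]
      rfl
    rw [hd]
    refine ContinuousLinearMap.ext fun v => ?_
    have hs := (Module.finBasis ℝ V).sum_repr (mfderiv I 𝓘(ℝ, V) e x v)
    have key : ∀ w : V, fderiv ℝ g (e x) w =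
        ∑ j, fderiv ℝ g (e x) (Module.finBasis ℝ V j) * (Module.finBasis ℝ V).coord j w := by
      intro w
      conv_lhs => rw [← (Module.finBasis ℝ V).sum_repr w]
      rw [map_sum]
      refine Finset.sum_congr rfl fun j _ => ?_
      rw [map_smul, smul_eq_mul, mul_comm]
      rfl
    refine (key _).trans ?_
    rw [_root_.sum_apply]
    rfl

/-- The value of a smooth `k`-vector field on the differentials of smooth functions is smooth. -/
theorem contMDiff_eval {k : ℕ} {X : ∀ x : N, MultivectorAt I k x} (hX : IsSmoothSection X)
    (f : Fin k → SmoothFun I N) :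
    ContMDiff I 𝓘(ℝ, ℝ) ∞ (fun x => X x (fun i => dAt I (f i) x)) := by
  classical
  intro x₀
  choose c hc hfc using fun i => exists_dAt_eq_sum (f i) x₀
  set ε : Fin (Module.finrank ℝ V) → V →L[ℝ] ℝ := fun j =>
    LinearMap.toContinuousLinearMap ((Module.finBasis ℝ V).coord j) with hε
  have hx₀ : (chartAt H x₀).source ∈ nhds x₀ :=
    (chartAt H x₀).open_source.mem_nhds (mem_chart_source H x₀)
  have hev : (fun x => X x (fun i => dAt I (f i) x)) =ᶠ[nhds x₀]
      fun x => ∑ J : Fin k → Fin (Module.finrank ℝ V), (∏ i, c i (J i) x) *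
        X x (fun i => (ε (J i)).comp (mfderiv I 𝓘(ℝ, V) (extChartAt I x₀) x)) := by
    filter_upwards [hx₀] with x hx
    have h1 : (fun i => dAt I (f i) x) = fun i => ∑ j, c i j x •
        ((ε j).comp (mfderiv I 𝓘(ℝ, V) (extChartAt I x₀) x)) :=
      funext fun i => hfc i x hx
    rw [h1]
    refine ((X x).toMultilinearMap.map_sum _).trans ?_
    refine Finset.sum_congr rfl fun J _ => ?_
    exact (X x).toMultilinearMap.map_smul_univ _ _
  refine ContMDiffAt.congr_of_eventuallyEq ?_ hev
  refine contMDiffAt_finsetSum fun J _ => ContMDiffAt.mul ?_ ?_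
  · exact contMDiffAt_finsetProd fun i _ => hc i (J i)
  · exact (hX x₀ (fun i => ε (J i))).contMDiffAt hx₀

/-- The `k`-cochain `(f₁, …, f_k) ↦ ⟨X, df₁ ⊗ ⋯ ⊗ df_k⟩` defined by a `k`-vector field `X`. -/
def evalCochain {D : ∀ x : N, Submodule ℝ (TangentSpace I x)} {k : ℕ} :
    multivectorField D k →ₗ[ℝ] Cochain (SmoothFun I N) k where
  toFun X := MultilinearMap.mk' (fun f => ⟨fun x => X.1 x (fun i => dAt I (f i) x),
      contMDiff_eval X.2.1 f⟩)
    (by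
      intro f i g g'
      ext x
      change X.1 x (fun j => dAt I (Function.update f i (g + g') j) x) =
        X.1 x (fun j => dAt I (Function.update f i g j) x) +
          X.1 x (fun j => dAt I (Function.update f i g' j) x)
      simp only [dAt_update_comp, dAt_add, AlternatingMap.map_update_add])
    (by
      intro f i c g
      ext x
      change X.1 x (fun j => dAt I (Function.update f i (c • g) j) x) =
        c • X.1 x (fun j => dAt I (Function.update f i g j) x)
      simp only [dAt_update_comp, dAt_smul, AlternatingMap.map_update_smul])
  map_add' X Y := by
    ext f x
    rfl
  map_smul' c X := by
    ext f x
    rfl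

/-- The Hochschild-Kostant-Rosenberg map on the level of cochains,
`(f₁, …, f_k) ↦ (1 / k!) ⟨X, df₁ ⊗ ⋯ ⊗ df_k⟩`. -/
def hkrCochain {D : ∀ x : N, Submodule ℝ (TangentSpace I x)} {k : ℕ} :
    multivectorField D k →ₗ[ℝ] Cochain (SmoothFun I N) k :=
  { toFun := fun X => ((k.factorial : ℝ)⁻¹) • evalCochain X
    map_add' := fun X Y => by rw [map_add, smul_add]
    map_smul' := fun c X => by rw [map_smul, smul_comm, RingHom.id_apply] }

section

variable {D : ∀ x : N, Submodule ℝ (TangentSpace I x)} {k : ℕ}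

theorem evalCochain_apply (X : multivectorField D k) (f : Fin k → SmoothFun I N) (x : N) :
    evalCochain X f x = X.1 x (fun i => dAt I (f i) x) := rfl

theorem evalCochain_isMultiDerivation (X : multivectorField D k) :
    IsMultiDerivation (evalCochain X) := by
  intro f i a b
  ext x
  change X.1 x (fun j => dAt I (Function.update f i (a * b) j) x) =
    a x * X.1 x (fun j => dAt I (Function.update f i b j) x) +
      b x * X.1 x (fun j => dAt I (Function.update f i a j) x)
  simp only [dAt_update_comp, dAt_mul, AlternatingMap.map_update_add,
    AlternatingMap.map_update_smul, smul_eq_mul]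

/-- The functions in `S` are constant along the distribution `D`. -/
def IsConstantAlong (D : ∀ x : N, Submodule ℝ (TangentSpace I x)) (S : Set (SmoothFun I N)) :
    Prop :=
  ∀ s ∈ S, ∀ x, ∀ v ∈ D x, dAt I s x v = 0

theorem evalCochain_isLinearOver {S : Set (SmoothFun I N)} (hS : IsConstantAlong D S)
    (X : multivectorField D k) : IsLinearOver S (evalCochain X) := by
  intro s hs i f
  rw [evalCochain_isMultiDerivation X f i s (f i), Function.update_eq_self]
  have : evalCochain X (Function.update f i s) = 0 := by
    ext x
    rw [evalCochain_apply]
    obtain ⟨b, hb⟩ := X.2.2 x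
    rw [hb]
    refine b.map_coord_zero i ?_
    ext v
    simpa using hS s hs x v v.2
  rw [this, mul_zero, add_zero]

/-- The Hochschild-Kostant-Rosenberg map takes values in the differential Hochschild cocycles; for a
multivector field tangent to `D` these cocycles are linear over the functions constant along `D`. -/
def hkr {S : Set (SmoothFun I N)} (hS : IsConstantAlong D S) (k : ℕ) :
    multivectorField D k →ₗ[ℝ] Cocycle (SmoothFun I N) S k where
  toFun X := ⟨⟨hkrCochain X, (diffCochain _ S k).smul_mem _
      ⟨(evalCochain_isMultiDerivation X).isMultiDiffOp, evalCochain_isLinearOver hS X⟩⟩, by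
    have h : IsMultiDerivation (hkrCochain X) := fun f i a b => by
      have := evalCochain_isMultiDerivation X f i a b
      change (k.factorial : ℝ)⁻¹ • evalCochain X (Function.update f i (a * b)) =
        a * (k.factorial : ℝ)⁻¹ • evalCochain X (Function.update f i b) +
          b * (k.factorial : ℝ)⁻¹ • evalCochain X (Function.update f i a)
      simp only [this, smul_add, mul_smul_comm]
    exact Subtype.ext h.hochschildD_eq_zero⟩
  map_add' X Y := Subtype.ext (Subtype.ext (map_add hkrCochain X Y))
  map_smul' c X := Subtype.ext (Subtype.ext (map_smul hkrCochain c X))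

end

/-- For antisymmetric multiderivations `Φ` of degree `m` and `Ψ` of degree `n`, the sum
`∑_σ sign σ · Φ(Ψ(f_{σ 1}, …, f_{σ n}), f_{σ(n+1)}, …, f_{σ p})` over all `(n, m - 1)`-shuffles, here
written as a sum over all permutations. It vanishes for `m = 0`. -/
def shuffleComp {A : Type*} [CommRing A] [Algebra ℝ A] {m n p : ℕ} (h : m + n = p + 1)
    (Φ : Cochain A m) (Ψ : Cochain A n) (f : Fin p → A) : A :=
  if hm : 0 < m then
    ((n.factorial * (m - 1).factorial : ℝ)⁻¹) • ∑ σ : Equiv.Perm (Fin p),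
      ((Equiv.Perm.sign σ : ℤ) : ℝ) • insertAt h ⟨0, hm⟩ Φ Ψ (f ∘ σ)
  else 0

/-- `Z` is the Schouten bracket `[X, Y]` of the multivector fields `X` and `Y` of degrees `m` and
`n`: in terms of the associated antisymmetric multiderivations of the algebra of functions, it is
the graded commutator `X ∘ Y - (-1)^{(m-1)(n-1)} Y ∘ X`. For vector fields this is the Lie bracket
`[X, Y] f = X (Y f) - Y (X f)`, and `[X, f] = X f` for a vector field `X` and a function `f`. -/
def IsSchoutenBracket {D : ∀ x : N, Submodule ℝ (TangentSpace I x)} {m n p : ℕ}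
    (h : m + n = p + 1) (X : multivectorField D m) (Y : multivectorField D n)
    (Z : multivectorField D p) : Prop :=
  ∀ f : Fin p → SmoothFun I N, evalCochain Z f =
    shuffleComp h (evalCochain X) (evalCochain Y) f -
      (-1 : ℝ) ^ ((m + 1) * (n + 1)) •
        shuffleComp (by omega) (evalCochain Y) (evalCochain X) f

/-- `G` is the Gerstenhaber algebra structure on the multivector fields tangent to `D` given by the
wedge product and the Schouten bracket. -/
structure IsSchoutenGerstenhaber {D : ∀ x : N, Submodule ℝ (TangentSpace I x)}
    (G : GerstenhaberAlgebra fun k => multivectorField D k) : Prop where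
  one : ∀ x α, G.one.1 x α = 1
  mul : ∀ (m n : ℕ) (X : multivectorField D m) (Y : multivectorField D n),
    ∃ Z : multivectorField D (m + n), (∀ x, Z.1 x = wedgeAt rfl (X.1 x) (Y.1 x)) ∧
      G.mul (DirectSum.lof ℝ ℕ (fun k => multivectorField D k) m X)
          (DirectSum.lof ℝ ℕ (fun k => multivectorField D k) n Y) =
        DirectSum.lof ℝ ℕ (fun k => multivectorField D k) (m + n) Z
  bracket : ∀ (m n p : ℕ) (h : m + n = p + 1) (X : multivectorField D m)
    (Y : multivectorField D n), ∃ Z : multivectorField D p, IsSchoutenBracket h X Y Z ∧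
      G.bracket (DirectSum.lof ℝ ℕ (fun k => multivectorField D k) m X)
          (DirectSum.lof ℝ ℕ (fun k => multivectorField D k) n Y) =
        DirectSum.lof ℝ ℕ (fun k => multivectorField D k) p Z

end Geometry

/-! ### Vector bundles -/

section Bundle

open Bundle

variable {B : Type*} [NormedAddCommGroup B] [NormedSpace ℝ B] {H : Type*} [TopologicalSpace H]
  (I : ModelWithCorners ℝ B H) {M : Type*} [TopologicalSpace M] [ChartedSpace H M]
  (F : Type*) [NormedAddCommGroup F] [NormedSpace ℝ F]
  (E : M → Type*) [∀ x, AddCommGroup (E x)] [∀ x, Module ℝ (E x)] [∀ x, TopologicalSpace (E x)]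
  [TopologicalSpace (TotalSpace F E)] [FiberBundle F E] [VectorBundle ℝ F E]

/-- The fiber `E_p` over `p`, regarded as a manifold. -/
def Fiber (p : M) : Type _ := E p

instance (p : M) : TopologicalSpace (Fiber E p) := inferInstanceAs (TopologicalSpace (E p))

/-- The linear isomorphism of `E_p` with the model fiber, as a chart. -/
def fiberChart (p : M) : OpenPartialHomeomorph (Fiber E p) F :=
  ((trivializationAt F E p).continuousLinearEquivAt ℝ p
    (FiberBundle.mem_baseSet_trivializationAt' p)).toHomeomorph.toOpenPartialHomeomorph

/-- The smooth structure of the vector space `E_p`: the one for which linear isomorphisms with the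
model fiber are diffeomorphisms. -/
instance (p : M) : ChartedSpace F (Fiber E p) :=
  (fiberChart F E p).singletonChartedSpace rfl

instance (p : M) : IsManifold 𝓘(ℝ, F) ∞ (Fiber E p) :=
  (fiberChart F E p).isManifold_singleton rfl

variable {E} in
/-- The inclusion `ι_p : E_p → E`. -/
def fiberIncl (p : M) (v : Fiber E p) : TotalSpace F E := ⟨p, v⟩

theorem contMDiff_fiberIncl (p : M) :
    ContMDiff 𝓘(ℝ, F) (I.prod 𝓘(ℝ, F)) ∞ (fiberIncl F (E := E) p) := by
  intro v
  rw [contMDiffAt_totalSpace]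
  refine ⟨contMDiffAt_const, ?_⟩
  have h : ContMDiffAt 𝓘(ℝ, F) 𝓘(ℝ, F) ∞ (extChartAt 𝓘(ℝ, F) v) v := contMDiffAt_extChartAt
  exact h

/-- The restriction `ι_p^* : C^∞(E) → C^∞(E_p)`. -/
def restrictFun (p : M) (f : SmoothFun (I.prod 𝓘(ℝ, F)) (TotalSpace F E)) :
    SmoothFun 𝓘(ℝ, F) (Fiber E p) :=
  ⟨fun v => f (fiberIncl F p v), f.contMDiff.comp (contMDiff_fiberIncl I F E p)⟩

/-- The space of vertical tangent vectors at `v ∈ E`, the kernel of `T_vπ`. -/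
def verticalSpace (v : TotalSpace F E) : Submodule ℝ (TangentSpace (I.prod 𝓘(ℝ, F)) v) :=
  LinearMap.ker (mfderiv (I.prod 𝓘(ℝ, F)) I (π F E) v).toLinearMap

/-- The pull-back `π^*u` of a smooth function on the base. -/
def pullback (u : SmoothFun I M) : SmoothFun (I.prod 𝓘(ℝ, F)) (TotalSpace F E) :=
  ⟨fun v => u v.proj, u.contMDiff.comp (contMDiff_proj E)⟩

/-- The vertical `k`-vector fields on `E`, the sections of `Λ^k Ver(E)`. -/
abbrev VerticalField (k : ℕ) := multivectorField (verticalSpace I F E) k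

/-- The vertical differential Hochschild `k`-cochains of `C^∞(E)`: the `k`-differential operators
with `φ(f₁, …, π^*u fᵢ, …, f_k) = π^*u φ(f₁, …, f_k)`. -/
abbrev VerticalCochain (k : ℕ) := diffCochain (SmoothFun (I.prod 𝓘(ℝ, F)) (TotalSpace F E))
  (Set.range (pullback I F E)) k

/-- The vertical differential Hochschild cohomology of `C^∞(E)`. -/
abbrev VerticalHH (k : ℕ) := HH (SmoothFun (I.prod 𝓘(ℝ, F)) (TotalSpace F E))
  (Set.range (pullback I F E)) k

/-- The `k`-vector fields on the manifold `E_p`. -/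
abbrev FiberField (p : M) (k : ℕ) :=
  multivectorField (I := 𝓘(ℝ, F)) (fun _ : Fiber E p => ⊤) k

/-- The differential Hochschild `k`-cochains of `C^∞(E_p)`. -/
abbrev FiberCochain (p : M) (k : ℕ) := diffCochain (SmoothFun 𝓘(ℝ, F) (Fiber E p)) ∅ k

/-- The differential Hochschild cohomology of `C^∞(E_p)`. -/
abbrev FiberHH (p : M) (k : ℕ) := HH (SmoothFun 𝓘(ℝ, F) (Fiber E p)) ∅ k

variable {I F E}

/-- `Y` is the restriction `ι_p^* X` of the vertical multivector field `X` to the fiber `E_p`: under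
the canonical identification `T_v(E_p) ≅ Ver_v(E)` given by `T_vι_p`, it coincides with `X`. -/
def IsFieldRestriction (p : M) {k : ℕ} (X : VerticalField I F E k) (Y : FiberField F E p k) :
    Prop :=
  ∀ (v : Fiber E p) (α : Fin k → TangentSpace (I.prod 𝓘(ℝ, F)) (fiberIncl F p v) →L[ℝ] ℝ),
    X.1 (fiberIncl F p v) α =
      Y.1 v (fun i => (α i).comp (mfderiv 𝓘(ℝ, F) (I.prod 𝓘(ℝ, F)) (fiberIncl F p) v))

/-- `χ` is the restriction `ι_p^* φ` of the vertical cochain `φ` to the fiber `E_p`: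
`(ι_p^* φ)(ι_p^* f₁, …, ι_p^* f_k) = ι_p^* (φ(f₁, …, f_k))`. -/
def IsCochainRestriction (p : M) {k : ℕ} (φ : VerticalCochain I F E k)
    (χ : FiberCochain F E p k) : Prop :=
  ∀ f : Fin k → SmoothFun (I.prod 𝓘(ℝ, F)) (TotalSpace F E),
    χ.1 (fun i => restrictFun I F E p (f i)) = restrictFun I F E p (φ.1 f)

variable (I F E) in
theorem isConstantAlong_pullback :
    IsConstantAlong (verticalSpace I F E) (Set.range (pullback I F E)) := by
  rintro _ ⟨u, rfl⟩ v w hw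
  have h : dAt (I.prod 𝓘(ℝ, F)) (pullback I F E u) v =
      (mfderiv I 𝓘(ℝ, ℝ) u v.proj).comp (mfderiv (I.prod 𝓘(ℝ, F)) I (π F E) v) :=
    mfderiv_comp v (u.mdifferentiableAt v.proj)
      ((contMDiff_proj (n := ∞) E).mdifferentiable (by simp) v)
  have hw' : mfderiv (I.prod 𝓘(ℝ, F)) I (π F E) v w = 0 := hw
  exact (DFunLike.congr_fun h w).trans
    ((congrArg (mfderiv I 𝓘(ℝ, ℝ) u v.proj) hw').trans (map_zero _))

variable [ContMDiffVectorBundle ∞ F E I] [IsManifold I ∞ M] [I.Boundaryless]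
  [FiniteDimensional ℝ B] [FiniteDimensional ℝ F]

variable (I F E) in
/-- The vertical Hochschild-Kostant-Rosenberg map, with values in the vertical cocycles. -/
def verticalHKR (k : ℕ) : VerticalField I F E k →ₗ[ℝ]
    Cocycle (SmoothFun (I.prod 𝓘(ℝ, F)) (TotalSpace F E)) (Set.range (pullback I F E)) k :=
  hkr (isConstantAlong_pullback I F E) k

variable (I F E) in
/-- The vertical Hochschild-Kostant-Rosenberg map, with values in cohomology. -/
def verticalHKRClass (k : ℕ) : VerticalField I F E k →ₗ[ℝ] VerticalHH I F E k :=
  HH.mk k ∘ₗ verticalHKR I F E k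

variable (F E) in
/-- The usual Hochschild-Kostant-Rosenberg map of `E_p`, with values in the cocycles. -/
def fiberHKR (p : M) (k : ℕ) :
    FiberField F E p k →ₗ[ℝ] Cocycle (SmoothFun 𝓘(ℝ, F) (Fiber E p)) ∅ k :=
  hkr (fun _ hs => hs.elim) k

variable (F E) in
/-- The usual Hochschild-Kostant-Rosenberg map of `E_p`, with values in cohomology. -/
def fiberHKRClass (p : M) (k : ℕ) : FiberField F E p k →ₗ[ℝ] FiberHH F E p k :=
  HH.mk k ∘ₗ fiberHKR F E p k

end Bundle

end VerticalHKR

end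

/-!
# The vertical Hochschild-Kostant-Rosenberg theorem

Throughout, `A` is a commutative algebra with a set `S` of scalars, and the cochains are the
multidifferential operators on `A` that are linear over `S` in each argument. With `A = C^∞(E)` and
`S` the functions pulled back from the base these are the vertical cochains of a vector bundle; with
`S = ∅` and `A = C^∞(E_p)` they are all differential cochains of a fiber. Both cases are treated at
once, and the restriction to the fiber compares them.

*Gerstenhaber structure on cohomology.* The needed identities hold for cochains. The Hochschild
differential is, up to signs, a derivation of the bracket (`dSeq_commF`). The associator of the
composition `φ ∘ ψ` is graded symmetric in its last two arguments (`circF_associator`), which gives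
the Jacobi identity. For cocycles, the graded commutator of the cup product is, up to sign, the
coboundary of `φ ∘ ψ` (`dSeq_circF`), and the defect of the Leibniz rule is the coboundary of a
brace (`dSeq_brace`, `commF_cup`). All these operations preserve differential operators and
linearity over `S`, so that the cohomology is a Gerstenhaber algebra (`hochschildGerstenhaber`).

*The local theorem.* Let `A` have coordinates `x j` with partial derivatives `d j` that kill `S`,
such that a differential operator that commutes with the multiplications by `S` and by the `x j` is
itself a multiplication operator (`LocalCoords`). The operators
`φ ↦ φ(…, d j f_s, …)` and the commutators with multiplication by `x j` in the argument `s` form a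
representation of the Weyl algebra on cochains. Hence the Euler operator, the sum of their products,
acts on a cochain of total order `d` as the number `d` up to terms of lower order
(`totOrd_euler_sub`). On a cocycle `φ`, the Euler operator is also `∑ j, d j ∪ (φ ∘ x j)` up to a
coboundary (`euler_sub_mem`), and `φ ∘ x j` is a cocycle with one argument less. Induction on the
number of arguments and on the total order shows that `φ` is cohomologous to `1 / k!` times its
antisymmetrisation, which is a multiderivation (`localHKR`). The argument also bounds the order of a
primitive in terms of the order of `φ`.

*Globalisation.* In a chart adapted to the projection to the base, the functions have coordinates in
this sense, by Hadamard's lemma. The bound on the orders makes it possible to glue local primitives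
with a partition of unity (`glued_hkr`, `smooth_hkr`). An antisymmetric multiderivation linear over
`S` is the same as a multivector field with values in the subbundle `D` tangent to the fibers
(`FibredAtlas.exists_evalCochain_eq`), and coboundaries have vanishing antisymmetrisation. This
gives the bijection between multivector fields and cohomology classes (`FibredAtlas.hkr_bijective`)
on any manifold with a `FibredAtlas`. Total spaces and fibers have one
(`nonempty_fibredAtlas_totalSpace`, `fiberFibredAtlas`). The Gerstenhaber structure on multivector
fields is transported along this bijection; its operations are the wedge product and the Schouten
bracket, because antisymmetrising a cup product or a composition of multiderivations yields the
formulas defining these (`factorial_smul_wedgeAt`, `altSum_circ`).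

*Restriction to a fiber.* If `f` vanishes on `E_p`, then by Hadamard's lemma in the directions of
the base it is, near `E_p`, a sum of products `(π^* u) g` with `u p = 0`
(`exists_eq_sum_of_restrictHom_eq_zero`). A vertical cochain takes out the factors `π^* u`, so its
values on `E_p` depend only on the restrictions of its arguments (`descends_restrictHom`). Since
restriction of functions is a surjective homomorphism of algebras, restriction of cochains respects
all operations. A multivector field restricts to a given field on the fiber exactly if their
multiderivations are related in this way (`isFieldRestriction_iff`), so the square commutes, and
the restriction of multivector fields is a homomorphism because the other three maps are and the
horizontal ones are bijective.
-/

noncomputable section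

namespace VerticalHKR

set_option linter.unusedSectionVars false

/-! ### Cochains evaluated on sequences -/

section Sequences

variable {A : Type*} [CommRing A] [Algebra ℝ A]

/-- The value of a `k`-cochain on the first `k` terms of a sequence. Sequences indexed by `ℕ`
replace tuples in the sign calculus below, since no casts between index types are needed. -/
def onSeq {k : ℕ} (φ : Cochain A k) (F : ℕ → A) : A := φ (fun i => F i)

/-- The sequence obtained from `F` by replacing the block of length `n` that starts at position `t`
by the single term `a`. -/
def insSeq (n t : ℕ) (a : A) (F : ℕ → A) : ℕ → A := fun j =>
  if j < t then F j else if j = t then a else F (j + n - 1)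

/-- Partial composition `Φ ∘ₜ Ψ` of functionals on sequences, `Ψ` having `n` arguments. -/
def insF (n t : ℕ) (Φ Ψ : (ℕ → A) → A) (F : ℕ → A) : A :=
  Φ (insSeq n t (Ψ fun u => F (t + u)) F)

/-- The `i`-th face, `0 ≤ i ≤ k + 1`, of a functional in `k` arguments: these are the terms of the
Hochschild differential. -/
def face (k i : ℕ) (Φ : (ℕ → A) → A) (F : ℕ → A) : A :=
  if i = 0 then F 0 * Φ (fun u => F (u + 1))
  else if i ≤ k then Φ (insSeq 2 (i - 1) (F (i - 1) * F i) F)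
  else Φ F * F k

/-- The Hochschild differential of a functional in `k` arguments. -/
def dSeq (k : ℕ) (Φ : (ℕ → A) → A) (F : ℕ → A) : A :=
  ∑ i ∈ Finset.range (k + 2), (-1 : ℝ) ^ i • face k i Φ F

/-- `Φ` only depends on the first `k` terms of a sequence. -/
def HasArity (k : ℕ) (Φ : (ℕ → A) → A) : Prop :=
  ∀ F G : ℕ → A, (∀ i < k, F i = G i) → Φ F = Φ G

theorem hasArity_onSeq {k : ℕ} (φ : Cochain A k) : HasArity k (onSeq φ) := fun F G h => by
  unfold onSeq
  congr 1
  funext i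
  exact h i i.2

theorem ext_onSeq {k : ℕ} {φ ψ : Cochain A k} (h : ∀ F, onSeq φ F = onSeq ψ F) : φ = ψ := by
  ext f
  have := h (fun n => if hn : n < k then f ⟨n, hn⟩ else 0)
  simpa [onSeq] using this

theorem onSeq_insertAt {m n p : ℕ} (h : m + n = p + 1) (i : Fin m) (φ : Cochain A m)
    (ψ : Cochain A n) (F : ℕ → A) :
    onSeq (insertAt h i φ ψ) F = insF n i (onSeq φ) (onSeq ψ) F := by
  rw [onSeq, insertAt_apply, insF, onSeq]
  congr 1
  funext j
  simp only [insertArgs, insSeq, Fin.lt_def, Fin.ext_iff, onSeq]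
  split_ifs <;> rfl

theorem onSeq_cup {m n p : ℕ} (h : m + n = p) (φ : Cochain A m) (ψ : Cochain A n) (F : ℕ → A) :
    onSeq (cup h φ ψ) F = onSeq φ F * onSeq ψ (fun u => F (m + u)) := rfl

@[simp] theorem onSeq_idCochain (F : ℕ → A) : onSeq (idCochain A) F = F 0 := by
  simp [onSeq, idCochain]

@[simp] theorem onSeq_mulCochain (F : ℕ → A) : onSeq (mulCochain A) F = F 0 * F 1 := by
  simp [mulCochain, onSeq_cup]

@[simp] theorem onSeq_add {k : ℕ} (φ ψ : Cochain A k) (F : ℕ → A) :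
    onSeq (φ + ψ) F = onSeq φ F + onSeq ψ F := rfl

@[simp] theorem onSeq_sub {k : ℕ} (φ ψ : Cochain A k) (F : ℕ → A) :
    onSeq (φ - ψ) F = onSeq φ F - onSeq ψ F := rfl

@[simp] theorem onSeq_smul {k : ℕ} (c : ℝ) (φ : Cochain A k) (F : ℕ → A) :
    onSeq (c • φ) F = c • onSeq φ F := rfl

@[simp] theorem onSeq_zero {k : ℕ} (F : ℕ → A) : onSeq (0 : Cochain A k) F = 0 := rfl

@[simp] theorem onSeq_sum {k : ℕ} {ι : Type*} (s : Finset ι) (φ : ι → Cochain A k) (F : ℕ → A) :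
    onSeq (∑ i ∈ s, φ i) F = ∑ i ∈ s, onSeq (φ i) F := by
  simp [onSeq, _root_.sum_apply]

theorem onSeq_hochschildD {k : ℕ} (φ : Cochain A k) (F : ℕ → A) :
    onSeq (hochschildD φ) F = dSeq k (onSeq φ) F := by
  rw [dSeq, Finset.sum_range_succ, Finset.sum_range_succ', hochschildD]
  simp only [onSeq_add, onSeq_sum, onSeq_smul, onSeq_insertAt, onSeq_cup, onSeq_idCochain]
  rw [Finset.sum_range fun i => (-1 : ℝ) ^ (i + 1) • face k (i + 1) (onSeq φ) F]
  have h0 : face k 0 (onSeq φ) F = F 0 * onSeq φ fun u => F (1 + u) := by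
    simp [face, add_comm]
  have h1 : face k (k + 1) (onSeq φ) F = onSeq φ F * F k := by simp [face]
  have h2 : ∀ i : Fin k, face k ((i : ℕ) + 1) (onSeq φ) F =
      insF 2 i (onSeq φ) (onSeq (mulCochain A)) F := fun i => by
    simp [face, insF]
  simp only [h0, h1, h2, pow_zero, one_smul, add_zero]
  abel

theorem onSeq_circ {m n p : ℕ} (h : m + n = p + 1) (φ : Cochain A m) (ψ : Cochain A n)
    (F : ℕ → A) : onSeq (circ h φ ψ) F =
      ∑ i ∈ Finset.range m, (-1 : ℝ) ^ ((n + 1) * i) • insF n i (onSeq φ) (onSeq ψ) F := by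
  simp only [circ, onSeq_sum, onSeq_smul, onSeq_insertAt]
  rw [Finset.sum_range fun i => (-1 : ℝ) ^ ((n + 1) * i) • insF n i (onSeq φ) (onSeq ψ) F]

theorem onSeq_insSeq_add {k n t : ℕ} (ht : t < k) (φ : Cochain A k) (a b : A) (F : ℕ → A) :
    onSeq φ (insSeq n t (a + b) F) = onSeq φ (insSeq n t a F) + onSeq φ (insSeq n t b F) := by
  have h : ∀ c : A, onSeq φ (insSeq n t c F) =
      φ (Function.update (fun i : Fin k => insSeq n t 0 F i) ⟨t, ht⟩ c) := fun c => by
    unfold onSeq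
    congr 1
    funext j
    simp only [insSeq, Function.update_apply, Fin.ext_iff]
    split_ifs <;> first | rfl | omega
  rw [h, h, h, φ.map_update_add]

theorem onSeq_insSeq_smul {k n t : ℕ} (ht : t < k) (φ : Cochain A k) (c : ℝ) (a : A)
    (F : ℕ → A) : onSeq φ (insSeq n t (c • a) F) = c • onSeq φ (insSeq n t a F) := by
  have h : ∀ c : A, onSeq φ (insSeq n t c F) =
      φ (Function.update (fun i : Fin k => insSeq n t 0 F i) ⟨t, ht⟩ c) := fun c => by
    unfold onSeq
    congr 1
    funext j
    simp only [insSeq, Function.update_apply, Fin.ext_iff]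
    split_ifs <;> first | rfl | omega
  rw [h, h, φ.map_update_smul]

/-! #### Faces of partial compositions -/

/-- The faces of `Φ ∘ₜ Ψ` which merge arguments to the left of the inserted `Ψ`. -/
theorem face_insF_of_le {k n t i : ℕ} {Φ Ψ : (ℕ → A) → A} (hi : i ≤ t) (ht : t < k)
    (F : ℕ → A) :
    face (k + n - 1) i (insF n t Φ Ψ) F = insF n (t + 1) (face k i Φ) Ψ F := by
  rcases Nat.eq_zero_or_pos i with rfl | h0
  · have h0 : insSeq n (t + 1) (Ψ fun u => F (t + 1 + u)) F 0 = F 0 := by simp [insSeq]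
    simp only [face, insF, if_true, h0]
    congr 2
    funext j
    simp only [insSeq]
    split_ifs <;> first | rfl | omega | skip
    · congr 1; funext u; congr 1; omega
    · congr 1; omega
  · have h1 : ¬ i = 0 := by omega
    have h2 : i ≤ k + n - 1 := by omega
    have h3 : i ≤ k := by omega
    simp only [face, insF, h1, h2, h3, if_true, if_false]
    congr 1
    funext j
    simp only [insSeq]
    split_ifs <;> first | rfl | omega | skip
    · congr 1
      funext u
      split_ifs <;> first | omega | skip
      congr 1; omega
    · congr 1; omega

/-- The faces of `Φ ∘ₜ Ψ` which merge arguments to the right of the inserted `Ψ`. -/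
theorem face_insF_of_ge {k n t i : ℕ} {Φ Ψ : (ℕ → A) → A} (hi : t + 2 ≤ i) (hk : i ≤ k + 1)
    (hΨ : HasArity n Ψ) (F : ℕ → A) :
    face (k + n - 1) (i + n - 1) (insF n t Φ Ψ) F = insF n t (face k i Φ) Ψ F := by
  rcases Nat.lt_or_ge k i with hik | hik
  · have h1 : ¬ i + n - 1 = 0 := by omega
    have h2 : ¬ i + n - 1 ≤ k + n - 1 := by omega
    have h3 : ¬ i ≤ k := by omega
    have h4 : ¬ i = 0 := by omega
    simp only [face, insF, h1, h2, h3, h4, if_false]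
    congr 1
    simp only [insSeq]
    split_ifs <;> first | omega | rfl
  · have h1 : ¬ i + n - 1 = 0 := by omega
    have h2 : i + n - 1 ≤ k + n - 1 := by omega
    have h4 : ¬ i = 0 := by omega
    simp only [face, insF, h1, h2, hik, h4, if_true, if_false]
    congr 1
    funext j
    simp only [insSeq]
    split_ifs <;> first | rfl | omega | skip
    · refine hΨ _ _ fun u hu => ?_
      rw [if_pos (by omega)]
    · congr 2; omega
    · congr 1; omega

/-- The faces of `Φ ∘ₜ Ψ` which merge two arguments of the inserted `Ψ`. -/
theorem face_insF_inner {k n t i : ℕ} {Φ Ψ : (ℕ → A) → A} (hi : 1 ≤ i) (hn : i ≤ n) (ht : t < k)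
    (F : ℕ → A) :
    face (k + n - 1) (t + i) (insF n t Φ Ψ) F = insF (n + 1) t Φ (face n i Ψ) F := by
  have h1 : ¬ t + i = 0 := by omega
  have h2 : t + i ≤ k + n - 1 := by omega
  have h4 : ¬ i = 0 := by omega
  simp only [face, insF, h1, h2, hn, h4, if_true, if_false]
  congr 1
  funext j
  simp only [insSeq]
  split_ifs <;> first | rfl | omega | skip
  · congr 1
    funext u
    simp only [insSeq]
    split_ifs <;> first | rfl | omega | skip
    · congr 2; omega
  · congr 1; omega

/-- The zeroth face of `Ψ`, inserted into `Φ`: the argument in front of `Ψ` is multiplied with the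
value of `Ψ`, as it is by a face of `Φ`. -/
theorem insF_face_zero {k n t : ℕ} {Φ Ψ : (ℕ → A) → A} (ht : t < k) (F : ℕ → A) :
    insF (n + 1) t Φ (face n 0 Ψ) F = insF n (t + 1) (face k (t + 1) Φ) Ψ F := by
  have h2 : t + 1 ≤ k := ht
  simp only [face, insF, h2, if_true, Nat.add_one_ne_zero, if_false]
  congr 1
  funext j
  simp only [insSeq]
  split_ifs <;> first | rfl | omega | skip
  · simp only [Nat.add_sub_cancel, add_zero]
    congr 2; funext u; congr 1; omega
  · congr 1; omega

/-- The last face of `Ψ`, inserted into `Φ`: the argument behind `Ψ` is multiplied with the value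
of `Ψ`, as it is by a face of `Φ`. -/
theorem insF_face_last {k n t : ℕ} {Φ Ψ : (ℕ → A) → A} (ht : t < k) (F : ℕ → A) :
    insF (n + 1) t Φ (face n (n + 1) Ψ) F = insF n t (face k (t + 1) Φ) Ψ F := by
  have h2 : t + 1 ≤ k := ht
  have h3 : ¬ n + 1 ≤ n := by omega
  simp only [face, insF, h2, h3, if_true, Nat.add_one_ne_zero, if_false]
  congr 1
  funext j
  simp only [insSeq]
  split_ifs <;> first | rfl | omega | skip
  · congr 2; omega
  · congr 1; omega

/-- Nested partial compositions. -/
theorem insF_insF_nested {n p i j : ℕ} {Φ Ψ Ξ : (ℕ → A) → A} (h1 : i ≤ j) (h2 : j < i + n)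
    (F : ℕ → A) :
    insF p j (insF n i Φ Ψ) Ξ F = insF (n + p - 1) i Φ (insF p (j - i) Ψ Ξ) F := by
  simp only [insF]
  congr 1
  funext l
  simp only [insSeq]
  split_ifs <;> first | rfl | omega | skip
  · congr 1
    funext u
    simp only [insSeq]
    split_ifs <;> first | rfl | omega | skip
    · congr 1; funext v; congr 1; omega
    · congr 1; omega
  · congr 1; omega

/-- Parallel partial compositions commute. -/
theorem insF_insF_parallel {n p i j : ℕ} {Φ Ψ Ξ : (ℕ → A) → A} (h : j < i) (hΞ : HasArity p Ξ)
    (F : ℕ → A) :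
    insF p j (insF n i Φ Ψ) Ξ F = insF n (i + p - 1) (insF p j Φ Ξ) Ψ F := by
  simp only [insF]
  congr 1
  funext l
  simp only [insSeq]
  split_ifs <;> first | rfl | omega | skip
  · refine hΞ _ _ fun u hu => ?_
    rw [if_pos (by omega)]
  · congr 1
    funext u
    split_ifs <;> first | rfl | omega | skip
    congr 1; omega
  · congr 1; omega

end Sequences

/-! ### Homotopies for compositions and for the cup product -/

section Homotopies

variable {A : Type*} [CommRing A] [Algebra ℝ A]

theorem neg_one_pow_smul_smul (i j : ℕ) (a : A) :
    (-1 : ℝ) ^ i • (-1 : ℝ) ^ j • a = (-1 : ℝ) ^ (i + j) • a := by rw [smul_smul, pow_add]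

/-- The partial sum of the first faces in the Hochschild differential. -/
def dLow (k j : ℕ) (Φ : (ℕ → A) → A) (F : ℕ → A) : A :=
  ∑ i ∈ Finset.range (j + 1), (-1 : ℝ) ^ i • face k i Φ F

/-- The partial sum of the last faces in the Hochschild differential. -/
def dHigh (k j : ℕ) (Φ : (ℕ → A) → A) (F : ℕ → A) : A :=
  ∑ i ∈ Finset.Ico j (k + 2), (-1 : ℝ) ^ i • face k i Φ F

theorem dLow_add_dHigh {k j : ℕ} (h : j ≤ k + 1) (Φ : (ℕ → A) → A) (F : ℕ → A) :
    dLow k j Φ F + dHigh k (j + 1) Φ F = dSeq k Φ F := by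
  rw [dLow, dHigh, dSeq, Finset.sum_range_add_sum_Ico _ (by omega)]

/-- The differential of a partial composition `φ ∘ₜ b`. The faces of `φ` are shared out: the first
ones act to the left of `b`, the last ones to its right. -/
theorem dSeq_insF {k n t : ℕ} (φ : Cochain A k) (b : Cochain A n) (ht : t < k) (F : ℕ → A) :
    dSeq (k + n - 1) (insF n t (onSeq φ) (onSeq b)) F =
      insF n (t + 1) (dLow k (t + 1) (onSeq φ)) (onSeq b) F +
        (-1 : ℝ) ^ (n + 1) • insF n t (dHigh k (t + 1) (onSeq φ)) (onSeq b) F +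
        (-1 : ℝ) ^ t • insF (n + 1) t (onSeq φ) (dSeq n (onSeq b)) F := by
  set Φ := onSeq φ
  set Ψ := onSeq b
  -- the inner faces of `b` are `δ b` without the two outer faces
  have hinner : ∑ i ∈ Finset.range n, (-1 : ℝ) ^ (i + 1) • insF (n + 1) t Φ (face n (i + 1) Ψ) F =
      insF (n + 1) t Φ (dSeq n Ψ) F - insF (n + 1) t Φ (face n 0 Ψ) F
        - (-1 : ℝ) ^ (n + 1) • insF (n + 1) t Φ (face n (n + 1) Ψ) F := by
    set T : ((ℕ → A) → A) → A := fun Θ => insF (n + 1) t Φ Θ F with hT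
    have hadd : ∀ Θ Θ' : (ℕ → A) → A, T (fun G => Θ G + Θ' G) = T Θ + T Θ' := fun Θ Θ' =>
      onSeq_insSeq_add ht φ _ _ F
    have hsmul : ∀ (c : ℝ) (Θ : (ℕ → A) → A), T (fun G => c • Θ G) = c • T Θ := fun c Θ =>
      onSeq_insSeq_smul ht φ c _ F
    have hzero : T (fun _ => 0) = 0 := by simpa using hsmul 0 (fun _ => 0)
    have hsum : ∀ (N : ℕ) (c : ℕ → ℝ) (Θ : ℕ → (ℕ → A) → A),
        T (fun G => ∑ i ∈ Finset.range N, c i • Θ i G) =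
          ∑ i ∈ Finset.range N, c i • T (Θ i) := by
      intro N c Θ
      induction N with
      | zero => simpa using hzero
      | succ N ih =>
        simp only [Finset.sum_range_succ]
        rw [hadd (fun G => ∑ i ∈ Finset.range N, c i • Θ i G) (fun G => c N • Θ N G), ih, hsmul]
    have h1 : T (dSeq n Ψ) = ∑ i ∈ Finset.range (n + 2), (-1 : ℝ) ^ i • T (face n i Ψ) :=
      hsum (n + 2) _ _
    rw [Finset.sum_range_succ, Finset.sum_range_succ', pow_zero, one_smul] at h1
    change ∑ i ∈ Finset.range n, (-1 : ℝ) ^ (i + 1) • T (face n (i + 1) Ψ) =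
      T (dSeq n Ψ) - T (face n 0 Ψ) - (-1 : ℝ) ^ (n + 1) • T (face n (n + 1) Ψ)
    rw [h1]
    abel
  have hsplit : dSeq (k + n - 1) (insF n t Φ Ψ) F =
      ∑ i ∈ Finset.range (t + 1), (-1 : ℝ) ^ i • insF n (t + 1) (face k i Φ) Ψ F
      + (-1 : ℝ) ^ t • ∑ i ∈ Finset.range n,
          (-1 : ℝ) ^ (i + 1) • insF (n + 1) t Φ (face n (i + 1) Ψ) F
      + (-1 : ℝ) ^ (n + 1) • ∑ i ∈ Finset.Ico (t + 2) (k + 2),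
          (-1 : ℝ) ^ i • insF n t (face k i Φ) Ψ F := by
    have e1 : k + n - 1 + 2 = k + n + 1 := by omega
    rw [dSeq, e1, ← Finset.sum_range_add_sum_Ico _ (show t + 1 + n ≤ k + n + 1 by omega),
      ← Finset.sum_range_add_sum_Ico _ (show t + 1 ≤ t + 1 + n by omega)]
    congr 1
    · congr 1
      · refine Finset.sum_congr rfl fun i hi => ?_
        rw [face_insF_of_le (by have := Finset.mem_range.1 hi; omega) ht]
      · rw [Finset.sum_Ico_eq_sum_range, Finset.smul_sum, Nat.add_sub_cancel_left]
        refine Finset.sum_congr rfl fun i hi => ?_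
        have e : t + 1 + i = t + (i + 1) := by ring
        rw [e, face_insF_inner (by omega) (by have := Finset.mem_range.1 hi; omega) ht,
          neg_one_pow_smul_smul]
    · rw [Finset.smul_sum, Finset.sum_Ico_eq_sum_range, Finset.sum_Ico_eq_sum_range]
      have e : k + n + 1 - (t + 1 + n) = k + 2 - (t + 2) := by omega
      rw [e]
      refine Finset.sum_congr rfl fun i hi => ?_
      have hi' := Finset.mem_range.1 hi
      have e2 : t + 1 + n + i = (t + 2 + i) + n - 1 := by omega
      rw [neg_one_pow_smul_smul, e2, face_insF_of_ge (by omega) (by omega) (hasArity_onSeq b),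
        ← e2]
      congr 1
      ring
  have hlow : insF n (t + 1) (dLow k (t + 1) Φ) Ψ F =
      ∑ i ∈ Finset.range (t + 1), (-1 : ℝ) ^ i • insF n (t + 1) (face k i Φ) Ψ F +
        (-1 : ℝ) ^ (t + 1) • insF n (t + 1) (face k (t + 1) Φ) Ψ F :=
    Finset.sum_range_succ _ _
  have hhigh : insF n t (dHigh k (t + 1) Φ) Ψ F =
      (-1 : ℝ) ^ (t + 1) • insF n t (face k (t + 1) Φ) Ψ F +
      ∑ i ∈ Finset.Ico (t + 2) (k + 2), (-1 : ℝ) ^ i • insF n t (face k i Φ) Ψ F :=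
    Finset.sum_eq_sum_Ico_succ_bot (by omega) _
  rw [hsplit, hlow, hhigh, hinner, insF_face_zero ht, insF_face_last ht, smul_sub, smul_sub,
    neg_one_pow_smul_smul, smul_add, neg_one_pow_smul_smul, sub_eq_add_neg, sub_eq_add_neg,
    ← neg_smul, ← neg_smul]
  have e1 : -(-1 : ℝ) ^ t = (-1) ^ (t + 1) := by ring
  have e2 : -(-1 : ℝ) ^ (t + (n + 1)) = (-1) ^ (n + 1 + (t + 1)) := by ring
  rw [e1, e2]
  abel

theorem insF_dHigh_last {k n : ℕ} (φ : Cochain A k) (b : Cochain A n) (F : ℕ → A) :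
    insF n k (dHigh k (k + 1) (onSeq φ)) (onSeq b) F =
      (-1 : ℝ) ^ (k + 1) • (onSeq φ F * onSeq b fun u => F (k + u)) := by
  have h : onSeq φ (insSeq n k (onSeq b fun u => F (k + u)) F) = onSeq φ F :=
    hasArity_onSeq φ _ _ fun i hi => by simp [insSeq, hi]
  simp [insF, dHigh, face, h]
  simp [insSeq]

theorem insF_dLow_zero {k n : ℕ} (φ : Cochain A k) (b : Cochain A n) (F : ℕ → A) :
    insF n 0 (dLow k 0 (onSeq φ)) (onSeq b) F = onSeq b F * onSeq φ fun u => F (n + u) := by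
  simp only [insF, dLow, face, zero_add, Finset.range_one, Finset.sum_singleton, pow_zero,
    if_true, one_smul]
  have h : ∀ a : A, insSeq n 0 a F 0 = a := fun a => by simp [insSeq]
  have h' : ∀ a : A, (fun u => insSeq n 0 a F (u + 1)) = fun u => F (n + u) := fun a => by
    funext u
    have : u + 1 + n - 1 = n + u := by omega
    simp [insSeq, this]
  rw [h, h']

theorem face_sum {ι : Type*} (s : Finset ι) (c : ι → ℝ) (Φ : ι → (ℕ → A) → A) (k i : ℕ)
    (F : ℕ → A) : face k i (fun G => ∑ t ∈ s, c t • Φ t G) F = ∑ t ∈ s, c t • face k i (Φ t) F := by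
  unfold face
  split_ifs <;> simp [Finset.mul_sum, Finset.sum_mul]

theorem dSeq_sum {ι : Type*} (s : Finset ι) (c : ι → ℝ) (Φ : ι → (ℕ → A) → A) (k : ℕ)
    (F : ℕ → A) : dSeq k (fun G => ∑ t ∈ s, c t • Φ t G) F = ∑ t ∈ s, c t • dSeq k (Φ t) F := by
  simp only [dSeq, face_sum, Finset.smul_sum]
  rw [Finset.sum_comm]
  refine Finset.sum_congr rfl fun t _ => Finset.sum_congr rfl fun i _ => ?_
  rw [smul_comm]

/-- The differential of the sum of the first `t` terms of `φ ∘ b`. -/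
theorem sum_dSeq_insF {k n t : ℕ} (φ : Cochain A k) (b : Cochain A n) (ht : t ≤ k) (F : ℕ → A) :
    ∑ s ∈ Finset.range t, (-1 : ℝ) ^ ((n + 1) * s) •
        dSeq (k + n - 1) (insF n s (onSeq φ) (onSeq b)) F =
      (-1 : ℝ) ^ (n + 1) • (∑ s ∈ Finset.range t,
          (-1 : ℝ) ^ ((n + 1) * s) • insF n s (dSeq k (onSeq φ)) (onSeq b) F +
        (-1 : ℝ) ^ ((n + 1) * t) • insF n t (dLow k t (onSeq φ)) (onSeq b) F -
        onSeq b F * onSeq φ fun u => F (n + u)) +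
      ∑ s ∈ Finset.range t, (-1 : ℝ) ^ ((n + 1 + 1) * s) •
        insF (n + 1) s (onSeq φ) (dSeq n (onSeq b)) F := by
  set P : ℕ → A := fun t => insF n t (dLow k t (onSeq φ)) (onSeq b) F with hP
  set Q : ℕ → A := fun t => insF n t (dHigh k (t + 1) (onSeq φ)) (onSeq b) F with hQ
  have hR : ∀ s ∈ Finset.range t, (-1 : ℝ) ^ ((n + 1) * s) •
      insF n s (dSeq k (onSeq φ)) (onSeq b) F =
      (-1 : ℝ) ^ ((n + 1) * s) • P s + (-1 : ℝ) ^ ((n + 1) * s) • Q s := fun s hs => by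
    rw [← smul_add]
    congr 1
    exact (dLow_add_dHigh (by have := Finset.mem_range.1 hs; omega) _ _).symm
  have hL : ∀ s ∈ Finset.range t, (-1 : ℝ) ^ ((n + 1) * s) •
      dSeq (k + n - 1) (insF n s (onSeq φ) (onSeq b)) F =
      (-1 : ℝ) ^ (n + 1) • ((-1 : ℝ) ^ ((n + 1) * (s + 1)) • P (s + 1)) +
        (-1 : ℝ) ^ (n + 1) • ((-1 : ℝ) ^ ((n + 1) * s) • Q s) +
        (-1 : ℝ) ^ ((n + 1 + 1) * s) •
          insF (n + 1) s (onSeq φ) (dSeq n (onSeq b)) F := fun s hs => by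
    rw [dSeq_insF φ b (by have := Finset.mem_range.1 hs; omega), smul_add, smul_add,
      neg_one_pow_smul_smul, neg_one_pow_smul_smul, neg_one_pow_smul_smul, neg_one_pow_smul_smul]
    congr 1
    · congr 1
      · congr 1
        have : n + 1 + (n + 1) * (s + 1) = 2 * (n + 1) + (n + 1) * s := by ring
        rw [this, pow_add, pow_mul]; simp
      · rw [add_comm]
    · rw [← Nat.succ_mul]
  have h0 : P 0 = onSeq b F * onSeq φ fun u => F (n + u) := insF_dLow_zero φ b F
  have htel : ∑ s ∈ Finset.range t, (-1 : ℝ) ^ ((n + 1) * (s + 1)) • P (s + 1) =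
      ∑ s ∈ Finset.range t, (-1 : ℝ) ^ ((n + 1) * s) • P s + (-1 : ℝ) ^ ((n + 1) * t) • P t
        - P 0 := by
    rw [← Finset.sum_range_succ (fun t => (-1 : ℝ) ^ ((n + 1) * t) • P t),
      Finset.sum_range_succ' (fun t => (-1 : ℝ) ^ ((n + 1) * t) • P t)]
    simp
  rw [Finset.sum_congr rfl hL, Finset.sum_congr rfl hR, Finset.sum_add_distrib,
    Finset.sum_add_distrib, Finset.sum_add_distrib, ← Finset.smul_sum, ← Finset.smul_sum, htel,
    ← h0, ← smul_add]
  congr 2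
  abel

theorem insF_zero_right {k n t : ℕ} (φ : Cochain A k) (ht : t < k) (F : ℕ → A) :
    insF n t (onSeq φ) (fun _ => 0) F = 0 := by
  simpa [insF] using onSeq_insSeq_smul (n := n) ht φ 0 0 F

/-- Inserting `b` and `a` into two arguments that are multiplied by a face of `Φ` amounts to
inserting their cup product. -/
theorem insF_face_cup {k m n t : ℕ} {Φ a b : (ℕ → A) → A} (ht : t < k) (F : ℕ → A) :
    insF m t (insF n (t + 1) (face k (t + 1) Φ) b) a F =
      insF (m + n) t Φ (fun G => a G * b fun u => G (m + u)) F := by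
  have h2 : t + 1 ≤ k := ht
  simp only [face, insF, h2, if_true, Nat.add_one_ne_zero, if_false]
  congr 1
  funext j
  simp only [insSeq]
  split_ifs <;> first | rfl | omega | skip
  · have e : (fun u => F (t + 1 + u + m - 1)) = fun u => F (t + (m + u)) := by
      funext u; congr 1; omega
    have h : ∀ u, ¬ (t + 1 + u < t) ∧ ¬ (t + 1 + u = t) := fun u => by omega
    simp [(h _).1, (h _).2, e]
  · congr 1; omega

/-- The brace homotopy: for cocycles `φ`, `a`, `b` the composition `φ ∘ -` is a derivation of the
cup product up to the coboundary of `φ{a, b}`. -/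
theorem dSeq_brace {k m n : ℕ} (φ : Cochain A k) (a : Cochain A m) (b : Cochain A n)
    (hφ : hochschildD φ = 0) (ha : hochschildD a = 0) (hb : hochschildD b = 0) (F : ℕ → A) :
    (-1 : ℝ) ^ (m + 1) • dSeq (k + n + m - 2) (fun G => ∑ t ∈ Finset.range k,
        (-1 : ℝ) ^ ((n + 1) * t) • ∑ s ∈ Finset.range t, (-1 : ℝ) ^ ((m + 1) * s) •
          insF m s (insF n t (onSeq φ) (onSeq b)) (onSeq a) G) F =
      ∑ t ∈ Finset.range k, (-1 : ℝ) ^ ((m + n + 1) * t) •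
          insF (m + n) t (onSeq φ) (fun G => onSeq a G * onSeq b fun u => G (m + u)) F
      - onSeq a F * (∑ t ∈ Finset.range k, (-1 : ℝ) ^ ((n + 1) * t) •
          insF n t (onSeq φ) (onSeq b) fun u => F (m + u))
      - (-1 : ℝ) ^ (n * (k + 1)) • ((∑ s ∈ Finset.range k, (-1 : ℝ) ^ ((m + 1) * s) •
          insF m s (onSeq φ) (onSeq a) F) * onSeq b fun u => F (k + m - 1 + u)) := by
  rcases Nat.eq_zero_or_pos k with rfl | hk0
  · simp [dSeq, face]
  have hK : k + n = (k + n - 1) + 1 := by omega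
  have hd0 : ∀ {l : ℕ} {c : Cochain A l}, hochschildD c = 0 → dSeq l (onSeq c) = fun _ => 0 :=
    fun {l c} hc => funext fun G => by rw [← onSeq_hochschildD, hc]; rfl
  -- `φ` is a cocycle, so the partial sums of its faces in `U` and in `V` cancel.
  set U : ℕ → ℕ → A := fun t s => insF m s (insF n t (dLow k t (onSeq φ)) (onSeq b)) (onSeq a) F
    with hU
  set V : ℕ → ℕ → A := fun t s =>
    insF m s (insF n t (dHigh k (t + 1) (onSeq φ)) (onSeq b)) (onSeq a) F with hV
  have hUV : ∀ t ≤ k, ∀ s, U t s = -V t s := fun t ht s => by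
    have h : ∀ G, dLow k t (onSeq φ) G + dHigh k (t + 1) (onSeq φ) G = 0 := fun G => by
      rw [dLow_add_dHigh (by omega), ← onSeq_hochschildD, hφ]; rfl
    exact eq_neg_of_add_eq_zero_left (h _)
  -- The summand of index `t` contributes a difference of consecutive terms, the insertion of the
  -- cup product and the product of `a` with an insertion of `b`.
  have hterm : ∀ t ∈ Finset.range k, (-1 : ℝ) ^ ((n + 1) * t) • dSeq (k + n + m - 2)
      (fun G => ∑ s ∈ Finset.range t, (-1 : ℝ) ^ ((m + 1) * s) •
          insF m s (insF n t (onSeq φ) (onSeq b)) (onSeq a) G) F =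
      (-1 : ℝ) ^ (m + 1) • ((-1 : ℝ) ^ (n + 1) •
          ((-1 : ℝ) ^ ((n + 1) * (t + 1)) • ∑ s ∈ Finset.range (t + 1),
            (-1 : ℝ) ^ ((m + 1) * s) • U (t + 1) s) -
        (-1 : ℝ) ^ (n + 1) • ((-1 : ℝ) ^ ((n + 1) * t) • ∑ s ∈ Finset.range t,
            (-1 : ℝ) ^ ((m + 1) * s) • U t s) +
        (-1 : ℝ) ^ ((m + n + 1) * t) •
          insF (m + n) t (onSeq φ) (fun G => onSeq a G * onSeq b fun u => G (m + u)) F -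
        (-1 : ℝ) ^ ((n + 1) * t) • (onSeq a F *
          insF n t (onSeq φ) (onSeq b) fun u => F (m + u))) := by
    intro t ht
    have ht' := Finset.mem_range.1 ht
    set ψ : Cochain A (k + n - 1) := insertAt hK ⟨t, ht'⟩ φ b with hψ
    have hψe : insF n t (onSeq φ) (onSeq b) = onSeq ψ :=
      funext fun G => (onSeq_insertAt hK ⟨t, ht'⟩ φ b G).symm
    have hd : dSeq (k + n - 1) (onSeq ψ) = fun G =>
        insF n (t + 1) (dLow k (t + 1) (onSeq φ)) (onSeq b) G +
          (-1 : ℝ) ^ (n + 1) • insF n t (dHigh k (t + 1) (onSeq φ)) (onSeq b) G := by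
      funext G
      rw [← hψe, dSeq_insF φ b ht', hd0 hb, insF_zero_right φ ht', smul_zero, add_zero]
    have hlow : dLow (k + n - 1) t (onSeq ψ) = insF n (t + 1) (dLow k t (onSeq φ)) (onSeq b) := by
      funext G
      refine Finset.sum_congr rfl fun i hi => ?_
      rw [← hψe, face_insF_of_le (by have := Finset.mem_range.1 hi; omega) ht']
      rfl
    have hW : insF m t (insF n (t + 1) (dLow k t (onSeq φ)) (onSeq b)) (onSeq a) F =
        U (t + 1) t + (-1 : ℝ) ^ t • insF (m + n) t (onSeq φ)
          (fun G => onSeq a G * onSeq b fun u => G (m + u)) F := by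
      rw [← insF_face_cup ht', ← sub_eq_iff_eq_add]
      have : U (t + 1) t = insF m t (insF n (t + 1) (dLow k t (onSeq φ)) (onSeq b)) (onSeq a) F +
          (-1 : ℝ) ^ (t + 1) •
            insF m t (insF n (t + 1) (face k (t + 1) (onSeq φ)) (onSeq b)) (onSeq a) F :=
        Finset.sum_range_succ _ _
      rw [this, pow_succ, mul_neg_one, neg_smul, sub_eq_add_neg]
    have hdU : ∀ s, insF m s (dSeq (k + n - 1) (onSeq ψ)) (onSeq a) F =
        U (t + 1) s + (-1 : ℝ) ^ (n + 1) • V t s := fun s => by rw [hd]; rfl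
    have e : k + n + m - 2 = k + n - 1 + m - 1 := by omega
    have hz : ∑ s ∈ Finset.range t, (-1 : ℝ) ^ ((m + 1 + 1) * s) •
        insF (m + 1) s (onSeq ψ) (dSeq m (onSeq a)) F = 0 :=
      Finset.sum_eq_zero fun s hs => by
        rw [hd0 ha, insF_zero_right ψ (by have := Finset.mem_range.1 hs; omega), smul_zero]
    rw [hψe, dSeq_sum, e, sum_dSeq_insF ψ a (by omega), hz, add_zero, hlow, hW]
    have hs : ∀ f g : ℕ → A, ∀ c : ℝ, ∑ s ∈ Finset.range t, (-1 : ℝ) ^ ((m + 1) * s) •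
        (f s + c • g s) = ∑ s ∈ Finset.range t, (-1 : ℝ) ^ ((m + 1) * s) • f s +
          c • ∑ s ∈ Finset.range t, (-1 : ℝ) ^ ((m + 1) * s) • g s := fun f g c => by
      simp only [smul_add, Finset.sum_add_distrib, Finset.smul_sum, smul_comm c]
    have hneg : ∑ s ∈ Finset.range t, (-1 : ℝ) ^ ((m + 1) * s) • U t s =
        -∑ s ∈ Finset.range t, (-1 : ℝ) ^ ((m + 1) * s) • V t s := by
      simp only [hUV t ht'.le, smul_neg, Finset.sum_neg_distrib]
    simp only [hdU, hs, hneg, Finset.sum_range_succ]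
    have hε : (-1 : ℝ) ^ (n + 1) * (-1) ^ (n + 1) = 1 := by rw [← mul_pow]; simp
    have hd1 : (-1 : ℝ) ^ ((n + 1) * (t + 1)) = (-1) ^ (n + 1) * (-1) ^ ((n + 1) * t) := by ring
    have hd2 : (-1 : ℝ) ^ ((m + n + 1) * t) =
        (-1) ^ ((n + 1) * t) * (-1) ^ ((m + 1) * t) * (-1) ^ t := by
      rw [← pow_add, ← pow_add,
        show (n + 1) * t + (m + 1) * t + t = (m + n + 1) * t + 2 * t by ring, pow_add _ _ (2 * t),
        pow_mul _ 2 t]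
      simp
    rw [hd1, hd2, ← hψe]
    simp only [smul_smul (_ ^ (n + 1)), ← mul_assoc, hε, one_mul]
    module
  rw [dSeq_sum, Finset.sum_congr rfl hterm, ← Finset.smul_sum, smul_smul, ← mul_pow]
  simp only [mul_neg, mul_one, neg_neg, one_pow, one_smul, Finset.sum_sub_distrib,
    Finset.sum_add_distrib, ← Finset.smul_sum, ← Finset.mul_sum, ← mul_smul_comm]
  set Y : ℕ → A := fun t => (-1 : ℝ) ^ ((n + 1) * t) • ∑ s ∈ Finset.range t,
    (-1 : ℝ) ^ ((m + 1) * s) • U t s with hY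
  -- The differences telescope to the boundary term `Y k`, where `b` stands behind all of `φ`.
  have htel : ∑ t ∈ Finset.range k, Y (t + 1) = ∑ t ∈ Finset.range k, Y t + Y k := by
    rw [← Finset.sum_range_succ, Finset.sum_range_succ']
    simp [hY]
  have hYk : Y k = -((-1 : ℝ) ^ ((n + 1) * k) • (-1 : ℝ) ^ (k + 1) •
      ((∑ s ∈ Finset.range k, (-1 : ℝ) ^ ((m + 1) * s) •
          insF m s (onSeq φ) (onSeq a) F) * onSeq b fun u => F (k + m - 1 + u))) := by
    rw [hY, Finset.sum_mul, Finset.smul_sum (r := (-1 : ℝ) ^ (k + 1)), ← smul_neg,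
      ← Finset.sum_neg_distrib]
    simp only
    congr 1
    refine Finset.sum_congr rfl fun s hs => ?_
    have hs' := Finset.mem_range.1 hs
    have : V k s = (-1 : ℝ) ^ (k + 1) • (insF m s (onSeq φ) (onSeq a) F *
        onSeq b fun u => F (k + m - 1 + u)) := by
      have := insF_dHigh_last φ b (insSeq m s (onSeq a fun u => F (s + u)) F)
      refine this.trans ?_
      congr 2
      congr 1
      funext u
      simp only [insSeq]
      split_ifs <;> first | omega | skip
      congr 1; omega
    rw [hUV k le_rfl, this, smul_neg, smul_mul_assoc, smul_comm]
  change (-1 : ℝ) ^ (n + 1) • ∑ t ∈ Finset.range k, Y (t + 1) -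
    (-1 : ℝ) ^ (n + 1) • ∑ t ∈ Finset.range k, Y t + _ - _ = _
  rw [htel, hYk, smul_add, add_sub_cancel_left, smul_neg, smul_smul, smul_smul]
  have e1 : (-1 : ℝ) ^ (n + 1) * ((-1) ^ ((n + 1) * k) * (-1) ^ (k + 1)) =
      (-1) ^ (n * (k + 1)) := by
    rw [← pow_add, ← pow_add,
      show n + 1 + ((n + 1) * k + (k + 1)) = 2 * (k + 1) + n * (k + 1) by ring, pow_add, pow_mul]
    simp
  rw [← mul_assoc] at e1
  rw [e1, mul_smul_comm]
  abel

/-- The Gerstenhaber composition of functionals in `m` and `n` arguments. -/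
def circF (m n : ℕ) (Φ Ψ : (ℕ → A) → A) (F : ℕ → A) : A :=
  ∑ i ∈ Finset.range m, (-1 : ℝ) ^ ((n + 1) * i) • insF n i Φ Ψ F

/-- The Gerstenhaber composition is a chain map up to the commutator of the cup product:
`δ(φ ∘ b) = (-1)^{n-1} (δφ) ∘ b + φ ∘ δb + (-1)^n (b ∪ φ - (-1)^{kn} φ ∪ b)`. -/
theorem dSeq_circF {k n : ℕ} (φ : Cochain A k) (b : Cochain A n) (F : ℕ → A) :
    dSeq (k + n - 1) (circF k n (onSeq φ) (onSeq b)) F =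
      (-1 : ℝ) ^ (n + 1) • circF (k + 1) n (dSeq k (onSeq φ)) (onSeq b) F +
      circF k (n + 1) (onSeq φ) (dSeq n (onSeq b)) F +
      (-1 : ℝ) ^ n • (onSeq b F * onSeq φ (fun u => F (n + u)) -
        (-1 : ℝ) ^ (k * n) • (onSeq φ F * onSeq b fun u => F (k + u))) := by
  unfold circF
  rw [dSeq_sum, sum_dSeq_insF φ b le_rfl, Finset.sum_range_succ]
  have hk : insF n k (dLow k k (onSeq φ)) (onSeq b) F = insF n k (dSeq k (onSeq φ)) (onSeq b) F -
      (-1 : ℝ) ^ (k + 1) • (onSeq φ F * onSeq b fun u => F (k + u)) := by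
    rw [eq_sub_iff_add_eq, ← insF_dHigh_last φ b F]
    exact dLow_add_dHigh (by omega) _ _
  rw [hk]
  generalize onSeq b F * onSeq φ (fun u => F (n + u)) = x
  generalize (onSeq φ F * onSeq b fun u => F (k + u)) = y
  simp only [smul_add, smul_sub, neg_one_pow_smul_smul]
  have e1 : (-1 : ℝ) ^ (n + 1) = -(-1) ^ n := by ring
  have e2 : (-1 : ℝ) ^ (n + 1 + ((n + 1) * k + (k + 1))) = (-1) ^ (n + k * n) := by
    have : n + 1 + ((n + 1) * k + (k + 1)) = 2 * (k + 1) + (n + k * n) := by ring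
    rw [this, pow_add, pow_mul]; simp
  rw [e2, e1, neg_smul _ x]
  abel

/-! #### The pre-Lie identity -/

/-- The brace `Φ{Ψ, Ξ}`: both functionals are inserted, `Ψ` to the left of `Ξ`. -/
def braceF (m n p : ℕ) (Φ Ψ Ξ : (ℕ → A) → A) (F : ℕ → A) : A :=
  ∑ i ∈ Finset.range m, ∑ j ∈ Finset.range i,
    (-1 : ℝ) ^ ((n + 1) * j + (p + 1) * i) • insF n j (insF p i Φ Ξ) Ψ F

theorem circF_add_left (m n : ℕ) (Φ Φ' Ψ : (ℕ → A) → A) (F : ℕ → A) :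
    circF m n (fun G => Φ G + Φ' G) Ψ F = circF m n Φ Ψ F + circF m n Φ' Ψ F := by
  simp only [circF, insF, smul_add, Finset.sum_add_distrib]

theorem circF_smul_left (m n : ℕ) (c : ℝ) (Φ Ψ : (ℕ → A) → A) (F : ℕ → A) :
    circF m n (fun G => c • Φ G) Ψ F = c • circF m n Φ Ψ F := by
  simp only [circF, insF, Finset.smul_sum]
  exact Finset.sum_congr rfl fun i _ => smul_comm _ _ _

theorem circF_add_right {m : ℕ} (φ : Cochain A m) (n : ℕ) (Ψ Ψ' : (ℕ → A) → A) (F : ℕ → A) :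
    circF m n (onSeq φ) (fun G => Ψ G + Ψ' G) F =
      circF m n (onSeq φ) Ψ F + circF m n (onSeq φ) Ψ' F := by
  simp only [circF, ← Finset.sum_add_distrib, ← smul_add]
  refine Finset.sum_congr rfl fun i hi => ?_
  rw [insF, onSeq_insSeq_add (Finset.mem_range.1 hi)]
  rfl

theorem circF_smul_right {m : ℕ} (φ : Cochain A m) (n : ℕ) (c : ℝ) (Ψ : (ℕ → A) → A)
    (F : ℕ → A) : circF m n (onSeq φ) (fun G => c • Ψ G) F = c • circF m n (onSeq φ) Ψ F := by
  simp only [circF, Finset.smul_sum]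
  refine Finset.sum_congr rfl fun i hi => ?_
  rw [insF, onSeq_insSeq_smul (Finset.mem_range.1 hi), smul_comm]
  rfl

theorem circF_sub_right {m : ℕ} (φ : Cochain A m) (n : ℕ) (c : ℝ) (Ψ Ψ' : (ℕ → A) → A)
    (F : ℕ → A) : circF m n (onSeq φ) (fun G => Ψ G - c • Ψ' G) F =
      circF m n (onSeq φ) Ψ F - c • circF m n (onSeq φ) Ψ' F := by
  have := circF_add_right φ n Ψ (fun G => (-c) • Ψ' G) F
  rw [circF_smul_right] at this
  simpa only [neg_smul, ← sub_eq_add_neg] using this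

theorem circF_sub_left (m n : ℕ) (c : ℝ) (Φ Φ' Ψ : (ℕ → A) → A) (F : ℕ → A) :
    circF m n (fun G => Φ G - c • Φ' G) Ψ F = circF m n Φ Ψ F - c • circF m n Φ' Ψ F := by
  have := circF_add_left m n Φ (fun G => (-c) • Φ' G) Ψ F
  rw [circF_smul_left] at this
  simpa only [neg_smul, ← sub_eq_add_neg] using this

/-- In `(φ ∘ Ψ) ∘ Ξ` the functional `Ξ` is inserted into `Ψ`, to the left of `Ψ` or to the right of
`Ψ`. -/
theorem circF_circF {m n p : ℕ} (φ : Cochain A m) (Ψ Ξ : (ℕ → A) → A) (hΨ : HasArity n Ψ)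
    (F : ℕ → A) :
    circF (m + n - 1) p (circF m n (onSeq φ) Ψ) Ξ F =
      circF m (n + p - 1) (onSeq φ) (circF n p Ψ Ξ) F + braceF m p n (onSeq φ) Ξ Ψ F +
        (-1 : ℝ) ^ ((n + 1) * (p + 1)) • braceF m n p (onSeq φ) Ψ Ξ F := by
  have hlin : ∀ i < m, insF (n + p - 1) i (onSeq φ) (circF n p Ψ Ξ) F =
      ∑ l ∈ Finset.range n, (-1 : ℝ) ^ ((p + 1) * l) •
        insF (n + p - 1) i (onSeq φ) (insF p l Ψ Ξ) F := by
    intro i hi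
    have h : ∀ N : ℕ, insF (n + p - 1) i (onSeq φ) (fun G => ∑ l ∈ Finset.range N,
        (-1 : ℝ) ^ ((p + 1) * l) • insF p l Ψ Ξ G) F =
        ∑ l ∈ Finset.range N, (-1 : ℝ) ^ ((p + 1) * l) •
          insF (n + p - 1) i (onSeq φ) (insF p l Ψ Ξ) F := by
      intro N
      induction N with
      | zero =>
        have := onSeq_insSeq_smul (n := n + p - 1) hi φ 0 0 F
        simpa [insF] using this
      | succ N ih =>
        simp only [Finset.sum_range_succ]
        rw [← ih, insF, onSeq_insSeq_add hi, onSeq_insSeq_smul hi]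
        rfl
    exact h n
  -- The positions `j` of `Ξ` to the left of `Ψ`, inside `Ψ`, and to its right.
  have hi : ∀ i ∈ Finset.range m, ∑ j ∈ Finset.range (m + n - 1), (-1 : ℝ) ^ ((p + 1) * j) •
      (-1 : ℝ) ^ ((n + 1) * i) • insF p j (insF n i (onSeq φ) Ψ) Ξ F =
      ∑ j ∈ Finset.range i, (-1 : ℝ) ^ ((p + 1) * j + (n + 1) * i) •
          insF p j (insF n i (onSeq φ) Ψ) Ξ F +
        (-1 : ℝ) ^ ((n + p - 1 + 1) * i) • insF (n + p - 1) i (onSeq φ) (circF n p Ψ Ξ) F +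
        ∑ i' ∈ Finset.Ico (i + 1) m, (-1 : ℝ) ^ ((n + 1) * (p + 1)) •
          (-1 : ℝ) ^ ((n + 1) * i + (p + 1) * i') •
            insF n i (insF p i' (onSeq φ) Ξ) Ψ F := by
    intro i him
    have him' := Finset.mem_range.1 him
    rw [← Finset.sum_range_add_sum_Ico _ (show i + n ≤ m + n - 1 by omega),
      ← Finset.sum_range_add_sum_Ico _ (show i ≤ i + n by omega)]
    congr 1
    · congr 1
      · refine Finset.sum_congr rfl fun j _ => ?_
        rw [neg_one_pow_smul_smul]
      · rw [hlin i him', Finset.sum_Ico_eq_sum_range, Nat.add_sub_cancel_left, Finset.smul_sum]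
        refine Finset.sum_congr rfl fun l hl => ?_
        have hl' := Finset.mem_range.1 hl
        rw [insF_insF_nested (by omega) (by omega), neg_one_pow_smul_smul, neg_one_pow_smul_smul,
          Nat.add_sub_cancel_left]
        congr 1
        rw [show n + p - 1 + 1 = n + p by omega,
          show (p + 1) * (i + l) + (n + 1) * i = (n + p) * i + (p + 1) * l + 2 * i by ring,
          pow_add _ _ (2 * i), pow_mul _ 2]
        simp
    · rw [Finset.sum_Ico_eq_sum_range, Finset.sum_Ico_eq_sum_range,
        show m + n - 1 - (i + n) = m - (i + 1) by omega]
      refine Finset.sum_congr rfl fun l hl => ?_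
      rw [insF_insF_parallel (i := i + 1 + l) (by omega) hΨ,
        show i + 1 + l + n - 1 = i + n + l by omega, neg_one_pow_smul_smul, neg_one_pow_smul_smul]
      congr 1
      rw [show (n + 1) * (p + 1) + ((n + 1) * i + (p + 1) * (i + 1 + l)) =
        (p + 1) * (i + n + l) + (n + 1) * i + 2 * (p + 1) by ring, pow_add _ _ (2 * (p + 1)),
        pow_mul _ 2]
      simp
  have hcomm : braceF m n p (onSeq φ) Ψ Ξ F = ∑ i ∈ Finset.range m,
      ∑ i' ∈ Finset.Ico (i + 1) m, (-1 : ℝ) ^ ((n + 1) * i + (p + 1) * i') •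
            insF n i (insF p i' (onSeq φ) Ξ) Ψ F := by
    refine Finset.sum_comm' fun x y => ?_
    simp only [Finset.mem_range, Finset.mem_Ico]
    omega
  have hl : circF (m + n - 1) p (circF m n (onSeq φ) Ψ) Ξ F =
      ∑ i ∈ Finset.range m, ∑ j ∈ Finset.range (m + n - 1), (-1 : ℝ) ^ ((p + 1) * j) •
      (-1 : ℝ) ^ ((n + 1) * i) • insF p j (insF n i (onSeq φ) Ψ) Ξ F := by
    rw [Finset.sum_comm]
    refine Finset.sum_congr rfl fun j _ => ?_
    rw [← Finset.smul_sum]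
    rfl
  rw [hl, Finset.sum_congr rfl hi, Finset.sum_add_distrib, Finset.sum_add_distrib, hcomm,
    Finset.smul_sum]
  simp only [Finset.smul_sum]
  rw [add_comm (circF m _ _ _ F)]
  rfl

/-- The Gerstenhaber composition is a graded right pre-Lie product: its associator is graded
symmetric in the last two arguments. -/
theorem circF_associator {m n p : ℕ} (φ : Cochain A m) (Ψ Ξ : (ℕ → A) → A) (hΨ : HasArity n Ψ)
    (hΞ : HasArity p Ξ) (F : ℕ → A) :
    circF (m + n - 1) p (circF m n (onSeq φ) Ψ) Ξ F
        - circF m (n + p - 1) (onSeq φ) (circF n p Ψ Ξ) F =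
      (-1 : ℝ) ^ ((n + 1) * (p + 1)) • (circF (m + p - 1) n (circF m p (onSeq φ) Ξ) Ψ F
        - circF m (p + n - 1) (onSeq φ) (circF p n Ξ Ψ) F) := by
  have h : (-1 : ℝ) ^ ((p + 1) * (n + 1)) = (-1) ^ ((n + 1) * (p + 1)) := by rw [mul_comm]
  have h' : (-1 : ℝ) ^ ((n + 1) * (p + 1)) * (-1) ^ ((n + 1) * (p + 1)) = 1 := by
    rw [← mul_pow]; simp
  rw [circF_circF φ Ψ Ξ hΨ, circF_circF φ Ξ Ψ hΞ, h]
  simp only [add_assoc, add_sub_cancel_left, smul_add, smul_smul, h', one_smul]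
  abel

/-- The graded commutator of functionals in `m` and `n` arguments. -/
def commF (m n : ℕ) (Φ Ψ : (ℕ → A) → A) (F : ℕ → A) : A :=
  circF m n Φ Ψ F - (-1 : ℝ) ^ ((m + 1) * (n + 1)) • circF n m Ψ Φ F

theorem onSeq_gBracket {m n p : ℕ} (h : m + n = p + 1) (φ : Cochain A m) (ψ : Cochain A n)
    (F : ℕ → A) : onSeq (gBracket h φ ψ) F = commF m n (onSeq φ) (onSeq ψ) F := by
  simp only [gBracket, onSeq_sub, onSeq_smul, onSeq_circ]
  rfl

/-- The graded Jacobi identity with the outer commutators written out, so that their signs do not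
involve truncated subtraction. -/
theorem commF_jacobi {m n p : ℕ} (a : Cochain A m) (b : Cochain A n) (c : Cochain A p)
    (F : ℕ → A) :
    circF m (n + p - 1) (onSeq a) (commF n p (onSeq b) (onSeq c)) F
      - (-1 : ℝ) ^ ((m + 1) * (n + p)) •
        circF (n + p - 1) m (commF n p (onSeq b) (onSeq c)) (onSeq a) F =
    circF (m + n - 1) p (commF m n (onSeq a) (onSeq b)) (onSeq c) F
      - (-1 : ℝ) ^ ((m + n) * (p + 1)) •
        circF p (m + n - 1) (onSeq c) (commF m n (onSeq a) (onSeq b)) F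
    + (-1 : ℝ) ^ ((m + 1) * (n + 1)) •
      (circF n (m + p - 1) (onSeq b) (commF m p (onSeq a) (onSeq c)) F
        - (-1 : ℝ) ^ ((n + 1) * (m + p)) •
          circF (m + p - 1) n (commF m p (onSeq a) (onSeq c)) (onSeq b) F) := by
  have ha := circF_associator a (onSeq b) (onSeq c) (hasArity_onSeq b) (hasArity_onSeq c) F
  have hb := circF_associator b (onSeq a) (onSeq c) (hasArity_onSeq a) (hasArity_onSeq c) F
  have hc := circF_associator c (onSeq a) (onSeq b) (hasArity_onSeq a) (hasArity_onSeq b) F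
  have e : ∀ i j : ℕ, (-1 : ℝ) ^ ((i + 1) * (j + 1)) = (-1) ^ ((j + 1) * (i + 1)) :=
    fun i j => by rw [mul_comm]
  have e1 : ∀ i j l : ℕ, (-1 : ℝ) ^ ((i + 1) * (j + l)) =
      (-1) ^ ((i + 1) * (j + 1)) * (-1) ^ ((i + 1) * (l + 1)) := fun i j l => by
    rw [← pow_add, show (i + 1) * (j + 1) + (i + 1) * (l + 1) =
      (i + 1) * (j + l) + 2 * (i + 1) by ring, pow_add _ _ (2 * _), pow_mul _ 2]
    simp
  have e2 : (-1 : ℝ) ^ ((m + n) * (p + 1)) =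
      (-1) ^ ((m + 1) * (p + 1)) * (-1) ^ ((n + 1) * (p + 1)) := by
    rw [mul_comm, e1, e p m, e p n]
  unfold commF
  simp only [circF_sub_left, circF_sub_right]
  rw [e2, e1 m n p, e1 n m p, e n m]
  rw [Nat.add_comm n m, Nat.add_comm p m, Nat.add_comm p n] at *
  -- The identity is linear in the three associators once the signs are fixed.
  have sq : ∀ i : ℕ, (-1 : ℝ) ^ i = 1 ∨ (-1 : ℝ) ^ i = -1 := neg_one_pow_eq_or ℝ
  rcases sq ((m + 1) * (n + 1)) with h1 | h1 <;> rcases sq ((m + 1) * (p + 1)) with h2 | h2 <;>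
    rcases sq ((n + 1) * (p + 1)) with h3 | h3 <;>
    simp only [h1, h2, h3, one_smul, neg_smul, mul_one, mul_neg, neg_neg] at ha hb hc ⊢ <;>
    first
    | linear_combination -ha + hb - hc
    | linear_combination -ha + hb + hc
    | linear_combination -ha - hb - hc
    | linear_combination -ha - hb + hc

end Homotopies

/-! ### The Gerstenhaber bracket of cochains -/

section Commutator

variable {A : Type*} [CommRing A] [Algebra ℝ A]

theorem dSeq_sub_smul (k : ℕ) (c : ℝ) (Φ Ψ : (ℕ → A) → A) (F : ℕ → A) :
    dSeq k (fun G => Φ G - c • Ψ G) F = dSeq k Φ F - c • dSeq k Ψ F := by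
  have h : ∀ i, face k i (fun G => Φ G - c • Ψ G) F = face k i Φ F - c • face k i Ψ F := by
    intro i
    unfold face
    split_ifs <;> simp [mul_sub, sub_mul]
  simp only [dSeq, h, smul_sub, Finset.sum_sub_distrib, Finset.smul_sum, smul_comm c]

theorem dSeq_smul (k : ℕ) (c : ℝ) (Φ : (ℕ → A) → A) (F : ℕ → A) :
    dSeq k (fun G => c • Φ G) F = c • dSeq k Φ F := by
  have h : ∀ i, face k i (fun G => c • Φ G) F = c • face k i Φ F := by
    intro i
    unfold face
    split_ifs <;> simp
  simp only [dSeq, h, Finset.smul_sum, smul_comm c]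

theorem dSeq_zero (k : ℕ) (F : ℕ → A) : dSeq k (fun _ => 0) F = 0 := by
  simpa using dSeq_smul k 0 (fun _ => 0) F

theorem dSeq_add (k : ℕ) (Φ Ψ : (ℕ → A) → A) (F : ℕ → A) :
    dSeq k (fun G => Φ G + Ψ G) F = dSeq k Φ F + dSeq k Ψ F := by
  have := dSeq_sub_smul k (-1) Φ Ψ F
  simpa only [neg_smul, one_smul, sub_neg_eq_add] using this

theorem circF_zero_right {m : ℕ} (φ : Cochain A m) (n : ℕ) (F : ℕ → A) :
    circF m n (onSeq φ) (fun _ => 0) F = 0 := by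
  simpa using circF_smul_right φ n 0 (fun _ => 0) F

theorem circF_zero_left (m n : ℕ) (Ψ : (ℕ → A) → A) (F : ℕ → A) :
    circF m n (fun _ => 0) Ψ F = 0 := by
  simpa using circF_smul_left m n 0 (fun _ => 0) Ψ F

/-- The Gerstenhaber bracket is a chain map up to signs. -/
theorem dSeq_commF {k n : ℕ} (φ : Cochain A k) (b : Cochain A n) (F : ℕ → A) :
    dSeq (k + n - 1) (commF k n (onSeq φ) (onSeq b)) F =
      (-1 : ℝ) ^ (n + 1) • commF (k + 1) n (dSeq k (onSeq φ)) (onSeq b) F +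
        commF k (n + 1) (onSeq φ) (dSeq n (onSeq b)) F := by
  have h1 := dSeq_circF φ b F
  have h2 := dSeq_circF b φ F
  rw [Nat.add_comm n k] at h2
  unfold commF
  rw [dSeq_sub_smul, h1, h2]
  simp only [smul_add, smul_sub, neg_one_pow_smul_smul]
  have e : ∀ i j : ℕ, i % 2 = j % 2 → (-1 : ℝ) ^ i = (-1) ^ j := fun i j h => by
    rw [neg_one_pow_eq_pow_mod_two, h, ← neg_one_pow_eq_pow_mod_two]
  have e1 : (-1 : ℝ) ^ ((k + 1) * (n + 1) + (k + 1)) = (-1) ^ ((k + 1) * (n + 1 + 1)) := by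
    rw [← Nat.mul_succ]
  have e2 : (-1 : ℝ) ^ (n + 1 + (k + 1 + 1) * (n + 1)) = (-1) ^ ((k + 1) * (n + 1)) := by
    rw [show n + 1 + (k + 1 + 1) * (n + 1) = (k + 1) * (n + 1) + 2 * (n + 1) by ring, pow_add,
      pow_mul _ 2]; simp
  have e3 : (-1 : ℝ) ^ ((k + 1) * (n + 1) + k) = -(-1) ^ (n + k * n) := by
    rw [show (k + 1) * (n + 1) + k = (n + k * n) + 2 * k + 1 by ring, pow_add, pow_add,
      pow_mul _ 2]; simp
  have e4 : (-1 : ℝ) ^ ((k + 1) * (n + 1) + (k + n * k)) = -(-1) ^ n := by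
    rw [show (k + 1) * (n + 1) + (k + n * k) = n + 2 * (k + k * n) + 1 by ring, pow_add, pow_add,
      pow_mul _ 2]; simp
  rw [e1, e2, e3, e4]
  module

theorem commF_zero_right {m : ℕ} (φ : Cochain A m) (n : ℕ) (F : ℕ → A) :
    commF m n (onSeq φ) (fun _ => 0) F = 0 := by
  rw [commF, circF_zero_right, circF_zero_left, smul_zero, sub_zero]

theorem commF_zero_left {m : ℕ} (φ : Cochain A m) (n : ℕ) (F : ℕ → A) :
    commF n m (fun _ => 0) (onSeq φ) F = 0 := by
  rw [commF, circF_zero_right, circF_zero_left, smul_zero, sub_zero]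

theorem commF_zero_zero (Φ Ψ : (ℕ → A) → A) : commF 0 0 Φ Ψ = fun _ => 0 := by
  funext F
  simp [commF, circF]

/-- The graded Jacobi identity for the commutator. The truncated degree `m + n - 1` is wrong for
`m = n = 0` only, where the inner commutator vanishes. -/
theorem commF_commF_jacobi {m n p : ℕ} (a : Cochain A m) (b : Cochain A n) (c : Cochain A p)
    (F : ℕ → A) :
    commF m (n + p - 1) (onSeq a) (commF n p (onSeq b) (onSeq c)) F =
      commF (m + n - 1) p (commF m n (onSeq a) (onSeq b)) (onSeq c) F
      + (-1 : ℝ) ^ ((m + 1) * (n + 1)) •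
        commF n (m + p - 1) (onSeq b) (commF m p (onSeq a) (onSeq c)) F := by
  have hr : ∀ {i j l : ℕ} (x : Cochain A i) (y : Cochain A j) (z : Cochain A l),
      commF i (j + l - 1) (onSeq x) (commF j l (onSeq y) (onSeq z)) F =
      circF i (j + l - 1) (onSeq x) (commF j l (onSeq y) (onSeq z)) F
      - (-1 : ℝ) ^ ((i + 1) * (j + l)) •
        circF (j + l - 1) i (commF j l (onSeq y) (onSeq z)) (onSeq x) F := by
    intro i j l x y z
    rcases Nat.eq_zero_or_pos (j + l) with h | h
    · obtain rfl : j = 0 := by omega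
      obtain rfl : l = 0 := by omega
      rw [commF_zero_zero, commF_zero_right, circF_zero_right, circF_zero_left]
      simp
    · rw [commF, Nat.sub_add_cancel h]
  have hl : commF (m + n - 1) p (commF m n (onSeq a) (onSeq b)) (onSeq c) F =
      circF (m + n - 1) p (commF m n (onSeq a) (onSeq b)) (onSeq c) F
      - (-1 : ℝ) ^ ((m + n) * (p + 1)) •
        circF p (m + n - 1) (onSeq c) (commF m n (onSeq a) (onSeq b)) F := by
    rcases Nat.eq_zero_or_pos (m + n) with h | h
    · obtain rfl : m = 0 := by omega
      obtain rfl : n = 0 := by omega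
      rw [commF_zero_zero, commF_zero_left, circF_zero_right, circF_zero_left]
      simp
    · rw [commF, Nat.sub_add_cancel h]
  rw [hr, hr, hl]
  exact commF_jacobi a b c F

/-- Composition from the right is a derivation of the cup product. -/
theorem circF_cup {m n p : ℕ} (a : Cochain A m) (Ψ Ξ : (ℕ → A) → A) (F : ℕ → A) :
    circF (m + n) p (fun G => onSeq a G * Ψ fun u => G (m + u)) Ξ F =
      circF m p (onSeq a) Ξ F * Ψ (fun u => F (m + p - 1 + u)) +
        (-1 : ℝ) ^ (m * (p + 1)) • (onSeq a F * circF n p Ψ Ξ fun u => F (m + u)) := by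
  unfold circF
  rw [Finset.sum_range_add, Finset.sum_mul, Finset.mul_sum, Finset.smul_sum]
  congr 1
  · refine Finset.sum_congr rfl fun i hi => ?_
    have hi' := Finset.mem_range.1 hi
    rw [smul_mul_assoc, insF]
    congr 2
    congr 1
    funext u
    simp only [insSeq]
    split_ifs <;> first | omega | skip
    congr 1; omega
  · refine Finset.sum_congr rfl fun i hi => ?_
    rw [mul_smul_comm, neg_one_pow_smul_smul, insF, insF]
    congr 1
    · congr 1; ring
    · congr 1
      · refine hasArity_onSeq a _ _ fun u hu => ?_
        simp [insSeq, show u < m + i by omega]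
      · congr 1
        funext u
        simp only [insSeq]
        split_ifs <;> first | rfl | omega | skip
        · congr 1; funext v; congr 1; omega
        · congr 1; omega

/-- The Hochschild differential is a graded derivation of the cup product. -/
theorem dSeq_cup {m n : ℕ} (a : Cochain A m) (Ψ : (ℕ → A) → A) (F : ℕ → A) :
    dSeq (m + n) (fun G => onSeq a G * Ψ fun u => G (m + u)) F =
      dSeq m (onSeq a) F * Ψ (fun u => F (m + 1 + u)) +
        (-1 : ℝ) ^ m • (onSeq a F * dSeq n Ψ fun u => F (m + u)) := by
  have h1 : ∀ i ≤ m, face (m + n) i (fun G => onSeq a G * Ψ fun u => G (m + u)) F =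
      face m i (onSeq a) F * Ψ (fun u => F (m + 1 + u)) := by
    intro i hi
    have hin : i ≤ m + n := by omega
    simp only [face, hi, hin, if_true]
    split_ifs
    · rw [mul_assoc]
      congr 3
      funext u; congr 1; omega
    · congr 2
      funext u
      simp only [insSeq]
      split_ifs <;> first | omega | skip
      congr 1; omega
  have h2 : ∀ i, face (m + n) (m + (i + 1)) (fun G => onSeq a G * Ψ fun u => G (m + u)) F =
      onSeq a F * face n (i + 1) Ψ (fun u => F (m + u)) := by
    intro i
    have e1 : ¬ m + (i + 1) = 0 := by omega
    have e2 : ¬ i + 1 = 0 := by omega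
    simp only [face, e1, e2, if_false]
    by_cases hi : i + 1 ≤ n
    · have hi' : m + (i + 1) ≤ m + n := by omega
      simp only [hi, hi', if_true]
      congr 1
      · refine hasArity_onSeq a _ _ fun u hu => ?_
        have hu' : u < m + (i + 1) - 1 := by omega
        simp only [insSeq, if_pos hu']
      · congr 1
        funext u
        simp only [insSeq]
        split_ifs <;> first | rfl | omega
    · have hi' : ¬ m + (i + 1) ≤ m + n := by omega
      simp only [hi, hi', if_false, mul_assoc]
  have h3 : onSeq a F * face n 0 Ψ (fun u => F (m + u)) =
      face m (m + 1) (onSeq a) F * Ψ (fun u => F (m + 1 + u)) := by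
    have e : (fun u => F (m + (u + 1))) = fun u => F (m + 1 + u) := by
      funext u; congr 1; omega
    simp [face, e, mul_assoc]
  unfold dSeq
  rw [show m + n + 2 = m + 1 + (n + 1) by ring, Finset.sum_range_add,
    Finset.sum_range_succ _ (m + 1), Finset.sum_range_succ' _ (n + 1), pow_zero, one_smul,
    add_mul, mul_add, h3, smul_add, smul_mul_assoc, Finset.sum_mul, Finset.mul_sum,
    Finset.smul_sum, pow_succ (-1 : ℝ) m]
  have k1 : ∀ i ∈ Finset.range (m + 1), (-1 : ℝ) ^ i •
      face (m + n) i (fun G => onSeq a G * Ψ fun u => G (m + u)) F =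
      (-1 : ℝ) ^ i • face m i (onSeq a) F * Ψ (fun u => F (m + 1 + u)) := fun i hi => by
    rw [h1 i (by have := Finset.mem_range.1 hi; omega), smul_mul_assoc]
  have k2 : ∀ i ∈ Finset.range (n + 1), (-1 : ℝ) ^ (m + 1 + i) •
      face (m + n) (m + 1 + i) (fun G => onSeq a G * Ψ fun u => G (m + u)) F =
      (-1 : ℝ) ^ m • (onSeq a F * (-1 : ℝ) ^ (i + 1) • face n (i + 1) Ψ fun u => F (m + u)) :=
    fun i _ => by
      rw [show m + 1 + i = m + (i + 1) by ring, h2, mul_smul_comm, neg_one_pow_smul_smul]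
  rw [Finset.sum_congr rfl k1, Finset.sum_congr rfl k2]
  module

/-- The graded Leibniz rule for the bracket and the cup product of cocycles, up to the coboundary of
a brace. -/
theorem commF_cup {k m n : ℕ} (a : Cochain A m) (b : Cochain A n) (φ : Cochain A k)
    (ha : hochschildD a = 0) (hb : hochschildD b = 0) (hφ : hochschildD φ = 0) (F : ℕ → A) :
    commF (m + n) k (fun G => onSeq a G * onSeq b fun u => G (m + u)) (onSeq φ) F
      - commF m k (onSeq a) (onSeq φ) F * onSeq b (fun u => F (m + k - 1 + u))
      - (-1 : ℝ) ^ (m * (k + 1)) • (onSeq a F * commF n k (onSeq b) (onSeq φ) fun u => F (m + u)) =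
    (-1 : ℝ) ^ ((m + n + 1) * (k + 1) + m) •
      dSeq (k + n + m - 2) (fun G => ∑ t ∈ Finset.range k,
        (-1 : ℝ) ^ ((n + 1) * t) • ∑ s ∈ Finset.range t, (-1 : ℝ) ^ ((m + 1) * s) •
          insF m s (insF n t (onSeq φ) (onSeq b)) (onSeq a) G) F := by
  have h := dSeq_brace φ a b hφ ha hb F
  have h' : ∀ x : A, (-1 : ℝ) ^ ((m + n + 1) * (k + 1) + m) • x =
      -((-1 : ℝ) ^ ((m + n + 1) * (k + 1)) • (-1 : ℝ) ^ (m + 1) • x) := fun x => by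
    rw [neg_one_pow_smul_smul, ← add_assoc, pow_succ, mul_neg_one, neg_smul, neg_neg]
  rw [h', h]
  unfold commF
  rw [circF_cup]
  change _ = -((-1 : ℝ) ^ ((m + n + 1) * (k + 1)) • (circF k (m + n) (onSeq φ)
      (fun G => onSeq a G * onSeq b fun u => G (m + u)) F -
        onSeq a F * circF k n (onSeq φ) (onSeq b) (fun u => F (m + u)) -
      (-1 : ℝ) ^ (n * (k + 1)) • (circF k m (onSeq φ) (onSeq a) F *
        onSeq b fun u => F (k + m - 1 + u))))
  rw [Nat.add_comm k m]
  have e1 : (-1 : ℝ) ^ ((m + n + 1) * (k + 1)) * (-1) ^ (n * (k + 1)) =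
      (-1) ^ ((m + 1) * (k + 1)) := by
    rw [← pow_add, show (m + n + 1) * (k + 1) + n * (k + 1) =
      (m + 1) * (k + 1) + 2 * (n * (k + 1)) by ring, pow_add, pow_mul _ 2]; simp
  have e2 : (-1 : ℝ) ^ (m * (k + 1)) * (-1) ^ ((n + 1) * (k + 1)) =
      (-1) ^ ((m + n + 1) * (k + 1)) := by
    rw [← pow_add]; congr 1; ring
  simp only [smul_sub, sub_mul, mul_sub, smul_mul_assoc, mul_smul_comm, smul_smul, e1, e2]
  abel

end Commutator

/-! ### Orders of differential cochains -/

section Orders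

variable {A : Type*} [CommRing A] [Algebra ℝ A] {S : Set A}

variable (S) in
/-- The `k`-cochains that are linear over `S` and of order `≤ N` in each argument. The bound on the
order is kept explicit since primitives of cocycles are later glued from infinitely many pieces. -/
def ordCochain (N k : ℕ) : Submodule ℝ (Cochain A k) where
  carrier := {φ | (∀ (i : Fin k) (f : Fin k → A), IsDiffOp N (φ.toLinearMap f i)) ∧
    IsLinearOver S φ}
  zero_mem' := ⟨fun _ _ => IsDiffOp.zero N, fun s _ i f => by simp⟩
  add_mem' := by
    rintro φ ψ ⟨h1, h2⟩ ⟨h3, h4⟩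
    refine ⟨fun i f => (h1 i f).add (h3 i f), fun s hs i f => ?_⟩
    simp only [_root_.add_apply, h2 s hs, h4 s hs, mul_add]
  smul_mem' := by
    rintro c φ ⟨h1, h2⟩
    refine ⟨fun i f => (h1 i f).smul c, fun s hs i f => ?_⟩
    simp only [_root_.smul_apply, h2 s hs, mul_smul_comm]

theorem mem_diffCochain_iff {k : ℕ} {φ : Cochain A k} :
    φ ∈ diffCochain A S k ↔ ∃ N, φ ∈ ordCochain S N k :=
  (and_congr_left' isMultiDiffOp_iff).trans ⟨fun ⟨⟨N, h⟩, h'⟩ => ⟨N, h, h'⟩,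
    fun ⟨N, h, h'⟩ => ⟨⟨N, h⟩, h'⟩⟩

theorem ordCochain_le_diffCochain (N k : ℕ) : ordCochain S N k ≤ diffCochain A S k :=
  fun _ h => mem_diffCochain_iff.2 ⟨N, h⟩

theorem ordCochain_mono {M N : ℕ} (h : M ≤ N) (k : ℕ) : ordCochain S M k ≤ ordCochain S N k :=
  fun _ hφ => ⟨fun i f => (hφ.1 i f).mono h, hφ.2⟩

theorem cup_mem_ord {m n p M N : ℕ} (h : m + n = p) {φ : Cochain A m} {ψ : Cochain A n}
    (hφ : φ ∈ ordCochain S M m) (hψ : ψ ∈ ordCochain S N n) :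
    cup h φ ψ ∈ ordCochain S (M + N) p := by
  refine ⟨fun s f => ?_, (cup_mem h (ordCochain_le_diffCochain _ _ hφ)
    (ordCochain_le_diffCochain _ _ hψ)).2⟩
  rcases cup_update h φ ψ f s with ⟨t, -, ht⟩ | ⟨t, -, ht⟩
  · have : (cup h φ ψ).toLinearMap f s =
        LinearMap.mulLeft ℝ (ψ (fun j => f ⟨m + j, by omega⟩)) ∘ₗ
          φ.toLinearMap (fun i => f ⟨i, by omega⟩) t := by
      ext x
      simp only [MultilinearMap.toLinearMap_apply, LinearMap.comp_apply,
        LinearMap.mulLeft_apply, ht, mul_comm]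
    rw [this]
    exact ((IsDiffOp.mulLeft _).comp (hφ.1 _ _)).mono (by omega)
  · have : (cup h φ ψ).toLinearMap f s =
        LinearMap.mulLeft ℝ (φ (fun i => f ⟨i, by omega⟩)) ∘ₗ
          ψ.toLinearMap (fun j => f ⟨m + j, by omega⟩) t := by
      ext x
      simp only [MultilinearMap.toLinearMap_apply, LinearMap.comp_apply,
        LinearMap.mulLeft_apply, ht]
    rw [this]
    exact ((IsDiffOp.mulLeft _).comp (hψ.1 _ _)).mono (by omega)

theorem insertAt_mem_ord {m n p M N : ℕ} (h : m + n = p + 1) (i : Fin m) {φ : Cochain A m}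
    {ψ : Cochain A n} (hφ : φ ∈ ordCochain S M m) (hψ : ψ ∈ ordCochain S N n) :
    insertAt h i φ ψ ∈ ordCochain S (M + N) p := by
  refine ⟨fun s f => ?_, (insertAt_mem h i (ordCochain_le_diffCochain _ _ hφ)
    (ordCochain_le_diffCochain _ _ hψ)).2⟩
  rcases insertArgs_update h i ψ f s with ⟨t, -, ht⟩ | ⟨j, -, hj⟩
  · have : (insertAt h i φ ψ).toLinearMap f s =
        φ.toLinearMap (insertArgs h i ψ f) i ∘ₗ
          ψ.toLinearMap (fun t : Fin n => f ⟨i + t, by omega⟩) t := by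
      ext x
      simp only [MultilinearMap.toLinearMap_apply, LinearMap.comp_apply, insertAt_apply, ht]
    rw [this]
    exact (hφ.1 _ _).comp (hψ.1 _ _)
  · have : (insertAt h i φ ψ).toLinearMap f s = φ.toLinearMap (insertArgs h i ψ f) j := by
      ext x
      simp only [MultilinearMap.toLinearMap_apply, insertAt_apply, hj]
    rw [this]
    exact (hφ.1 _ _).mono (by omega)

theorem circ_mem_ord {m n p M N : ℕ} (h : m + n = p + 1) {φ : Cochain A m} {ψ : Cochain A n}
    (hφ : φ ∈ ordCochain S M m) (hψ : ψ ∈ ordCochain S N n) :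
    circ h φ ψ ∈ ordCochain S (M + N) p :=
  sum_mem fun _ _ => Submodule.smul_mem _ _ (insertAt_mem_ord _ _ hφ hψ)

/-- The brace `φ{a, b}` of differential cochains is a differential cochain. -/
theorem exists_brace {k m n M N P : ℕ} {φ : Cochain A k} {a : Cochain A m} {b : Cochain A n}
    (hφ : φ ∈ ordCochain S M k) (ha : a ∈ ordCochain S N m) (hb : b ∈ ordCochain S P n) :
    ∃ ψ ∈ ordCochain S (M + P + N) (k + n + m - 2), onSeq ψ = fun G =>
      ∑ t ∈ Finset.range k, (-1 : ℝ) ^ ((n + 1) * t) • ∑ s ∈ Finset.range t,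
        (-1 : ℝ) ^ ((m + 1) * s) • insF m s (insF n t (onSeq φ) (onSeq b)) (onSeq a) G := by
  by_cases hk : 2 ≤ k
  · refine ⟨∑ t : Fin k, (-1 : ℝ) ^ ((n + 1) * (t : ℕ)) • ∑ s : Fin t,
      (-1 : ℝ) ^ ((m + 1) * (s : ℕ)) •
      insertAt (p := k + n + m - 2) (m := k + n - 1) (by omega) ⟨s, by omega⟩
        (insertAt (p := k + n - 1) (by omega) t φ b) a,
      sum_mem fun _ _ => Submodule.smul_mem _ _ <| sum_mem fun _ _ => Submodule.smul_mem _ _ <|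
        insertAt_mem_ord _ _ (insertAt_mem_ord _ _ hφ hb) ha, ?_⟩
    funext F
    rw [Finset.sum_range]
    simp only [onSeq_sum, onSeq_smul]
    refine Finset.sum_congr rfl fun t _ => ?_
    rw [Finset.sum_range]
    congr 1
    refine Finset.sum_congr rfl fun s _ => ?_
    congr 1
    rw [onSeq_insertAt]
    congr 1
    funext G
    rw [onSeq_insertAt]
  · refine ⟨0, zero_mem _, funext fun F => ?_⟩
    rw [onSeq_zero, eq_comm]
    refine Finset.sum_eq_zero fun t ht => ?_
    obtain rfl : t = 0 := by have := Finset.mem_range.1 ht; omega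
    simp

variable (S) in
/-- The coboundaries of cochains that are linear over `S` and of order `≤ N`. -/
def ordBd (N : ℕ) : ∀ k, Submodule ℝ (Cochain A k)
  | 0 => ⊥
  | k + 1 => (ordCochain S N k).map
      { toFun := hochschildD
        map_add' := fun φ ψ => ext_onSeq fun F => by
          rw [onSeq_add, onSeq_hochschildD, onSeq_hochschildD, onSeq_hochschildD, ← dSeq_add]
          rfl
        map_smul' := fun c φ => ext_onSeq fun F => by
          rw [RingHom.id_apply, onSeq_smul, onSeq_hochschildD, onSeq_hochschildD, ← dSeq_smul]
          rfl }

theorem hochschildD_mem_ordBd {N k : ℕ} {ψ : Cochain A k} (h : ψ ∈ ordCochain S N k) :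
    hochschildD ψ ∈ ordBd S N (k + 1) := ⟨ψ, h, rfl⟩

theorem ordBd_mono {M N : ℕ} (h : M ≤ N) (k : ℕ) : ordBd (A := A) S M k ≤ ordBd S N k := by
  cases k with
  | zero => exact le_rfl
  | succ k => exact Submodule.map_mono (ordCochain_mono h k)

theorem hochschildD_sub_smul {k : ℕ} (c : ℝ) (φ ψ : Cochain A k) :
    hochschildD (φ - c • ψ) = hochschildD φ - c • hochschildD ψ := ext_onSeq fun F => by
  rw [onSeq_sub, onSeq_smul, onSeq_hochschildD, onSeq_hochschildD, onSeq_hochschildD,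
    ← dSeq_sub_smul]
  rfl

/-- The square of the Hochschild differential is zero: since `δφ = id ∪ φ - (-1)^k φ ∪ id - φ ∘ μ`,
the rules for `δ` of cup products and compositions give `δδφ = -δδφ`. -/
theorem hochschildD_hochschildD {k : ℕ} (φ : Cochain A k) : hochschildD (hochschildD φ) = 0 := by
  have h0 : ∀ {j : ℕ} (χ : Cochain A j) (F : ℕ → A), dSeq j (onSeq χ) F =
      onSeq (idCochain A) F * (onSeq χ fun u => F (1 + u)) -
        (-1 : ℝ) ^ j • (onSeq χ F * onSeq (idCochain A) fun u => F (j + u)) -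
        (1 : ℝ) • circF j 2 (onSeq χ) (onSeq (mulCochain A)) F := by
    intro j χ F
    have hi : dSeq 1 (onSeq (idCochain A)) = onSeq (mulCochain A) := funext fun F => by
      simp [dSeq, face, Finset.sum_range_succ, insSeq]
    -- Composition with the identity multiplies by the number of arguments, so `dSeq_circF` for
    -- `χ ∘ id` expresses `δχ` by `id ∪ χ`, `χ ∪ id` and `χ ∘ μ`.
    have hc : ∀ {i : ℕ} (ξ : Cochain A i) (F : ℕ → A),
        circF i 1 (onSeq ξ) (onSeq (idCochain A)) F = (i : ℝ) • onSeq ξ F := by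
      intro i ξ F
      have : ∀ t ∈ Finset.range i, (-1 : ℝ) ^ ((1 + 1) * t) •
          insF 1 t (onSeq ξ) (onSeq (idCochain A)) F = onSeq ξ F := fun t _ => by
        rw [pow_mul, insF]
        simp only [onSeq_idCochain, Nat.reduceAdd, even_two, Even.neg_pow, one_pow, one_smul,
          add_zero]
        congr 1
        funext u
        simp only [insSeq]
        split_ifs with h1 h2 <;> first | rfl | rw [h2]
      rw [circF, Finset.sum_congr rfl this]
      simp [Nat.cast_smul_eq_nsmul]
    have h := dSeq_circF χ (idCochain A) F
    have e1 : circF j 1 (onSeq χ) (onSeq (idCochain A)) = fun F => (j : ℝ) • onSeq χ F :=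
      funext fun F => hc χ F
    have e2 : dSeq j (onSeq χ) = onSeq (hochschildD χ) :=
      funext fun F => (onSeq_hochschildD χ F).symm
    rw [e1, hi, Nat.add_sub_cancel, dSeq_smul, e2, hc] at h
    rw [e2]
    push_cast at h
    simp only [even_two, Even.neg_pow, one_pow, one_smul, pow_one, neg_smul, mul_one,
      add_smul] at h ⊢
    linear_combination -h
  refine ext_onSeq fun F => ?_
  have hi : dSeq 1 (onSeq (idCochain A)) = onSeq (mulCochain A) := funext fun F => by
    simp [dSeq, face, Finset.sum_range_succ, insSeq]
  have hμ : dSeq 2 (onSeq (mulCochain A)) = fun _ => 0 := funext fun F => by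
    simp [dSeq, face, Finset.sum_range_succ, insSeq, pow_succ]
    ring
  have e2 : dSeq k (onSeq φ) = onSeq (hochschildD φ) := funext fun F => (onSeq_hochschildD φ F).symm
  have h1 := dSeq_cup (n := k) (idCochain A) (onSeq φ) F
  have h2 := dSeq_cup (n := 1) φ (onSeq (idCochain A)) F
  have h3 := dSeq_circF φ (mulCochain A) F
  have h4 := h0 (hochschildD φ) F
  rw [show k + 2 - 1 = k + 1 by omega, hμ, circF_zero_right, e2] at h3
  rw [hi, e2, Nat.add_comm 1 k] at h1
  rw [hi, e2] at h2
  have e5 : dSeq (k + 1) (onSeq (hochschildD φ)) F = dSeq (k + 1) (fun F =>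
      onSeq (idCochain A) F * (onSeq φ fun u => F (1 + u)) -
        (-1 : ℝ) ^ k • (onSeq φ F * onSeq (idCochain A) fun u => F (k + u)) -
        (1 : ℝ) • circF k 2 (onSeq φ) (onSeq (mulCochain A)) F) F := by
    rw [← e2, funext (h0 φ)]
  rw [onSeq_hochschildD, onSeq_zero]
  rw [dSeq_sub_smul, dSeq_sub_smul, h1, h2, h3] at e5
  have hk : (-1 : ℝ) ^ k * (-1) ^ k = 1 := by rw [← mul_pow]; simp
  have e6 : (2 : ℝ) • dSeq (k + 1) (onSeq (hochschildD φ)) F = 0 := by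
    rw [two_smul]
    nth_rewrite 1 [e5]
    rw [h4]
    simp only [Nat.reduceAdd, one_smul, neg_smul, smul_add, smul_smul, hk, pow_succ, mul_neg_one,
      pow_mul']
    simp only [pow_zero, neg_neg, one_smul]
    ring_nf
    rw [one_smul, neg_add_cancel]
  exact (smul_eq_zero.1 e6).resolve_left two_ne_zero

theorem hochschildD_of_mem_ordBd {N k : ℕ} {φ : Cochain A k} (h : φ ∈ ordBd S N k) :
    hochschildD φ = 0 := by
  cases k with
  | zero =>
    rw [(Submodule.mem_bot ℝ).1 h]
    exact IsMultiDerivation.hochschildD_eq_zero fun _ i => i.elim0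
  | succ k =>
    obtain ⟨ψ, -, rfl⟩ := h
    exact hochschildD_hochschildD ψ

end Orders

/-! ### The Gerstenhaber algebra of Hochschild cohomology -/

section GradedBilinear

variable {X : ℕ → Type*} [∀ k, AddCommGroup (X k)] [∀ k, Module ℝ (X k)]

/-- The bilinear map on a direct sum with homogeneous components `f m n`. -/
def gradedBilin (d : ℕ → ℕ → ℕ) (f : ∀ m n, X m →ₗ[ℝ] X n →ₗ[ℝ] X (d m n)) :
    (⨁ k, X k) →ₗ[ℝ] (⨁ k, X k) →ₗ[ℝ] (⨁ k, X k) :=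
  DirectSum.toModule ℝ ℕ _ fun m => LinearMap.flip <| DirectSum.toModule ℝ ℕ _ fun n =>
    LinearMap.flip ((f m n).compr₂ (DirectSum.lof ℝ ℕ X (d m n)))

@[simp] theorem gradedBilin_lof (d : ℕ → ℕ → ℕ) (f : ∀ m n, X m →ₗ[ℝ] X n →ₗ[ℝ] X (d m n))
    (m n : ℕ) (a : X m) (b : X n) :
    gradedBilin d f (DirectSum.lof ℝ ℕ X m a) (DirectSum.lof ℝ ℕ X n b) =
      DirectSum.lof ℝ ℕ X (d m n) (f m n a b) := by
  simp [gradedBilin]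

theorem DirectSum.lof_induction {P : (⨁ k, X k) → Prop} (a : ⨁ k, X k) (h0 : P 0)
    (hl : ∀ k x, P (DirectSum.lof ℝ ℕ X k x)) (ha : ∀ a b, P a → P b → P (a + b)) : P a :=
  DirectSum.induction_on a h0 (fun k x => hl k x) ha

/-- A bilinear map that is compatible with submodules induces a bilinear map of the quotients. -/
def quotBilin {X Y Z : Type*} [AddCommGroup X] [Module ℝ X] [AddCommGroup Y] [Module ℝ Y]
    [AddCommGroup Z] [Module ℝ Z] (P : Submodule ℝ X) (Q : Submodule ℝ Y) (R : Submodule ℝ Z)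
    (f : X →ₗ[ℝ] Y →ₗ[ℝ] Z) (h1 : ∀ x ∈ P, ∀ y, f x y ∈ R) (h2 : ∀ x, ∀ y ∈ Q, f x y ∈ R) :
    X ⧸ P →ₗ[ℝ] Y ⧸ Q →ₗ[ℝ] Z ⧸ R :=
  P.liftQ
    { toFun := fun x => Q.mapQ R (f x) fun y hy => h2 x y hy
      map_add' := fun x x' => by ext y; simp
      map_smul' := fun c x => by ext y; simp }
    (fun x hx => by
      rw [LinearMap.mem_ker]
      ext y
      simpa using h1 x hx y)

end GradedBilinear

section HH

variable {A : Type*} [CommRing A] [Algebra ℝ A] {S : Set A}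

-- Shortcuts for instance search on cocycles, cohomology and their direct sums.

local instance moduleCocycle (k : ℕ) : Module ℝ (Cocycle A S k) := Submodule.module _

local instance mulActionCocycle (k : ℕ) : MulAction ℝ (Cocycle A S k) :=
  DistribMulAction.toMulAction

local instance addCommGroupHH (k : ℕ) : AddCommGroup (HH A S k) := Submodule.Quotient.addCommGroup _

local instance moduleHH (k : ℕ) : Module ℝ (HH A S k) := Submodule.Quotient.module _

local instance addCommGroupDirectSumHH : AddCommGroup (⨁ k, HH A S k) := DirectSum.instAddCommGroup

local instance moduleDirectSumHH : Module ℝ (⨁ k, HH A S k) := DirectSum.instModule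

theorem HH.mk_surjective (k : ℕ) : Function.Surjective (HH.mk (A := A) (S := S) k) :=
  Submodule.mkQ_surjective _

theorem Cocycle.dSeq_eq_zero {k : ℕ} (x : Cocycle A S k) : dSeq k (onSeq x.1.1) = fun _ => 0 := by
  funext F
  rw [← onSeq_hochschildD]
  have : hochschildD x.1.1 = 0 := congrArg Subtype.val (LinearMap.mem_ker.1 x.2)
  rw [this]
  rfl

theorem mem_cocycle_iff {k : ℕ} (φ : diffCochain A S k) :
    φ ∈ Cocycle A S k ↔ ∀ F, dSeq k (onSeq φ.1) F = 0 := by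
  rw [LinearMap.mem_ker]
  constructor
  · intro h F
    rw [← onSeq_hochschildD, show hochschildD φ.1 = 0 from congrArg Subtype.val h]
    rfl
  · intro h
    refine Subtype.ext (ext_onSeq fun F => ?_)
    exact (onSeq_hochschildD φ.1 F).trans (h F)

theorem mem_coboundary {p r : ℕ} (hr : r + 1 = p) (x : diffCochain A S p) (ψ : diffCochain A S r)
    (c : ℝ) (h : ∀ F, onSeq x.1 F = c • dSeq r (onSeq ψ.1) F) : x ∈ Coboundary A S p := by
  subst hr
  refine ⟨c • ψ, Subtype.ext (ext_onSeq fun F => ?_)⟩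
  rw [map_smul]
  change onSeq (c • hochschildD ψ.1) F = _
  rw [onSeq_smul, onSeq_hochschildD, h]

/-- Two cocycles whose difference is a coboundary define the same class. -/
theorem HH.mk_eq_of_dSeq {p r : ℕ} (hr : r + 1 = p) (x y : Cocycle A S p) (ψ : diffCochain A S r)
    (c : ℝ) (h : ∀ F, onSeq x.1.1 F - onSeq y.1.1 F = c • dSeq r (onSeq ψ.1) F) :
    HH.mk p x = HH.mk p y := by
  refine (Submodule.Quotient.eq _).2 ?_
  refine mem_coboundary hr (x.1 - y.1) ψ c fun F => ?_
  exact h F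

theorem Cocycle.ext_onSeq {p : ℕ} {x y : Cocycle A S p} (h : ∀ F, onSeq x.1.1 F = onSeq y.1.1 F) :
    x = y :=
  Subtype.ext (Subtype.ext (VerticalHKR.ext_onSeq h))

/-- The class of a cocycle as an element of the graded vector space `⨁ k, HH A S k`. -/
def HH.cls (k : ℕ) : Cocycle A S k →ₗ[ℝ] ⨁ k, HH A S k :=
  DirectSum.lof ℝ ℕ (HH A S) k ∘ₗ HH.mk k

theorem HH.cls_add_smul {k : ℕ} (x y : Cocycle A S k) (c : ℝ) :
    HH.cls k x + c • HH.cls k y = HH.cls k (x + c • y) := by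
  rw [map_add, LinearMap.map_smul]

theorem HH.cls_induction {P : (⨁ k, HH A S k) → Prop} (a : ⨁ k, HH A S k) (h0 : P 0)
    (hl : ∀ k x, P (HH.cls k x)) (ha : ∀ a b, P a → P b → P (a + b)) : P a :=
  DirectSum.lof_induction a h0 (fun k x => by
    obtain ⟨x, rfl⟩ := HH.mk_surjective k x
    exact hl k x) ha

/-- A cocycle of degree `k` regarded as a cocycle of degree `p`; zero if `k ≠ p`. It compares
classes in degrees which are equal, but not definitionally so. -/
def castZ {k : ℕ} (p : ℕ) (x : Cocycle A S k) : Cocycle A S p := if h : k = p then h ▸ x else 0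

theorem onSeq_castZ {k p : ℕ} (x : Cocycle A S k) (h : k = p ∨ ∀ F, onSeq x.1.1 F = 0)
    (F : ℕ → A) : onSeq (castZ p x).1.1 F = onSeq x.1.1 F := by
  by_cases hk : k = p
  · subst hk
    simp [castZ]
  · rw [castZ, dif_neg hk, (h.resolve_left hk) F]
    rfl

theorem cls_castZ {k p : ℕ} (x : Cocycle A S k) (h : k = p ∨ ∀ F, onSeq x.1.1 F = 0) :
    HH.cls k x = HH.cls p (castZ p x) := by
  by_cases hk : k = p
  · subst hk
    simp [castZ]
  · have : x = 0 := Cocycle.ext_onSeq fun F => (h.resolve_left hk) F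
    rw [castZ, dif_neg hk, this, map_zero, map_zero]

theorem onSeq_gBracket_eq {m n p : ℕ} (h : m + n = p + 1) (φ : Cochain A m) (ψ : Cochain A n) :
    onSeq (gBracket h φ ψ) = commF m n (onSeq φ) (onSeq ψ) :=
  funext fun F => onSeq_gBracket h φ ψ F

/-- The cup product of cocycles. -/
def cupZ (m n : ℕ) : Cocycle A S m →ₗ[ℝ] Cocycle A S n →ₗ[ℝ] Cocycle A S (m + n) :=
  LinearMap.mk₂ ℝ (fun x y => ⟨diffCochain.cup rfl x.1 y.1, by
      rw [mem_cocycle_iff]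
      intro F
      have := dSeq_cup (n := n) x.1.1 (onSeq y.1.1) F
      rw [Cocycle.dSeq_eq_zero x, Cocycle.dSeq_eq_zero y] at this
      rw [zero_mul, mul_zero, smul_zero, add_zero] at this
      exact this⟩)
    (fun x x' y => Cocycle.ext_onSeq fun F => add_mul _ _ _)
    (fun c x y => Cocycle.ext_onSeq fun F => smul_mul_assoc _ _ _)
    (fun x y y' => Cocycle.ext_onSeq fun F => mul_add _ _ _)
    (fun c x y => Cocycle.ext_onSeq fun F => mul_smul_comm _ _ _)

theorem onSeq_cupZ {m n : ℕ} (x : Cocycle A S m) (y : Cocycle A S n) :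
    onSeq (cupZ m n x y).1.1 = fun F => onSeq x.1.1 F * onSeq y.1.1 fun u => F (m + u) := rfl

theorem coe_cupZ {m n : ℕ} (x : Cocycle A S m) (y : Cocycle A S n) :
    (cupZ m n x y).1 = diffCochain.cup rfl x.1 y.1 := rfl

/-- The bracket of differential cochains, in any degrees: zero for two cochains of degree zero. -/
def bracketC {m n : ℕ} (x : diffCochain A S m) (y : diffCochain A S n) :
    diffCochain A S (m + n - 1) :=
  if h : m + n = m + n - 1 + 1 then diffCochain.bracket h x y else 0

theorem onSeq_bracketC {m n : ℕ} (x : diffCochain A S m) (y : diffCochain A S n) :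
    onSeq (bracketC x y).1 = commF m n (onSeq x.1) (onSeq y.1) := by
  unfold bracketC
  split_ifs with h
  · exact onSeq_gBracket_eq h _ _
  · obtain rfl : m = 0 := by omega
    obtain rfl : n = 0 := by omega
    rw [commF_zero_zero]
    rfl

/-- The bracket of cocycles. -/
def bracketZ (m n : ℕ) : Cocycle A S m →ₗ[ℝ] Cocycle A S n →ₗ[ℝ] Cocycle A S (m + n - 1) :=
  LinearMap.mk₂ ℝ (fun x y => ⟨bracketC x.1 y.1, by
      rw [mem_cocycle_iff]
      intro F
      rw [onSeq_bracketC, dSeq_commF, Cocycle.dSeq_eq_zero x, Cocycle.dSeq_eq_zero y,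
        commF_zero_left, commF_zero_right]
      simp⟩)
    (fun x x' y => Cocycle.ext_onSeq fun F => by
      change onSeq (bracketC (x.1 + x'.1) y.1).1 F =
        onSeq (bracketC x.1 y.1).1 F + onSeq (bracketC x'.1 y.1).1 F
      simp only [onSeq_bracketC, commF]
      have e : onSeq (x.1 + x'.1).1 = fun F => onSeq x.1.1 F + onSeq x'.1.1 F := rfl
      rw [e, circF_add_left, circF_add_right, smul_add]
      abel)
    (fun c x y => Cocycle.ext_onSeq fun F => by
      change onSeq (bracketC (c • x.1) y.1).1 F = c • onSeq (bracketC x.1 y.1).1 F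
      simp only [onSeq_bracketC, commF]
      have e : onSeq (c • x.1).1 = fun F => c • onSeq x.1.1 F := rfl
      rw [e, circF_smul_left, circF_smul_right, smul_sub, smul_comm c])
    (fun x y y' => Cocycle.ext_onSeq fun F => by
      change onSeq (bracketC x.1 (y.1 + y'.1)).1 F =
        onSeq (bracketC x.1 y.1).1 F + onSeq (bracketC x.1 y'.1).1 F
      simp only [onSeq_bracketC, commF]
      have e : onSeq (y.1 + y'.1).1 = fun F => onSeq y.1.1 F + onSeq y'.1.1 F := rfl
      rw [e, circF_add_left, circF_add_right, smul_add]
      abel)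
    (fun c x y => Cocycle.ext_onSeq fun F => by
      change onSeq (bracketC x.1 (c • y.1)).1 F = c • onSeq (bracketC x.1 y.1).1 F
      simp only [onSeq_bracketC, commF]
      have e : onSeq (c • y.1).1 = fun F => c • onSeq y.1.1 F := rfl
      rw [e, circF_smul_left, circF_smul_right, smul_sub, smul_comm c])

theorem onSeq_bracketZ {m n : ℕ} (x : Cocycle A S m) (y : Cocycle A S n) :
    onSeq (bracketZ m n x y).1.1 = commF m n (onSeq x.1.1) (onSeq y.1.1) :=
  onSeq_bracketC x.1 y.1

theorem exists_of_mem_coboundary {k : ℕ} {x : diffCochain A S k} (h : x ∈ Coboundary A S k) :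
    x = 0 ∨ ∃ (r : ℕ) (_ : r + 1 = k) (ψ : diffCochain A S r),
      onSeq x.1 = dSeq r (onSeq ψ.1) := by
  cases k with
  | zero => exact Or.inl ((Submodule.mem_bot ℝ).1 h)
  | succ k =>
    obtain ⟨ψ, rfl⟩ := h
    exact Or.inr ⟨k, rfl, ψ, funext fun F => onSeq_hochschildD ψ.1 F⟩

/-- The cup product on cohomology. -/
def cupH (m n : ℕ) : HH A S m →ₗ[ℝ] HH A S n →ₗ[ℝ] HH A S (m + n) :=
  quotBilin _ _ _ (cupZ m n)
    (fun x hx y => by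
      rw [Submodule.mem_comap] at hx ⊢
      rcases exists_of_mem_coboundary hx with h | ⟨r, rfl, ψ, h⟩
      · obtain rfl : x = 0 := Subtype.ext h
        rw [map_zero]
        exact Submodule.zero_mem _
      · refine mem_coboundary (show r + n + 1 = r + 1 + n by omega) _
          (diffCochain.cup rfl ψ y.1) 1 fun F => ?_
        have h1 := dSeq_cup (n := n) ψ.1 (onSeq y.1.1) F
        rw [Cocycle.dSeq_eq_zero y, mul_zero, smul_zero, add_zero] at h1
        rw [one_smul]
        change onSeq x.1.1 F * _ = _
        change onSeq x.1.1 = _ at h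
        rw [h]
        exact h1.symm)
    (fun x y hy => by
      rw [Submodule.mem_comap] at hy ⊢
      rcases exists_of_mem_coboundary hy with h | ⟨r, rfl, ψ, h⟩
      · obtain rfl : y = 0 := Subtype.ext h
        rw [map_zero]
        exact Submodule.zero_mem _
      · refine mem_coboundary (show m + r + 1 = m + (r + 1) by omega) _
          (diffCochain.cup rfl x.1 ψ) ((-1) ^ m) fun F => ?_
        have h1 := dSeq_cup (n := r) x.1.1 (onSeq ψ.1) F
        rw [Cocycle.dSeq_eq_zero x, zero_mul, zero_add] at h1
        change onSeq y.1.1 = _ at h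
        change onSeq (cupZ m (r + 1) x y).1.1 F = _
        rw [onSeq_cupZ, h]
        change _ = _ • dSeq (m + r) (fun G => onSeq x.1.1 G * onSeq ψ.1 fun u => G (m + u)) F
        rw [h1, smul_smul, ← mul_pow]
        simp)

/-- The Gerstenhaber bracket on cohomology. -/
def bracketH (m n : ℕ) : HH A S m →ₗ[ℝ] HH A S n →ₗ[ℝ] HH A S (m + n - 1) :=
  quotBilin _ _ _ (bracketZ m n)
    (fun x hx y => by
      rw [Submodule.mem_comap] at hx ⊢
      rcases exists_of_mem_coboundary hx with h | ⟨r, rfl, ψ, h⟩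
      · obtain rfl : x = 0 := Subtype.ext h
        rw [map_zero]
        exact Submodule.zero_mem _
      · have h1 : ∀ F, onSeq (bracketZ (r + 1) n x y).1.1 F =
            (-1 : ℝ) ^ (n + 1) • dSeq (r + n - 1) (onSeq (bracketC ψ y.1).1) F := fun F => by
          rw [onSeq_bracketC, dSeq_commF, Cocycle.dSeq_eq_zero y, commF_zero_right, add_zero,
            smul_smul, ← mul_pow, onSeq_bracketZ, ← h]
          simp
        -- In degrees `r = n = 0` the truncated degree is wrong, but the bracket vanishes.
        by_cases hr : r + n = 0
        · obtain rfl : r = 0 := by omega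
          obtain rfl : n = 0 := by omega
          have : bracketZ (0 + 1) 0 x y = 0 := Cocycle.ext_onSeq fun F => by
            rw [h1, onSeq_bracketC, commF_zero_zero, dSeq_zero, smul_zero]
            rfl
          rw [this]
          exact Submodule.zero_mem _
        · exact mem_coboundary (show r + n - 1 + 1 = r + 1 + n - 1 by omega) _ _ _ h1)
    (fun x y hy => by
      rw [Submodule.mem_comap] at hy ⊢
      rcases exists_of_mem_coboundary hy with h | ⟨r, rfl, ψ, h⟩
      · obtain rfl : y = 0 := Subtype.ext h
        rw [map_zero]
        exact Submodule.zero_mem _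
      · have h1 : ∀ F, onSeq (bracketZ m (r + 1) x y).1.1 F =
            (1 : ℝ) • dSeq (m + r - 1) (onSeq (bracketC x.1 ψ).1) F := fun F => by
          rw [onSeq_bracketC, dSeq_commF, Cocycle.dSeq_eq_zero x, commF_zero_left, smul_zero,
            zero_add, one_smul, onSeq_bracketZ, ← h]
          rfl
        -- In degrees `m = r = 0` the truncated degree is wrong, but the bracket vanishes.
        by_cases hr : m + r = 0
        · obtain rfl : r = 0 := by omega
          obtain rfl : m = 0 := by omega
          have : bracketZ 0 (0 + 1) x y = 0 := Cocycle.ext_onSeq fun F => by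
            rw [h1, onSeq_bracketC, commF_zero_zero, dSeq_zero, smul_zero]
            rfl
          rw [this]
          exact Submodule.zero_mem _
        · exact mem_coboundary (show m + r - 1 + 1 = m + (r + 1) - 1 by omega) _ _ _ h1)

variable (A S) in
/-- The constant `1` as a cocycle of degree zero. -/
def oneZ : Cocycle A S 0 :=
  ⟨⟨MultilinearMap.constOfIsEmpty ℝ _ 1, ⟨fun _ => 0, fun i => i.elim0⟩, fun _ _ i => i.elim0⟩, by
    rw [mem_cocycle_iff]
    intro F
    change ∑ i ∈ Finset.range 2, _ = _
    simp [Finset.sum_range_succ, face, onSeq]⟩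

theorem onSeq_oneZ (F : ℕ → A) : onSeq (oneZ A S).1.1 F = 1 := rfl

variable (A S) in
/-- The product of the Hochschild cohomology. -/
def hhMul : (⨁ k, HH A S k) →ₗ[ℝ] (⨁ k, HH A S k) →ₗ[ℝ] (⨁ k, HH A S k) :=
  gradedBilin (· + ·) cupH

variable (A S) in
/-- The bracket of the Hochschild cohomology. -/
def hhBracket : (⨁ k, HH A S k) →ₗ[ℝ] (⨁ k, HH A S k) →ₗ[ℝ] (⨁ k, HH A S k) :=
  gradedBilin (fun m n => m + n - 1) bracketH

theorem hhMul_cls {m n : ℕ} (a : Cocycle A S m) (b : Cocycle A S n) :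
    hhMul A S (HH.cls m a) (HH.cls n b) = HH.cls (m + n) (cupZ m n a b) :=
  gradedBilin_lof _ _ _ _ _ _

theorem hhBracket_cls {m n : ℕ} (a : Cocycle A S m) (b : Cocycle A S n) :
    hhBracket A S (HH.cls m a) (HH.cls n b) = HH.cls (m + n - 1) (bracketZ m n a b) :=
  gradedBilin_lof _ _ _ _ _ _

theorem hhMul_one (a : ⨁ k, HH A S k) : hhMul A S (HH.cls 0 (oneZ A S)) a = a := by
  induction a using HH.cls_induction with
  | h0 => rw [map_zero]
  | ha a b h1 h2 => rw [map_add, h1, h2]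
  | hl k x =>
    rw [hhMul_cls, cls_castZ _ (Or.inl (Nat.zero_add k))]
    congr 1
    refine Cocycle.ext_onSeq fun F => ?_
    rw [onSeq_castZ _ (Or.inl (Nat.zero_add k)), onSeq_cupZ]
    simp [onSeq_oneZ]

theorem hhMul_assoc (a b c : ⨁ k, HH A S k) :
    hhMul A S (hhMul A S a b) c = hhMul A S a (hhMul A S b c) := by
  induction a using HH.cls_induction with
  | h0 => simp
  | ha a b h1 h2 => simp only [map_add, LinearMap.add_apply, h1, h2]
  | hl m a =>
  induction b using HH.cls_induction with
  | h0 => simp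
  | ha a b h1 h2 => simp only [map_add, LinearMap.add_apply, h1, h2]
  | hl n b =>
  induction c using HH.cls_induction with
  | h0 => simp
  | ha a b h1 h2 => simp only [map_add, h1, h2]
  | hl p c =>
    simp only [hhMul_cls]
    rw [cls_castZ _ (Or.inl (Nat.add_assoc m n p))]
    congr 1
    refine Cocycle.ext_onSeq fun F => ?_
    rw [onSeq_castZ _ (Or.inl (Nat.add_assoc m n p))]
    simp only [onSeq_cupZ, mul_assoc, Nat.add_assoc]

/-- Graded commutativity on cohomology: the commutator of the cup product is the coboundary of a
Gerstenhaber composition. -/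
theorem hhMul_comm {m n : ℕ} (a : Cocycle A S m) (b : Cocycle A S n) :
    hhMul A S (HH.cls m a) (HH.cls n b) =
      (-1 : ℝ) ^ (m * n) • hhMul A S (HH.cls n b) (HH.cls m a) := by
  simp only [hhMul_cls]
  rw [cls_castZ (cupZ n m b a) (Or.inl (Nat.add_comm n m)), ← map_smul]
  have h := fun F => dSeq_circF a.1.1 b.1.1 F
  simp only [Cocycle.dSeq_eq_zero a, Cocycle.dSeq_eq_zero b, circF_zero_right, circF_zero_left,
    smul_zero, zero_add] at h
  have key : ∀ F, onSeq (cupZ m n a b).1.1 F -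
      onSeq ((-1 : ℝ) ^ (m * n) • castZ (m + n) (cupZ n m b a)).1.1 F =
      -((-1 : ℝ) ^ (m * n + n)) •
        dSeq (m + n - 1) (circF m n (onSeq a.1.1) (onSeq b.1.1)) F := by
    intro F
    rw [h, neg_smul, neg_one_pow_smul_smul, add_assoc, ← two_mul n, pow_add, pow_mul _ 2]
    change _ - (-1 : ℝ) ^ (m * n) • onSeq (castZ (m + n) (cupZ n m b a)).1.1 F = _
    rw [onSeq_castZ _ (Or.inl (Nat.add_comm n m)), onSeq_cupZ, onSeq_cupZ]
    simp only [neg_one_sq, one_pow, mul_one, smul_sub, smul_smul, ← mul_pow]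
    simp
  rcases Nat.eq_zero_or_pos (m + n) with h0 | h0
  · obtain rfl : m = 0 := by omega
    obtain rfl : n = 0 := by omega
    congr 1
    refine Cocycle.ext_onSeq fun F => sub_eq_zero.1 ((key F).trans ?_)
    have : circF 0 0 (onSeq a.1.1) (onSeq b.1.1) = fun _ => 0 := by
      funext F; simp [circF]
    rw [this, dSeq_zero, smul_zero]
  · refine congrArg (DirectSum.lof ℝ ℕ (HH A S) _) <| HH.mk_eq_of_dSeq (Nat.sub_add_cancel h0) _ _
      ⟨circ (by omega) a.1.1 b.1.1, circ_mem _ a.1.2 b.1.2⟩ (-((-1 : ℝ) ^ (m * n + n)))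
      fun F => (key F).trans ?_
    congr 2
    funext G
    exact (onSeq_circ _ _ _ G).symm

theorem hhBracket_antisymm {m n : ℕ} (a : Cocycle A S m) (b : Cocycle A S n) :
    hhBracket A S (HH.cls m a) (HH.cls n b) =
      -((-1 : ℝ) ^ ((m + 1) * (n + 1)) • hhBracket A S (HH.cls n b) (HH.cls m a)) := by
  simp only [hhBracket_cls]
  have hd : n + m - 1 = m + n - 1 := by omega
  rw [cls_castZ (bracketZ n m b a) (Or.inl hd), ← map_smul, ← map_neg]
  congr 1
  refine Cocycle.ext_onSeq fun F => ?_
  change _ = -((-1 : ℝ) ^ ((m + 1) * (n + 1)) • onSeq (castZ (m + n - 1) (bracketZ n m b a)).1.1 F)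
  rw [onSeq_castZ _ (Or.inl hd), onSeq_bracketZ, onSeq_bracketZ, commF, commF, smul_sub,
    neg_one_pow_smul_smul, Nat.mul_comm (n + 1), ← two_mul, pow_mul]
  simp

theorem hhBracket_jacobi {m n : ℕ} (a : Cocycle A S m) (b : Cocycle A S n) (c : ⨁ k, HH A S k) :
    hhBracket A S (HH.cls m a) (hhBracket A S (HH.cls n b) c) =
      hhBracket A S (hhBracket A S (HH.cls m a) (HH.cls n b)) c +
        (-1 : ℝ) ^ ((m + 1) * (n + 1)) •
          hhBracket A S (HH.cls n b) (hhBracket A S (HH.cls m a) c) := by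
  induction c using HH.cls_induction with
  | h0 => simp
  | ha a b h1 h2 => simp only [map_add, h1, h2, smul_add]; abel
  | hl p c =>
    simp only [hhBracket_cls]
    -- The truncated degrees of the double brackets agree unless an inner bracket vanishes.
    have h0 : ∀ {i j l : ℕ} (x : Cocycle A S i) (y : Cocycle A S j) (z : Cocycle A S l),
        i + (j + l - 1) - 1 = i + j + l - 2 ∨
        ∀ F, onSeq (bracketZ i (j + l - 1) x (bracketZ j l y z)).1.1 F = 0 := by
      intro i j l x y z
      rcases Nat.eq_zero_or_pos (j + l) with h | h
      · obtain rfl : j = 0 := by omega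
        obtain rfl : l = 0 := by omega
        refine Or.inr fun F => ?_
        rw [onSeq_bracketZ, onSeq_bracketZ, commF_zero_zero, commF_zero_right]
      · exact Or.inl (by omega)
    have h1 : m + n - 1 + p - 1 = m + n + p - 2 ∨
        ∀ F, onSeq (bracketZ (m + n - 1) p (bracketZ m n a b) c).1.1 F = 0 := by
      rcases Nat.eq_zero_or_pos (m + n) with h | h
      · obtain rfl : m = 0 := by omega
        obtain rfl : n = 0 := by omega
        refine Or.inr fun F => ?_
        rw [onSeq_bracketZ, onSeq_bracketZ, commF_zero_zero, commF_zero_left]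
      · exact Or.inl (by omega)
    have h2 : n + (m + p - 1) - 1 = m + n + p - 2 ∨
        ∀ F, onSeq (bracketZ n (m + p - 1) b (bracketZ m p a c)).1.1 F = 0 :=
      (h0 b a c).imp_left fun h => h.trans (by omega)
    rw [cls_castZ _ (h0 a b c), cls_castZ _ h1, cls_castZ _ h2, HH.cls_add_smul]
    congr 1
    refine Cocycle.ext_onSeq fun F => ?_
    change _ = onSeq (castZ _ _).1.1 F + (-1 : ℝ) ^ ((m + 1) * (n + 1)) • onSeq (castZ _ _).1.1 F
    rw [onSeq_castZ _ (h0 a b c), onSeq_castZ _ h1, onSeq_castZ _ h2]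
    simp only [onSeq_bracketZ]
    exact commF_commF_jacobi a.1.1 b.1.1 c.1.1 F

set_option maxHeartbeats 800000 in
/-- The graded Leibniz rule on cohomology: the defect is the coboundary of a brace. -/
theorem hhBracket_mul {m p : ℕ} (a : Cocycle A S m) (b : ⨁ k, HH A S k) (c : Cocycle A S p) :
    hhBracket A S (hhMul A S (HH.cls m a) b) (HH.cls p c) =
      hhMul A S (hhBracket A S (HH.cls m a) (HH.cls p c)) b +
        (-1 : ℝ) ^ (m * (p + 1)) • hhMul A S (HH.cls m a) (hhBracket A S b (HH.cls p c)) := by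
  induction b using HH.cls_induction with
  | h0 => simp
  | ha a b h1 h2 => simp only [map_add, LinearMap.add_apply, h1, h2, smul_add]; abel
  | hl n b =>
    simp only [hhBracket_cls, hhMul_cls]
    have h1 : m + p - 1 + n = m + n + p - 1 ∨
        ∀ F, onSeq (cupZ (m + p - 1) n (bracketZ m p a c) b).1.1 F = 0 := by
      rcases Nat.eq_zero_or_pos (m + p) with h | h
      · obtain rfl : m = 0 := by omega
        obtain rfl : p = 0 := by omega
        refine Or.inr fun F => ?_
        simp only [onSeq_cupZ, onSeq_bracketZ, commF_zero_zero, zero_mul]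
      · exact Or.inl (by omega)
    have h2 : m + (n + p - 1) = m + n + p - 1 ∨
        ∀ F, onSeq (cupZ m (n + p - 1) a (bracketZ n p b c)).1.1 F = 0 := by
      rcases Nat.eq_zero_or_pos (n + p) with h | h
      · obtain rfl : n = 0 := by omega
        obtain rfl : p = 0 := by omega
        refine Or.inr fun F => ?_
        simp only [onSeq_cupZ, onSeq_bracketZ, commF_zero_zero, mul_zero]
      · exact Or.inl (by omega)
    rw [cls_castZ _ h1, cls_castZ _ h2, HH.cls_add_smul]
    have key : ∀ F, onSeq (bracketZ (m + n) p (cupZ m n a b) c).1.1 F -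
        onSeq (castZ (m + n + p - 1) (cupZ (m + p - 1) n (bracketZ m p a c) b) +
          (-1 : ℝ) ^ (m * (p + 1)) • castZ (m + n + p - 1)
            (cupZ m (n + p - 1) a (bracketZ n p b c))).1.1 F =
        (-1 : ℝ) ^ ((m + n + 1) * (p + 1) + m) •
          dSeq (p + n + m - 2) (fun G => ∑ t ∈ Finset.range p,
            (-1 : ℝ) ^ ((n + 1) * t) • ∑ s ∈ Finset.range t, (-1 : ℝ) ^ ((m + 1) * s) •
              insF m s (insF n t (onSeq c.1.1) (onSeq b.1.1)) (onSeq a.1.1) G) F := by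
      intro F
      rw [← commF_cup a.1.1 b.1.1 c.1.1 (congrArg Subtype.val (LinearMap.mem_ker.1 a.2))
        (congrArg Subtype.val (LinearMap.mem_ker.1 b.2))
        (congrArg Subtype.val (LinearMap.mem_ker.1 c.2)), sub_sub]
      change _ - (onSeq (castZ _ _).1.1 F + (-1 : ℝ) ^ (m * (p + 1)) • onSeq (castZ _ _).1.1 F) = _
      rw [onSeq_castZ _ h1, onSeq_castZ _ h2]
      simp only [onSeq_bracketZ, onSeq_cupZ]
    -- For `p < 2` there is no room for two insertions, and the brace vanishes.
    by_cases hp : 2 ≤ p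
    · obtain ⟨M, hM⟩ := mem_diffCochain_iff.1 c.1.2
      obtain ⟨M', hM'⟩ := mem_diffCochain_iff.1 a.1.2
      obtain ⟨M'', hM''⟩ := mem_diffCochain_iff.1 b.1.2
      obtain ⟨ψ, hψm, hψ⟩ := exists_brace hM hM' hM''
      refine congrArg (DirectSum.lof ℝ ℕ (HH A S) _) <| HH.mk_eq_of_dSeq
        (r := p + n + m - 2) (by omega) _ _
          ⟨ψ, ordCochain_le_diffCochain _ _ hψm⟩
          ((-1) ^ ((m + n + 1) * (p + 1) + m)) fun F => ?_
      rw [hψ]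
      exact key F
    · congr 1
      refine Cocycle.ext_onSeq fun F => sub_eq_zero.1 ((key F).trans ?_)
      have : ∀ t ∈ Finset.range p, ∀ G : ℕ → A, (-1 : ℝ) ^ ((n + 1) * t) • ∑ s ∈ Finset.range t,
          (-1 : ℝ) ^ ((m + 1) * s) •
            insF m s (insF n t (onSeq c.1.1) (onSeq b.1.1)) (onSeq a.1.1) G = 0 := by
        intro t ht G
        obtain rfl : t = 0 := by have := Finset.mem_range.1 ht; omega
        simp
      simp only [Finset.sum_congr rfl fun t ht => this t ht _, Finset.sum_const_zero, dSeq_zero,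
        smul_zero]

variable (A S) in
set_option maxHeartbeats 1600000 in
/-- The Gerstenhaber algebra structure on the Hochschild cohomology. -/
def hochschildGerstenhaber : GerstenhaberAlgebra (HH A S) where
  one := HH.mk 0 (oneZ A S)
  mul := hhMul A S
  bracket := hhBracket A S
  mul_mem m n a b := ⟨_, gradedBilin_lof _ _ _ _ _ _⟩
  bracket_mem m n p h a b := by
    obtain rfl : m + n - 1 = p := by omega
    exact ⟨_, gradedBilin_lof _ _ _ _ _ _⟩
  bracket_zero_zero a b := by
    obtain ⟨a, rfl⟩ := HH.mk_surjective 0 a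
    obtain ⟨b, rfl⟩ := HH.mk_surjective 0 b
    refine (hhBracket_cls a b).trans ?_
    have : bracketZ 0 0 a b = 0 := Cocycle.ext_onSeq fun F => by
      rw [onSeq_bracketZ, commF_zero_zero]
      rfl
    rw [this, map_zero]
  one_mul := hhMul_one
  mul_assoc := hhMul_assoc
  mul_comm m n a b := by
    obtain ⟨a, rfl⟩ := HH.mk_surjective m a
    obtain ⟨b, rfl⟩ := HH.mk_surjective n b
    exact hhMul_comm a b
  bracket_antisymm m n a b := by
    obtain ⟨a, rfl⟩ := HH.mk_surjective m a
    obtain ⟨b, rfl⟩ := HH.mk_surjective n b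
    exact hhBracket_antisymm a b
  jacobi m n a b c := by
    obtain ⟨a, rfl⟩ := HH.mk_surjective m a
    obtain ⟨b, rfl⟩ := HH.mk_surjective n b
    exact hhBracket_jacobi a b c
  leibniz m p a b c := by
    obtain ⟨a, rfl⟩ := HH.mk_surjective m a
    obtain ⟨c, rfl⟩ := HH.mk_surjective p c
    exact hhBracket_mul a b c

set_option maxHeartbeats 800000 in
/-- The structure is induced by the cup product and the Gerstenhaber bracket of cocycles. -/
theorem isHochschildGerstenhaber : IsHochschildGerstenhaber (hochschildGerstenhaber A S) where
  one := ⟨oneZ A S, fun _ => rfl, rfl⟩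
  mul m n φ ψ := ⟨cupZ m n φ ψ, coe_cupZ φ ψ, hhMul_cls φ ψ⟩
  bracket m n p h φ ψ := by
    obtain rfl : m + n - 1 = p := by omega
    refine ⟨bracketZ m n φ ψ, Subtype.ext (ext_onSeq fun F => ?_), hhBracket_cls φ ψ⟩
    rw [onSeq_bracketZ]
    exact (onSeq_gBracket h _ _ F).symm

end HH

/-! ### Antisymmetrisation of cochains -/

section Alternation

variable {A : Type*} [CommRing A] [Algebra ℝ A]

/-- The sum `∑_σ sign σ · g(f_{σ 0}, …, f_{σ (k - 1)})`. -/
def altSum {k : ℕ} {X : Type*} {Y : Type*} [AddCommGroup Y] [Module ℝ Y] (g : (Fin k → X) → Y)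
    (f : Fin k → X) : Y :=
  ∑ σ : Equiv.Perm (Fin k), ((Equiv.Perm.sign σ : ℤ) : ℝ) • g (f ∘ σ)

section AltSum

variable {X Y : Type*} [AddCommGroup Y] [Module ℝ Y]

theorem altSum_comp {k : ℕ} (g : (Fin k → X) → Y) (τ : Equiv.Perm (Fin k)) (f : Fin k → X) :
    altSum (fun f => g (f ∘ τ)) f = ((Equiv.Perm.sign τ : ℤ) : ℝ) • altSum g f := by
  unfold altSum
  rw [← Equiv.sum_comp (Equiv.mulRight τ) fun σ => ((Equiv.Perm.sign σ : ℤ) : ℝ) • g (f ∘ σ),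
    Finset.smul_sum]
  refine Finset.sum_congr rfl fun σ _ => ?_
  rw [Equiv.coe_mulRight, smul_smul, Equiv.Perm.sign_mul]
  have h : ((Equiv.Perm.sign τ : ℤ) : ℝ) * ((Equiv.Perm.sign τ : ℤ) : ℝ) = 1 := by
    rcases Int.units_eq_one_or (Equiv.Perm.sign τ) with h | h <;> simp [h]
  congr 1
  push_cast
  linear_combination (-((Equiv.Perm.sign σ : ℤ) : ℝ)) * h

/-- The alternating sum of a function which is symmetric in two arguments vanishes. -/
theorem altSum_eq_zero {k : ℕ} (g : (Fin k → X) → Y) {i j : Fin k} (hij : i ≠ j)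
    (hg : ∀ f, g (f ∘ Equiv.swap i j) = g f) (f : Fin k → X) : altSum g f = 0 := by
  have h := altSum_comp g (Equiv.swap i j) f
  simp only [hg, Equiv.Perm.sign_swap hij] at h
  have h2 : (2 : ℝ) • altSum g f = 0 := by
    rw [two_smul]
    nth_rewrite 1 [show altSum g f = altSum (fun f => g f) f from rfl, h]
    simp
  exact (smul_eq_zero.1 h2).resolve_left two_ne_zero

theorem altSum_add {k : ℕ} (g g' : (Fin k → X) → Y) (f : Fin k → X) :
    altSum (fun f => g f + g' f) f = altSum g f + altSum g' f := by
  simp only [altSum, smul_add, Finset.sum_add_distrib]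

theorem altSum_smul {k : ℕ} (c : ℝ) (g : (Fin k → X) → Y) (f : Fin k → X) :
    altSum (fun f => c • g f) f = c • altSum g f := by
  simp only [altSum, Finset.smul_sum, smul_comm c]

theorem altSum_sum {k : ℕ} {ι : Type*} (s : Finset ι) (g : ι → (Fin k → X) → Y) (f : Fin k → X) :
    altSum (fun f => ∑ i ∈ s, g i f) f = ∑ i ∈ s, altSum (g i) f := by
  simp only [altSum, Finset.smul_sum]
  exact Finset.sum_comm

/-- `g` changes sign under odd permutations of its arguments. -/
def IsAlt {k : ℕ} (g : (Fin k → X) → Y) : Prop :=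
  ∀ (τ : Equiv.Perm (Fin k)) (f : Fin k → X),
    g (f ∘ τ) = ((Equiv.Perm.sign τ : ℤ) : ℝ) • g f

/-- The alternating sum of an antisymmetric function of `k` arguments is `k!` times the function. -/
theorem IsAlt.altSum {k : ℕ} {g : (Fin k → X) → Y} (h : IsAlt g) (f : Fin k → X) :
    altSum g f = (k.factorial : ℝ) • g f := by
  have : ∀ σ : Equiv.Perm (Fin k), ((Equiv.Perm.sign σ : ℤ) : ℝ) • g (f ∘ σ) = g f := fun σ => by
    rw [h, smul_smul]
    rcases Int.units_eq_one_or (Equiv.Perm.sign σ) with h | h <;> simp [h]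
  simp only [VerticalHKR.altSum, this, Finset.sum_const, Finset.card_univ, Fintype.card_perm,
    Fintype.card_fin, Nat.cast_smul_eq_nsmul]

end AltSum

/-- The antisymmetrisation of a cochain, a sum over all permutations. -/
def altC {k : ℕ} (φ : Cochain A k) : Cochain A k :=
  ∑ σ : Equiv.Perm (Fin k), ((Equiv.Perm.sign σ : ℤ) : ℝ) • φ.domDomCongr σ

theorem altC_apply {k : ℕ} (φ : Cochain A k) (f : Fin k → A) : altC φ f = altSum φ f := by
  simp only [altC, _root_.sum_apply, _root_.smul_apply, MultilinearMap.domDomCongr_apply, altSum]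
  rfl

theorem isAlt_altC {k : ℕ} (φ : Cochain A k) : IsAlt (altC φ) := by
  intro τ f
  rw [altC_apply, altC_apply]
  unfold altSum
  rw [← Equiv.sum_comp (Equiv.mulLeft τ) fun σ => ((Equiv.Perm.sign σ : ℤ) : ℝ) • φ (f ∘ σ),
    Finset.smul_sum]
  refine Finset.sum_congr rfl fun σ _ => ?_
  rw [Equiv.coe_mulLeft, smul_smul, Equiv.Perm.sign_mul]
  have h : ((Equiv.Perm.sign τ : ℤ) : ℝ) * ((Equiv.Perm.sign τ : ℤ) : ℝ) = 1 := by
    rcases Int.units_eq_one_or (Equiv.Perm.sign τ) with h | h <;> simp [h]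
  have e : (f ∘ τ) ∘ σ = f ∘ ⇑(τ * σ) := by
    funext i; simp
  rw [e]
  congr 1
  push_cast
  linear_combination (-((Equiv.Perm.sign σ : ℤ) : ℝ)) * h

theorem altC_add {k : ℕ} (φ ψ : Cochain A k) : altC (φ + ψ) = altC φ + altC ψ := by
  ext f
  rw [_root_.add_apply, altC_apply, altC_apply, altC_apply, ← altSum_add]
  rfl

theorem altC_smul {k : ℕ} (c : ℝ) (φ : Cochain A k) : altC (c • φ) = c • altC φ := by
  ext f
  rw [_root_.smul_apply, altC_apply, altC_apply, ← altSum_smul]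
  rfl

/-- The antisymmetrisation of a Hochschild coboundary vanishes: the terms with a product of two
neighbouring arguments are symmetric in these arguments, and the two outer terms cancel because of
the sign of a cyclic permutation. -/
theorem altC_hochschildD {k : ℕ} (φ : Cochain A k) : altC (hochschildD φ) = 0 := by
  ext f
  rw [altC_apply]
  have e : (hochschildD φ : (Fin (k + 1) → A) → A) = fun f =>
      (cup (by omega) (idCochain A) φ : Cochain A (k + 1)) f
        + ∑ i : Fin k, (-1 : ℝ) ^ ((i : ℕ) + 1) •
          (insertAt (by omega) i φ (mulCochain A) : Cochain A (k + 1)) f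
        + (-1 : ℝ) ^ (k + 1) • (cup rfl φ (idCochain A) : Cochain A (k + 1)) f := by
    funext f
    simp only [hochschildD, _root_.add_apply, _root_.sum_apply, _root_.smul_apply]
  rw [e, altSum_add, altSum_add, altSum_smul, altSum_sum]
  have h1 : ∀ i : Fin k, altSum (fun f => (-1 : ℝ) ^ ((i : ℕ) + 1) •
      (insertAt (by omega) i φ (mulCochain A) : Cochain A (k + 1)) f) f = 0 := by
    intro i
    rw [altSum_smul, altSum_eq_zero _ (i := i.castSucc) (j := i.succ), smul_zero]
    · exact Fin.castSucc_lt_succ.ne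
    · intro g
      rw [insertAt_apply, insertAt_apply]
      congr 1
      funext j
      simp only [insertArgs]
      split_ifs with hlt heq
      · rw [Function.comp_apply, Equiv.swap_apply_of_ne_of_ne]
        · simp only [ne_eq, Fin.ext_iff, Fin.val_castSucc]; omega
        · simp only [ne_eq, Fin.ext_iff, Fin.val_succ]; omega
      · have a1 : ∀ h h', (⟨(i : ℕ) + ((0 : Fin 2) : ℕ), h⟩ : Fin (k + 1)) = i.castSucc ∧
            (⟨(i : ℕ) + ((1 : Fin 2) : ℕ), h'⟩ : Fin (k + 1)) = i.succ := fun _ _ => ⟨rfl, rfl⟩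
        have a2 : ∀ F : Fin 2 → A, mulCochain A F = F 0 * F 1 := fun F => by
          simp [mulCochain, cup_apply, idCochain]
        rw [a2, a2]
        simp only [Function.comp_apply, (a1 (by omega) (by simp)).1, (a1 (by omega) (by simp)).2,
          Equiv.swap_apply_left, Equiv.swap_apply_right]
        rw [mul_comm]
      · rw [Function.comp_apply, Equiv.swap_apply_of_ne_of_ne]
        · simp only [ne_eq, Fin.ext_iff, Fin.val_castSucc]; omega
        · simp only [ne_eq, Fin.ext_iff, Fin.val_succ]; omega
  have h2 : altSum (fun f => (cup (by omega) (idCochain A) φ : Cochain A (k + 1)) f) f =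
      ((Equiv.Perm.sign (finRotate (k + 1)) : ℤ) : ℝ) •
        altSum (fun f => (cup rfl φ (idCochain A) : Cochain A (k + 1)) f) f := by
    rw [← altSum_comp]
    unfold altSum
    refine Finset.sum_congr rfl fun σ _ => ?_
    congr 1
    beta_reduce
    rw [cup_apply, cup_apply, mul_comm]
    congr 1
    · congr 1
      funext j
      simp only [Function.comp_apply]
      congr 2
      have : (⟨(j : ℕ), by omega⟩ : Fin (k + 1)) = j.castSucc := rfl
      rw [this, finRotate_apply]
      ext
      rw [Fin.coeSucc_eq_succ]
      simp [add_comm]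
    · simp only [idCochain, MultilinearMap.ofSubsingleton_apply_apply, LinearMap.id_apply,
        Function.comp_apply]
      congr 2
      have : (⟨k + ((0 : Fin 1) : ℕ), by simp⟩ : Fin (k + 1)) = Fin.last k := rfl
      rw [this, finRotate_last]
      rfl
  rw [Finset.sum_congr rfl fun i _ => h1 i, Finset.sum_const_zero, add_zero, h2, sign_finRotate,
    ← add_smul]
  have : (((-1 : ℤˣ) ^ (k + 1 - 1) : ℤˣ) : ℤ) = (-1) ^ k := by simp
  rw [this]
  push_cast
  rw [pow_succ, mul_neg_one, add_neg_cancel, zero_smul]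
  rfl

/-- For an antisymmetric `Φ`, moving the inserted cochain by one argument changes the
antisymmetrisation of a partial composition by a sign. -/
theorem altSum_insertAt_succ {m n p : ℕ} (h : m + n = p + 1) {Φ : Cochain A m} (hΦ : IsAlt Φ)
    (Ψ : Cochain A n) {i : ℕ} (hi : i + 1 < m) (f : Fin p → A) :
    altSum (insertAt h ⟨i + 1, hi⟩ Φ Ψ) f =
      (-1 : ℝ) ^ (n + 1) • altSum (insertAt h ⟨i, by omega⟩ Φ Ψ) f := by
  have hp : 0 < p := by omega
  have : NeZero p := ⟨hp.ne'⟩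
  set a : Fin p := ⟨i, by omega⟩ with ha
  set b : Fin p := ⟨i + n, by omega⟩ with hb
  have hab : a ≤ b := by simp [a, b, Fin.le_def]
  -- The cycle which moves an argument across the block of `n` arguments of `Ψ`; its sign is
  -- `(-1)^n`, and exchanging two neighbouring arguments of `Φ` gives one more sign.
  set c := Fin.cycleIcc a b with hc
  have hval : ∀ k : Fin p, ((c k : Fin p) : ℕ) =
      if (k : ℕ) < i then (k : ℕ) else if (k : ℕ) < i + n then (k : ℕ) + 1 else
        if (k : ℕ) = i + n then i else (k : ℕ) := by
    intro k
    by_cases h1 : (k : ℕ) < i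
    · rw [if_pos h1, hc, Fin.cycleIcc_of_lt (by simpa [a, Fin.lt_def] using h1)]
    · rw [if_neg h1]
      by_cases h2 : (k : ℕ) < i + n
      · rw [if_pos h2, hc, Fin.cycleIcc_of_ge_of_lt (by simpa [a, Fin.le_def] using h1)
          (by simpa [b, Fin.lt_def] using h2)]
        rw [Fin.val_add_one_of_lt']
        omega
      · rw [if_neg h2]
        by_cases h3 : (k : ℕ) = i + n
        · rw [if_pos h3, hc, show k = b from Fin.ext h3, Fin.cycleIcc_of_last hab]
        · rw [if_neg h3, hc, Fin.cycleIcc_of_gt]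
          simp only [b, Fin.lt_def]; omega
  have key : ∀ g : Fin p → A, insertAt h ⟨i + 1, hi⟩ Φ Ψ g =
      -(insertAt h ⟨i, by omega⟩ Φ Ψ (g ∘ c)) := by
    intro g
    have hne : (⟨i, by omega⟩ : Fin m) ≠ ⟨i + 1, hi⟩ := by simp
    have h1 := hΦ (Equiv.swap ⟨i, by omega⟩ ⟨i + 1, hi⟩) (insertArgs h ⟨i + 1, hi⟩ Ψ g)
    rw [Equiv.Perm.sign_swap hne] at h1
    have h2 : insertArgs h ⟨i + 1, hi⟩ Ψ g ∘ Equiv.swap ⟨i, by omega⟩ ⟨i + 1, hi⟩ =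
        insertArgs h ⟨i, by omega⟩ Ψ (g ∘ c) := by
      funext j
      rw [Function.comp_apply, Equiv.swap_apply_def]
      by_cases h3 : (j : ℕ) = i
      · have h3' : j = ⟨i, by omega⟩ := Fin.ext h3
        simp only [insertArgs, h3', if_true, lt_irrefl, dif_neg, not_false_iff, dif_pos]
        congr 1
        funext t
        rw [Function.comp_apply]
        congr 1
        ext
        rw [hval]
        simp only
        rw [if_neg (by omega), if_pos (by omega)]
        omega
      · by_cases h4 : (j : ℕ) = i + 1
        · have h4' : j = ⟨i + 1, hi⟩ := Fin.ext h4
          subst h4'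
          rw [if_neg (by simp), if_pos rfl]
          simp only [insertArgs, Fin.lt_def]
          rw [dif_pos (by omega), dif_neg (by omega), dif_neg (by simp), Function.comp_apply]
          congr 1
          ext
          rw [hval]
          simp only
          rw [if_neg (by omega), if_neg (by omega), if_pos (by omega)]
        · rw [if_neg (fun h => h3 (congrArg Fin.val h)), if_neg (fun h => h4 (congrArg Fin.val h))]
          simp only [insertArgs, Fin.lt_def, Fin.ext_iff]
          by_cases h5 : (j : ℕ) < i
          · rw [dif_pos (by omega), dif_pos h5, Function.comp_apply]
            congr 1
            ext
            rw [hval, if_pos h5]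
          · rw [dif_neg (by omega), dif_neg h4, dif_neg h5, dif_neg h3, Function.comp_apply]
            congr 1
            ext
            rw [hval]
            simp only
            rw [if_neg (by omega), if_neg (by omega), if_neg (by omega)]
    rw [h2] at h1
    rw [insertAt_apply, insertAt_apply, h1]
    simp
  have e : (insertAt h ⟨i + 1, hi⟩ Φ Ψ : (Fin p → A) → A) =
      fun g => (-1 : ℝ) • (fun g => insertAt h ⟨i, by omega⟩ Φ Ψ (g ∘ c)) g := by
    funext g
    rw [key, neg_one_smul]
  rw [e, altSum_smul, altSum_comp (insertAt h ⟨i, by omega⟩ Φ Ψ) c, hc, Fin.sign_cycleIcc_of_le hab,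
    smul_smul]
  congr 1
  simp only [a, b, Nat.add_sub_cancel_left]
  have : (((-1 : ℤˣ) ^ n : ℤˣ) : ℤ) = (-1) ^ n := by simp
  rw [this]
  push_cast
  ring

theorem altSum_insertAt {m n p : ℕ} (h : m + n = p + 1) {Φ : Cochain A m} (hΦ : IsAlt Φ)
    (Ψ : Cochain A n) {i : ℕ} (hi : i < m) (f : Fin p → A) :
    altSum (insertAt h ⟨i, hi⟩ Φ Ψ) f =
      (-1 : ℝ) ^ ((n + 1) * i) • altSum (insertAt h ⟨0, by omega⟩ Φ Ψ) f := by
  induction i with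
  | zero => simp
  | succ i ih =>
    rw [altSum_insertAt_succ h hΦ, ih (by omega), smul_smul, ← pow_add]
    congr 2
    ring

/-- The antisymmetrisation of the Gerstenhaber composition of antisymmetric cochains is the
composition over shuffles. -/
theorem altSum_circ {m n p : ℕ} (h : m + n = p + 1) {Φ : Cochain A m} (hΦ : IsAlt Φ)
    (Ψ : Cochain A n) (f : Fin p → A) :
    altSum (circ h Φ Ψ) f = (m.factorial * n.factorial : ℝ) • shuffleComp h Φ Ψ f := by
  have e : (circ h Φ Ψ : (Fin p → A) → A) =
      fun f => ∑ i : Fin m, (fun f => (-1 : ℝ) ^ ((n + 1) * (i : ℕ)) • insertAt h i Φ Ψ f) f := by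
    funext f
    simp only [circ, _root_.sum_apply, _root_.smul_apply]
  rw [e, altSum_sum, shuffleComp]
  split_ifs with hm
  · have : ∀ i : Fin m, altSum (fun f => (-1 : ℝ) ^ ((n + 1) * (i : ℕ)) • insertAt h i Φ Ψ f) f =
        altSum (insertAt h ⟨0, hm⟩ Φ Ψ) f := fun i => by
      rw [altSum_smul, altSum_insertAt h hΦ Ψ i.2, smul_smul, ← mul_pow]
      simp
    rw [Finset.sum_congr rfl fun i _ => this i, Finset.sum_const, Finset.card_univ,
      Fintype.card_fin, ← Nat.cast_smul_eq_nsmul ℝ, smul_smul]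
    change _ = _ • altSum (insertAt h ⟨0, hm⟩ Φ Ψ) f
    congr 1
    obtain ⟨m, rfl⟩ : ∃ m', m = m' + 1 := ⟨m - 1, by omega⟩
    have h1 : (n.factorial : ℝ) ≠ 0 := by positivity
    have h2 : (m.factorial : ℝ) ≠ 0 := by positivity
    simp only [Nat.add_sub_cancel, Nat.factorial_succ]
    push_cast
    field_simp
  · obtain rfl : m = 0 := by omega
    simp

/-- Inserting a constant into an antisymmetrised cochain. -/
theorem altC_circ_zero {k : ℕ} (φ : Cochain A (k + 1)) (a : Cochain A 0) (f : Fin k → A) :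
    altC (circ (m := k + 1) (n := 0) (p := k) rfl φ a) f = altC φ (Fin.cons (a Fin.elim0) f) := by
  set x := a Fin.elim0 with hx
  have hax : ∀ g, a g = x := fun g => congrArg a (Subsingleton.elim _ _)
  have e : (circ (m := k + 1) (n := 0) (p := k) rfl φ a : (Fin k → A) → A) =
      fun f => ∑ i : Fin (k + 1), (fun f => (-1 : ℝ) ^ (i : ℕ) • φ (i.insertNth x f)) f := by
    funext f
    simp only [circ, _root_.sum_apply, _root_.smul_apply, Nat.zero_add, one_mul]
    refine Finset.sum_congr rfl fun i _ => ?_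
    congr 1
    rw [insertAt_apply]
    congr 1
    funext j
    simp only [insertArgs, hax]
    rcases lt_trichotomy j i with hlt | rfl | hgt
    · rw [dif_pos hlt, Fin.insertNth_apply_below hlt, eq_rec_constant]
      rfl
    · simp
    · rw [dif_neg (not_lt.2 hgt.le), dif_neg hgt.ne', Fin.insertNth_apply_above hgt,
        eq_rec_constant]
      rfl
  rw [altC_apply, altC_apply, e, altSum_sum]
  -- A permutation of `k + 1` arguments is given by the position `i` of the first argument and a
  -- permutation of the others.
  let D : Fin (k + 1) × Equiv.Perm (Fin k) → Equiv.Perm (Fin (k + 1)) := fun q =>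
    Equiv.Perm.decomposeFin.symm (0, q.2) * Fin.cycleRange q.1
  have hD0 : ∀ q, D q q.1 = 0 := fun q => by simp [D]
  have hD : Function.Bijective D := by
    rw [Fintype.bijective_iff_injective_and_card]
    refine ⟨fun q r hqr => ?_, by simp [Fintype.card_perm, Nat.factorial_succ]⟩
    have h1 : q.1 = r.1 := (D r).injective (by rw [← hqr, hD0, hqr, hD0])
    refine Prod.ext h1 ?_
    simp only [D, h1, mul_left_inj] at hqr
    exact (Prod.mk.inj (Equiv.Perm.decomposeFin.symm.injective hqr)).2
  unfold altSum
  rw [← hD.sum_comp, Fintype.sum_prod_type]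
  refine Finset.sum_congr rfl fun i _ => Finset.sum_congr rfl fun τ _ => ?_
  have e1 : Fin.cons x f ∘ D (i, τ) = i.insertNth x (f ∘ τ) := by
    rw [← Fin.cons_comp_cycleRange]
    funext j
    simp only [D, Function.comp_apply, Equiv.Perm.coe_mul]
    generalize Fin.cycleRange i j = l
    cases l using Fin.cases <;> simp
  have e2 : Equiv.Perm.sign (D (i, τ)) = Equiv.Perm.sign τ * (-1) ^ (i : ℕ) := by
    simp [D, Equiv.Perm.sign_mul]
  rw [e1, e2, smul_smul]
  push_cast
  rfl

end Alternation

/-! ### The Hochschild-Kostant-Rosenberg theorem for algebras with coordinates -/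

section Weyl

variable {V T : Type*} [AddCommGroup V] [Module ℝ V]

/-- `v` is annihilated by all products of `d + 1` of the operators `ad a`. -/
def TotOrd (ad : T → V →ₗ[ℝ] V) : ℕ → V → Prop
  | 0, v => ∀ a, ad a v = 0
  | d + 1, v => ∀ a, TotOrd ad d (ad a v)

variable [Fintype T] [DecidableEq T] (ad D : T → V →ₗ[ℝ] V)

/-- In a representation of the Weyl algebra, the Euler operator `∑ D_b ad_b` acts on the vectors of
filtration degree `d + 1` as multiplication by `d + 1`, up to vectors of lower degree. -/
theorem totOrd_euler_sub (hcomm : ∀ a b v, ad a (ad b v) = ad b (ad a v))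
    (hweyl : ∀ a b v, ad a (D b v) = D b (ad a v) + if a = b then v else 0) (d : ℕ) (v : V)
    (hv : TotOrd ad (d + 1) v) :
    TotOrd ad d ((∑ b, D b (ad b v)) - (d + 1 : ℝ) • v) := by
  have key : ∀ a v, ad a (∑ b, D b (ad b v)) = (∑ b, D b (ad b (ad a v))) + ad a v := by
    intro a v
    simp only [map_sum, hweyl, Finset.sum_add_distrib, Finset.sum_ite_eq, Finset.mem_univ, if_true,
      hcomm a]
  induction d generalizing v with
  | zero =>
    intro a
    have h0 : ∀ b, ad b (ad a v) = 0 := fun b => hv a b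
    simp [key, h0]
  | succ d ih =>
    intro a
    have h := ih (ad a v) (hv a)
    have e : ad a ((∑ b, D b (ad b v)) - ((d + 1 : ℕ) + 1 : ℝ) • v) =
        (∑ b, D b (ad b (ad a v))) - (d + 1 : ℝ) • ad a v := by
      rw [map_sub, key, map_smul]
      push_cast
      module
    rw [e]
    exact h

end Weyl

section Slots

variable {A : Type*} [CommRing A] [Algebra ℝ A] {S : Set A}

/-- The cochain `f ↦ φ(f₀, …, L f_s, …, f_{k-1})`. -/
def slot {k : ℕ} (L : A →ₗ[ℝ] A) (s : Fin k) : Cochain A k →ₗ[ℝ] Cochain A k where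
  toFun φ := φ.compLinearMap (Function.update (fun _ => LinearMap.id) s L)
  map_add' _ _ := rfl
  map_smul' _ _ := rfl

theorem slot_apply {k : ℕ} (L : A →ₗ[ℝ] A) (s : Fin k) (φ : Cochain A k) (f : Fin k → A) :
    slot L s φ f = φ (Function.update f s (L (f s))) := by
  change φ _ = φ _
  congr 1
  funext i
  rcases eq_or_ne i s with rfl | h
  · simp
  · simp [h]

theorem slot_slot_of_ne {k : ℕ} (L L' : A →ₗ[ℝ] A) {s t : Fin k} (h : s ≠ t) (φ : Cochain A k) :
    slot L s (slot L' t φ) = slot L' t (slot L s φ) := by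
  ext f
  simp only [slot_apply, Function.update_of_ne h, Function.update_of_ne h.symm]
  rw [Function.update_comm h]

theorem slot_slot_self {k : ℕ} (L L' : A →ₗ[ℝ] A) (s : Fin k) (φ : Cochain A k) :
    slot L s (slot L' s φ) = slot (L' ∘ₗ L) s φ := by
  ext f
  simp [slot_apply]

theorem slot_add_left {k : ℕ} (L L' : A →ₗ[ℝ] A) (s : Fin k) (φ : Cochain A k) :
    slot (L + L') s φ = slot L s φ + slot L' s φ := by
  ext f
  simp [slot_apply]

theorem slot_id {k : ℕ} (s : Fin k) (φ : Cochain A k) : slot LinearMap.id s φ = φ := by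
  ext f
  simp [slot_apply]

theorem slot_zero_left {k : ℕ} (s : Fin k) (φ : Cochain A k) : slot 0 s φ = 0 := by
  ext f
  simp only [slot_apply, LinearMap.zero_apply]
  exact φ.map_coord_zero s (by simp)

/-- Multiplication of the values of a cochain by `a`. -/
def mulC {k : ℕ} (a : A) : Cochain A k →ₗ[ℝ] Cochain A k where
  toFun φ := (LinearMap.mulLeft ℝ a).compMultilinearMap φ
  map_add' φ ψ := by ext; simp
  map_smul' c φ := by ext; simp

@[simp] theorem mulC_apply {k : ℕ} (a : A) (φ : Cochain A k) (f : Fin k → A) :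
    mulC a φ f = a * φ f := rfl

theorem slot_mulC {k : ℕ} (L : A →ₗ[ℝ] A) (s : Fin k) (a : A) (φ : Cochain A k) :
    slot L s (mulC a φ) = mulC a (slot L s φ) := by
  ext f
  simp [slot_apply]

/-- The commutator of `φ`, as an operator in the argument `s`, with the multiplication by `a`. -/
def adSlot {k : ℕ} (a : A) (s : Fin k) : Cochain A k →ₗ[ℝ] Cochain A k :=
  slot (LinearMap.mulLeft ℝ a) s - mulC a

theorem adSlot_apply {k : ℕ} (a : A) (s : Fin k) (φ : Cochain A k) :
    adSlot a s φ = slot (LinearMap.mulLeft ℝ a) s φ - mulC a φ := rfl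

theorem adSlot_comm {k : ℕ} (a b : A) (s t : Fin k) (φ : Cochain A k) :
    adSlot a s (adSlot b t φ) = adSlot b t (adSlot a s φ) := by
  simp only [adSlot_apply, map_sub, slot_mulC]
  have h1 : slot (LinearMap.mulLeft ℝ a) s (slot (LinearMap.mulLeft ℝ b) t φ) =
      slot (LinearMap.mulLeft ℝ b) t (slot (LinearMap.mulLeft ℝ a) s φ) := by
    rcases eq_or_ne s t with rfl | h
    · rw [slot_slot_self, slot_slot_self]
      congr 2
      ext x
      simp [mul_left_comm]
    · exact slot_slot_of_ne _ _ h φ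
  have h2 : mulC a (mulC b φ) = mulC b (mulC a φ) := by
    ext f
    simp [mul_left_comm]
  rw [h1, h2]
  abel

/-- A cochain of order `≤ R i` in the argument `i` has total order `≤ ∑ i, R i`. -/
theorem totOrd_adSlot {ι : Type*} (x : ι → A) {k : ℕ} (R : Fin k → ℕ) (φ : Cochain A k)
    (h : ∀ (i : Fin k) (f : Fin k → A), IsDiffOp (R i) (φ.toLinearMap f i)) :
    TotOrd (fun a : Fin k × ι => adSlot (x a.2) a.1) (∑ i, R i) φ := by
  have zero : ∀ d, TotOrd (fun a : Fin k × ι => adSlot (x a.2) a.1) d (0 : Cochain A k) := by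
    intro d
    induction d with
    | zero => exact fun a => map_zero _
    | succ d ih =>
      intro a
      rw [map_zero]
      exact ih
  have hself : ∀ (s : Fin k) (j : ι) (ψ : Cochain A k) (f : Fin k → A),
      (adSlot (x j) s ψ).toLinearMap f s = ψ.toLinearMap f s ∘ₗ LinearMap.mulLeft ℝ (x j) -
        LinearMap.mulLeft ℝ (x j) ∘ₗ ψ.toLinearMap f s := by
    intro s j ψ f
    ext y
    simp [adSlot_apply, slot_apply]
  induction hd : ∑ i, R i generalizing R φ with
  | zero =>
    rintro ⟨s, j⟩
    have hR : R s = 0 := by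
      have := Finset.single_le_sum (f := R) (fun _ _ => Nat.zero_le _) (Finset.mem_univ s)
      omega
    ext f
    have h1 := hself s j φ f
    have h2 := h s f
    rw [hR] at h2
    rw [h2 (x j)] at h1
    have h3 := LinearMap.congr_fun h1 (f s)
    simpa using h3
  | succ d ih =>
    rintro ⟨s, j⟩
    cases hR : R s with
    | zero =>
      have : adSlot (x j) s φ = 0 := by
        ext f
        have h1 := hself s j φ f
        have h2 := h s f
        rw [hR] at h2
        rw [h2 (x j)] at h1
        have h3 := LinearMap.congr_fun h1 (f s)
        simpa using h3
      change TotOrd _ d (adSlot (x j) s φ)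
      rw [this]
      exact zero d
    | succ r =>
      refine ih (Function.update R s r) _ (fun i f => ?_) ?_
      · rcases eq_or_ne i s with rfl | hi
        · rw [Function.update_self]
          change IsDiffOp r ((adSlot (x j) i φ).toLinearMap f i)
          rw [hself]
          have := h i f
          rw [hR] at this
          exact this (x j)
        · rw [Function.update_of_ne hi]
          have e : (adSlot (x j) s φ).toLinearMap f i =
              φ.toLinearMap (Function.update f s (x j * f s)) i +
                (-1 : ℝ) • (LinearMap.mulLeft ℝ (x j) ∘ₗ φ.toLinearMap f i) := by
            ext y
            simp [adSlot_apply, slot_apply, Function.update_of_ne hi.symm,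
              Function.update_comm hi, sub_eq_add_neg]
          change IsDiffOp (R i) ((adSlot (x j) s φ).toLinearMap f i)
          rw [e]
          exact (h i _).add ((((IsDiffOp.mulLeft (x j)).comp (h i f)).mono (by omega)).smul _)
      · have h1 := Finset.sum_update_of_mem (Finset.mem_univ s) R r
        have h2 := Finset.add_sum_erase Finset.univ R (Finset.mem_univ s)
        rw [← Finset.erase_eq] at h1
        omega

end Slots

section LocalHKR

/-- Coordinates on a commutative algebra `B` relative to a set `S` of scalars: functions `x j`,
the coordinate derivations `d j`, which kill `S`, and the property that a differential operator
which commutes with `S` and the coordinates is a multiplication operator. The model is the algebra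
of functions on `U × ℝⁿ`, with `S` the functions on `U`. -/
structure LocalCoords (B : Type*) [CommRing B] [Algebra ℝ B] (S : Set B) where
  n : ℕ
  x : Fin n → B
  d : Fin n → B →ₗ[ℝ] B
  leibniz : ∀ j a b, d j (a * b) = a * d j b + b * d j a
  d_scalar : ∀ j, ∀ s ∈ S, d j s = 0
  d_x : ∀ i j, d i (x j) = if i = j then 1 else 0
  eq_mul_one : ∀ (N : ℕ) (D : B →ₗ[ℝ] B), IsDiffOp N D → (∀ s ∈ S, ∀ f, D (s * f) = s * D f) →
    (∀ j f, D (x j * f) = x j * D f) → ∀ f, D f = f * D 1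

variable {B : Type*} [CommRing B] [Algebra ℝ B] {S : Set B}

/-- The element `a` as a cochain of degree zero. -/
def constC (a : B) : Cochain B 0 := MultilinearMap.constOfIsEmpty ℝ _ a

/-- A linear map as a cochain of degree one. -/
def linC (L : B →ₗ[ℝ] B) : Cochain B 1 := MultilinearMap.ofSubsingleton ℝ B B 0 L

@[simp] theorem constC_apply (a : B) (f : Fin 0 → B) : constC a f = a := rfl

@[simp] theorem linC_apply (L : B →ₗ[ℝ] B) (f : Fin 1 → B) : linC L f = L (f 0) := rfl

theorem constC_mem (a : B) : constC a ∈ ordCochain S 0 0 := ⟨fun i => i.elim0, fun _ _ i => i.elim0⟩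

theorem hochschildD_constC (a : B) : hochschildD (constC a) = 0 :=
  IsMultiDerivation.hochschildD_eq_zero fun _ i => i.elim0

theorem IsMultiDerivation.isDiffOp {k : ℕ} {φ : Cochain B k} (h : IsMultiDerivation φ) (i : Fin k)
    (f : Fin k → B) : IsDiffOp 1 (φ.toLinearMap f i) := by
  intro a
  have : φ.toLinearMap f i ∘ₗ LinearMap.mulLeft ℝ a - LinearMap.mulLeft ℝ a ∘ₗ φ.toLinearMap f i =
      LinearMap.mulLeft ℝ (φ (Function.update f i a)) := by
    ext x
    simp only [LinearMap.sub_apply, LinearMap.comp_apply, LinearMap.mulLeft_apply,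
      MultilinearMap.toLinearMap_apply, h f i a x]
    ring
  rw [this]
  exact IsDiffOp.mulLeft _

theorem IsMultiDerivation.add {k : ℕ} {φ ψ : Cochain B k} (h : IsMultiDerivation φ)
    (h' : IsMultiDerivation ψ) : IsMultiDerivation (φ + ψ) := fun f i a b => by
  simp only [_root_.add_apply, h f i a b, h' f i a b]
  ring

theorem IsMultiDerivation.smul {k : ℕ} {φ : Cochain B k} (c : ℝ) (h : IsMultiDerivation φ) :
    IsMultiDerivation (c • φ) := fun f i a b => by
  simp only [_root_.smul_apply, h f i a b, smul_add, mul_smul_comm]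

theorem IsMultiDerivation.zero {k : ℕ} : IsMultiDerivation (0 : Cochain B k) := fun f i a b => by
  simp

theorem IsMultiDerivation.sum {k : ℕ} {ι : Type*} (s : Finset ι) {φ : ι → Cochain B k}
    (h : ∀ i ∈ s, IsMultiDerivation (φ i)) : IsMultiDerivation (∑ i ∈ s, φ i) :=
  Finset.sum_induction _ _ (fun _ _ h h' => h.add h') .zero h

theorem IsMultiDerivation.domDomCongr {k : ℕ} {φ : Cochain B k} (h : IsMultiDerivation φ)
    (σ : Equiv.Perm (Fin k)) : IsMultiDerivation (φ.domDomCongr σ) := fun f i a b => by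
  have e : ∀ c, (φ.domDomCongr σ) (Function.update f i c) =
      φ (Function.update (fun j => f (σ j)) (σ.symm i) c) := fun c => by
    rw [MultilinearMap.domDomCongr_apply]
    congr 1
    funext j
    simp only [Function.update_apply, Equiv.eq_symm_apply]
  simp only [e, h _ _ a b]

theorem IsMultiDerivation.altC {k : ℕ} {φ : Cochain B k} (h : IsMultiDerivation φ) :
    IsMultiDerivation (altC φ) :=
  .sum _ fun σ _ => (h.domDomCongr σ).smul _

theorem IsLinearOver.altC {k : ℕ} {φ : Cochain B k} (h : IsLinearOver S φ) :
    IsLinearOver S (altC φ) := fun s hs i f => by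
  simp only [VerticalHKR.altC, _root_.sum_apply, _root_.smul_apply, Finset.mul_sum]
  refine Finset.sum_congr rfl fun σ _ => ?_
  rw [mul_smul_comm, MultilinearMap.domDomCongr_apply, MultilinearMap.domDomCongr_apply,
    ← h s hs (σ.symm i)]
  congr 2
  funext j
  simp only [Function.update_apply, Equiv.eq_symm_apply, Equiv.apply_symm_apply]

theorem IsMultiDerivation.mem_ordCochain {k : ℕ} {φ : Cochain B k} (h : IsMultiDerivation φ)
    (hS : IsLinearOver S φ) : φ ∈ ordCochain S 1 k := ⟨h.isDiffOp, hS⟩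

theorem IsMultiDerivation.cup {m n p : ℕ} (hp : m + n = p) {φ : Cochain B m} {ψ : Cochain B n}
    (h : IsMultiDerivation φ) (h' : IsMultiDerivation ψ) :
    IsMultiDerivation (cup hp φ ψ) := fun f i a b => by
  rcases cup_update hp φ ψ f i with ⟨t, -, ht⟩ | ⟨t, -, ht⟩
  · simp only [ht, h _ t a b]
    ring
  · simp only [ht, h' _ t a b]
    ring

theorem altC_of_mem_ordBd {N k : ℕ} {φ : Cochain B k} (h : φ ∈ ordBd S N k) : altC φ = 0 := by
  cases k with
  | zero =>
    rw [(Submodule.mem_bot ℝ).1 h]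
    ext f
    simp [altC]
  | succ k =>
    obtain ⟨ψ, -, rfl⟩ := h
    exact altC_hochschildD ψ

/-- A cocycle which is linear over the algebra in its first argument is a coboundary. -/
theorem mem_ordBd_of_linear {N k : ℕ} {φ : Cochain B (k + 1)} (hN : φ ∈ ordCochain S N (k + 1))
    (hφ : hochschildD φ = 0)
    (h0 : ∀ (f : Fin (k + 1) → B) (a : B),
      φ (Function.update f 0 a) = a * φ (Function.update f 0 1)) :
    φ ∈ ordBd S N (k + 1) := by
  -- The primitive is `φ(1, f₁, …, f_k)`; by linearity in the first argument `δφ(1, f₀, …, f_k) = 0`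
  -- is the claim.
  set ψ : Cochain B k := insertAt (m := k + 1) (n := 0) (p := k) rfl 0 φ (constC 1) with hψ
  have hψm : ψ ∈ ordCochain S (N + 0) k := insertAt_mem_ord _ _ hN (constC_mem 1)
  have hval : ∀ F : ℕ → B, onSeq ψ F = onSeq φ (insSeq 0 0 1 F) := fun F =>
    onSeq_insertAt (m := k + 1) (n := 0) (p := k) rfl 0 φ (constC 1) F
  have hlin : ∀ (a : B) (F : ℕ → B), onSeq φ (insSeq 0 0 a F) = a * onSeq φ (insSeq 0 0 1 F) := by
    intro a F
    have e : ∀ a, onSeq φ (insSeq 0 0 a F) =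
        φ (Function.update (fun i : Fin (k + 1) => insSeq 0 0 0 F i) 0 a) := fun a => by
      unfold onSeq
      congr 1
      funext i
      refine Fin.cases ?_ (fun i => ?_) i
      · simp [insSeq]
      · rw [Function.update_of_ne (Fin.succ_ne_zero i)]
        simp [insSeq]
    rw [e, e, h0]
  have hF : ∀ F : ℕ → B, insSeq 0 0 (F 0) (fun u => F (u + 1)) = F := fun F => by
    funext u
    cases u <;> simp [insSeq]
  have : φ = hochschildD ψ := ext_onSeq fun F => by
    have h1 : dSeq (k + 1) (onSeq φ) (insSeq 0 0 1 F) = 0 := by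
      rw [← onSeq_hochschildD, hφ, onSeq_zero]
    have hf : ∀ i, face (k + 1) (i + 1 + 1) (onSeq φ) (insSeq 0 0 1 F) =
        face k (i + 1) (onSeq ψ) F := by
      intro i
      simp only [face, Nat.add_eq_zero_iff, one_ne_zero, and_false, if_false,
        Nat.add_le_add_iff_right, hval, Nat.add_sub_cancel]
      split_ifs
      · congr 1
        funext u
        simp only [insSeq]
        rcases Nat.eq_zero_or_pos u with rfl | hu
        · simp
        · simp only [show ¬ u = 0 by omega, if_false, Nat.not_lt_zero]
          rcases lt_trichotomy u (i + 1) with h | rfl | h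
          · rw [if_pos h, if_pos (by omega)]
          · simp
          · rw [if_neg (by omega), if_neg (by omega), if_neg (by omega), if_neg (by omega),
              if_neg (by omega)]
            congr 1; omega
      · congr 1
    have hf0 : face (k + 1) 0 (onSeq φ) (insSeq 0 0 1 F) = onSeq φ F := by
      simp [face, insSeq]
    have hf1 : face (k + 1) 1 (onSeq φ) (insSeq 0 0 1 F) = onSeq φ F := by
      simp only [face, one_ne_zero, if_false, Nat.le_add_left, if_true]
      congr 1
      funext u
      cases u <;> simp [insSeq]
    have hg0 : face k 0 (onSeq ψ) F = onSeq φ F := by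
      simp only [face, if_true, hval]
      rw [← hlin, hF]
    rw [onSeq_hochschildD]
    unfold dSeq at h1 ⊢
    rw [Finset.sum_range_succ', Finset.sum_range_succ', hf0, hf1] at h1
    rw [Finset.sum_range_succ', hg0]
    simp only [hf] at h1
    have e : ∀ i, (-1 : ℝ) ^ (i + 1 + 1) = (-1) * (-1 : ℝ) ^ (i + 1) := fun i => by ring
    simp only [e, mul_smul, ← Finset.smul_sum] at h1
    simp only [zero_add, pow_one, pow_zero, one_smul, neg_smul] at h1 ⊢
    linear_combination h1
  rw [this]
  exact hochschildD_mem_ordBd hψm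

/-- Inserting an element of the algebra maps cocycles to cocycles, since the algebra is commutative.
-/
theorem hochschildD_circ_constC {k : ℕ} {φ : Cochain B (k + 1)} (hφ : hochschildD φ = 0) (a : B) :
    hochschildD (circ (m := k + 1) (n := 0) (p := k) rfl φ (constC a)) = 0 := by
  refine ext_onSeq fun F => ?_
  have h := dSeq_circF φ (constC a) F
  have e1 : dSeq (k + 1) (onSeq φ) = fun _ => 0 := funext fun F => by
    rw [← onSeq_hochschildD, hφ, onSeq_zero]
  have e2 : dSeq 0 (onSeq (constC a)) = fun _ => 0 := funext fun F => by
    rw [← onSeq_hochschildD, hochschildD_constC, onSeq_zero]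
  rw [e1, e2, circF_zero_left, circF_zero_right] at h
  rw [onSeq_hochschildD, onSeq_zero]
  have e3 : onSeq (circ (m := k + 1) (n := 0) (p := k) rfl φ (constC a)) =
      circF (k + 1) 0 (onSeq φ) (onSeq (constC a)) := funext fun G => onSeq_circ ..
  rw [e3]
  refine Eq.trans h ?_
  simp [onSeq, mul_comm]

theorem circ_constC_mem {k N : ℕ} {β : Cochain B (k + 1)} (h : β ∈ ordCochain S N (k + 1))
    (a : B) : circ (m := k + 1) (n := 0) (p := k) rfl β (constC a) ∈ ordCochain S N k :=
  circ_mem_ord (N := 0) _ h (constC_mem a)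

theorem slot_mem_ord {k N r : ℕ} {L : B →ₗ[ℝ] B} (hL : IsDiffOp r L)
    (hS : ∀ c ∈ S, ∀ a, L (c * a) = c * L a) (s : Fin k) {φ : Cochain B k}
    (hφ : φ ∈ ordCochain S N k) : slot L s φ ∈ ordCochain S (N + r) k := by
  refine ⟨fun i f => ?_, fun c hc i f => ?_⟩
  · rcases eq_or_ne i s with rfl | hi
    · have e : (slot L i φ).toLinearMap f i = φ.toLinearMap f i ∘ₗ L := by
        ext y
        simp [slot_apply]
      rw [e]
      exact (hφ.1 i f).comp hL
    · have e : (slot L s φ).toLinearMap f i =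
          φ.toLinearMap (Function.update f s (L (f s))) i := by
        ext y
        simp [slot_apply, Function.update_of_ne hi.symm, Function.update_comm hi]
      rw [e]
      exact (hφ.1 i _).mono (by omega)
  · rcases eq_or_ne i s with rfl | hi
    · have := hφ.2 c hc i (Function.update f i (L (f i)))
      simp only [Function.update_self, Function.update_idem] at this
      simp only [slot_apply, Function.update_self, Function.update_idem, hS c hc, this]
    · have := hφ.2 c hc i (Function.update f s (L (f s)))
      rw [Function.update_of_ne hi] at this
      simp only [slot_apply, Function.update_of_ne hi.symm]
      rw [Function.update_comm hi, this]

theorem adSlot_mem_ord {k N : ℕ} (a : B) (s : Fin k) {φ : Cochain B k}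
    (hφ : φ ∈ ordCochain S N k) : adSlot a s φ ∈ ordCochain S N k := by
  refine sub_mem (slot_mem_ord (IsDiffOp.mulLeft a) (fun c _ b => ?_) s hφ) ⟨fun i f => ?_, ?_⟩
  · simp [mul_left_comm]
  · exact ((IsDiffOp.mulLeft a).comp (hφ.1 i f)).mono (by omega)
  · intro c hc i f
    rw [mulC_apply, mulC_apply, hφ.2 c hc, mul_left_comm]

namespace LocalCoords

variable (L : LocalCoords B S)

theorem isMultiDerivation_linC (j : Fin L.n) : IsMultiDerivation (linC (L.d j)) := by
  intro f i a b
  obtain rfl : i = 0 := Subsingleton.elim _ _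
  simp [L.leibniz]

theorem linC_mem (j : Fin L.n) : linC (L.d j) ∈ ordCochain S 1 1 :=
  (L.isMultiDerivation_linC j).mem_ordCochain fun s hs i f => by
    obtain rfl : i = 0 := Subsingleton.elim _ _
    simp [L.leibniz, L.d_scalar j s hs]

/-- A derivation that kills the scalars is determined by its values on the coordinates. -/
theorem derivation_eq_sum {D : B →ₗ[ℝ] B} (hD : ∀ a b, D (a * b) = a * D b + b * D a)
    (hS : ∀ s ∈ S, D s = 0) (f : B) : D f = ∑ j, L.d j f * D (L.x j) := by
  -- The difference of both sides commutes with the coordinates, hence is the multiplication by its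
  -- value at `1`, which is zero.
  set D' : B →ₗ[ℝ] B := D - ∑ j, LinearMap.mulRight ℝ (D (L.x j)) ∘ₗ L.d j with hD'
  have hval : ∀ f, D' f = D f - ∑ j, L.d j f * D (L.x j) := fun f => by
    simp [hD', LinearMap.sum_apply]
  have hder : ∀ a b, D' (a * b) = a * D' b + b * D' a := fun a b => by
    simp only [hval, hD, L.leibniz, add_mul, Finset.sum_add_distrib, mul_sub, Finset.mul_sum,
      mul_assoc]
    ring
  have hx : ∀ j, D' (L.x j) = 0 := fun j => by
    simp [hval, L.d_x]
  have hs : ∀ s ∈ S, D' s = 0 := fun s h => by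
    simp [hval, hS s h, L.d_scalar _ s h]
  have hord : IsDiffOp 1 D' := by
    intro a
    have : D' ∘ₗ LinearMap.mulLeft ℝ a - LinearMap.mulLeft ℝ a ∘ₗ D' =
        LinearMap.mulLeft ℝ (D' a) := by
      ext x
      simp only [LinearMap.sub_apply, LinearMap.comp_apply, LinearMap.mulLeft_apply, hder]
      ring
    rw [this]
    exact IsDiffOp.mulLeft _
  have h1 : D' 1 = 0 := by
    have := hder 1 1
    simpa using this
  have h := L.eq_mul_one 1 D' hord (fun s h f => by rw [hder, hs s h]; ring)
    (fun j f => by rw [hder, hx]; ring) f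
  rw [h1, mul_zero, hval, sub_eq_zero] at h
  exact h

/-- A multiderivation that is linear over the scalars is determined in each argument by its values
on the coordinates. -/
theorem multiDerivation_eq_sum {k : ℕ} {β : Cochain B k} (hβ : IsMultiDerivation β)
    (hS : IsLinearOver S β) (s : Fin k) (f : Fin k → B) (a : B) :
    β (Function.update f s a) = ∑ j, L.d j a * β (Function.update f s (L.x j)) := by
  refine L.derivation_eq_sum (D := β.toLinearMap f s) (fun a b => hβ f s a b) (fun c hc => ?_) a
  have h1 := hβ f s 1 1
  have h2 := hS c hc s (Function.update f s 1)
  simp only [mul_one, one_mul] at h1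
  rw [left_eq_add] at h1
  rw [Function.update_idem, Function.update_self, mul_one, h1, mul_zero] at h2
  exact h2

/-- The operator `∑_{s, j} D_{s, j} ad_{s, j}`, where `ad_{s, j}` is the commutator with the
coordinate `x j` and `D_{s, j}` the insertion of the derivation `d j` in the argument `s`. -/
def euler {k : ℕ} (φ : Cochain B k) : Cochain B k :=
  ∑ b : Fin k × Fin L.n, slot (L.d b.2) b.1 (adSlot (L.x b.2) b.1 φ)

/-- On cochains of total order `d + 1` the Euler operator is `d + 1` up to lower total order. -/
theorem totOrd_euler {k : ℕ} (d : ℕ) (φ : Cochain B k)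
    (h : TotOrd (fun a : Fin k × Fin L.n => adSlot (L.x a.2) a.1) (d + 1) φ) :
    TotOrd (fun a : Fin k × Fin L.n => adSlot (L.x a.2) a.1) d
      (L.euler φ - (d + 1 : ℝ) • φ) := by
  refine totOrd_euler_sub (fun a : Fin k × Fin L.n => adSlot (L.x a.2) a.1)
    (fun a => slot (L.d a.2) a.1) (fun a b v => adSlot_comm _ _ _ _ v) ?_ d φ h
  rintro ⟨s, i⟩ ⟨t, j⟩ v
  simp only [adSlot_apply, map_sub, slot_mulC]
  rcases eq_or_ne s t with rfl | hst
  · have e : L.d j ∘ₗ LinearMap.mulLeft ℝ (L.x i) = LinearMap.mulLeft ℝ (L.x i) ∘ₗ L.d j +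
        if i = j then LinearMap.id else 0 := by
      ext y
      rcases eq_or_ne i j with rfl | hij
      · simp [L.leibniz, L.d_x]
      · simp [L.leibniz, L.d_x, hij, hij.symm]
    rw [slot_slot_self, slot_slot_self, e, slot_add_left]
    rcases eq_or_ne i j with rfl | hij
    · simp only [if_true, slot_id]
      abel
    · simp only [hij, if_false, slot_zero_left, Prod.mk.injEq, true_and]
      abel
  · rw [slot_slot_of_ne _ _ hst]
    simp [hst]

theorem insertArgs_one {k : ℕ} (s : Fin k) (ψ : (Fin 1 → B) → B) (f : Fin k → B) :
    insertArgs (p := k) rfl s ψ f = Function.update f s (ψ fun _ => f s) := by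
  funext j
  simp only [insertArgs, Function.update_apply]
  split_ifs with h1 h2 h3 <;> first | rfl | (exact absurd h2 h1.ne) | skip
  congr 1
  funext t
  congr 1
  ext
  simp

/-- For a cocycle `φ`, the Euler operator gives `∑_j d j ∪ (φ ∘ x j)` up to a coboundary: it is
`∑_j φ ∘ (d j ∪ x j) - (φ ∘ d j) ∪ x j`, and `φ ∘ -` is a derivation of the cup product up to the
coboundary of a brace. -/
theorem euler_sub_mem {k N : ℕ} {φ : Cochain B (k + 1)} (hN : φ ∈ ordCochain S N (k + 1))
    (hφ : hochschildD φ = 0) :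
    L.euler φ - ∑ j, cup (by omega) (linC (L.d j))
        (circ (m := k + 1) (n := 0) (p := k) rfl φ (constC (L.x j))) ∈
      ordBd S (N + 1) (k + 1) := by
  have h1 : ∀ j : Fin L.n, ∃ ψ ∈ ordCochain S (N + 1) k, ∀ F, dSeq k (onSeq ψ) F =
      onSeq (circ (m := k + 1) (n := 1) (p := k + 1) rfl φ
        (cup (m := 1) (n := 0) rfl (linC (L.d j)) (constC (L.x j)))) F -
      onSeq (cup (p := k + 1) (by omega) (linC (L.d j))
        (circ (m := k + 1) (n := 0) (p := k) rfl φ (constC (L.x j)))) F -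
      L.x j * onSeq (circ (m := k + 1) (n := 1) (p := k + 1) rfl φ (linC (L.d j))) F := by
    intro j
    obtain ⟨ψ, hψ, e⟩ := exists_brace hN (L.linC_mem j) (constC_mem (S := S) (L.x j))
    refine ⟨ψ, ordCochain_mono (by omega) _ hψ, fun F => ?_⟩
    have h2 := dSeq_brace φ (linC (L.d j)) (constC (L.x j)) hφ
      (L.isMultiDerivation_linC j).hochschildD_eq_zero (hochschildD_constC _) F
    rw [← e] at h2
    simp only [onSeq_circ, onSeq_cup]
    have e1 : (-1 : ℝ) ^ (1 + 1) = 1 := by norm_num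
    rw [e1, one_smul, Nat.zero_mul, pow_zero, one_smul] at h2
    refine h2.trans ?_
    rw [mul_comm (L.x j)]
    congr 2
  choose ψ hψ hd using h1
  have h3 : L.euler φ - ∑ j, cup (by omega) (linC (L.d j))
        (circ (m := k + 1) (n := 0) (p := k) rfl φ (constC (L.x j))) = hochschildD (∑ j, ψ j) := by
    refine ext_onSeq fun F => ?_
    have e : onSeq (∑ j, ψ j) = fun F => ∑ j, (1 : ℝ) • onSeq (ψ j) F := by
      funext F
      simp [onSeq_sum]
    rw [onSeq_hochschildD, e, dSeq_sum]
    simp only [one_smul, hd, onSeq_sub, onSeq_sum]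
    rw [Finset.sum_sub_distrib, Finset.sum_sub_distrib, sub_right_comm]
    congr 1
    rw [← Finset.sum_sub_distrib]
    unfold euler onSeq
    rw [_root_.sum_apply, Fintype.sum_prod_type_right]
    refine Finset.sum_congr rfl fun j _ => ?_
    simp only [circ, _root_.sum_apply, _root_.smul_apply, Finset.mul_sum]
    rw [← Finset.sum_sub_distrib]
    refine Finset.sum_congr rfl fun s _ => ?_
    have e2 : (-1 : ℝ) ^ ((1 + 1) * (s : ℕ)) = 1 := by rw [pow_mul]; norm_num
    rw [e2, one_smul, one_smul, insertAt_apply, insertAt_apply, insertArgs_one, insertArgs_one,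
      slot_apply, adSlot_apply]
    simp only [_root_.sub_apply, slot_apply, mulC_apply, cup_apply, linC_apply, constC_apply,
      Function.update_self, Function.update_idem, LinearMap.mulLeft_apply, mul_comm (L.x j)]
  rw [h3]
  exact hochschildD_mem_ordBd (sum_mem fun j _ => hψ j)

/-- The cup product of a derivation with a coboundary is a coboundary. -/
theorem cup_linC_mem_ordBd (j : Fin L.n) {N k : ℕ} {χ : Cochain B k} (h : χ ∈ ordBd S N k) :
    cup (p := k + 1) (by omega) (linC (L.d j)) χ ∈ ordBd S (1 + N) (k + 1) := by
  cases k with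
  | zero =>
    rw [(Submodule.mem_bot ℝ).1 h]
    have e : cup (p := 1) (by omega) (linC (L.d j)) (0 : Cochain B 0) = 0 := by
      ext f
      simp [cup_apply]
    rw [e]
    exact zero_mem _
  | succ k =>
    obtain ⟨ψ, hψ, rfl⟩ := h
    have e : cup (p := k + 2) (by omega) (linC (L.d j)) (hochschildD ψ) =
        (-1 : ℝ) • hochschildD (cup (p := k + 1) (by omega) (linC (L.d j)) ψ) := by
      refine ext_onSeq fun F => ?_
      have h1 := dSeq_cup (n := k) (linC (L.d j)) (onSeq ψ) F
      rw [← onSeq_hochschildD (linC (L.d j)),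
        (L.isMultiDerivation_linC j).hochschildD_eq_zero, onSeq_zero, zero_mul, zero_add] at h1
      rw [onSeq_smul, onSeq_hochschildD, onSeq_cup]
      have e2 : onSeq (cup (p := k + 1) (by omega) (linC (L.d j)) ψ) =
          fun G => onSeq (linC (L.d j)) G * onSeq ψ fun u => G (1 + u) :=
            funext fun G => onSeq_cup ..
      have e3 : ∀ Φ, dSeq (k + 1) Φ F = dSeq (1 + k) Φ F := fun Φ => by rw [Nat.add_comm]
      rw [e2, e3, h1, smul_smul]
      simp [onSeq_hochschildD]
    change cup _ _ (hochschildD ψ) ∈ _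
    rw [e]
    exact Submodule.smul_mem _ _ (hochschildD_mem_ordBd (cup_mem_ord _ (L.linC_mem j) hψ))

/-- The Euler operator multiplies a multiderivation by its degree. -/
theorem euler_multiDerivation {k : ℕ} {β : Cochain B k} (hβ : IsMultiDerivation β)
    (hS : IsLinearOver S β) : L.euler β = (k : ℝ) • β := by
  ext f
  unfold euler
  rw [_root_.sum_apply, Fintype.sum_prod_type]
  have h : ∀ s : Fin k, ∑ j, slot (L.d j) s (adSlot (L.x j) s β) f = β f := fun s => by
    have h1 := L.multiDerivation_eq_sum hβ hS s f (f s)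
    rw [Function.update_eq_self] at h1
    rw [h1]
    refine Finset.sum_congr rfl fun j _ => ?_
    rw [slot_apply, adSlot_apply, _root_.sub_apply, slot_apply, mulC_apply, Function.update_self,
      Function.update_idem, LinearMap.mulLeft_apply, hβ]
    ring
  rw [Finset.sum_congr rfl fun s _ => h s]
  simp [Nat.cast_smul_eq_nsmul]

/-- An antisymmetrised multiderivation is recovered from the insertions of the coordinates. -/
theorem sum_cup_altC_circ {k : ℕ} {β : Cochain B (k + 1)} (hβ : IsMultiDerivation β)
    (hS : IsLinearOver S β) :
    ∑ j, cup (p := k + 1) (by omega) (linC (L.d j))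
      (altC (circ (m := k + 1) (n := 0) (p := k) rfl β (constC (L.x j)))) = altC β := by
  ext f
  have h := L.multiDerivation_eq_sum hβ.altC hS.altC 0 f (f 0)
  rw [Function.update_eq_self] at h
  rw [h, _root_.sum_apply]
  refine Finset.sum_congr rfl fun j _ => ?_
  rw [cup_apply, altC_circ_zero, linC_apply]
  congr 2
  funext i
  refine Fin.cases ?_ (fun i => ?_) i
  · simp
  · rw [Fin.cons_succ, Function.update_of_ne (Fin.succ_ne_zero i)]
    congr 1
    ext
    simp [add_comm]

end LocalCoords

/-- The Hochschild-Kostant-Rosenberg theorem in degree `k` for algebras with coordinates, with a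
bound on the order of the primitives which depends on the order of the cocycle only. -/
def LocalHKR.{u} (k : ℕ) : Prop :=
  ∀ N, ∃ N', ∀ (B : Type u) [CommRing B] [Algebra ℝ B] (S : Set B) (_ : LocalCoords B S)
    (φ : Cochain B k), φ ∈ ordCochain S N k → hochschildD φ = 0 →
      IsMultiDerivation (altC φ) ∧ φ - (k.factorial : ℝ)⁻¹ • altC φ ∈ ordBd S N' k

/-- By induction on the total order, a cocycle is cohomologous to a multiderivation: the Euler
operator turns it into a multiderivation up to coboundaries, and acts as a nonzero number up to
lower order. -/
theorem exists_multiDerivation.{u} {k : ℕ} (hk : LocalHKR.{u} k) (d : ℕ) :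
    ∀ N, ∃ N', ∀ (B : Type u) [CommRing B] [Algebra ℝ B] (S : Set B) (L : LocalCoords B S)
      (φ : Cochain B (k + 1)), φ ∈ ordCochain S N (k + 1) → hochschildD φ = 0 →
      TotOrd (fun a : Fin (k + 1) × Fin L.n => adSlot (L.x a.2) a.1) d φ →
      ∃ β : Cochain B (k + 1), IsMultiDerivation β ∧ β ∈ ordCochain S 1 (k + 1) ∧
        φ - β ∈ ordBd S N' (k + 1) := by
  induction d with
  | zero =>
    refine fun N => ⟨N, fun B _ _ S L φ hN hφ hd => ⟨0, .zero, zero_mem _, ?_⟩⟩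
    rw [sub_zero]
    refine mem_ordBd_of_linear hN hφ fun f a => ?_
    refine L.eq_mul_one N (φ.toLinearMap f 0) (hN.1 0 f) (fun s hs g => ?_) (fun j g => ?_) a
    · have := hN.2 s hs 0 (Function.update f 0 g)
      simpa using this
    · have h1 := congrArg (fun χ : Cochain B (k + 1) => χ (Function.update f 0 g)) (hd (0, j))
      simp only [adSlot_apply, _root_.sub_apply, slot_apply, mulC_apply, Function.update_self,
        Function.update_idem, LinearMap.mulLeft_apply] at h1
      exact sub_eq_zero.1 h1
  | succ d ih =>
    intro N
    obtain ⟨N₁, h₁⟩ := hk N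
    obtain ⟨N₂, h₂⟩ := ih (N + 1)
    refine ⟨N + 1 + (1 + N₁) + N₂, fun B _ _ S L φ hN hφ hd => ?_⟩
    have hc := fun j => h₁ B S L _ (circ_constC_mem hN (L.x j))
      (hochschildD_circ_constC hφ (L.x j))
    set χ : Fin L.n → Cochain B k := fun j =>
      circ (m := k + 1) (n := 0) (p := k) rfl φ (constC (L.x j)) with hχ
    -- By `euler_sub_mem` and the theorem in degree `k`, the Euler operator applied to `φ` is
    -- cohomologous to the multiderivation `β₁`.
    set β₁ : Cochain B (k + 1) := ∑ j, cup (p := k + 1) (by omega) (linC (L.d j))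
      ((k.factorial : ℝ)⁻¹ • altC (χ j)) with hβ₁
    have hβ₁d : IsMultiDerivation β₁ := .sum _ fun j _ =>
      (L.isMultiDerivation_linC j).cup _ ((hc j).1.smul _)
    have hβ₁m : β₁ ∈ ordCochain S 1 (k + 1) := by
      refine hβ₁d.mem_ordCochain (sum_mem (S := ordCochain S 2 (k + 1)) fun j _ => ?_).2
      exact cup_mem_ord (M := 1) (N := 1) _ (L.linC_mem j) (((hc j).1.smul _).mem_ordCochain
        (Submodule.smul_mem _ _ ((hc j).1.mem_ordCochain
          (circ_constC_mem hN (L.x j)).2.altC)).2)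
    have he : L.euler φ - β₁ ∈ ordBd S (N + 1 + (1 + N₁)) (k + 1) := by
      have h3 := L.euler_sub_mem hN hφ
      have h4 : ∑ j, cup (p := k + 1) (by omega) (linC (L.d j)) (χ j) - β₁ ∈
          ordBd S (1 + N₁) (k + 1) := by
        rw [hβ₁, ← Finset.sum_sub_distrib]
        refine sum_mem fun j _ => ?_
        have h5 := L.cup_linC_mem_ordBd j (hc j).2
        convert h5 using 1
        ext f
        simp [cup_apply, mul_sub]
        rfl
      have h6 := add_mem (ordBd_mono (Nat.le_add_right (N + 1) (1 + N₁)) _ h3)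
        (ordBd_mono (Nat.le_add_left (1 + N₁) (N + 1)) _ h4)
      convert h6 using 1
      abel
    have hem : L.euler φ ∈ ordCochain S (N + 1) (k + 1) :=
      sum_mem fun b _ => slot_mem_ord (show IsDiffOp 1 (L.d b.2) from by
          have e : (linC (L.d b.2)).toLinearMap 0 0 = L.d b.2 := by ext; simp
          exact e ▸ (L.linC_mem b.2).1 0 0)
        (fun c hc a => by rw [L.leibniz, L.d_scalar _ c hc, mul_zero, add_zero]) _
        (adSlot_mem_ord _ _ hN)
    have hed : hochschildD (L.euler φ) = 0 := by
      have h3 := hochschildD_of_mem_ordBd he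
      rwa [← one_smul ℝ β₁, hochschildD_sub_smul, hβ₁d.hochschildD_eq_zero, smul_zero,
        sub_zero] at h3
    -- The induction hypothesis applies to `euler φ - (d + 1) φ`, which has total order `≤ d`.
    have hdd : hochschildD (L.euler φ - (d + 1 : ℝ) • φ) = 0 := by
      rw [hochschildD_sub_smul, hed, hφ, smul_zero, sub_zero]
    obtain ⟨β₂, hβ₂d, hβ₂m, hβ₂⟩ := h₂ B S L (L.euler φ - (d + 1 : ℝ) • φ)
      (sub_mem hem (Submodule.smul_mem _ _ (ordCochain_mono (Nat.le_succ N) _ hN))) hdd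
      (L.totOrd_euler d φ hd)
    have hd0 : (d + 1 : ℝ) ≠ 0 := by positivity
    refine ⟨(d + 1 : ℝ)⁻¹ • (β₁ - β₂), ?_, Submodule.smul_mem _ _ (sub_mem hβ₁m hβ₂m), ?_⟩
    · rw [sub_eq_add_neg, ← neg_one_smul ℝ β₂]
      exact (hβ₁d.add (hβ₂d.smul _)).smul _
    · have h7 := Submodule.smul_mem _ (d + 1 : ℝ)⁻¹ (sub_mem
        (ordBd_mono (Nat.le_add_right (N + 1 + (1 + N₁)) N₂) _ he)
        (ordBd_mono (Nat.le_add_left N₂ (N + 1 + (1 + N₁))) _ hβ₂))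
      convert h7 using 1
      have : φ = (d + 1 : ℝ)⁻¹ • ((d + 1 : ℝ) • φ) := by
        rw [smul_smul, inv_mul_cancel₀ hd0, one_smul]
      nth_rewrite 1 [this]
      refine (smul_sub (d + 1 : ℝ)⁻¹ ((d + 1 : ℝ) • φ) (β₁ - β₂)).symm.trans (congrArg _ ?_)
      abel

/-- The Hochschild-Kostant-Rosenberg theorem for algebras with coordinates. A cocycle is
cohomologous to a multiderivation `β`; the Euler operator multiplies `β` by its degree, and it also
gives `∑_j d j ∪ (β ∘ x j)`, where inductively `β ∘ x j` may be replaced by its antisymmetrisation.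
-/
theorem localHKR.{u} (k : ℕ) : LocalHKR.{u} k := by
  induction k with
  | zero =>
    refine fun N => ⟨0, fun B _ _ S L φ hN hφ => ⟨fun _ i => i.elim0, ?_⟩⟩
    have : altC φ = φ := by
      ext f
      rw [altC_apply]
      simp only [altSum, Finset.univ_unique, Finset.sum_singleton]
      rw [Subsingleton.elim (f ∘ _) f]
      simp
    rw [this]
    simp
  | succ k ih =>
    intro N
    obtain ⟨N₁, h₁⟩ := exists_multiDerivation ih ((k + 1) * N) N
    obtain ⟨N₂, h₂⟩ := ih 1
    refine ⟨N₁ + (2 + N₂), fun B _ _ S L φ hN hφ => ?_⟩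
    obtain ⟨β, hβ, hβm, hφβ⟩ := h₁ B S L φ hN hφ (by
      have := totOrd_adSlot L.x (fun _ => N) φ hN.1
      simpa using this)
    have halt : altC φ = altC β := by
      have h3 := altC_of_mem_ordBd hφβ
      have h4 := altC_add (φ - β) β
      rw [sub_add_cancel, h3, zero_add] at h4
      exact h4
    rw [halt]
    refine ⟨hβ.altC, ?_⟩
    have hd := hβ.hochschildD_eq_zero
    have hc := fun j => h₂ B S L _ (circ_constC_mem hβm (L.x j))
      (hochschildD_circ_constC hd (L.x j))
    have h3 := L.euler_sub_mem hβm hd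
    rw [L.euler_multiDerivation hβ hβm.2] at h3
    have h4 := sum_mem fun j (_ : j ∈ Finset.univ) => L.cup_linC_mem_ordBd j (hc j).2
    have h5 : (k + 1 : ℝ) • β - (k.factorial : ℝ)⁻¹ • altC β ∈ ordBd S (2 + N₂) (k + 1) := by
      have h6 := add_mem (ordBd_mono (show 1 + 1 ≤ 2 + N₂ by omega) _ h3)
        (ordBd_mono (show 1 + N₂ ≤ 2 + N₂ by omega) _ h4)
      convert h6 using 1
      rw [← L.sum_cup_altC_circ hβ hβm.2, Finset.smul_sum, sub_add, ← Finset.sum_sub_distrib]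
      push_cast
      congr 1
      refine Finset.sum_congr rfl fun j _ => ?_
      ext f
      simp [cup_apply, mul_sub]
    have hk0 : (k + 1 : ℝ) ≠ 0 := by positivity
    have h7 := add_mem (ordBd_mono (show N₁ ≤ N₁ + (2 + N₂) by omega) _ hφβ)
      (ordBd_mono (show 2 + N₂ ≤ N₁ + (2 + N₂) by omega) _
        (Submodule.smul_mem _ (k + 1 : ℝ)⁻¹ h5))
    convert h7 using 1
    rw [smul_sub, smul_smul, inv_mul_cancel₀ hk0, one_smul, smul_smul, ← mul_inv,
      Nat.factorial_succ]
    push_cast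
    abel

end LocalHKR

/-! ### Descent and gluing of cochains -/

section Descent

variable {A B : Type*} [CommRing A] [Algebra ℝ A] [CommRing B] [Algebra ℝ B]

theorem hochschildD_apply {k : ℕ} (φ : Cochain A k) (f : Fin (k + 1) → A) :
    hochschildD φ f = f 0 * φ (fun j => f ⟨1 + j, by omega⟩)
      + ∑ i : Fin k, (-1 : ℝ) ^ ((i : ℕ) + 1) • φ (insertArgs (by omega) i (mulCochain A) f)
      + (-1 : ℝ) ^ (k + 1) • (φ (fun i => f ⟨i, by omega⟩) * f (Fin.last k)) := by
  simp only [hochschildD, _root_.add_apply, _root_.sum_apply, _root_.smul_apply, cup_apply,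
    insertAt_apply, idCochain, MultilinearMap.ofSubsingleton_apply_apply, LinearMap.id_apply]
  rfl

/-- The cochains `φ` of `A` and `χ` of `B` correspond to each other under `ρ : A → B`. -/
def IsRelated (ρ : A →ₐ[ℝ] B) {k : ℕ} (φ : Cochain A k) (χ : Cochain B k) : Prop :=
  ∀ f : Fin k → A, χ (fun i => ρ (f i)) = ρ (φ f)

variable {ρ : A →ₐ[ℝ] B}

theorem map_insertArgs {m n p : ℕ} (h : m + n = p + 1) (i : Fin m) {ψ : Cochain A n}
    {ψ' : Cochain B n} (hψ : IsRelated ρ ψ ψ') (f : Fin p → A) :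
    insertArgs h i ψ' (fun j => ρ (f j)) = fun j => ρ (insertArgs h i ψ f j) := by
  funext j
  simp only [insertArgs]
  split_ifs
  · rfl
  · exact hψ _
  · rfl

theorem IsRelated.cup {m n p : ℕ} (h : m + n = p) {φ : Cochain A m} {φ' : Cochain B m}
    {ψ : Cochain A n} {ψ' : Cochain B n} (hφ : IsRelated ρ φ φ') (hψ : IsRelated ρ ψ ψ') :
    IsRelated ρ (cup h φ ψ) (cup h φ' ψ') := fun f => by
  rw [cup_apply, cup_apply, map_mul, ← hφ, ← hψ]

theorem IsRelated.insertAt {m n p : ℕ} (h : m + n = p + 1) (i : Fin m) {φ : Cochain A m}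
    {φ' : Cochain B m} {ψ : Cochain A n} {ψ' : Cochain B n} (hφ : IsRelated ρ φ φ')
    (hψ : IsRelated ρ ψ ψ') : IsRelated ρ (insertAt h i φ ψ) (insertAt h i φ' ψ') := fun f => by
  rw [insertAt_apply, insertAt_apply, map_insertArgs h i hψ, hφ]

theorem IsRelated.add {k : ℕ} {φ ψ : Cochain A k} {φ' ψ' : Cochain B k} (hφ : IsRelated ρ φ φ')
    (hψ : IsRelated ρ ψ ψ') : IsRelated ρ (φ + ψ) (φ' + ψ') := fun f => by
  rw [_root_.add_apply, _root_.add_apply, map_add, hφ, hψ]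

theorem IsRelated.smul {k : ℕ} {φ : Cochain A k} {φ' : Cochain B k} (c : ℝ)
    (hφ : IsRelated ρ φ φ') : IsRelated ρ (c • φ) (c • φ') := fun f => by
  rw [_root_.smul_apply, _root_.smul_apply, map_smul, hφ]

theorem IsRelated.sub {k : ℕ} {φ ψ : Cochain A k} {φ' ψ' : Cochain B k} (hφ : IsRelated ρ φ φ')
    (hψ : IsRelated ρ ψ ψ') : IsRelated ρ (φ - ψ) (φ' - ψ') := fun f => by
  rw [_root_.sub_apply, _root_.sub_apply, map_sub, hφ, hψ]

theorem IsRelated.sum {k : ℕ} {ι : Type*} (s : Finset ι) {φ : ι → Cochain A k}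
    {φ' : ι → Cochain B k} (h : ∀ i ∈ s, IsRelated ρ (φ i) (φ' i)) :
    IsRelated ρ (∑ i ∈ s, φ i) (∑ i ∈ s, φ' i) := fun f => by
  rw [_root_.sum_apply, _root_.sum_apply, map_sum]
  exact Finset.sum_congr rfl fun i hi => h i hi f

theorem IsRelated.id : IsRelated ρ (idCochain A) (idCochain B) := fun _ => rfl

theorem IsRelated.mul : IsRelated ρ (mulCochain A) (mulCochain B) :=
  IsRelated.id.cup _ IsRelated.id

theorem IsRelated.hochschildD {k : ℕ} {φ : Cochain A k} {φ' : Cochain B k}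
    (h : IsRelated ρ φ φ') : IsRelated ρ (hochschildD φ) (hochschildD φ') :=
  ((IsRelated.id.cup _ h).add (.sum _ fun i _ => (h.insertAt _ i .mul).smul _)).add
    ((h.cup _ .id).smul _)

theorem IsRelated.circ {m n p : ℕ} (h : m + n = p + 1) {φ : Cochain A m} {φ' : Cochain B m}
    {ψ : Cochain A n} {ψ' : Cochain B n} (hφ : IsRelated ρ φ φ') (hψ : IsRelated ρ ψ ψ') :
    IsRelated ρ (circ h φ ψ) (circ h φ' ψ') :=
  .sum _ fun i _ => (hφ.insertAt h i hψ).smul _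

theorem IsRelated.gBracket {m n p : ℕ} (h : m + n = p + 1) {φ : Cochain A m} {φ' : Cochain B m}
    {ψ : Cochain A n} {ψ' : Cochain B n} (hφ : IsRelated ρ φ φ') (hψ : IsRelated ρ ψ ψ') :
    IsRelated ρ (gBracket h φ ψ) (gBracket h φ' ψ') :=
  (hφ.circ h hψ).sub ((hψ.circ _ hφ).smul _)

theorem IsRelated.altC {k : ℕ} {φ : Cochain A k} {φ' : Cochain B k}
    (h : IsRelated ρ φ φ') : IsRelated ρ (altC φ) (altC φ') := fun f => by
  simp only [altC_apply, altSum, map_sum, map_smul]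
  exact Finset.sum_congr rfl fun σ _ => congrArg _ (h (f ∘ σ))

theorem IsRelated.unique (hρ : Function.Surjective ρ) {k : ℕ} {φ : Cochain A k}
    {χ χ' : Cochain B k} (h : IsRelated ρ φ χ) (h' : IsRelated ρ φ χ') : χ = χ' := by
  ext g
  choose f hf using fun i => hρ (g i)
  obtain rfl : (fun i => ρ (f i)) = g := funext hf
  rw [h, h']

theorem update_map {k : ℕ} (f : Fin k → A) (i : Fin k) (a : A) :
    Function.update (fun j => ρ (f j)) i (ρ a) = fun j => ρ (Function.update f i a j) := by
  funext j
  rcases eq_or_ne j i with rfl | h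
  · simp
  · simp [h]

/-- A cochain descends along a surjection `ρ` if its values lie in the kernel of `ρ` as soon as one
of the arguments does. -/
theorem exists_isRelated (hρ : Function.Surjective ρ) {k : ℕ} (φ : Cochain A k)
    (h : ∀ (i : Fin k) (f : Fin k → A), ρ (f i) = 0 → ρ (φ f) = 0) :
    ∃ χ : Cochain B k, IsRelated ρ φ χ := by
  classical
  have key : ∀ f g : Fin k → A, (∀ i, ρ (f i) = ρ (g i)) → ρ (φ f) = ρ (φ g) := by
    intro f g hfg
    have : ∀ s : Finset (Fin k), ρ (φ (s.piecewise f g)) = ρ (φ g) := by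
      intro s
      induction s using Finset.induction_on with
      | empty => simp
      | insert i s hi ih =>
        rw [← ih, Finset.piecewise_insert, ← sub_eq_zero, ← map_sub]
        have h1 : s.piecewise f g = Function.update (s.piecewise f g) i (g i) := by
          rw [eq_comm, Function.update_eq_self_iff, Finset.piecewise_eq_of_notMem _ _ _ hi]
        nth_rewrite 2 [h1]
        rw [← MultilinearMap.map_update_sub]
        exact h i _ (by rw [Function.update_self, map_sub, hfg, sub_self])
    simpa using this Finset.univ
  set s := Function.surjInv hρ with hs
  have hsr : ∀ b, ρ (s b) = b := Function.surjInv_eq hρ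
  refine ⟨MultilinearMap.mk' (fun g => ρ (φ fun i => s (g i))) ?_ ?_,
    fun f => key _ _ fun i => hsr _⟩
  · intro g i x y
    have hu : ∀ z, (fun j => s (Function.update g i z j)) =
        Function.update (fun j => s (g j)) i (s z) := fun z => by
      funext j
      rcases eq_or_ne j i with rfl | h
      · simp
      · simp [h]
    rw [hu, hu, hu, ← map_add, ← MultilinearMap.map_update_add]
    refine key _ _ fun j => ?_
    rcases eq_or_ne j i with rfl | h
    · simp [hsr]
    · simp [h]
  · intro g i c x
    have hu : ∀ z, (fun j => s (Function.update g i z j)) =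
        Function.update (fun j => s (g j)) i (s z) := fun z => by
      funext j
      rcases eq_or_ne j i with rfl | h
      · simp
      · simp [h]
    rw [hu, hu, ← map_smul, ← MultilinearMap.map_update_smul]
    refine key _ _ fun j => ?_
    rcases eq_or_ne j i with rfl | h
    · simp [hsr]
    · simp [h]

/-- An operator induced by a differential operator on a quotient algebra is a differential operator
of the same order. -/
theorem IsDiffOp.descend (hρ : Function.Surjective ρ) {N : ℕ} : ∀ {D : A →ₗ[ℝ] A}
    {D' : B →ₗ[ℝ] B}, (∀ a, D' (ρ a) = ρ (D a)) → IsDiffOp N D → IsDiffOp N D' := by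
  have key : ∀ {D : A →ₗ[ℝ] A} {D' : B →ₗ[ℝ] B}, (∀ a, D' (ρ a) = ρ (D a)) → ∀ c a,
      (D' ∘ₗ LinearMap.mulLeft ℝ (ρ c) - LinearMap.mulLeft ℝ (ρ c) ∘ₗ D') (ρ a) =
        ρ ((D ∘ₗ LinearMap.mulLeft ℝ c - LinearMap.mulLeft ℝ c ∘ₗ D) a) := by
    intro D D' h c a
    simp only [LinearMap.sub_apply, LinearMap.comp_apply, LinearMap.mulLeft_apply, map_sub,
      map_mul, ← h]
  induction N with
  | zero =>
    intro D D' h hD b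
    obtain ⟨c, rfl⟩ := hρ b
    ext x
    obtain ⟨a, rfl⟩ := hρ x
    rw [key h, hD]
    simp
  | succ N ih =>
    intro D D' h hD b
    obtain ⟨c, rfl⟩ := hρ b
    exact ih (key h c) (hD c)

theorem IsRelated.mem_ordCochain (hρ : Function.Surjective ρ) {S : Set A} {T : Set B}
    (hT : T ⊆ ρ '' S) {N k : ℕ} {φ : Cochain A k} {χ : Cochain B k} (h : IsRelated ρ φ χ)
    (hφ : φ ∈ ordCochain S N k) : χ ∈ ordCochain T N k := by
  refine ⟨fun i g => ?_, fun t ht i g => ?_⟩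
  · choose f hf using fun i => hρ (g i)
    obtain rfl : (fun i => ρ (f i)) = g := funext hf
    refine IsDiffOp.descend hρ (fun a => ?_) (hφ.1 i f)
    rw [MultilinearMap.toLinearMap_apply, MultilinearMap.toLinearMap_apply, update_map, h]
  · choose f hf using fun i => hρ (g i)
    obtain rfl : (fun i => ρ (f i)) = g := funext hf
    obtain ⟨s, hs, rfl⟩ := hT ht
    rw [← map_mul, update_map, h, hφ.2 s hs, map_mul, h]

end Descent

section Glue

variable {A : Type*} [CommRing A] [Algebra ℝ A] {ι : Type*} {B : ι → Type*}
  [∀ α, CommRing (B α)] [∀ α, Algebra ℝ (B α)] (ρ : ∀ α, A →ₐ[ℝ] B α)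
  (σ : (∀ α, B α) →ₗ[ℝ] A)

/-- The cochain `f ↦ σ (ψ_α (ρ_α f))` of `A` glued from cochains `ψ_α` of algebras `B_α` over `A`.
-/
def glue {k : ℕ} (ψ : ∀ α, Cochain (B α) k) : Cochain A k :=
  σ.compMultilinearMap (MultilinearMap.pi fun α => (ψ α).compLinearMap fun _ => (ρ α).toLinearMap)

theorem glue_apply {k : ℕ} (ψ : ∀ α, Cochain (B α) k) (f : Fin k → A) :
    glue ρ σ ψ f = σ fun α => ψ α fun i => ρ α (f i) := rfl

variable {ρ σ}

/-- The gluing of differential operators of bounded order is a differential operator: `σ`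
intertwines multiplication by `a` and by the elements `ρ_α a`, hence also the iterated commutators.
-/
theorem glue_isDiffOp (hσ : ∀ a b, σ (fun α => ρ α a * b α) = a * σ b)
    {N : ℕ} : ∀ {D : ∀ α, B α →ₗ[ℝ] B α} {D' : A →ₗ[ℝ] A},
    (∀ a, D' a = σ fun α => D α (ρ α a)) → (∀ α, IsDiffOp N (D α)) → IsDiffOp N D' := by
  have key : ∀ {D : ∀ α, B α →ₗ[ℝ] B α} {D' : A →ₗ[ℝ] A},
      (∀ a, D' a = σ fun α => D α (ρ α a)) → ∀ c a,
      (D' ∘ₗ LinearMap.mulLeft ℝ c - LinearMap.mulLeft ℝ c ∘ₗ D') a = σ fun α =>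
        (D α ∘ₗ LinearMap.mulLeft ℝ (ρ α c) - LinearMap.mulLeft ℝ (ρ α c) ∘ₗ D α) (ρ α a) := by
    intro D D' h c a
    simp only [LinearMap.sub_apply, LinearMap.comp_apply, LinearMap.mulLeft_apply, h, ← hσ,
      ← map_sub, map_mul]
    rfl
  induction N with
  | zero =>
    intro D D' h hD c
    ext a
    rw [key h]
    refine Eq.trans (congrArg σ (funext fun α => ?_)) (map_zero σ)
    rw [hD α]
    rfl
  | succ N ih => exact fun h hD c => ih (key h c) fun α => hD α _

theorem glue_mem_ordCochain (hσ : ∀ a b, σ (fun α => ρ α a * b α) = a * σ b)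
    {S : Set A} {N k : ℕ} {ψ : ∀ α, Cochain (B α) k}
    (h : ∀ α, ψ α ∈ ordCochain (ρ α '' S) N k) : glue ρ σ ψ ∈ ordCochain S N k := by
  refine ⟨fun i f => glue_isDiffOp hσ (D := fun α => (ψ α).toLinearMap (fun j => ρ α (f j)) i)
    (fun a => ?_) fun α => (h α).1 i _, fun s hs i f => ?_⟩
  · simp only [MultilinearMap.toLinearMap_apply, glue_apply, update_map]
  · rw [glue_apply, glue_apply, ← hσ]
    congr 1
    funext α
    rw [← (h α).2 _ ⟨s, hs, rfl⟩ i, ← map_mul, update_map]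

/-- Gluing commutes with the Hochschild differential. -/
theorem hochschildD_glue (hσ : ∀ a b, σ (fun α => ρ α a * b α) = a * σ b)
    {k : ℕ} (ψ : ∀ α, Cochain (B α) k) :
    hochschildD (glue ρ σ ψ) = glue ρ σ fun α => hochschildD (ψ α) := by
  ext f
  rw [glue_apply]
  have h : (fun α => hochschildD (ψ α) fun i => ρ α (f i)) =
      (fun α => ρ α (f 0) * ψ α fun j => ρ α (f ⟨1 + j, by omega⟩)) +
      ∑ i : Fin k, (-1 : ℝ) ^ ((i : ℕ) + 1) •
        (fun α => ψ α fun j => ρ α (insertArgs (by omega) i (mulCochain A) f j)) +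
      (-1 : ℝ) ^ (k + 1) • (fun α => ρ α (f (Fin.last k)) *
        ψ α fun i => ρ α (f ⟨i, by omega⟩)) := by
    funext α
    simp only [hochschildD_apply, map_insertArgs _ _ IsRelated.mul, Pi.add_apply, Finset.sum_apply,
      Pi.smul_apply, mul_comm (ρ α (f (Fin.last k)))]
  rw [h, map_add, map_add, map_sum, hσ, map_smul, hσ, hochschildD_apply]
  simp only [map_smul, glue_apply, mul_comm]

/-- If `A` is glued from algebras `B_α` with coordinates, then every cocycle of `A` is cohomologous
to its antisymmetrisation, and the latter is a multiderivation. -/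
theorem glued_hkr.{u} {A : Type u} [CommRing A] [Algebra ℝ A] {ι : Type*} {B : ι → Type u}
    [∀ α, CommRing (B α)] [∀ α, Algebra ℝ (B α)] {ρ : ∀ α, A →ₐ[ℝ] B α} {σ : (∀ α, B α) →ₗ[ℝ] A}
    (hσ : ∀ a b, σ (fun α => ρ α a * b α) = a * σ b) (hσ1 : σ 1 = 1) {S : Set A}
    (hρ : ∀ α, Function.Surjective (ρ α)) (L : ∀ α, LocalCoords (B α) (ρ α '' S))
    (hloc : ∀ (α : ι) (k : ℕ) (φ : Cochain A k), φ ∈ diffCochain A S k → ∀ (i : Fin k) f,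
      ρ α (f i) = 0 → ρ α (φ f) = 0) {k : ℕ} {φ : Cochain A k} (hφ : φ ∈ diffCochain A S k)
    (hd : hochschildD φ = 0) :
    IsMultiDerivation (altC φ) ∧ ∃ N, φ - (k.factorial : ℝ)⁻¹ • altC φ ∈ ordBd S N k := by
  have hσρ : ∀ a, (σ fun α => ρ α a) = a := fun a => by
    have := hσ a 1
    simpa [hσ1] using this
  have hinj : ∀ a b, (∀ α, ρ α a = ρ α b) → a = b := fun a b h => by
    rw [← hσρ a, ← hσρ b]
    simp only [h]
  obtain ⟨N, hN⟩ := mem_diffCochain_iff.1 hφ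
  choose χ hχ using fun α => exists_isRelated (hρ α) φ (hloc α k φ hφ)
  have hχm := fun α => (hχ α).mem_ordCochain (hρ α) subset_rfl hN
  have hχd : ∀ α, hochschildD (χ α) = 0 := fun α =>
    (hχ α).hochschildD.unique (hρ α) (by rw [hd]; exact fun f => by simp)
  obtain ⟨N', h⟩ := localHKR k N
  have h' := fun α => h (B α) _ (L α) (χ α) (hχm α) (hχd α)
  refine ⟨fun f i a b => hinj _ _ fun α => ?_, N', ?_⟩
  · have := (h' α).1 (fun j => ρ α (f j)) i (ρ α a) (ρ α b)
    rw [← map_mul, update_map, update_map, update_map] at this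
    rw [map_add, map_mul, map_mul, ← (hχ α).altC, ← (hχ α).altC, ← (hχ α).altC, this]
  · have hrel := fun α => (hχ α).sub ((hχ α).altC.smul (k.factorial : ℝ)⁻¹)
    cases k with
    | zero =>
      refine (Submodule.mem_bot ℝ).2 ?_
      ext f
      refine hinj _ _ fun α => ?_
      rw [← hrel α, (Submodule.mem_bot ℝ).1 (h' α).2]
      simp
    | succ k =>
      -- The primitives in the algebras `B_α` all have order `≤ N'`, so that they can be glued.
      choose ψ hψm hψ using fun α => Submodule.mem_map.1 (h' α).2
      have : hochschildD (glue ρ σ ψ) = φ - ((k + 1).factorial : ℝ)⁻¹ • altC φ := by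
        rw [hochschildD_glue hσ]
        ext f
        rw [glue_apply, ← hσρ ((φ - ((k + 1).factorial : ℝ)⁻¹ • altC φ) f)]
        congr 1
        funext α
        exact (DFunLike.congr_fun (hψ α) _).trans (hrel α f)
      rw [← this]
      exact hochschildD_mem_ordBd (glue_mem_ordCochain hσ hψm)

end Glue

/-! ### Hadamard's lemma with parameters -/

section Hadamard

open MeasureTheory Set

/-- An integral over `[0, 1]` depends smoothly on parameters. It is the convolution with the
characteristic function of `[0, 1]`, after cutting off the integrand outside `[0, 1]`. -/
theorem contDiffOn_integral {P : Type*} [NormedAddCommGroup P] [NormedSpace ℝ P] {s : Set P}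
    (hs : IsOpen s) {G : P × ℝ → ℝ} (hG : ContDiffOn ℝ ∞ G (s ×ˢ univ)) :
    ContDiffOn ℝ ∞ (fun y => ∫ t in (0 : ℝ)..1, G (y, t)) s := by
  let b : ContDiffBump (0 : ℝ) := ⟨1, 2, by norm_num, by norm_num⟩
  have h1 : ContDiffOn ℝ ∞ (↿fun (p : P) (t : ℝ) => b t * G (p, -t)) (s ×ˢ univ) := by
    have h2 : ContDiffOn ℝ ∞ (fun q : P × ℝ => G (q.1, -q.2)) (s ×ˢ univ) :=
      hG.comp (contDiff_fst.prodMk contDiff_snd.neg).contDiffOn fun q hq => ⟨hq.1, mem_univ _⟩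
    exact (b.contDiff.comp contDiff_snd).contDiffOn.mul h2
  have h3 := contDiffOn_convolution_right_with_param_comp (n := ⊤) (μ := volume)
    (f := (Ioc (0 : ℝ) 1).indicator fun _ => (1 : ℝ))
    (ContinuousLinearMap.mul ℝ ℝ) (v := fun _ : P => (0 : ℝ)) contDiffOn_const hs
    (isCompact_closedBall (0 : ℝ) 2) (g := fun p t => b t * G (p, -t)) (fun p t _ ht => by
      rw [b.zero_of_le_dist (le_of_lt (by simpa using ht)), zero_mul])
    ((locallyIntegrable_const 1).indicator measurableSet_Ioc) h1
  refine h3.congr fun y hy => ?_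
  rw [convolution_def, intervalIntegral.integral_of_le zero_le_one,
    ← integral_indicator measurableSet_Ioc]
  congr 1
  funext t
  by_cases ht : t ∈ Ioc (0 : ℝ) 1
  · have : b (-t) = 1 := b.one_of_mem_closedBall (by
      have h0 := ht.1
      have h1 := ht.2
      simp only [Metric.mem_closedBall, dist_zero_right, norm_neg, Real.norm_eq_abs]
      rw [abs_of_pos h0]
      exact h1)
    simp [ht, this]
  · simp [ht]

variable {V : Type*} [NormedAddCommGroup V] [NormedSpace ℝ V] {H : Type*} [TopologicalSpace H]
  {J : ModelWithCorners ℝ V H} {P : Type*} [TopologicalSpace P] [ChartedSpace H P]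
  [IsManifold J ∞ P]

theorem contMDiffOn_integral [J.Boundaryless] {s : Set P} (hs : IsOpen s) {G : P × ℝ → ℝ}
    (hG : ContMDiffOn (J.prod 𝓘(ℝ, ℝ)) 𝓘(ℝ, ℝ) ∞ G (s ×ˢ univ)) :
    ContMDiffOn J 𝓘(ℝ, ℝ) ∞ (fun y => ∫ t in (0 : ℝ)..1, G (y, t)) s := by
  intro y₀ hy₀
  refine ContMDiffAt.contMDiffWithinAt ?_
  set e := extChartAt J y₀ with he
  set T := e.target ∩ e.symm ⁻¹' s with hT
  have hTo : IsOpen T := (continuousOn_extChartAt_symm y₀).isOpen_inter_preimage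
    (isOpen_extChartAt_target y₀) hs
  have h1 : ContMDiffOn (𝓘(ℝ, V).prod 𝓘(ℝ, ℝ)) 𝓘(ℝ, ℝ) ∞ (fun q : V × ℝ => G (e.symm q.1, q.2))
      (T ×ˢ univ) := by
    refine hG.comp (t := s ×ˢ univ) ?_ fun q hq => ⟨hq.1.2, mem_univ _⟩
    refine ContMDiffOn.prodMk ?_ contMDiffOn_snd
    exact (contMDiffOn_extChartAt_symm y₀).comp contMDiffOn_fst fun q hq => hq.1.1
  have h1' : ContMDiffOn 𝓘(ℝ, V × ℝ) 𝓘(ℝ, ℝ) ∞ (fun q : V × ℝ => G (e.symm q.1, q.2))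
      (T ×ˢ univ) := by
    rw [modelWithCornersSelf_prod, ← chartedSpaceSelf_prod]
    exact h1
  have h2 := contDiffOn_integral hTo (contMDiffOn_iff_contDiffOn.1 h1')
  have hy : e y₀ ∈ T := ⟨mem_extChartAt_target y₀, by
    simpa [he, extChartAt_to_inv] using hy₀⟩
  have h3 : ContMDiffAt J 𝓘(ℝ, ℝ) ∞ ((fun z => ∫ t in (0 : ℝ)..1, G (e.symm z, t)) ∘ e) y₀ :=
    (h2.contDiffAt (hTo.mem_nhds hy)).contMDiffAt.comp y₀ contMDiffAt_extChartAt
  refine h3.congr_of_eventuallyEq ?_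
  filter_upwards [extChartAt_source_mem_nhds (I := J) y₀] with y hy
  simp only [Function.comp_apply]
  rw [e.left_inv hy]

variable {F : Type*} [NormedAddCommGroup F] [NormedSpace ℝ F]

/-- Partial derivatives in a vector space direction depend smoothly on all variables. -/
theorem contMDiffOn_fderiv_snd {U : Set P} (hU : IsOpen U) {K : P × F → ℝ}
    (hK : ContMDiffOn (J.prod 𝓘(ℝ, F)) 𝓘(ℝ, ℝ) ∞ K (U ×ˢ univ)) (w : F) :
    ContMDiffOn (J.prod 𝓘(ℝ, F)) 𝓘(ℝ, ℝ) ∞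
      (fun q : P × F => fderiv ℝ (fun v => K (q.1, v)) q.2 w) (U ×ˢ univ) := by
  intro q hq
  refine ContMDiffAt.contMDiffWithinAt ?_
  have h1 : ContMDiffAt ((J.prod 𝓘(ℝ, F)).prod 𝓘(ℝ, F)) 𝓘(ℝ, ℝ) ∞
      (Function.uncurry fun (q : P × F) (v : F) => K (q.1, v)) (q, q.2) := by
    have h2 := hK.contMDiffAt ((hU.prod isOpen_univ).mem_nhds hq)
    exact ContMDiffAt.comp (g := K) (f := fun z : (P × F) × F => (z.1.1, z.2)) (q, q.2) h2
      (contMDiffAt_fst.fst.prodMk contMDiffAt_snd)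
  have h3 := ContMDiffAt.mfderiv (m := ∞) _ (fun q : P × F => q.2) h1 contMDiffAt_snd (by simp)
  have h4 : ContMDiffAt (J.prod 𝓘(ℝ, F)) 𝓘(ℝ, F →L[ℝ] ℝ) ∞
      (fun q : P × F => fderiv ℝ (fun v => K (q.1, v)) q.2) q := by
    refine ContMDiffAt.congr_of_eventuallyEq h3 (.of_forall fun x => ?_)
    simp only
    rw [← mfderiv_eq_fderiv]
    exact (congrFun (inTangentCoordinates_model_space (I := 𝓘(ℝ, F)) (I' := 𝓘(ℝ, ℝ))
      (fun q : P × F => q.2) (fun q : P × F => K (q.1, q.2))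
      (fun q : P × F => mfderiv 𝓘(ℝ, F) 𝓘(ℝ, ℝ) (fun v => K (q.1, v)) q.2) q) x).symm
  exact h4.clm_apply contMDiffAt_const

theorem contDiff_snd_of_contMDiffOn {U : Set P} {K : P × F → ℝ}
    (hK : ContMDiffOn (J.prod 𝓘(ℝ, F)) 𝓘(ℝ, ℝ) ∞ K (U ×ˢ univ)) {x : P} (hx : x ∈ U) :
    ContDiff ℝ ∞ fun v => K (x, v) := by
  rw [← contMDiff_iff_contDiff, ← contMDiffOn_univ]
  exact hK.comp (contMDiff_const.prodMk contMDiff_id).contMDiffOn fun v _ => ⟨hx, mem_univ v⟩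

/-- Hadamard's lemma for a smooth function on `U × F`, with respect to the second variable: the
coefficients are the integrals of the partial derivatives over the segment from `v₀` to `v`. -/
theorem hadamard [J.Boundaryless] {U : Set P} (hU : IsOpen U) {K : P × F → ℝ}
    (hK : ContMDiffOn (J.prod 𝓘(ℝ, F)) 𝓘(ℝ, ℝ) ∞ K (U ×ˢ univ)) {n : ℕ}
    (b : Module.Basis (Fin n) ℝ F) (v₀ : F) :
    ∃ g : Fin n → P × F → ℝ,
      (∀ l, ContMDiffOn (J.prod 𝓘(ℝ, F)) 𝓘(ℝ, ℝ) ∞ (g l) (U ×ˢ univ)) ∧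
      ∀ x ∈ U, ∀ v, K (x, v) = K (x, v₀) + ∑ l, b.coord l (v - v₀) * g l (x, v) := by
  refine ⟨fun l q => ∫ t in (0 : ℝ)..1,
    fderiv ℝ (fun v => K (q.1, v)) (v₀ + t • (q.2 - v₀)) (b l), fun l => ?_, fun x hx v => ?_⟩
  · refine contMDiffOn_integral (J := J.prod 𝓘(ℝ, F)) (hU.prod isOpen_univ)
      (G := fun z : (P × F) × ℝ =>
        fderiv ℝ (fun v => K (z.1.1, v)) (v₀ + z.2 • (z.1.2 - v₀)) (b l)) ?_
    refine (contMDiffOn_fderiv_snd hU hK (b l)).comp (ContMDiff.contMDiffOn ?_)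
      (f := fun z : (P × F) × ℝ => (z.1.1, v₀ + z.2 • (z.1.2 - v₀)))
      fun z hz => ⟨hz.1.1, mem_univ _⟩
    refine contMDiff_fst.fst.prodMk ?_
    exact contMDiff_const.add (contMDiff_snd.smul (contMDiff_fst.snd.sub contMDiff_const))
  · have hd := contDiff_snd_of_contMDiffOn hK hx
    set k : F → ℝ := fun v => K (x, v) with hk
    have hc : ∀ w : F, Continuous fun t : ℝ => fderiv ℝ k (v₀ + t • (v - v₀)) w := fun w =>
      ((hd.continuous_fderiv (by simp)).comp (by fun_prop)).clm_apply continuous_const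
    have h1 : ∫ t in (0 : ℝ)..1, fderiv ℝ k (v₀ + t • (v - v₀)) (v - v₀) = k v - k v₀ := by
      have := intervalIntegral.integral_eq_sub_of_hasDerivAt (a := 0) (b := 1)
        (f := fun t : ℝ => k (v₀ + t • (v - v₀)))
        (f' := fun t : ℝ => fderiv ℝ k (v₀ + t • (v - v₀)) (v - v₀)) (fun t _ => by
          have h2 : HasDerivAt (fun t : ℝ => v₀ + t • (v - v₀)) (v - v₀) t := by
            simpa using ((hasDerivAt_id t).smul_const (v - v₀)).const_add v₀
          exact ((hd.differentiable (by simp)) _).hasFDerivAt.comp_hasDerivAt t h2)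
        ((hc _).intervalIntegrable _ _)
      simpa using this
    have h2 : ∀ t : ℝ, fderiv ℝ k (v₀ + t • (v - v₀)) (v - v₀) =
        ∑ l, b.coord l (v - v₀) * fderiv ℝ k (v₀ + t • (v - v₀)) (b l) := fun t => by
      conv_lhs => rw [← b.sum_repr (v - v₀)]
      simp only [map_sum, map_smul, smul_eq_mul, Module.Basis.coord_apply]
      rw [b.sum_repr]
    simp only [h2] at h1
    rw [intervalIntegral.integral_finsetSum fun l _ =>
      ((hc (b l)).const_mul _ ).intervalIntegrable _ _] at h1
    simp only [intervalIntegral.integral_const_mul] at h1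
    linarith

end Hadamard

/-! ### Algebras of smooth functions covered by fibred charts -/

section FibredChart

variable {V : Type*} [NormedAddCommGroup V] [NormedSpace ℝ V] {H : Type*} [TopologicalSpace H]
  {I : ModelWithCorners ℝ V H} {N : Type*} [TopologicalSpace N] [ChartedSpace H N]

/-- The smooth functions which vanish on `W`. -/
def vanishingOn (I : ModelWithCorners ℝ V H) (W : Set N) : Ideal (SmoothFun I N) where
  carrier := {f | ∀ p ∈ W, f p = 0}
  zero_mem' := fun _ _ => rfl
  add_mem' := fun {f g} hf hg p hp => by
    change f p + g p = 0
    rw [hf p hp, hg p hp, add_zero]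
  smul_mem' := fun c f hf p hp => by
    change c p * f p = 0
    rw [hf p hp, mul_zero]

theorem SmoothFun.sum_apply {ι : Type*} (s : Finset ι) (f : ι → SmoothFun I N) (p : N) :
    (∑ i ∈ s, f i) p = ∑ i ∈ s, f i p := by
  have : ((∑ i ∈ s, f i : SmoothFun I N) : N → ℝ) = ∑ i ∈ s, (f i : N → ℝ) :=
    map_sum ContMDiffMap.coeFnAddMonoidHom f s
  rw [this, Finset.sum_apply]

/-- Fibre coordinates on `W ⊆ N`, relative to a set `S` of functions which are constant along the
fibres. The functions `x j` and the derivations `d j` are defined on all of `N`, but are coordinates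
and partial derivatives on `W` only. Functions generated by `S` suffice for the remainder `f₀` in
Hadamard's lemma along the fibres, and separate points of `W` from the complement of `W`. -/
structure FibredChart (I : ModelWithCorners ℝ V H) (S : Set (SmoothFun I N)) where
  W : Set N
  n : ℕ
  x : Fin n → SmoothFun I N
  d : Fin n → SmoothFun I N →ₗ[ℝ] SmoothFun I N
  leibniz : ∀ j a b, d j (a * b) = a * d j b + b * d j a
  d_local : ∀ j, ∀ f ∈ vanishingOn I W, d j f ∈ vanishingOn I W
  d_scalar : ∀ j, ∀ s ∈ S, d j s ∈ vanishingOn I W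
  d_x : ∀ i j, ∀ p ∈ W, d i (x j) p = if i = j then 1 else 0
  hadamard : ∀ f : SmoothFun I N, ∀ p ∈ W, ∃ f₀ ∈ Algebra.adjoin ℝ S, ∃ g : Fin n → SmoothFun I N,
    ∀ q ∈ W, f q = f₀ q + ∑ l, (x l q - x l p) * g l q
  separating : ∀ p ∈ W, ∃ c ∈ Algebra.adjoin ℝ S, c p = 0 ∧ ∀ q ∉ W, c q = 1

/-- A map which is linear over `S` is linear over the subalgebra generated by `S`. -/
theorem linear_adjoin {A B : Type*} [CommRing A] [Algebra ℝ A] [CommRing B] [Algebra ℝ B]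
    {S : Set A} (ρ : A →ₐ[ℝ] B) {D : A →ₗ[ℝ] B} (hD : ∀ s ∈ S, ∀ f, D (s * f) = ρ s * D f) {c : A}
    (hc : c ∈ Algebra.adjoin ℝ S) : ∀ f, D (c * f) = ρ c * D f := by
  induction hc using Algebra.adjoin_induction with
  | mem s hs => exact hD s hs
  | algebraMap r => intro f; rw [← Algebra.smul_def, map_smul, AlgHom.commutes, Algebra.smul_def]
  | add a b _ _ ha hb => intro f; rw [add_mul, map_add, ha, hb, map_add, add_mul]
  | mul a b _ _ ha hb => intro f; rw [mul_assoc, ha, hb, map_mul, mul_assoc]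

namespace FibredChart

variable {S : Set (SmoothFun I N)} (C : FibredChart I S)

/-- Operators which are linear over `S` are local over `W`: a function that vanishes on `W` is not
changed by a multiplication with a function generated by `S` that is `1` outside `W` and vanishes at
the given point of `W`. -/
theorem map_mem_vanishingOn {D : SmoothFun I N →ₗ[ℝ] SmoothFun I N}
    (hD : ∀ s ∈ S, ∀ f, D (s * f) = s * D f) {f : SmoothFun I N} (hf : f ∈ vanishingOn I C.W) :
    D f ∈ vanishingOn I C.W := by
  intro p hp
  obtain ⟨c, hc, hcp, hc1⟩ := C.separating p hp
  have h1 : c * f = f := by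
    ext q
    change c q * f q = f q
    by_cases hq : q ∈ C.W
    · rw [hf q hq, mul_zero]
    · rw [hc1 q hq, one_mul]
  have h2 := linear_adjoin (AlgHom.id ℝ _) (D := D) hD hc f
  rw [h1] at h2
  rw [h2]
  change c p * D f p = 0
  rw [hcp, zero_mul]

/-- The restrictions to `W` of the smooth functions. -/
abbrev Alg : Type _ := SmoothFun I N ⧸ vanishingOn I C.W

/-- The restriction of functions to `W`. -/
def res : SmoothFun I N →ₐ[ℝ] C.Alg := Ideal.Quotient.mkₐ ℝ _

theorem res_surjective : Function.Surjective C.res := Ideal.Quotient.mkₐ_surjective ℝ _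

theorem res_eq_zero {f : SmoothFun I N} : C.res f = 0 ↔ f ∈ vanishingOn I C.W :=
  Ideal.Quotient.eq_zero_iff_mem

theorem res_eq {f g : SmoothFun I N} : C.res f = C.res g ↔ ∀ p ∈ C.W, f p = g p := by
  rw [← sub_eq_zero, ← map_sub, C.res_eq_zero]
  exact forall₂_congr fun p _ => sub_eq_zero

/-- The partial derivatives, on functions on `W`. -/
def dRes (j : Fin C.n) : C.Alg →ₗ[ℝ] C.Alg :=
  ((vanishingOn I C.W).restrictScalars ℝ).mapQ ((vanishingOn I C.W).restrictScalars ℝ) (C.d j)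
    (C.d_local j)

theorem dRes_res (j : Fin C.n) (f : SmoothFun I N) : C.dRes j (C.res f) = C.res (C.d j f) := rfl

/-- The value at a point of `W`. -/
def evalAt (p : N) (hp : p ∈ C.W) : C.Alg →ₐ[ℝ] ℝ :=
  Ideal.Quotient.liftₐ _ ((Pi.evalAlgHom ℝ (fun _ : N => ℝ) p).comp ContMDiffMap.coeFnAlgHom)
    fun _ hf => hf p hp

/-- A fibred chart turns the algebra of functions on `W` into an algebra with coordinates. -/
def localCoords : LocalCoords C.Alg (C.res '' S) where
  n := C.n
  x j := C.res (C.x j)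
  d := C.dRes
  leibniz j a b := by
    obtain ⟨a, rfl⟩ := C.res_surjective a
    obtain ⟨b, rfl⟩ := C.res_surjective b
    rw [← map_mul, C.dRes_res, C.dRes_res, C.dRes_res, C.leibniz, map_add, map_mul, map_mul]
  d_scalar := by
    rintro j _ ⟨s, hs, rfl⟩
    rw [C.dRes_res, C.res_eq_zero]
    exact C.d_scalar j s hs
  d_x i j := by
    rw [C.dRes_res]
    have : C.res (C.d i (C.x j)) = C.res (if i = j then 1 else 0) := C.res_eq.2 fun p hp => by
      rw [C.d_x i j p hp]
      split_ifs <;> rfl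
    rw [this]
    split_ifs
    · exact map_one _
    · exact map_zero _
  eq_mul_one r D _ hS hx f := by
    obtain ⟨f, rfl⟩ := C.res_surjective f
    -- By Hadamard's lemma `f` is, on `W`, an element generated by `S` plus terms with a factor
    -- `x l - x l p`. Both can be pulled out of `D`, and the factor vanishes at `p`.
    have key : ∀ p (hp : p ∈ C.W), ∀ b, D (C.res f) - C.res f * D 1 = C.res b → b p = 0 := by
      intro p hp b hb
      obtain ⟨f₀, hf₀, g, hg⟩ := C.hadamard f p hp
      have h1 : C.res f = C.res f₀ + ∑ l, (C.res (C.x l) - algebraMap ℝ _ (C.x l p)) *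
          C.res (g l) := by
        have : C.res f = C.res (f₀ + ∑ l, (C.x l - algebraMap ℝ _ (C.x l p)) * g l) :=
          C.res_eq.2 fun q hq => by
            rw [hg q hq]
            change _ = f₀ q + (∑ l, (C.x l - algebraMap ℝ _ (C.x l p)) * g l : SmoothFun I N) q
            rw [SmoothFun.sum_apply]
            rfl
        rw [this, map_add, map_sum]
        simp only [map_mul, map_sub, AlgHom.commutes]
      have hS' : ∀ s ∈ S, ∀ a, (D ∘ₗ C.res.toLinearMap) (s * a) =
          C.res s * (D ∘ₗ C.res.toLinearMap) a := fun s hs a => by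
        change D (C.res (s * a)) = C.res s * D (C.res a)
        rw [map_mul, hS _ ⟨s, hs, rfl⟩]
      have h2 : D (C.res f₀) = C.res f₀ * D 1 := by
        have := linear_adjoin C.res hS' hf₀ 1
        rw [mul_one] at this
        simpa using this
      have h3 : ∀ l, D ((C.res (C.x l) - algebraMap ℝ _ (C.x l p)) * C.res (g l)) =
          (C.res (C.x l) - algebraMap ℝ _ (C.x l p)) * D (C.res (g l)) := fun l => by
        rw [sub_mul, sub_mul, map_sub, hx, ← Algebra.smul_def, ← Algebra.smul_def, map_smul]
      have h4 : b p = C.evalAt p hp (C.res b) := rfl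
      rw [h4, ← hb, h1, map_add, map_sum, h2]
      have h5 : ∀ l, C.evalAt p hp (C.res (C.x l) - algebraMap ℝ _ (C.x l p)) = 0 := fun l => by
        rw [map_sub, AlgHom.commutes]
        exact sub_self _
      simp only [h3, add_mul, Finset.sum_mul, map_add, map_sub, map_mul, map_sum, mul_assoc]
      have h6 : ∀ l, C.evalAt p hp (C.res (C.x l)) - C.evalAt p hp (algebraMap ℝ _ (C.x l p)) = 0 :=
        fun l => by rw [← map_sub, h5]
      simp only [h6, zero_mul, Finset.sum_const_zero, add_zero, sub_self]
    obtain ⟨b, hb⟩ := C.res_surjective (D (C.res f) - C.res f * D 1)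
    rw [← sub_eq_zero, ← hb, C.res_eq_zero]
    exact fun p hp => key p hp b hb.symm

/-- Multiplication of functions on `W` with a function supported in `W`. -/
def extendBy (χ : SmoothFun I N) (hχ : ∀ q, χ q ≠ 0 → q ∈ C.W) : C.Alg →ₗ[ℝ] SmoothFun I N :=
  ((vanishingOn I C.W).restrictScalars ℝ).liftQ (LinearMap.mulLeft ℝ χ) fun f hf => by
    rw [LinearMap.mem_ker]
    ext q
    change χ q * f q = 0
    by_cases h : χ q = 0
    · rw [h, zero_mul]
    · rw [hf q (hχ q h), mul_zero]

theorem extendBy_res (χ : SmoothFun I N) (hχ : ∀ q, χ q ≠ 0 → q ∈ C.W) (f : SmoothFun I N) (q : N) :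
    C.extendBy χ hχ (C.res f) q = χ q * f q := rfl

theorem extendBy_eq_zero (χ : SmoothFun I N) (hχ : ∀ q, χ q ≠ 0 → q ∈ C.W) (b : C.Alg) {q : N}
    (hq : χ q = 0) : C.extendBy χ hχ b q = 0 := by
  obtain ⟨f, rfl⟩ := C.res_surjective b
  rw [extendBy_res, hq, zero_mul]

end FibredChart

variable {S : Set (SmoothFun I N)} {ι : Type*} (C : ι → FibredChart I S) (χ : ι → SmoothFun I N)
  (hχ : ∀ α q, χ α q ≠ 0 → q ∈ (C α).W)
  (hfin : LocallyFinite fun α => Function.support (χ α))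

/-- The gluing of functions on the domains of fibred charts by means of a partition of unity. -/
def glueFun : (∀ α, (C α).Alg) →ₗ[ℝ] SmoothFun I N :=
  have hf : ∀ b : ∀ α, (C α).Alg, ∀ q,
      (Function.support fun α => (C α).extendBy (χ α) (hχ α) (b α) q).Finite := fun b q =>
    (hfin.point_finite q).subset fun α hα h => hα ((C α).extendBy_eq_zero _ _ _ h)
  { toFun := fun b => ⟨fun q => ∑ᶠ α, (C α).extendBy (χ α) (hχ α) (b α) q,
      contMDiff_finsum (fun α => ((C α).extendBy (χ α) (hχ α) (b α)).contMDiff)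
        (hfin.subset fun α q hq h => hq ((C α).extendBy_eq_zero _ _ _ h))⟩
    map_add' := fun b b' => by
      ext q
      refine Eq.trans ?_ (finsum_add_distrib (hf b q) (hf b' q))
      exact finsum_congr fun α => by rw [Pi.add_apply, map_add]; rfl
    map_smul' := fun c b => by
      ext q
      refine Eq.trans ?_ (smul_finsum' c (hf b q)).symm
      exact finsum_congr fun α => by rw [Pi.smul_apply, map_smul]; rfl }

/-- Over a manifold covered by fibred charts with a subordinate partition of unity, cocycles are
cohomologous to their antisymmetrisations, and the latter are multiderivations. -/
theorem smooth_hkr (hsum : ∀ q, ∑ᶠ α, χ α q = 1) (hχ : ∀ α q, χ α q ≠ 0 → q ∈ (C α).W)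
    (hfin : LocallyFinite fun α => Function.support (χ α)) {k : ℕ} {φ : Cochain (SmoothFun I N) k}
    (hφ : φ ∈ diffCochain _ S k) (hd : hochschildD φ = 0) :
    IsMultiDerivation (altC φ) ∧ ∃ N, φ - (k.factorial : ℝ)⁻¹ • altC φ ∈ ordBd S N k := by
  refine glued_hkr (ρ := fun α => (C α).res) (σ := glueFun C χ hχ hfin) (fun a b => ?_) ?_
    (fun α => (C α).res_surjective) (fun α => (C α).localCoords) (fun α k φ hφ i f hf => ?_) hφ hd
  · ext q
    choose f hf using fun α => (C α).res_surjective (b α)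
    obtain rfl : (fun α => (C α).res (f α)) = b := funext hf
    change ∑ᶠ α, _ = a q * ∑ᶠ α, _
    rw [mul_finsum' _ _ ((hfin.point_finite q).subset fun α hα h =>
      hα ((C α).extendBy_eq_zero _ _ _ h))]
    refine finsum_congr fun α => ?_
    simp only [← map_mul, (C α).extendBy_res]
    exact mul_left_comm (χ α q) (a q) (f α q)
  · ext q
    refine Eq.trans (finsum_congr fun α => ?_) (hsum q)
    change (C α).extendBy (χ α) (hχ α) 1 q = _
    rw [← map_one (C α).res, (C α).extendBy_res]
    exact mul_one _
  · rw [(C α).res_eq_zero] at hf ⊢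
    have := (C α).map_mem_vanishingOn (D := φ.toLinearMap f i) (fun s hs g => ?_) hf
    · simpa using this
    · have := hφ.2 s hs i (Function.update f i g)
      simpa using this

end FibredChart

/-! ### Multivector fields and multiderivations -/

section Expansion

variable {A Y : Type*} [AddCommGroup A] [Module ℝ A] [AddCommGroup Y] [Module ℝ Y]

/-- If a multilinear map is expressed in every argument by functionals `ℓ j` and its values on
elements `x j`, then it is expressed by them in all arguments simultaneously. -/
theorem multilinear_expand {k n : ℕ} (G : MultilinearMap ℝ (fun _ : Fin k => A) Y) (x : Fin n → A)
    (ℓ : Fin n → A →ₗ[ℝ] ℝ)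
    (h : ∀ (s : Fin k) (f : Fin k → A) (a : A), G (Function.update f s a) =
      ∑ j, ℓ j a • G (Function.update f s (x j))) (f : Fin k → A) :
    G f = ∑ J : Fin k → Fin n, (∏ i, ℓ (J i) (f i)) • G (fun i => x (J i)) := by
  classical
  set r : A → A := fun a => ∑ j, ℓ j a • x j with hr
  have h1 : ∀ s f, G f = G (Function.update f s (r (f s))) := fun s f => by
    conv_lhs => rw [← Function.update_eq_self s f, h]
    rw [hr, MultilinearMap.map_update_sum]
    simp only [MultilinearMap.map_update_smul]
  have h2 : ∀ t : Finset (Fin k), G f = G (t.piecewise (fun i => r (f i)) f) := by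
    intro t
    induction t using Finset.induction_on with
    | empty => simp
    | insert i t hi ih =>
      rw [ih, h1 i, Finset.piecewise_insert, Finset.piecewise_eq_of_notMem _ _ _ hi]
  have h3 := h2 Finset.univ
  rw [Finset.piecewise_univ] at h3
  rw [h3, hr, MultilinearMap.map_sum]
  simp only [MultilinearMap.map_smul_univ]

/-- The antisymmetric tensor with components `c J` with respect to vectors `w j`, as an alternating
form on the dual space. -/
def alternatingOf {W : Type*} [AddCommGroup W] [Module ℝ W] [TopologicalSpace W] {k n : ℕ}
    (c : (Fin k → Fin n) → ℝ) (w : Fin n → W) : (W →L[ℝ] ℝ) [⋀^Fin k]→ₗ[ℝ] ℝ :=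
  (k.factorial : ℝ)⁻¹ • MultilinearMap.alternatization
    (∑ J : Fin k → Fin n, c J • (MultilinearMap.mkPiAlgebra ℝ (Fin k) ℝ).compLinearMap fun i =>
      ({ toFun := fun α => α (w (J i)), map_add' := fun _ _ => rfl,
         map_smul' := fun _ _ => rfl } : (W →L[ℝ] ℝ) →ₗ[ℝ] ℝ))

theorem alternatingOf_apply {W : Type*} [AddCommGroup W] [Module ℝ W] [TopologicalSpace W] {k n : ℕ}
    (c : (Fin k → Fin n) → ℝ) (w : Fin n → W) (α : Fin k → W →L[ℝ] ℝ) :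
    alternatingOf c w α = (k.factorial : ℝ)⁻¹ • altSum (fun α : Fin k → W →L[ℝ] ℝ =>
      ∑ J : Fin k → Fin n, c J * ∏ i, α i (w (J i))) α := by
  rw [alternatingOf, AlternatingMap.smul_apply, MultilinearMap.alternatization_apply, altSum]
  congr 1
  refine Finset.sum_congr rfl fun σ _ => ?_
  rw [MultilinearMap.domDomCongr_apply, _root_.sum_apply, Units.smul_def,
    ← Int.cast_smul_eq_zsmul ℝ]
  congr 1

end Expansion

section Fields

variable {V : Type*} [NormedAddCommGroup V] [NormedSpace ℝ V] {H : Type*} [TopologicalSpace H]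
  {I : ModelWithCorners ℝ V H} {N : Type*} [TopologicalSpace N] [ChartedSpace H N]
  [IsManifold I ∞ N] [FiniteDimensional ℝ V]

/-- A smooth function on an open set agrees near a given point with a smooth function on `N`. -/
theorem exists_smooth_extension [T2Space N] {U : Set N} (hU : IsOpen U) {g : N → ℝ}
    (hg : ContMDiffOn I 𝓘(ℝ, ℝ) ∞ g U) {x : N} (hx : x ∈ U) :
    ∃ f : SmoothFun I N, (f : N → ℝ) =ᶠ[nhds x] g := by
  obtain ⟨b, -, hb⟩ :=
    (SmoothBumpFunction.nhds_basis_tsupport (I := I) x).mem_iff.1 (hU.mem_nhds hx)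
  refine ⟨⟨fun y => b y • g y, contMDiff_of_tsupport fun y hy => ?_⟩, ?_⟩
  · have h1 : y ∈ U := hb (tsupport_smul_subset_left _ _ hy)
    exact b.contMDiffAt.smul (hg.contMDiffAt (hU.mem_nhds h1))
  · filter_upwards [b.eventuallyEq_one] with y hy
    change b y • g y = g y
    rw [hy, Pi.one_apply, one_smul]

theorem dAt_congr {f : SmoothFun I N} {g : N → ℝ} {x : N} (h : (f : N → ℝ) =ᶠ[nhds x] g) :
    dAt I f x = mfderiv I 𝓘(ℝ, ℝ) g x := h.mfderiv_eq

/-- There is a function which is a linear coordinate of the chart at `x₀` in a neighbourhood of `x`.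
-/
theorem exists_dAt_eventuallyEq [T2Space N] (x₀ : N) (α : V →L[ℝ] ℝ) {x : N}
    (hx : x ∈ (chartAt H x₀).source) : ∃ f : SmoothFun I N, ∀ᶠ y in nhds x,
      dAt I f y = α.comp (mfderiv I 𝓘(ℝ, V) (extChartAt I x₀) y) := by
  have h1 : ContMDiffOn I 𝓘(ℝ, ℝ) ∞ (fun y => α (extChartAt I x₀ y)) (chartAt H x₀).source :=
    α.contMDiff.comp_contMDiffOn contMDiffOn_extChartAt
  obtain ⟨f, hf⟩ := exists_smooth_extension (chartAt H x₀).open_source h1 hx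
  refine ⟨f, ?_⟩
  filter_upwards [hf.eventuallyEq_nhds, (chartAt H x₀).open_source.mem_nhds hx] with y hy hys
  rw [dAt_congr hy]
  have h2 := mfderiv_comp (I := I) (I' := 𝓘(ℝ, V)) (I'' := 𝓘(ℝ, ℝ)) y
    (f := extChartAt I x₀) (g := α) α.mdifferentiableAt
    (mdifferentiableAt_extChartAt hys)
  refine h2.trans ?_
  rw [mfderiv_eq_fderiv, α.fderiv]
  rfl

/-- Every covector is the differential of a function. -/
theorem exists_dAt_eq [T2Space N] (x : N) (α : TangentSpace I x →L[ℝ] ℝ) :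
    ∃ f : SmoothFun I N, dAt I f x = α := by
  set e : TangentSpace I x →L[ℝ] V := mfderiv I 𝓘(ℝ, V) (extChartAt I x) x with he
  have h1 : e.IsInvertible := isInvertible_mfderiv_extChartAt (mem_extChartAt_source (I := I) x)
  obtain ⟨f, hf⟩ := exists_dAt_eventuallyEq (I := I) x (α.comp e.inverse) (mem_chart_source H x)
  refine ⟨f, hf.self_of_nhds.trans ?_⟩
  ext v
  exact congrArg α (DFunLike.congr_fun h1.inverse_comp_self v)

/-- A family of fibred charts of `N` with a subordinate partition of unity, such that the partial
derivatives of the charts are given by vectors in the subspaces `D p ⊆ T_pN`. -/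
structure FibredAtlas (D : ∀ p : N, Submodule ℝ (TangentSpace I p)) (S : Set (SmoothFun I N))
    (ι : Type*) where
  C : ι → FibredChart I S
  vec : ∀ α, Fin (C α).n → ∀ p : N, D p
  d_apply : ∀ α j f p, (C α).d j f p = dAt I f p (vec α j p)
  χ : ι → SmoothFun I N
  mem_of_ne_zero : ∀ α q, χ α q ≠ 0 → q ∈ (C α).W
  locallyFinite : LocallyFinite fun α => Function.support (χ α)
  sum_eq_one : ∀ q, ∑ᶠ α, χ α q = 1

variable {D : ∀ p : N, Submodule ℝ (TangentSpace I p)} {S : Set (SmoothFun I N)} {ι : Type*}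
  {k : ℕ}

theorem FibredAtlas.exists_mem (L : FibredAtlas D S ι) (p : N) : ∃ α, p ∈ (L.C α).W := by
  by_contra! h
  have h1 := L.sum_eq_one p
  rw [finsum_eq_zero_of_forall_eq_zero fun α => ?_] at h1
  · exact zero_ne_one h1
  · by_contra h2
    exact h α (L.mem_of_ne_zero α p h2)

/-- The local formula for a multiderivation that is linear over `S`. -/
theorem FibredAtlas.multiDerivation_apply (L : FibredAtlas D S ι)
    {Φ : Cochain (SmoothFun I N) k} (hΦ : IsMultiDerivation Φ) (hS : IsLinearOver S Φ)
    {α : ι} {p : N} (hp : p ∈ (L.C α).W) (f : Fin k → SmoothFun I N) :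
    Φ f p = ∑ J : Fin k → Fin (L.C α).n, Φ (fun i => (L.C α).x (J i)) p *
      ∏ i, dAt I (f i) p (L.vec α (J i) p) := by
  set C := L.C α
  have hloc : ∀ (i : Fin k) (f : Fin k → SmoothFun I N), C.res (f i) = 0 → C.res (Φ f) = 0 :=
    fun i f hf => by
      rw [C.res_eq_zero] at hf ⊢
      have := C.map_mem_vanishingOn (D := Φ.toLinearMap f i) (fun s hs g => ?_) hf
      · simpa using this
      · have := hS s hs i (Function.update f i g)
        simpa using this
  obtain ⟨χ, hχ⟩ := exists_isRelated C.res_surjective Φ hloc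
  have hχS : IsLinearOver (C.res '' S) χ := by
    have h1 := hχ.mem_ordCochain C.res_surjective subset_rfl
      (hΦ.mem_ordCochain hS)
    exact h1.2
  have hχd : IsMultiDerivation χ := fun g i a b => by
    choose f hf using fun i => C.res_surjective (g i)
    obtain rfl : (fun i => C.res (f i)) = g := funext hf
    obtain ⟨a, rfl⟩ := C.res_surjective a
    obtain ⟨b, rfl⟩ := C.res_surjective b
    rw [← map_mul, update_map, update_map, update_map, hχ, hχ, hχ, hΦ, map_add, map_mul, map_mul]
  let ev : SmoothFun I N →ₗ[ℝ] ℝ := ⟨⟨fun f => f p, fun _ _ => rfl⟩, fun _ _ => rfl⟩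
  let ℓ : Fin C.n → SmoothFun I N →ₗ[ℝ] ℝ := fun j => ev ∘ₗ C.d j
  have h1 := multilinear_expand (ev.compMultilinearMap Φ) C.x ℓ (fun s f a => ?_) f
  · refine h1.trans (Finset.sum_congr rfl fun J _ => ?_)
    rw [smul_eq_mul, mul_comm]
    congr 1
    exact Finset.prod_congr rfl fun i _ => L.d_apply α _ _ _
  · have h2 := C.localCoords.multiDerivation_eq_sum hχd hχS s (fun i => C.res (f i)) (C.res a)
    have h3 : C.res (Φ (Function.update f s a)) =
        C.res (∑ j, C.d j a * Φ (Function.update f s (C.x j))) := by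
      rw [← hχ, ← update_map, h2, map_sum]
      refine Finset.sum_congr rfl fun j _ => ?_
      rw [map_mul, ← hχ, ← update_map]
      rfl
    refine (C.res_eq.1 h3 p hp).trans ?_
    rw [SmoothFun.sum_apply]
    rfl

/-- A multivector field is determined by its values on differentials of functions. -/
theorem evalCochain_injective [I.Boundaryless] [T2Space N] :
    Function.Injective (evalCochain (I := I) (D := D) (k := k)) := by
  refine (injective_iff_map_eq_zero _).2 fun X hX => ?_
  ext x α
  choose f hf using fun i => exists_dAt_eq x (α i)
  have h1 := congrArg (fun φ : Cochain (SmoothFun I N) k => φ f x) hX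
  simp only [evalCochain_apply, hf] at h1
  exact h1

theorem isAlt_evalCochain [I.Boundaryless] (X : multivectorField D k) :
    IsAlt (evalCochain X) := fun σ f => by
  ext x
  refine ((X.1 x).map_perm (fun i => dAt I (f i) x) σ).trans ?_
  rw [Units.smul_def, ← Int.cast_smul_eq_zsmul ℝ]
  rfl

/-- Antisymmetric multiderivations which are linear over `S` are given by multivector fields
tangent to `D`. -/
theorem FibredAtlas.exists_evalCochain_eq [I.Boundaryless] [T2Space N] (L : FibredAtlas D S ι)
    {Φ : Cochain (SmoothFun I N) k} (hΦ : IsMultiDerivation Φ) (hS : IsLinearOver S Φ)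
    (halt : IsAlt Φ) : ∃ X : multivectorField D k, evalCochain X = Φ := by
  choose a ha using L.exists_mem
  -- At each point the tensor is built in one fibred chart; it depends on `Φ` only, since it is
  -- determined by its values on differentials.
  let b : ∀ p, (D p →L[ℝ] ℝ) [⋀^Fin k]→ₗ[ℝ] ℝ := fun p =>
    alternatingOf (fun J => Φ (fun i => (L.C (a p)).x (J i)) p) fun j => L.vec (a p) j p
  let X : ∀ p, MultivectorAt I k p := fun p => (b p).compLinearMap
    { toFun := fun α => α.comp (D p).subtypeL
      map_add' := fun _ _ => rfl
      map_smul' := fun _ _ => rfl }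
  have hX₀ : ∀ p α, X p α = alternatingOf (fun J => Φ (fun i => (L.C (a p)).x (J i)) p)
      (fun j => L.vec (a p) j p) (fun i => (α i).comp (D p).subtypeL) := fun _ _ => rfl
  have hX : ∀ f p, X p (fun i => dAt I (f i) p) = Φ f p := fun f p => by
    rw [hX₀, alternatingOf_apply]
    have h1 := congrArg (fun g : SmoothFun I N => g p) (halt.altSum f)
    have h2 : altSum Φ f p = altSum (fun α : Fin k → D p →L[ℝ] ℝ =>
        ∑ J : Fin k → Fin (L.C (a p)).n, Φ (fun i => (L.C (a p)).x (J i)) p *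
          ∏ i, α i (L.vec (a p) (J i) p)) (fun i => (dAt I (f i) p).comp (D p).subtypeL) := by
      rw [altSum, altSum, SmoothFun.sum_apply]
      refine Finset.sum_congr rfl fun σ _ => ?_
      exact congrArg (fun t : ℝ => ((Equiv.Perm.sign σ : ℤ) : ℝ) * t)
        (L.multiDerivation_apply hΦ hS (ha p) (f ∘ σ))
    refine (congrArg _ (h2.symm.trans h1)).trans ?_
    change (k.factorial : ℝ)⁻¹ * ((k.factorial : ℝ) * Φ f p) = _
    rw [inv_mul_cancel_left₀ (by positivity)]
  refine ⟨⟨X, fun x₀ α x hx => ?_, fun p => ⟨b p, fun α => rfl⟩⟩, ?_⟩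
  · choose f hf using fun i => exists_dAt_eventuallyEq (I := I) x₀ (α i) hx
    refine (((Φ f).contMDiff x).congr_of_eventuallyEq ?_).contMDiffWithinAt
    filter_upwards [Filter.eventually_all.2 hf] with y hy
    rw [← hX]
    simp only [hy]
  · ext f p
    exact hX f p

end Fields

/-! ### The Hochschild-Kostant-Rosenberg isomorphism -/

section Transport

variable {A B : ℕ → Type*} [∀ k, AddCommGroup (A k)] [∀ k, Module ℝ (A k)]
  [∀ k, AddCommGroup (B k)] [∀ k, Module ℝ (B k)]

/-- A family of linear isomorphisms as a linear isomorphism of direct sums. -/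
def directSumEquiv (u : ∀ k, A k ≃ₗ[ℝ] B k) : (⨁ k, A k) ≃ₗ[ℝ] (⨁ k, B k) :=
  LinearEquiv.ofLinearMap (DirectSum.lmap fun k => (u k).toLinearMap)
    (DirectSum.lmap fun k => (u k).symm.toLinearMap)
    (by ext k x : 2; simp) (by ext k x : 2; simp)

@[simp] theorem directSumEquiv_lof (u : ∀ k, A k ≃ₗ[ℝ] B k) (k : ℕ) (a : A k) :
    directSumEquiv u (DirectSum.lof ℝ ℕ A k a) = DirectSum.lof ℝ ℕ B k (u k a) :=
  DirectSum.lmap_lof ..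

@[simp] theorem directSumEquiv_symm_lof (u : ∀ k, A k ≃ₗ[ℝ] B k) (k : ℕ) (b : B k) :
    (directSumEquiv u).symm (DirectSum.lof ℝ ℕ B k b) = DirectSum.lof ℝ ℕ A k ((u k).symm b) :=
  DirectSum.lmap_lof ..

/-- The transport of a Gerstenhaber algebra structure along linear isomorphisms. -/
def GerstenhaberAlgebra.transport (G : GerstenhaberAlgebra B) (u : ∀ k, A k ≃ₗ[ℝ] B k) :
    GerstenhaberAlgebra A where
  one := (u 0).symm G.one
  mul := (G.mul.compl₁₂ (directSumEquiv u).toLinearMap (directSumEquiv u).toLinearMap).compr₂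
    (directSumEquiv u).symm.toLinearMap
  bracket := (G.bracket.compl₁₂ (directSumEquiv u).toLinearMap
    (directSumEquiv u).toLinearMap).compr₂ (directSumEquiv u).symm.toLinearMap
  mul_mem m n a b := by
    obtain ⟨c, hc⟩ := G.mul_mem m n (u m a) (u n b)
    exact ⟨(u _).symm c, by simp [hc]⟩
  bracket_mem m n p h a b := by
    obtain ⟨c, hc⟩ := G.bracket_mem m n p h (u m a) (u n b)
    exact ⟨(u _).symm c, by simp [hc]⟩
  bracket_zero_zero a b := by simp [G.bracket_zero_zero]
  one_mul a := by simp [G.one_mul]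
  mul_assoc a b c := by simp [G.mul_assoc]
  mul_comm m n a b := by
    simp only [LinearMap.compr₂_apply, LinearMap.compl₁₂_apply, LinearEquiv.coe_coe,
      directSumEquiv_lof]
    rw [G.mul_comm, LinearEquiv.map_smul]
  bracket_antisymm m n a b := by
    simp only [LinearMap.compr₂_apply, LinearMap.compl₁₂_apply, LinearEquiv.coe_coe,
      directSumEquiv_lof]
    rw [G.bracket_antisymm, map_neg, LinearEquiv.map_smul]
  jacobi m n a b c := by
    simp only [LinearMap.compr₂_apply, LinearMap.compl₁₂_apply, LinearEquiv.coe_coe,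
      directSumEquiv_lof, LinearEquiv.apply_symm_apply]
    rw [G.jacobi, LinearEquiv.map_add, LinearEquiv.map_smul]
  leibniz m p a b c := by
    simp only [LinearMap.compr₂_apply, LinearMap.compl₁₂_apply, LinearEquiv.coe_coe,
      directSumEquiv_lof, LinearEquiv.apply_symm_apply]
    rw [G.leibniz, LinearEquiv.map_add, LinearEquiv.map_smul]

theorem GerstenhaberAlgebra.transport_mul (G : GerstenhaberAlgebra B) (u : ∀ k, A k ≃ₗ[ℝ] B k)
    (a b : ⨁ k, A k) : (G.transport u).mul a b =
      (directSumEquiv u).symm (G.mul (directSumEquiv u a) (directSumEquiv u b)) := rfl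

theorem GerstenhaberAlgebra.transport_bracket (G : GerstenhaberAlgebra B)
    (u : ∀ k, A k ≃ₗ[ℝ] B k) (a b : ⨁ k, A k) : (G.transport u).bracket a b =
      (directSumEquiv u).symm (G.bracket (directSumEquiv u a) (directSumEquiv u b)) := rfl

theorem GerstenhaberAlgebra.transport_mul_lof (G : GerstenhaberAlgebra B)
    (u : ∀ k, A k ≃ₗ[ℝ] B k) {m n p : ℕ} {a : A m} {b : A n} {c : B p}
    (h : G.mul (DirectSum.lof ℝ ℕ B m (u m a)) (DirectSum.lof ℝ ℕ B n (u n b)) =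
      DirectSum.lof ℝ ℕ B p c) :
    (G.transport u).mul (DirectSum.lof ℝ ℕ A m a) (DirectSum.lof ℝ ℕ A n b) =
      DirectSum.lof ℝ ℕ A p ((u p).symm c) := by
  rw [transport_mul, directSumEquiv_lof, directSumEquiv_lof, h, directSumEquiv_symm_lof]

theorem GerstenhaberAlgebra.transport_bracket_lof (G : GerstenhaberAlgebra B)
    (u : ∀ k, A k ≃ₗ[ℝ] B k) {m n p : ℕ} {a : A m} {b : A n} {c : B p}
    (h : G.bracket (DirectSum.lof ℝ ℕ B m (u m a)) (DirectSum.lof ℝ ℕ B n (u n b)) =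
      DirectSum.lof ℝ ℕ B p c) :
    (G.transport u).bracket (DirectSum.lof ℝ ℕ A m a) (DirectSum.lof ℝ ℕ A n b) =
      DirectSum.lof ℝ ℕ A p ((u p).symm c) := by
  rw [transport_bracket, directSumEquiv_lof, directSumEquiv_lof, h, directSumEquiv_symm_lof]

theorem isGerstenhaberHom_transport (G : GerstenhaberAlgebra B) (u : ∀ k, A k ≃ₗ[ℝ] B k) :
    IsGerstenhaberHom (G.transport u) G fun k => (u k).toLinearMap where
  map_one := (u 0).apply_symm_apply _
  map_mul _ _ := (directSumEquiv u).apply_symm_apply _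
  map_bracket _ _ := (directSumEquiv u).apply_symm_apply _

end Transport

section Wedge

variable {V : Type*} [NormedAddCommGroup V] [NormedSpace ℝ V] {H : Type*} [TopologicalSpace H]
  {I : ModelWithCorners ℝ V H} {N : Type*} [TopologicalSpace N] [ChartedSpace H N]

/-- The wedge product as a sum over all permutations instead of shuffles. -/
theorem factorial_smul_wedgeAt {m n p : ℕ} (h : m + n = p) {x : N} (a : MultivectorAt I m x)
    (b : MultivectorAt I n x) (α : Fin p → TangentSpace I x →L[ℝ] ℝ) :
    (m.factorial * n.factorial : ℝ) * wedgeAt h a b α =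
      altSum (fun α : Fin p → TangentSpace I x →L[ℝ] ℝ =>
        a (fun i => α ⟨i, by omega⟩) * b (fun j => α ⟨m + j, by omega⟩)) α := by
  set e : Fin m ⊕ Fin n ≃ Fin p := finSumFinEquiv.trans (finCongr h) with he
  have h1 := MultilinearMap.domCoprod_alternization_eq a b
  have h2 := congrArg (fun g => LinearMap.mul' ℝ ℝ (g fun i => α (e i))) h1
  rw [Fintype.card_fin, Fintype.card_fin] at h2
  have h3 : LinearMap.mul' ℝ ℝ (((m.factorial * n.factorial) • a.domCoprod b) fun i => α (e i)) =
      (m.factorial * n.factorial : ℝ) * wedgeAt h a b α := by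
    rw [AlternatingMap.smul_apply, ← Nat.cast_smul_eq_nsmul ℝ, map_smul, smul_eq_mul]
    push_cast
    rfl
  rw [← h3, ← h2, MultilinearMap.alternatization_apply, map_sum, altSum]
  refine Fintype.sum_equiv e.permCongr _ _ fun σ => ?_
  rw [Equiv.Perm.sign_permCongr, Units.smul_def, map_zsmul, ← Int.cast_smul_eq_zsmul ℝ]
  congr 1
  change (a fun i => α (e (σ (Sum.inl i)))) * (b fun j => α (e (σ (Sum.inr j)))) = _
  congr 2
  · funext i
    have : (⟨i, by omega⟩ : Fin p) = e (Sum.inl i) := by ext; simp [he]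
    simp [this]
  · funext j
    have : (⟨m + j, by omega⟩ : Fin p) = e (Sum.inr j) := by ext; simp [he]
    simp [this]

end Wedge

section HKR

variable {V : Type*} [NormedAddCommGroup V] [NormedSpace ℝ V] {H : Type*} [TopologicalSpace H]
  {I : ModelWithCorners ℝ V H} {N : Type*} [TopologicalSpace N] [ChartedSpace H N]
  [IsManifold I ∞ N] [FiniteDimensional ℝ V] [I.Boundaryless] [T2Space N]
  {D : ∀ p : N, Submodule ℝ (TangentSpace I p)} {S : Set (SmoothFun I N)} {ι : Type*} {k : ℕ}

/-- The factor `1 / k!` of the HKR map is normalised so that antisymmetrisation recovers the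
multiderivation of the field. -/
theorem altC_hkrCochain (X : multivectorField D k) : altC (hkrCochain X) = evalCochain X := by
  change altC ((k.factorial : ℝ)⁻¹ • evalCochain X) = _
  ext f : 1
  rw [altC_smul, _root_.smul_apply, altC_apply, (isAlt_evalCochain X).altSum, smul_smul,
    inv_mul_cancel₀ (by positivity), one_smul]

theorem coe_hkr (hS : IsConstantAlong D S) (X : multivectorField D k) :
    (hkr hS k X).1.1 = hkrCochain X := rfl

theorem mem_coboundary_of_ordBd {A : Type*} [CommRing A] [Algebra ℝ A] {S : Set A} {M k : ℕ}
    {x : diffCochain A S k} (h : x.1 ∈ ordBd S M k) : x ∈ Coboundary A S k := by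
  cases k with
  | zero => exact (Submodule.mem_bot ℝ).2 (Subtype.ext ((Submodule.mem_bot ℝ).1 h))
  | succ k =>
    obtain ⟨ψ, hψ, h⟩ := Submodule.mem_map.1 h
    exact ⟨⟨ψ, ordCochain_le_diffCochain _ _ hψ⟩, Subtype.ext h⟩

theorem altC_of_mem_coboundary {A : Type*} [CommRing A] [Algebra ℝ A] {S : Set A} {k : ℕ}
    {x : diffCochain A S k} (h : x ∈ Coboundary A S k) : altC x.1 = 0 := by
  cases k with
  | zero =>
    obtain rfl := (Submodule.mem_bot ℝ).1 h
    have := altC_smul (0 : ℝ) (0 : Cochain A 0)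
    rwa [zero_smul, zero_smul] at this
  | succ k =>
    obtain ⟨ψ, rfl⟩ := h
    exact altC_hochschildD ψ.1

/-- The class of a cocycle determines its antisymmetrisation. -/
theorem altC_eq_of_mk_eq {A : Type*} [CommRing A] [Algebra ℝ A] {S : Set A} {k : ℕ}
    {x y : Cocycle A S k} (h : HH.mk k x = HH.mk k y) : altC x.1.1 = altC y.1.1 := by
  have h1 := altC_of_mem_coboundary (x := x.1 - y.1)
    ((Submodule.Quotient.eq ((Coboundary A S k).comap (Cocycle A S k).subtype)).1 h)
  have h2 := altC_add (x.1.1 - y.1.1) y.1.1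
  rw [sub_add_cancel] at h2
  rw [h2]
  exact (congrArg (· + altC y.1.1) h1).trans (zero_add _)

theorem circ_smul_smul {A : Type*} [CommRing A] [Algebra ℝ A] {m n p : ℕ} (h : m + n = p + 1)
    (c c' : ℝ) (φ : Cochain A m) (ψ : Cochain A n) :
    circ h (c • φ) (c' • ψ) = (c * c') • circ h φ ψ := by
  ext f
  simp only [circ, _root_.sum_apply, _root_.smul_apply, insertAt_apply, Finset.smul_sum]
  refine Finset.sum_congr rfl fun i _ => ?_
  have : insertArgs h i (c' • ψ) f =
      Function.update (insertArgs h i ψ f) i (c' • insertArgs h i ψ f i) := by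
    funext j
    rcases eq_or_ne j i with rfl | hj
    · simp [insertArgs]
    · simp [insertArgs, hj]
  rw [this, MultilinearMap.map_update_smul, Function.update_eq_self, smul_smul, smul_smul,
    smul_smul]
  congr 1
  ring

theorem altC_sub_smul {A : Type*} [CommRing A] [Algebra ℝ A] (φ ψ : Cochain A k) (c : ℝ)
    (f : Fin k → A) : altC (φ - c • ψ) f = altC φ f - c • altC ψ f := by
  have h := congrArg (fun χ : Cochain A k => χ f) (altC_add (φ - c • ψ) (c • ψ))
  simp only [sub_add_cancel, altC_smul, _root_.add_apply, _root_.smul_apply] at h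
  rw [h, add_sub_cancel_right]

namespace FibredAtlas

/-- Every cocycle is cohomologous to `1 / k!` times its antisymmetrisation, which is a
multiderivation. -/
theorem hkr_cocycle (L : FibredAtlas D S ι) (c : Cocycle (SmoothFun I N) S k) :
    IsMultiDerivation (altC c.1.1) ∧
    ∃ M, c.1.1 - (k.factorial : ℝ)⁻¹ • altC c.1.1 ∈ ordBd S M k :=
  smooth_hkr L.C L.χ L.sum_eq_one L.mem_of_ne_zero L.locallyFinite c.1.2
    (congrArg Subtype.val (LinearMap.mem_ker.1 c.2))

/-- The class of a cocycle is determined by its antisymmetrisation. -/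
theorem mk_eq_of_altC_eq (L : FibredAtlas D S ι) {c c' : Cocycle (SmoothFun I N) S k}
    (h : altC c.1.1 = altC c'.1.1) :
    HH.mk k c = HH.mk k c' := by
  obtain ⟨M, hM⟩ := (L.hkr_cocycle c).2
  obtain ⟨M', hM'⟩ := (L.hkr_cocycle c').2
  refine (Submodule.Quotient.eq _).2 (mem_coboundary_of_ordBd (M := M + M') ?_)
  have := sub_mem (ordBd_mono (Nat.le_add_right M M') _ hM)
    (ordBd_mono (Nat.le_add_left M' M) _ hM')
  rw [h, sub_sub_sub_cancel_right] at this
  exact this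

/-- A multivector field corresponds to the class of a cocycle if and only if its multiderivation is
the antisymmetrisation of the cocycle. -/
theorem mk_hkr_eq_iff (L : FibredAtlas D S ι)
    (hS : IsConstantAlong D S) {X : multivectorField D k} {c : Cocycle (SmoothFun I N) S k} :
    HH.mk k (hkr hS k X) = HH.mk k c ↔ evalCochain X = altC c.1.1 := by
  rw [← altC_hkrCochain, ← coe_hkr hS]
  exact ⟨fun h => altC_eq_of_mk_eq h, fun h => L.mk_eq_of_altC_eq h⟩

/-- The Hochschild-Kostant-Rosenberg theorem. -/
theorem hkr_bijective (L : FibredAtlas D S ι)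
    (hS : IsConstantAlong D S) : Function.Bijective (HH.mk k ∘ₗ hkr hS k) := by
  refine ⟨fun X Y h => evalCochain_injective ?_, fun c => ?_⟩
  · rw [(L.mk_hkr_eq_iff hS).1 h]
    exact altC_hkrCochain Y
  · obtain ⟨c, rfl⟩ := HH.mk_surjective k c
    obtain ⟨X, hX⟩ := L.exists_evalCochain_eq (L.hkr_cocycle c).1 c.1.2.2.altC (isAlt_altC _)
    exact ⟨X, (L.mk_hkr_eq_iff hS).2 hX⟩

/-- The Hochschild-Kostant-Rosenberg isomorphism. -/
def hkrEquiv (L : FibredAtlas D S ι)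
    (hS : IsConstantAlong D S) (k : ℕ) : multivectorField D k ≃ₗ[ℝ] HH (SmoothFun I N) S k :=
  LinearEquiv.ofBijective (HH.mk k ∘ₗ hkr hS k) (L.hkr_bijective hS)

/-- The multivector fields with the structure of a Gerstenhaber algebra that corresponds to the one
of the Hochschild cohomology. -/
def schoutenGerstenhaber (L : FibredAtlas D S ι)
    (hS : IsConstantAlong D S) : GerstenhaberAlgebra fun k => multivectorField D k :=
  (hochschildGerstenhaber (SmoothFun I N) S).transport (L.hkrEquiv hS)

theorem hkrEquiv_symm_eq (L : FibredAtlas D S ι)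
    (hS : IsConstantAlong D S) {c : Cocycle (SmoothFun I N) S k} :
    evalCochain ((L.hkrEquiv hS k).symm (HH.mk k c)) = altC c.1.1 :=
  (L.mk_hkr_eq_iff hS).1 ((L.hkrEquiv hS k).apply_symm_apply _)

theorem isGerstenhaberHom_hkr (L : FibredAtlas D S ι) (hS : IsConstantAlong D S) :
    IsGerstenhaberHom (L.schoutenGerstenhaber hS) (hochschildGerstenhaber (SmoothFun I N) S)
      fun k => HH.mk k ∘ₗ hkr hS k :=
  @isGerstenhaberHom_transport (fun k => multivectorField D k) (fun k => HH (SmoothFun I N) S k)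
    inferInstance inferInstance inferInstance inferInstance (hochschildGerstenhaber _ _)
    (L.hkrEquiv hS)

/-- The transported structure is given by the wedge product and the Schouten bracket: these are the
antisymmetrisations of the cup product and of the Gerstenhaber bracket of HKR cocycles. -/
theorem isSchoutenGerstenhaber (L : FibredAtlas D S ι)
    (hS : IsConstantAlong D S) : IsSchoutenGerstenhaber (L.schoutenGerstenhaber hS) where
  one x α := by
    choose f hf using fun i => exists_dAt_eq x (α i)
    have h1 := congrArg (fun φ : Cochain (SmoothFun I N) 0 => φ f x)
      (L.hkrEquiv_symm_eq hS (c := oneZ _ S))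
    simp only [evalCochain_apply, hf] at h1
    refine h1.trans ?_
    rw [altC_apply, altSum, SmoothFun.sum_apply, Fintype.sum_unique]
    change ((Equiv.Perm.sign (default : Equiv.Perm (Fin 0)) : ℤ) : ℝ) * 1 = 1
    simp
  mul m n X Y := by
    refine ⟨(L.hkrEquiv hS _).symm (HH.mk _ (cupZ m n (hkr hS m X) (hkr hS n Y))), fun x => ?_, ?_⟩
    · ext α
      choose f hf using fun i => exists_dAt_eq x (α i)
      have h1 := congrArg (fun φ : Cochain (SmoothFun I N) (m + n) => φ f x)
        (L.hkrEquiv_symm_eq hS (c := cupZ m n (hkr hS m X) (hkr hS n Y)))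
      simp only [evalCochain_apply, hf] at h1
      refine h1.trans ?_
      have h2 := factorial_smul_wedgeAt rfl (X.1 x) (Y.1 x) α
      have h3 : (m.factorial * n.factorial : ℝ) ≠ 0 := by positivity
      refine mul_left_cancel₀ h3 (Eq.trans ?_ h2.symm)
      rw [altC_apply, altSum, SmoothFun.sum_apply, altSum, Finset.mul_sum]
      refine Finset.sum_congr rfl fun σ _ => ?_
      have h4 : (cupZ m n (hkr hS m X) (hkr hS n Y)).1.1 (f ∘ σ) x =
          ((m.factorial : ℝ)⁻¹ * X.1 x (fun i => dAt I (f (σ ⟨i, by omega⟩)) x)) *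
          ((n.factorial : ℝ)⁻¹ * Y.1 x (fun j => dAt I (f (σ ⟨m + j, by omega⟩)) x)) := rfl
      change (m.factorial * n.factorial : ℝ) * (((Equiv.Perm.sign σ : ℤ) : ℝ) *
        (cupZ m n (hkr hS m X) (hkr hS n Y)).1.1 (f ∘ σ) x) = ((Equiv.Perm.sign σ : ℤ) : ℝ) *
          ((X.1 x fun i => α (σ ⟨i, by omega⟩)) * (Y.1 x fun j => α (σ ⟨m + j, by omega⟩)))
      rw [h4]
      simp only [hf]
      field_simp
    · exact GerstenhaberAlgebra.transport_mul_lof _ _ (hhMul_cls (hkr hS m X) (hkr hS n Y))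
  bracket m n p h X Y := by
    obtain rfl : m + n - 1 = p := by omega
    refine ⟨(L.hkrEquiv hS _).symm (HH.mk _ (bracketZ m n (hkr hS m X) (hkr hS n Y))),
      fun f => ?_, ?_⟩
    · rw [L.hkrEquiv_symm_eq hS]
      have h1 : (bracketZ m n (hkr hS m X) (hkr hS n Y)).1.1 =
          gBracket h (hkrCochain X) (hkrCochain Y) := ext_onSeq fun F => by
        rw [onSeq_bracketZ, onSeq_gBracket_eq, coe_hkr, coe_hkr]
      have h2 : ∀ {m' n' : ℕ} (h : m' + n' = (m + n - 1) + 1) (X : multivectorField D m')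
          (Y : multivectorField D n'), altC (circ h (hkrCochain X) (hkrCochain Y)) f =
          shuffleComp h (evalCochain X) (evalCochain Y) f := fun {m' n'} h X Y => by
        have h3 : circ h (hkrCochain X) (hkrCochain Y) =
            ((m'.factorial : ℝ)⁻¹ * (n'.factorial : ℝ)⁻¹) •
              circ h (evalCochain X) (evalCochain Y) :=
          circ_smul_smul h _ _ _ _
        rw [h3, altC_smul, _root_.smul_apply, altC_apply, altSum_circ h (isAlt_evalCochain X),
          smul_smul, ← mul_inv, inv_mul_cancel₀ (by positivity), one_smul]
      rw [h1, gBracket, altC_sub_smul, h2 h, h2]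
    · exact GerstenhaberAlgebra.transport_bracket_lof _ _
        (hhBracket_cls (hkr hS m X) (hkr hS n Y))

end FibredAtlas

end HKR

/-! ### Fibred charts from local product structures -/

section ProductChart

open Set

variable {V : Type*} [NormedAddCommGroup V] [NormedSpace ℝ V] {H : Type*} [TopologicalSpace H]
  {I : ModelWithCorners ℝ V H} {N : Type*} [TopologicalSpace N] [ChartedSpace H N]
  {V' : Type*} [NormedAddCommGroup V'] [NormedSpace ℝ V'] {H' : Type*} [TopologicalSpace H']
  {P : Type*} [TopologicalSpace P] [ChartedSpace H' P]
  {F : Type*} [NormedAddCommGroup F] [NormedSpace ℝ F]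

theorem contMDiff_mul_of_tsupport (χ : SmoothFun I N) {W : Set N} (hW : IsOpen W)
    (hχ : tsupport χ ⊆ W) {g : N → ℝ} (hg : ContMDiffOn I 𝓘(ℝ, ℝ) ∞ g W) :
    ContMDiff I 𝓘(ℝ, ℝ) ∞ fun q => χ q * g q :=
  contMDiff_of_tsupport fun q hq => by
    have h1 : q ∈ W := hχ (tsupport_mul_subset_left hq)
    exact χ.contMDiff.contMDiffAt.mul (hg.contMDiffAt (hW.mem_nhds h1))

/-- A product structure on an open set `W₀ ⊆ N`, with fibres tangent to `D`: the map `T` sends a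
point to its base point in `U ⊆ P` and its fibre coordinate in `F`, and `Ψ` is the inverse map. The
function `χ` is supported in `W₀` and equal to `1` on the smaller open set `W`. Over `W`, the
functions of the base point are generated by `S`. -/
structure ProductChart (I : ModelWithCorners ℝ V H) (J : ModelWithCorners ℝ V' H') (P : Type*)
    [TopologicalSpace P] [ChartedSpace H' P] (F : Type*) [NormedAddCommGroup F] [NormedSpace ℝ F]
    (D : ∀ p : N, Submodule ℝ (TangentSpace I p)) (S : Set (SmoothFun I N)) where
  n : ℕ
  b : Module.Basis (Fin n) ℝ F
  U : Set P
  W₀ : Set N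
  W : Set N
  T : N → P × F
  Ψ : P × F → N
  χ : SmoothFun I N
  isOpen_U : IsOpen U
  isOpen_W₀ : IsOpen W₀
  isOpen_W : IsOpen W
  T_mem : ∀ q ∈ W₀, (T q).1 ∈ U
  left_inv : ∀ q ∈ W₀, Ψ (T q) = q
  T_snd : ∀ x ∈ U, ∀ w, (T (Ψ (x, w))).2 = w
  smooth_T : ContMDiffOn I (J.prod 𝓘(ℝ, F)) ∞ T W₀
  smooth_Ψ : ContMDiffOn (J.prod 𝓘(ℝ, F)) I ∞ Ψ (U ×ˢ univ)
  tangent : ∀ q ∈ W₀, ∀ w : F, (show TangentSpace I q from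
    mfderiv 𝓘(ℝ, F) I (fun v => Ψ ((T q).1, v)) (T q).2 w) ∈ D q
  tsupport_χ : tsupport χ ⊆ W₀
  χ_eq_one : ∀ q ∈ W, χ q = 1
  base : ∀ h : P → ℝ, ContMDiffOn J 𝓘(ℝ, ℝ) ∞ h U →
    ∃ f₀ ∈ Algebra.adjoin ℝ S, ∀ q ∈ W, f₀ q = h (T q).1
  separating : ∀ p ∈ W, ∃ c ∈ Algebra.adjoin ℝ S, c p = 0 ∧ ∀ q ∉ W, c q = 1

namespace ProductChart

variable {J : ModelWithCorners ℝ V' H'} {D : ∀ p : N, Submodule ℝ (TangentSpace I p)}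
  {S : Set (SmoothFun I N)} (C : ProductChart I J P F D S)

theorem W_subset : C.W ⊆ C.W₀ := fun q hq => C.tsupport_χ (subset_tsupport _ (by
  rw [Function.mem_support, C.χ_eq_one q hq]
  exact one_ne_zero))

theorem χ_eq_zero {q : N} (hq : q ∉ C.W₀) : C.χ q = 0 := by
  by_contra h
  exact hq (C.tsupport_χ (subset_tsupport _ h))

/-- A smooth function on `W₀` multiplied with the cut-off function. -/
def cut (g : N → ℝ) (hg : ContMDiffOn I 𝓘(ℝ, ℝ) ∞ g C.W₀) : SmoothFun I N :=
  ⟨fun q => C.χ q * g q, contMDiff_mul_of_tsupport C.χ C.isOpen_W₀ C.tsupport_χ hg⟩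

theorem cut_apply {g : N → ℝ} (hg : ContMDiffOn I 𝓘(ℝ, ℝ) ∞ g C.W₀) {q : N} (hq : q ∈ C.W) :
    C.cut g hg q = g q := by
  change C.χ q * g q = g q
  rw [C.χ_eq_one q hq, one_mul]

theorem contMDiffOn_comp_T {g : P × F → ℝ}
    (hg : ContMDiffOn (J.prod 𝓘(ℝ, F)) 𝓘(ℝ, ℝ) ∞ g (C.U ×ˢ univ)) :
    ContMDiffOn I 𝓘(ℝ, ℝ) ∞ (fun q => g (C.T q)) C.W₀ :=
  hg.comp C.smooth_T fun q hq => ⟨C.T_mem q hq, mem_univ _⟩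

theorem contMDiffOn_comp_Ψ (f : SmoothFun I N) :
    ContMDiffOn (J.prod 𝓘(ℝ, F)) 𝓘(ℝ, ℝ) ∞ (fun z => f (C.Ψ z)) (C.U ×ˢ univ) :=
  f.contMDiff.comp_contMDiffOn C.smooth_Ψ

/-- The partial derivative `∂_j`, multiplied with the cut-off function. -/
def vec (j : Fin C.n) (q : N) : D q :=
  ⟨C.χ q • (show TangentSpace I q from
    mfderiv 𝓘(ℝ, F) I (fun v => C.Ψ ((C.T q).1, v)) (C.T q).2 (C.b j)), by
    by_cases hq : q ∈ C.W₀
    · exact (D q).smul_mem _ (C.tangent q hq _)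
    · rw [C.χ_eq_zero hq, zero_smul]
      exact (D q).zero_mem⟩

/-- The derivative along the field `vec j` is the partial derivative of `f ∘ Ψ`, with the cut-off
factor. -/
theorem dAt_vec [FiniteDimensional ℝ F] (f : SmoothFun I N) (j : Fin C.n) (q : N) :
    dAt I f q (C.vec j q) =
      C.χ q * fderiv ℝ (fun v => f (C.Ψ ((C.T q).1, v))) (C.T q).2 (C.b j) := by
  by_cases hq : q ∈ C.W₀
  · have h0 : MDifferentiableAt 𝓘(ℝ, F) I (fun v => C.Ψ ((C.T q).1, v)) (C.T q).2 := by
      have h1 : ContMDiffOn 𝓘(ℝ, F) I ∞ (fun v : F => C.Ψ ((C.T q).1, v)) univ :=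
        C.smooth_Ψ.comp (contMDiff_const.prodMk contMDiff_id).contMDiffOn
          fun v _ => ⟨C.T_mem q hq, mem_univ v⟩
      exact (contMDiffOn_univ.1 h1).mdifferentiable (by simp) _
    have h2 := mfderiv_comp (C.T q).2 (f.mdifferentiableAt (C.Ψ ((C.T q).1, (C.T q).2))) h0
    have h3 : C.Ψ ((C.T q).1, (C.T q).2) = q := C.left_inv q hq
    rw [mfderiv_eq_fderiv] at h2
    have h4 := DFunLike.congr_fun h2 (C.b j)
    change dAt I f q (C.χ q • _) = _
    rw [map_smul, smul_eq_mul]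
    congr 1
    refine Eq.trans ?_ h4.symm
    -- Transport from `Ψ (T q)` to `q`: the two points are equal, but not definitionally so.
    have h5 : ∀ q' : N, q' = q → ∀ v : V,
        (dAt I f q : V →L[ℝ] ℝ) v = (dAt I f q' : V →L[ℝ] ℝ) v := by
      rintro _ rfl v
      rfl
    exact h5 _ h3 _
  · change dAt I f q (C.χ q • _) = _
    rw [map_smul, C.χ_eq_zero hq, zero_smul, zero_mul]

variable [FiniteDimensional ℝ F] [IsManifold J ∞ P]

/-- The partial derivative `∂_j` as an operator on smooth functions. -/
def der (j : Fin C.n) : SmoothFun I N →ₗ[ℝ] SmoothFun I N where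
  toFun f := ⟨fun q => dAt I f q (C.vec j q), by
    simp only [C.dAt_vec]
    exact contMDiff_mul_of_tsupport C.χ C.isOpen_W₀ C.tsupport_χ (C.contMDiffOn_comp_T
      (contMDiffOn_fderiv_snd C.isOpen_U (C.contMDiffOn_comp_Ψ f) (C.b j)))⟩
  map_add' f g := by
    ext q
    exact DFunLike.congr_fun (dAt_add f g q) _
  map_smul' c f := by
    ext q
    exact DFunLike.congr_fun (dAt_smul c f q) _

theorem der_apply (j : Fin C.n) (f : SmoothFun I N) (q : N) :
    C.der j f q = dAt I f q (C.vec j q) := rfl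

/-- The fibre coordinates, multiplied with the cut-off function. -/
def coord (j : Fin C.n) : SmoothFun I N :=
  C.cut (fun q => C.b.coord j (C.T q).2) (C.contMDiffOn_comp_T (g := fun z => C.b.coord j z.2)
    ((LinearMap.toContinuousLinearMap (C.b.coord j)).contMDiff.comp contMDiff_snd).contMDiffOn)

/-- The fibred chart given by a local product structure. -/
def fibredChart [J.Boundaryless] (hS : IsConstantAlong D S) : FibredChart I S where
  W := C.W
  n := C.n
  x := C.coord
  d := C.der
  leibniz j a b := by
    ext q
    exact DFunLike.congr_fun (dAt_mul a b q) _
  d_local j f hf p hp := by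
    have h : (f : N → ℝ) =ᶠ[nhds p] fun _ => 0 := by
      filter_upwards [C.isOpen_W.mem_nhds hp] with q hq using hf q hq
    rw [der_apply]
    have h2 : dAt I f p = 0 := h.mfderiv_eq.trans mfderiv_const
    rw [h2]
    rfl
  d_scalar j s hs p hp := hS s hs p _ (C.vec j p).2
  d_x i j p hp := by
    rw [der_apply, C.dAt_vec, C.χ_eq_one p hp, one_mul]
    have hpU := C.T_mem p (C.W_subset hp)
    have hΨ : Continuous fun v : F => C.Ψ ((C.T p).1, v) := by
      have h1 : ContMDiffOn 𝓘(ℝ, F) I ∞ (fun v : F => C.Ψ ((C.T p).1, v)) univ :=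
        C.smooth_Ψ.comp (contMDiff_const.prodMk contMDiff_id).contMDiffOn
          fun v _ => ⟨hpU, mem_univ v⟩
      exact (contMDiffOn_univ.1 h1).continuous
    have h1 : (fun v => C.coord j (C.Ψ ((C.T p).1, v))) =ᶠ[nhds (C.T p).2]
        LinearMap.toContinuousLinearMap (C.b.coord j) := by
      have h2 : C.W ∈ nhds (C.Ψ ((C.T p).1, (C.T p).2)) := by
        rw [Prod.mk.eta, C.left_inv p (C.W_subset hp)]
        exact C.isOpen_W.mem_nhds hp
      filter_upwards [hΨ.continuousAt.preimage_mem_nhds h2] with v hv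
      rw [coord, C.cut_apply _ hv, C.T_snd _ hpU]
      rfl
    rw [h1.fderiv_eq, ContinuousLinearMap.fderiv]
    change C.b.coord j (C.b i) = _
    rw [Module.Basis.coord_apply, Module.Basis.repr_self, Finsupp.single_apply]
  hadamard f p hp := by
    obtain ⟨g, hg, hK⟩ := hadamard C.isOpen_U (C.contMDiffOn_comp_Ψ f) C.b (C.T p).2
    obtain ⟨f₀, hf₀, h₀⟩ := C.base (fun x => f (C.Ψ (x, (C.T p).2)))
      ((C.contMDiffOn_comp_Ψ f).comp (contMDiff_id.prodMk contMDiff_const).contMDiffOn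
        fun x hx => ⟨hx, mem_univ _⟩)
    refine ⟨f₀, hf₀, fun l => C.cut _ (C.contMDiffOn_comp_T (hg l)), fun q hq => ?_⟩
    have h1 := hK (C.T q).1 (C.T_mem q (C.W_subset hq)) (C.T q).2
    rw [Prod.mk.eta, C.left_inv q (C.W_subset hq)] at h1
    rw [h1, h₀ q hq]
    congr 1
    refine Finset.sum_congr rfl fun l _ => ?_
    rw [C.cut_apply _ hq, coord, C.cut_apply _ hq, C.cut_apply _ hp, map_sub]
  separating := C.separating

end ProductChart

/-- The fibred atlas given by local product structures and a partition of unity. -/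
def FibredAtlas.ofProductCharts {J : ModelWithCorners ℝ V' H'} [J.Boundaryless] [IsManifold J ∞ P]
    [IsManifold I ∞ N] [FiniteDimensional ℝ V]
    [FiniteDimensional ℝ F] {D : ∀ p : N, Submodule ℝ (TangentSpace I p)} {S : Set (SmoothFun I N)}
    (hS : IsConstantAlong D S) {ι : Type*} (C : ι → ProductChart I J P F D S)
    (χ : ι → SmoothFun I N)
    (hχ : ∀ α q, χ α q ≠ 0 → q ∈ (C α).W)
    (hfin : LocallyFinite fun α => Function.support (χ α)) (hsum : ∀ q, ∑ᶠ α, χ α q = 1) :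
    FibredAtlas D S ι where
  C α := (C α).fibredChart hS
  vec α j q := (C α).vec j q
  d_apply _ _ _ _ := rfl
  χ := χ
  mem_of_ne_zero := hχ
  locallyFinite := hfin
  sum_eq_one := hsum

end ProductChart

/-! ### The fibred atlases of a vector bundle and of its fibers -/

section Cutoff

variable {V : Type*} [NormedAddCommGroup V] [NormedSpace ℝ V] {H : Type*} [TopologicalSpace H]
  {I : ModelWithCorners ℝ V H} {N : Type*} [TopologicalSpace N] [ChartedSpace H N]
  [IsManifold I ∞ N] [FiniteDimensional ℝ V]

theorem exists_cutoff [T2Space N] {U : Set N} (hU : IsOpen U) {x : N} (hx : x ∈ U) :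
    ∃ χ : SmoothFun I N, tsupport χ ⊆ U ∧ ∃ W, IsOpen W ∧ x ∈ W ∧ ∀ y ∈ W, χ y = 1 := by
  obtain ⟨b, -, hb⟩ :=
    (SmoothBumpFunction.nhds_basis_tsupport (I := I) x).mem_iff.1 (hU.mem_nhds hx)
  refine ⟨⟨b, b.contMDiff⟩, hb, ?_⟩
  obtain ⟨W, hW, hWo, hxW⟩ := mem_nhds_iff.1 b.eventuallyEq_one
  exact ⟨W, hWo, hxW, fun y hy => hW hy⟩

end Cutoff

section TotalSpace

open Bundle Set

variable {B : Type*} [NormedAddCommGroup B] [NormedSpace ℝ B] {H : Type*} [TopologicalSpace H]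
  (I : ModelWithCorners ℝ B H) {M : Type*} [TopologicalSpace M] [ChartedSpace H M]
  (F : Type*) [NormedAddCommGroup F] [NormedSpace ℝ F]
  (E : M → Type*) [∀ x, AddCommGroup (E x)] [∀ x, Module ℝ (E x)] [∀ x, TopologicalSpace (E x)]
  [TopologicalSpace (TotalSpace F E)] [FiberBundle F E] [VectorBundle ℝ F E]

/-- Two points of the same fiber are separated in a local trivialization, points of different fibers
already in the base. -/
theorem t2Space_totalSpace [T2Space M] : T2Space (TotalSpace F E) := by
  refine ⟨fun v w hvw => ?_⟩
  by_cases h : v.proj = w.proj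
  · let e := trivializationAt F E v.proj
    have hv : v ∈ e.source := FiberBundle.mem_trivializationAt_proj_source
    have hw : w ∈ e.source := by
      rw [e.mem_source, ← h]
      exact FiberBundle.mem_baseSet_trivializationAt' _
    obtain ⟨U, U', hU, hU', hvU, hwU', hd⟩ := t2_separation (e.injOn.ne hv hw hvw)
    exact ⟨_, _, e.toOpenPartialHomeomorph.isOpen_inter_preimage hU,
      e.toOpenPartialHomeomorph.isOpen_inter_preimage hU', ⟨hv, hvU⟩, ⟨hw, hwU'⟩,
      (hd.preimage e).mono inter_subset_right inter_subset_right⟩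
  · obtain ⟨U, U', hU, hU', hvU, hwU', hd⟩ := t2_separation h
    have hc : Continuous (π F E) := FiberBundle.continuous_proj F E
    exact ⟨_, _, hU.preimage hc, hU'.preimage hc, hvU, hwU', hd.preimage _⟩

/-- The model fiber and the fiber `E_p` are homeomorphic. -/
def fiberHomeomorph (p : M) : Fiber E p ≃ₜ F :=
  ((trivializationAt F E p).continuousLinearEquivAt ℝ p
    (FiberBundle.mem_baseSet_trivializationAt' p)).toHomeomorph

theorem contMDiff_fiberHomeomorph (p : M) :
    ContMDiff 𝓘(ℝ, F) 𝓘(ℝ, F) ∞ (fiberHomeomorph F E p) := fun v =>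
  (contMDiffAt_extChartAt : ContMDiffAt 𝓘(ℝ, F) 𝓘(ℝ, F) ∞ (extChartAt 𝓘(ℝ, F) v) v)

theorem contMDiff_fiberHomeomorph_symm (p : M) :
    ContMDiff 𝓘(ℝ, F) 𝓘(ℝ, F) ∞ (fiberHomeomorph F E p).symm := fun v => by
  have h : ContMDiffOn 𝓘(ℝ, F) 𝓘(ℝ, F) ∞ (fiberHomeomorph F E p).symm univ :=
    contMDiffOn_chart_symm (I := 𝓘(ℝ, F)) (n := ∞) (x := (fiberHomeomorph F E p).symm 0)
  exact contMDiffOn_univ.1 h v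

variable [ContMDiffVectorBundle ∞ F E I] [IsManifold I ∞ M] [I.Boundaryless]
  [FiniteDimensional ℝ B] [FiniteDimensional ℝ F]

variable {I} in
theorem tsupport_pullback_subset {χ : SmoothFun I M} {U : Set M} (hχ : tsupport χ ⊆ U) :
    tsupport (pullback I F E χ) ⊆ π F E ⁻¹' U :=
  ((FiberBundle.continuous_proj F E).closure_preimage_subset _).trans (preimage_mono hχ)

/-- The local product structure of `E` given by a local trivialization. -/
theorem exists_productChart [T2Space M] (x : M) :
    ∃ (C : ProductChart (I.prod 𝓘(ℝ, F)) I M F (verticalSpace I F E) (Set.range (pullback I F E)))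
      (W : Set M),
      IsOpen W ∧ x ∈ W ∧ C.W = π F E ⁻¹' W := by
  let e := trivializationAt F E x
  have hc : Continuous (π F E) := FiberBundle.continuous_proj F E
  obtain ⟨χ, hχ, W, hW, hxW, hχW⟩ := exists_cutoff (I := I) e.open_baseSet
    (FiberBundle.mem_baseSet_trivializationAt' x)
  have hWe : W ⊆ e.baseSet := fun y hy => hχ (subset_tsupport _ (by
    rw [Function.mem_support, hχW y hy]; exact one_ne_zero))
  have hΨ : ContMDiffOn (I.prod 𝓘(ℝ, F)) (I.prod 𝓘(ℝ, F)) ∞ e.toOpenPartialHomeomorph.symm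
      (e.baseSet ×ˢ univ) := by
    rw [← e.target_eq]
    exact e.contMDiffOn_symm
  refine ⟨{ n := _, b := Module.finBasis ℝ F, U := e.baseSet, W₀ := e.source, W := π F E ⁻¹' W,
            T := e, Ψ := e.toOpenPartialHomeomorph.symm, χ := pullback I F E χ,
            isOpen_U := e.open_baseSet, isOpen_W₀ := e.open_source,
            isOpen_W := hW.preimage hc
            T_mem := fun q hq => ?_
            left_inv := fun q hq => e.symm_apply_apply hq
            T_snd := fun y hy w => ?_
            smooth_T := e.contMDiffOn
            smooth_Ψ := hΨ
            tangent := fun q hq w => ?_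
            tsupport_χ := ?_
            χ_eq_one := fun q hq => hχW _ hq
            base := fun h hh => ?_
            separating := fun q hq => ?_ }, W, hW, hxW, rfl⟩
  · rw [e.coe_fst hq]
    exact e.mem_source.1 hq
  · exact congrArg Prod.snd (e.apply_symm_apply' hy)
  · have hq' : (e q).1 ∈ e.baseSet := by
      rw [e.coe_fst hq]
      exact e.mem_source.1 hq
    have h1 : ContMDiff 𝓘(ℝ, F) (I.prod 𝓘(ℝ, F)) ∞
        fun v : F => e.toOpenPartialHomeomorph.symm ((e q).1, v) :=
      contMDiffOn_univ.1 (hΨ.comp (contMDiff_const.prodMk contMDiff_id).contMDiffOn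
        fun v _ => ⟨hq', mem_univ v⟩)
    have h2 := mfderiv_comp (e q).2 (g := π F E)
      ((contMDiff_proj (n := ∞) E).mdifferentiable (I' := I) (by simp) _)
      (h1.mdifferentiable (by simp) (e q).2)
    have h3 : π F E ∘ (fun v : F => e.toOpenPartialHomeomorph.symm ((e q).1, v)) =
        fun _ => (e q).1 := funext fun v => e.proj_symm_apply' hq'
    rw [h3, mfderiv_const] at h2
    -- Transport from `Ψ (T q)` to `q`: the two points are equal, but not definitionally so.
    have h4 : ∀ q' : TotalSpace F E, q' = q → ∀ u : B × F,
        (mfderiv (I.prod 𝓘(ℝ, F)) I (π F E) q' : B × F →L[ℝ] B) u = 0 →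
        (mfderiv (I.prod 𝓘(ℝ, F)) I (π F E) q : B × F →L[ℝ] B) u = 0 := by
      rintro _ rfl u hu
      exact hu
    exact h4 _ (e.symm_apply_apply hq) _ (DFunLike.congr_fun h2 w).symm
  · rw [e.source_eq]
    exact tsupport_pullback_subset F E hχ
  · refine ⟨pullback I F E ⟨_, contMDiff_mul_of_tsupport χ e.open_baseSet hχ hh⟩,
      Algebra.subset_adjoin ⟨_, rfl⟩, fun q hq => ?_⟩
    change χ q.proj * h q.proj = _
    rw [hχW _ hq, one_mul, e.coe_fst (e.mem_source.2 (hWe hq))]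
  · obtain ⟨χ', hχ', W', -, hqW', h1⟩ := exists_cutoff (I := I) hW hq
    refine ⟨pullback I F E (1 - χ'), Algebra.subset_adjoin ⟨_, rfl⟩, ?_, fun v hv => ?_⟩
    · change 1 - χ' q.proj = 0
      rw [h1 _ hqW', sub_self]
    · change 1 - χ' v.proj = 1
      have : χ' v.proj = 0 := by
        by_contra h
        exact hv (hχ' (subset_tsupport _ h))
      rw [this, sub_zero]

/-- Local trivializations of `E` and a partition of unity pulled back from the base. -/
theorem nonempty_fibredAtlas_totalSpace [T2Space M] [SecondCountableTopology M] :
    Nonempty (FibredAtlas (verticalSpace I F E) (Set.range (pullback I F E)) M) := by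
  have : LocallyCompactSpace H := I.locallyCompactSpace
  have : LocallyCompactSpace M := ChartedSpace.locallyCompactSpace H M
  choose C W hW hxW hCW using exists_productChart I F E
  obtain ⟨χ, hχ⟩ := SmoothPartitionOfUnity.exists_isSubordinate I isClosed_univ W hW
    fun x _ => mem_iUnion.2 ⟨x, hxW x⟩
  refine ⟨FibredAtlas.ofProductCharts (isConstantAlong_pullback I F E) C
    (fun x => pullback I F E (χ x)) (fun x v hv => ?_) ?_ fun v => χ.sum_eq_one (mem_univ v.proj)⟩
  · rw [hCW]
    exact hχ x (subset_tsupport _ hv)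
  · exact χ.locallyFinite.preimage_continuous (FiberBundle.continuous_proj F E)

/-- The global product structure of a fiber, with constant base coordinate. The base is taken to be
the model fiber, since only the base point `0` matters. -/
def fiberProductChart (p : M) :
    ProductChart 𝓘(ℝ, F) 𝓘(ℝ, F) F F (fun _ : Fiber E p => ⊤) (∅ : Set (SmoothFun 𝓘(ℝ, F) _)) where
  n := _
  b := Module.finBasis ℝ F
  U := univ
  W₀ := univ
  W := univ
  T v := (0, fiberHomeomorph F E p v)
  Ψ z := (fiberHomeomorph F E p).symm z.2
  χ := 1
  isOpen_U := isOpen_univ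
  isOpen_W₀ := isOpen_univ
  isOpen_W := isOpen_univ
  T_mem _ _ := mem_univ _
  left_inv v _ := (fiberHomeomorph F E p).symm_apply_apply v
  T_snd _ _ w := (fiberHomeomorph F E p).apply_symm_apply w
  smooth_T := (contMDiff_const.prodMk (contMDiff_fiberHomeomorph F E p)).contMDiffOn
  smooth_Ψ := ((contMDiff_fiberHomeomorph_symm F E p).comp contMDiff_snd).contMDiffOn
  tangent _ _ _ := trivial
  tsupport_χ := subset_univ _
  χ_eq_one _ _ := rfl
  base h _ := ⟨algebraMap ℝ _ (h 0), Subalgebra.algebraMap_mem _ _, fun _ _ => rfl⟩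
  separating _ _ := ⟨0, Subalgebra.zero_mem _, rfl, fun _ h => (h (mem_univ _)).elim⟩

/-- The fibred atlas of a fiber, with a single chart. -/
def fiberFibredAtlas (p : M) :
    FibredAtlas (fun _ : Fiber E p => ⊤) (∅ : Set (SmoothFun 𝓘(ℝ, F) _)) Unit :=
  FibredAtlas.ofProductCharts (fun _ hs => hs.elim) (fun _ => fiberProductChart F E p) (fun _ => 1)
    (fun _ _ _ => mem_univ _) (locallyFinite_of_finite _) fun _ => by
      rw [finsum_unique]
      rfl

end TotalSpace

/-! ### Functions on a vector bundle and on its fibers -/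

section Restriction

open Bundle Set

variable {B : Type*} [NormedAddCommGroup B] [NormedSpace ℝ B] {H : Type*} [TopologicalSpace H]
  (I : ModelWithCorners ℝ B H) {M : Type*} [TopologicalSpace M] [ChartedSpace H M]
  (F : Type*) [NormedAddCommGroup F] [NormedSpace ℝ F]
  (E : M → Type*) [∀ x, AddCommGroup (E x)] [∀ x, Module ℝ (E x)] [∀ x, TopologicalSpace (E x)]
  [TopologicalSpace (TotalSpace F E)] [FiberBundle F E] [VectorBundle ℝ F E]

/-- The restriction `ι_p^* : C^∞(E) → C^∞(E_p)` as a homomorphism of algebras. -/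
def restrictHom (p : M) :
    SmoothFun (I.prod 𝓘(ℝ, F)) (TotalSpace F E) →ₐ[ℝ] SmoothFun 𝓘(ℝ, F) (Fiber E p) where
  toFun := restrictFun I F E p
  map_one' := rfl
  map_mul' _ _ := rfl
  map_zero' := rfl
  map_add' _ _ := rfl
  commutes' _ := rfl

variable [ContMDiffVectorBundle ∞ F E I] [IsManifold I ∞ M] [I.Boundaryless]
  [FiniteDimensional ℝ B] [FiniteDimensional ℝ F]

variable {E} in
/-- Every function on a fiber extends to the total space: extend it constantly in a local
trivialization and cut it off. -/
theorem restrictHom_surjective [T2Space M] (p : M) :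
    Function.Surjective (restrictHom I F E p) := fun g => by
  let e := trivializationAt F E p
  have hp : p ∈ e.baseSet := FiberBundle.mem_baseSet_trivializationAt' p
  obtain ⟨χ, hχ, W, -, hpW, hχW⟩ := exists_cutoff (I := I) e.open_baseSet hp
  have hχE : tsupport (pullback I F E χ) ⊆ e.source := by
    rw [e.source_eq]
    exact tsupport_pullback_subset F E hχ
  refine ⟨⟨_, contMDiff_mul_of_tsupport (pullback I F E χ) e.open_source hχE
    (g := fun v => g ((fiberHomeomorph F E p).symm (e v).2))
    ((g.contMDiff.comp (contMDiff_fiberHomeomorph_symm F E p)).comp_contMDiffOn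
      (contMDiff_snd.comp_contMDiffOn e.contMDiffOn))⟩, ?_⟩
  ext v
  change χ p * g ((fiberHomeomorph F E p).symm (fiberHomeomorph F E p v)) = g v
  rw [hχW p hpW, one_mul, Homeomorph.symm_apply_apply]

/-- A smooth retraction of the model space of `M` into a coordinate neighbourhood of `p`, written in
the chart at `p`: it is the identity near `p` and has values in a prescribed open set `U`. -/
theorem exists_chart_retraction {U : Set M} (hU : IsOpen U) {p : M} (hp : p ∈ U) :
    ∃ (τ : B → M) (V : Set M), ContMDiff 𝓘(ℝ, B) I ∞ τ ∧ (∀ y, τ y ∈ U) ∧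
      IsOpen V ∧ p ∈ V ∧ V ⊆ U ∩ (chartAt H p).source ∧ ∀ x ∈ V, τ (extChartAt I p x) = x := by
  have hO : (extChartAt I p).target ∩ (extChartAt I p).symm ⁻¹' U ∈ nhds (extChartAt I p p) := by
    refine Filter.inter_mem (extChartAt_target_mem_nhds p)
      ((continuousAt_extChartAt_symm p).preimage_mem_nhds ?_)
    rw [extChartAt_to_inv]
    exact hU.mem_nhds hp
  obtain ⟨r, hr, hrO⟩ := Metric.mem_nhds_iff.1 hO
  let b : ContDiffBump (extChartAt I p p) := ⟨r / 2, r, half_pos hr, half_lt_self hr⟩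
  let s : B → B := fun y => extChartAt I p p + b y • (y - extChartAt I p p)
  have hs : ∀ y, s y ∈ (extChartAt I p).target ∩ (extChartAt I p).symm ⁻¹' U := fun y => by
    refine hrO ?_
    rw [Metric.mem_ball, dist_eq_norm, add_sub_cancel_left, norm_smul, Real.norm_of_nonneg b.nonneg]
    by_cases hy : ‖y - extChartAt I p p‖ < r
    · exact (mul_le_of_le_one_left (norm_nonneg _) b.le_one).trans_lt hy
    · rw [b.zero_of_le_dist (by rw [dist_eq_norm]; exact not_lt.1 hy), zero_mul]
      exact hr
  have hsm : ContDiff ℝ ∞ s := contDiff_const.add (b.contDiff.smul (contDiff_id.sub contDiff_const))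
  refine ⟨fun y => (extChartAt I p).symm (s y),
    U ∩ ((chartAt H p).source ∩ extChartAt I p ⁻¹' Metric.ball (extChartAt I p p) (r / 2)),
    ?_, fun y => (hs y).2, ?_, ?_, ?_, ?_⟩
  · exact contMDiffOn_univ.1 ((contMDiffOn_extChartAt_symm p).comp hsm.contMDiff.contMDiffOn
      fun y _ => (hs y).1)
  · exact hU.inter (isOpen_extChartAt_preimage (I := I) p Metric.isOpen_ball)
  · exact ⟨hp, mem_chart_source H p, Metric.mem_ball_self (half_pos hr)⟩
  · exact fun x hx => ⟨hx.1, hx.2.1⟩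
  · intro x hx
    have h1 : b (extChartAt I p x) = 1 :=
      b.one_of_mem_closedBall (Metric.ball_subset_closedBall hx.2.2)
    change (extChartAt I p).symm (extChartAt I p p + b (extChartAt I p x) • _) = x
    rw [h1, one_smul, add_sub_cancel]
    exact (extChartAt I p).left_inv (by rw [extChartAt_source]; exact hx.2.1)

variable {I F E}

/-- Near the fiber `E_p`, a function which vanishes on `E_p` is a combination of functions on the
base vanishing at `p`, with coefficients in the functions on `E`: Hadamard's lemma in the directions
of the base. The cut-off function `χ` with `χ p = 1` makes this a global identity. -/
theorem exists_eq_sum_of_restrictHom_eq_zero [T2Space M] {p : M}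
    {f : SmoothFun (I.prod 𝓘(ℝ, F)) (TotalSpace F E)} (hf : restrictHom I F E p f = 0) :
    ∃ (χ : SmoothFun I M) (n : ℕ) (u : Fin n → SmoothFun I M)
      (g : Fin n → SmoothFun (I.prod 𝓘(ℝ, F)) (TotalSpace F E)), χ p = 1 ∧ (∀ l, u l p = 0) ∧
      pullback I F E χ * f = ∑ l, pullback I F E (u l) * g l := by
  let e := trivializationAt F E p
  have hp : p ∈ e.baseSet := FiberBundle.mem_baseSet_trivializationAt' p
  obtain ⟨τ, V, hτ, hτe, hV, hpV, hVe, hτV⟩ := exists_chart_retraction I e.open_baseSet hp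
  -- The retraction `τ` makes the base coordinate range over the whole model space, as Hadamard's
  -- lemma requires, without leaving the trivialization.
  have hK : ContMDiffOn (𝓘(ℝ, F).prod 𝓘(ℝ, B)) 𝓘(ℝ, ℝ) ∞
      (fun z : F × B => f (e.toOpenPartialHomeomorph.symm (τ z.2, z.1))) (univ ×ˢ univ) := by
    have h1 : ContMDiffOn (I.prod 𝓘(ℝ, F)) (I.prod 𝓘(ℝ, F)) ∞ e.toOpenPartialHomeomorph.symm
        e.target := e.contMDiffOn_symm
    refine f.contMDiff.comp_contMDiffOn (h1.comp
      ((hτ.comp contMDiff_snd).prodMk contMDiff_fst).contMDiffOn fun z _ => ?_)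
    exact e.mem_target.2 (hτe _)
  let b := Module.finBasis ℝ B
  obtain ⟨g, hg, hfg⟩ := hadamard isOpen_univ hK b (extChartAt I p p)
  obtain ⟨χ, hχ, W, -, hpW, hχW⟩ := exists_cutoff (I := I) hV hpV
  have hVs : V ⊆ (chartAt H p).source := fun x hx => (hVe hx).2
  have hφ : ContMDiffOn I 𝓘(ℝ, B) ∞ (extChartAt I p) V := contMDiffOn_extChartAt.mono hVs
  have hVE : IsOpen (π F E ⁻¹' V) := hV.preimage (FiberBundle.continuous_proj F E)
  have hu : ∀ l, ContMDiffOn I 𝓘(ℝ, ℝ) ∞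
      (fun x => b.coord l (extChartAt I p x - extChartAt I p p)) V := fun l =>
    ((LinearMap.toContinuousLinearMap (b.coord l)).contDiff.comp
      (contDiff_id.sub contDiff_const)).contMDiff.comp_contMDiffOn hφ
  have hh : ∀ l, ContMDiffOn (I.prod 𝓘(ℝ, F)) 𝓘(ℝ, ℝ) ∞
      (fun v : TotalSpace F E => g l ((e v).2, extChartAt I p v.proj)) (π F E ⁻¹' V) := fun l => by
    refine (hg l).comp ((contMDiff_snd.comp_contMDiffOn (e.contMDiffOn.mono ?_)).prodMk
      (hφ.comp (contMDiff_proj E).contMDiffOn fun v hv => hv)) fun v _ => ⟨mem_univ _, mem_univ _⟩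
    exact fun v hv => e.mem_source.2 (hVe hv).1
  -- One factor `χ` cuts off the base functions, the other one the coefficients.
  refine ⟨χ * χ, _, fun l => ⟨_, contMDiff_mul_of_tsupport χ hV hχ (hu l)⟩,
    fun l => ⟨_, contMDiff_mul_of_tsupport (pullback I F E χ) hVE
      (tsupport_pullback_subset F E hχ) (hh l)⟩, ?_, fun l => ?_, ?_⟩
  · change χ p * χ p = 1
    rw [hχW p hpW, one_mul]
  · change χ p * b.coord l (extChartAt I p p - extChartAt I p p) = 0
    rw [sub_self, map_zero, mul_zero]
  · ext v
    rw [SmoothFun.sum_apply]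
    change χ v.proj * χ v.proj * f v = ∑ l,
      χ v.proj * b.coord l (extChartAt I p v.proj - extChartAt I p p) *
        (χ v.proj * g l ((e v).2, extChartAt I p v.proj))
    by_cases hv : v.proj ∈ V
    · have hve : v ∈ e.source := e.mem_source.2 (hVe hv).1
      have h1 := hfg (e v).2 (mem_univ _) (extChartAt I p v.proj)
      have h2 : τ (extChartAt I p p) = p := hτV p hpV
      have h3 : e.toOpenPartialHomeomorph.symm (p, (e v).2) =
          fiberIncl F p ((fiberHomeomorph F E p).symm (e v).2) :=
        e.symm_apply_eq_mk_continuousLinearEquivAt_symm (R := ℝ) p hp (e v).2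
      have h4 : e.toOpenPartialHomeomorph.symm (v.proj, (e v).2) = v := by
        rw [← e.coe_fst hve]
        exact e.symm_apply_apply hve
      have h5 : f (fiberIncl F p ((fiberHomeomorph F E p).symm (e v).2)) = 0 :=
        DFunLike.congr_fun hf _
      rw [hτV _ hv, h4, h2, h3, h5, zero_add] at h1
      rw [h1, Finset.mul_sum]
      exact Finset.sum_congr rfl fun l _ => by ring
    · have h1 : χ v.proj = 0 := by
        by_contra h
        exact hv (hχ (subset_tsupport _ h))
      simp [h1]

end Restriction

/-! ### Restriction of cochains and cohomology classes -/

section Descent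

variable {A B : Type*} [CommRing A] [Algebra ℝ A] [CommRing B] [Algebra ℝ B] {ρ : A →ₐ[ℝ] B}
  {S : Set A} {T : Set B}

/-- The cochains of `A` which are linear over `S` descend along the surjection `ρ : A → B`, and give
cochains which are linear over `T`. -/
structure Descends (ρ : A →ₐ[ℝ] B) (S : Set A) (T : Set B) : Prop where
  surjective : Function.Surjective ρ
  subset : T ⊆ ρ '' S
  map_eq_zero : ∀ {k : ℕ} (φ : diffCochain A S k) (i : Fin k) (f : Fin k → A), ρ (f i) = 0 →
    ρ (φ.1 f) = 0

namespace Descends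

theorem exists_isRelated (h : Descends ρ S T) {k : ℕ} (φ : diffCochain A S k) :
    ∃ χ : diffCochain B T k, IsRelated ρ φ.1 χ.1 := by
  obtain ⟨χ, hχ⟩ := VerticalHKR.exists_isRelated h.surjective φ.1 (h.map_eq_zero φ)
  obtain ⟨N, hN⟩ := mem_diffCochain_iff.1 φ.2
  exact ⟨⟨χ, mem_diffCochain_iff.2 ⟨N, hχ.mem_ordCochain h.surjective h.subset hN⟩⟩, hχ⟩

/-- A cochain of `B` is determined by the cochain of `A` that it is related to. -/
theorem ext (h : Descends ρ S T) {k : ℕ} {φ : Cochain A k} {χ χ' : diffCochain B T k}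
    (h1 : IsRelated ρ φ χ.1)
    (h2 : IsRelated ρ φ χ'.1) : χ = χ' :=
  Subtype.ext (h1.unique h.surjective h2)

/-- The induced map on cochains. -/
def onCochain (h : Descends ρ S T) (k : ℕ) : diffCochain A S k →ₗ[ℝ] diffCochain B T k where
  toFun φ := (h.exists_isRelated φ).choose
  map_add' φ ψ := h.ext (h.exists_isRelated _).choose_spec
    ((h.exists_isRelated φ).choose_spec.add (h.exists_isRelated ψ).choose_spec)
  map_smul' c φ := h.ext (h.exists_isRelated _).choose_spec
    ((h.exists_isRelated φ).choose_spec.smul c)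

theorem isRelated (h : Descends ρ S T) {k : ℕ} (φ : diffCochain A S k) :
    IsRelated ρ φ.1 (h.onCochain k φ).1 :=
  (h.exists_isRelated φ).choose_spec

theorem isRelated_iff (h : Descends ρ S T) {k : ℕ} {φ : diffCochain A S k} {χ : diffCochain B T k} :
    IsRelated ρ φ.1 χ.1 ↔ χ = h.onCochain k φ :=
  ⟨fun h1 => h.ext h1 (h.isRelated φ), fun h1 => h1 ▸ h.isRelated φ⟩

theorem onCochain_d (h : Descends ρ S T) {k : ℕ} (φ : diffCochain A S k) :
    h.onCochain (k + 1) (diffCochain.d k φ) = diffCochain.d k (h.onCochain k φ) :=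
  h.ext (h.isRelated _) (h.isRelated φ).hochschildD

theorem onCochain_cup (h : Descends ρ S T) {m n p : ℕ} (hp : m + n = p) (φ : diffCochain A S m)
    (ψ : diffCochain A S n) : h.onCochain p (diffCochain.cup hp φ ψ) =
      diffCochain.cup hp (h.onCochain m φ) (h.onCochain n ψ) :=
  h.ext (h.isRelated _) ((h.isRelated φ).cup hp (h.isRelated ψ))

theorem onCochain_bracket (h : Descends ρ S T) {m n p : ℕ} (hp : m + n = p + 1)
    (φ : diffCochain A S m)
    (ψ : diffCochain A S n) : h.onCochain p (diffCochain.bracket hp φ ψ) =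
      diffCochain.bracket hp (h.onCochain m φ) (h.onCochain n ψ) :=
  h.ext (h.isRelated _) ((h.isRelated φ).gBracket hp (h.isRelated ψ))

/-- The induced map on cocycles. -/
def onCocycle (h : Descends ρ S T) (k : ℕ) : Cocycle A S k →ₗ[ℝ] Cocycle B T k :=
  (h.onCochain k).restrict fun φ hφ => by
    rw [LinearMap.mem_ker] at hφ ⊢
    rw [← h.onCochain_d, hφ, map_zero]

/-- The induced map on cohomology. -/
def onHH (h : Descends ρ S T) (k : ℕ) : HH A S k →ₗ[ℝ] HH B T k :=
  Submodule.mapQ _ _ (h.onCocycle k) fun φ hφ => by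
    cases k with
    | zero =>
      have h1 : φ.1 = 0 := hφ
      change h.onCochain 0 φ.1 = 0
      rw [h1, map_zero]
    | succ k =>
      obtain ⟨ψ, hψ⟩ : ∃ ψ, diffCochain.d k ψ = φ.1 := hφ
      exact ⟨h.onCochain k ψ, by rw [← h.onCochain_d, hψ]; rfl⟩

theorem lmap_onHH_cls (h : Descends ρ S T) {k : ℕ} (φ : Cocycle A S k) :
    DirectSum.lmap h.onHH (HH.cls k φ) = HH.cls k (h.onCocycle k φ) :=
  DirectSum.lmap_lof ..

/-- The induced map on cohomology preserves the Gerstenhaber structure, as the map on cochains is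
compatible with the cup product and the bracket. -/
theorem isGerstenhaberHom_onHH (h : Descends ρ S T) :
    IsGerstenhaberHom (hochschildGerstenhaber A S) (hochschildGerstenhaber B T) h.onHH where
  map_one := congrArg (HH.mk 0) (Subtype.ext (h.ext (h.isRelated (oneZ A S).1) fun _ =>
    (map_one ρ).symm))
  map_mul a b := by
    change DirectSum.lmap h.onHH (hhMul A S a b) = hhMul B T _ _
    induction a using HH.cls_induction with
    | h0 => simp
    | ha a b h1 h2 => simp only [map_add, LinearMap.add_apply, h1, h2]
    | hl m a =>
    induction b using HH.cls_induction with
    | h0 => simp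
    | ha a b h1 h2 => simp only [map_add, h1, h2]
    | hl n b =>
    simp only [hhMul_cls, lmap_onHH_cls]
    exact congrArg (HH.cls _) (Subtype.ext (h.onCochain_cup rfl a.1 b.1))
  map_bracket a b := by
    change DirectSum.lmap h.onHH (hhBracket A S a b) = hhBracket B T _ _
    induction a using HH.cls_induction with
    | h0 => simp
    | ha a b h1 h2 => simp only [map_add, LinearMap.add_apply, h1, h2]
    | hl m a =>
    induction b using HH.cls_induction with
    | h0 => simp
    | ha a b h1 h2 => simp only [map_add, h1, h2]
    | hl n b =>
    simp only [hhBracket_cls, lmap_onHH_cls]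
    refine congrArg (HH.cls _) (Subtype.ext ?_)
    change h.onCochain _ (bracketC a.1 b.1) = bracketC (h.onCochain m a.1) (h.onCochain n b.1)
    unfold bracketC
    split_ifs with hp
    · exact h.onCochain_bracket hp a.1 b.1
    · exact map_zero _

end Descends

end Descent

/-! ### Restriction of multivector fields -/

section HomTransport

variable {A B A' B' : ℕ → Type*} [∀ k, AddCommGroup (A k)] [∀ k, Module ℝ (A k)]
  [∀ k, AddCommGroup (B k)] [∀ k, Module ℝ (B k)] [∀ k, AddCommGroup (A' k)]
  [∀ k, Module ℝ (A' k)] [∀ k, AddCommGroup (B' k)] [∀ k, Module ℝ (B' k)]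

theorem lmap_conj (e : ∀ k, A k ≃ₗ[ℝ] B k) (e' : ∀ k, A' k ≃ₗ[ℝ] B' k) (u : ∀ k, B k →ₗ[ℝ] B' k)
    (x : ⨁ k, A k) :
    DirectSum.lmap (fun k => (e' k).symm.toLinearMap ∘ₗ u k ∘ₗ (e k).toLinearMap) x =
      (directSumEquiv e').symm (DirectSum.lmap u (directSumEquiv e x)) := by
  induction x using DirectSum.lof_induction with
  | h0 => simp
  | hl k x => simp
  | ha x y h1 h2 => simp only [map_add, h1, h2]

theorem IsGerstenhaberHom.transport {G : GerstenhaberAlgebra B} {G' : GerstenhaberAlgebra B'}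
    {u : ∀ k, B k →ₗ[ℝ] B' k} (h : IsGerstenhaberHom G G' u) (e : ∀ k, A k ≃ₗ[ℝ] B k)
    (e' : ∀ k, A' k ≃ₗ[ℝ] B' k) : IsGerstenhaberHom (G.transport e) (G'.transport e')
      fun k => (e' k).symm.toLinearMap ∘ₗ u k ∘ₗ (e k).toLinearMap where
  map_one := by
    change (e' 0).symm (u 0 (e 0 ((e 0).symm G.one))) = (e' 0).symm G'.one
    rw [LinearEquiv.apply_symm_apply, h.map_one]
  map_mul a b := by
    simp only [lmap_conj]
    simp [GerstenhaberAlgebra.transport, h.map_mul]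
  map_bracket a b := by
    simp only [lmap_conj]
    simp [GerstenhaberAlgebra.transport, h.map_bracket]

end HomTransport

section OnField

variable {V : Type*} [NormedAddCommGroup V] [NormedSpace ℝ V] {H : Type*} [TopologicalSpace H]
  {I : ModelWithCorners ℝ V H} {N : Type*} [TopologicalSpace N] [ChartedSpace H N]
  [IsManifold I ∞ N] [FiniteDimensional ℝ V] [I.Boundaryless] [T2Space N]
  {D : ∀ x : N, Submodule ℝ (TangentSpace I x)} {S : Set (SmoothFun I N)} {ι : Type*}
  {V' : Type*} [NormedAddCommGroup V'] [NormedSpace ℝ V'] {H' : Type*} [TopologicalSpace H']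
  {I' : ModelWithCorners ℝ V' H'} {N' : Type*} [TopologicalSpace N'] [ChartedSpace H' N']
  [IsManifold I' ∞ N'] [FiniteDimensional ℝ V'] [I'.Boundaryless] [T2Space N']
  {D' : ∀ x : N', Submodule ℝ (TangentSpace I' x)} {S' : Set (SmoothFun I' N')} {ι' : Type*}
  {ρ : SmoothFun I N →ₐ[ℝ] SmoothFun I' N'}

/-- The map of multivector fields which corresponds to the map of cohomology induced by `ρ`. -/
def Descends.onField (h : Descends ρ S S') (L : FibredAtlas D S ι) (hS : IsConstantAlong D S)
    (L' : FibredAtlas D' S' ι') (hS' : IsConstantAlong D' S') (k : ℕ) :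
    multivectorField D k →ₗ[ℝ] multivectorField D' k :=
  (L'.hkrEquiv hS' k).symm.toLinearMap ∘ₗ h.onHH k ∘ₗ (L.hkrEquiv hS k).toLinearMap

/-- The induced map of multivector fields is the one given by relating multiderivations. -/
theorem Descends.isRelated_onField (h : Descends ρ S S') (L : FibredAtlas D S ι)
    (hS : IsConstantAlong D S) (L' : FibredAtlas D' S' ι') (hS' : IsConstantAlong D' S') {k : ℕ}
    (X : multivectorField D k) :
    IsRelated ρ (evalCochain X) (evalCochain (h.onField L hS L' hS' k X)) := by
  have h1 : evalCochain (h.onField L hS L' hS' k X) = altC (h.onCocycle k (hkr hS k X)).1.1 :=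
    L'.hkrEquiv_symm_eq hS'
  rw [h1, ← altC_hkrCochain X]
  exact (h.isRelated (hkr hS k X).1).altC

theorem Descends.hkr_onField (h : Descends ρ S S') (L : FibredAtlas D S ι)
    (hS : IsConstantAlong D S) (L' : FibredAtlas D' S' ι') (hS' : IsConstantAlong D' S') {k : ℕ}
    (X : multivectorField D k) :
    HH.mk k (hkr hS' k (h.onField L hS L' hS' k X)) = h.onHH k (HH.mk k (hkr hS k X)) :=
  (L'.hkrEquiv hS' k).apply_symm_apply _

theorem Descends.isGerstenhaberHom_onField (h : Descends ρ S S') (L : FibredAtlas D S ι)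
    (hS : IsConstantAlong D S) (L' : FibredAtlas D' S' ι') (hS' : IsConstantAlong D' S') :
    IsGerstenhaberHom (L.schoutenGerstenhaber hS) (L'.schoutenGerstenhaber hS')
      (h.onField L hS L' hS') :=
  @IsGerstenhaberHom.transport (fun k => multivectorField D k) (fun k => HH (SmoothFun I N) S k)
    (fun k => multivectorField D' k) (fun k => HH (SmoothFun I' N') S' k)
    inferInstance inferInstance inferInstance inferInstance inferInstance inferInstance
    inferInstance inferInstance _ _ _ h.isGerstenhaberHom_onHH (L.hkrEquiv hS) (L'.hkrEquiv hS')

end OnField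

section Fiber

open Bundle Set

variable {B : Type*} [NormedAddCommGroup B] [NormedSpace ℝ B] {H : Type*} [TopologicalSpace H]
  (I : ModelWithCorners ℝ B H) {M : Type*} [TopologicalSpace M] [ChartedSpace H M]
  (F : Type*) [NormedAddCommGroup F] [NormedSpace ℝ F]
  (E : M → Type*) [∀ x, AddCommGroup (E x)] [∀ x, Module ℝ (E x)] [∀ x, TopologicalSpace (E x)]
  [TopologicalSpace (TotalSpace F E)] [FiberBundle F E] [VectorBundle ℝ F E]
  [ContMDiffVectorBundle ∞ F E I] [IsManifold I ∞ M] [I.Boundaryless]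
  [FiniteDimensional ℝ B] [FiniteDimensional ℝ F] [T2Space M]

/-- The values of a vertical cochain on the fiber `E_p` depend only on the restrictions of the
arguments to `E_p`: if `f` vanishes on `E_p`, then near `E_p` it is a combination of functions on
the base which vanish at `p`, and these can be pulled out of the cochain. -/
theorem descends_restrictHom (p : M) :
    Descends (restrictHom I F E p) (Set.range (pullback I F E)) ∅ where
  surjective := restrictHom_surjective I F p
  subset := empty_subset _
  map_eq_zero φ i f hf := by
    obtain ⟨χ, n, u, g, hχ, hu, h⟩ := exists_eq_sum_of_restrictHom_eq_zero hf
    have h1 : φ.1 (Function.update f i (pullback I F E χ * f i)) = pullback I F E χ * φ.1 f :=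
      φ.2.2 _ ⟨χ, rfl⟩ i f
    have h2 : ∀ l, φ.1 (Function.update f i (pullback I F E (u l) * g l)) =
        pullback I F E (u l) * φ.1 (Function.update f i (g l)) := fun l => by
      have := φ.2.2 _ ⟨u l, rfl⟩ i (Function.update f i (g l))
      rwa [Function.update_idem, Function.update_self] at this
    rw [h, ← MultilinearMap.toLinearMap_apply, map_sum] at h1
    simp only [MultilinearMap.toLinearMap_apply, h2] at h1
    have h3 : ∀ w : SmoothFun I M, restrictHom I F E p (pullback I F E w) =
        algebraMap ℝ _ (w p) := fun w => rfl
    have h4 := congrArg (restrictHom I F E p) h1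
    simp only [map_sum, map_mul, h3, hu, hχ, map_zero, zero_mul, Finset.sum_const_zero, map_one,
      one_mul] at h4
    exact h4.symm

variable {I F E}

theorem dAt_restrictFun (p : M) (f : SmoothFun (I.prod 𝓘(ℝ, F)) (TotalSpace F E)) (v : Fiber E p) :
    dAt 𝓘(ℝ, F) (restrictFun I F E p f) v = (dAt (I.prod 𝓘(ℝ, F)) f (fiberIncl F p v)).comp
      (mfderiv 𝓘(ℝ, F) (I.prod 𝓘(ℝ, F)) (fiberIncl F p) v) :=
  mfderiv_comp v (f.mdifferentiableAt _)
    ((contMDiff_fiberIncl I F E p).mdifferentiable (by simp) v)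

/-- A multivector field restricts to a given field on the fiber if and only if the associated
multiderivations are related by the restriction of functions. -/
theorem isFieldRestriction_iff {p : M} {k : ℕ} {X : VerticalField I F E k}
    {Y : FiberField F E p k} : IsFieldRestriction p X Y ↔
      IsRelated (restrictHom I F E p) (evalCochain X) (evalCochain Y) := by
  have := t2Space_totalSpace F E
  refine ⟨fun h f => ?_, fun h v α => ?_⟩
  · ext v
    change Y.1 v (fun i => dAt 𝓘(ℝ, F) (restrictFun I F E p (f i)) v) =
      X.1 (fiberIncl F p v) fun i => dAt (I.prod 𝓘(ℝ, F)) (f i) (fiberIncl F p v)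
    simp only [dAt_restrictFun]
    exact (h v _).symm
  · choose f hf using fun i => exists_dAt_eq (fiberIncl F p v) (α i)
    have h1 := DFunLike.congr_fun (h f) v
    change Y.1 v (fun i => dAt 𝓘(ℝ, F) (restrictFun I F E p (f i)) v) =
      X.1 (fiberIncl F p v) (fun i => dAt (I.prod 𝓘(ℝ, F)) (f i) (fiberIncl F p v)) at h1
    simp only [dAt_restrictFun, hf] at h1
    exact h1.symm

variable (I F E)

theorem isConstantAlong_empty (p : M) : IsConstantAlong (fun _ : Fiber E p => ⊤)
    (∅ : Set (SmoothFun 𝓘(ℝ, F) (Fiber E p))) :=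
  fun _ hs => hs.elim

variable {I E} {ι : Type*}
  (L : FibredAtlas (verticalSpace I F E) (Set.range (pullback I F E)) ι)

/-- The restriction of vertical multivector fields to the fiber `E_p`, obtained from the restriction
of cohomology classes. -/
def fieldRestriction (p : M) (k : ℕ) : VerticalField I F E k →ₗ[ℝ] FiberField F E p k :=
  have : T2Space (TotalSpace F E) := t2Space_totalSpace F E
  have : T2Space (Fiber E p) := (fiberHomeomorph F E p).symm.t2Space
  (descends_restrictHom I F E p).onField L (isConstantAlong_pullback I F E)
    (fiberFibredAtlas F E p) (isConstantAlong_empty F E p) k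

variable {F} {p : M} {k : ℕ}

/-- The square of HKR maps and restrictions commutes in cohomology. -/
theorem fiberHKRClass_fieldRestriction (X : VerticalField I F E k) :
    fiberHKRClass F E p k (fieldRestriction F L p k X) =
      (descends_restrictHom I F E p).onHH k (verticalHKRClass I F E k X) :=
  have : T2Space (TotalSpace F E) := t2Space_totalSpace F E
  have : T2Space (Fiber E p) := (fiberHomeomorph F E p).symm.t2Space
  (descends_restrictHom I F E p).hkr_onField L (isConstantAlong_pullback I F E)
    (fiberFibredAtlas F E p) (isConstantAlong_empty F E p) X

theorem isRelated_fieldRestriction (X : VerticalField I F E k) : IsRelated (restrictHom I F E p)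
    (evalCochain X) (evalCochain (fieldRestriction F L p k X)) :=
  have : T2Space (TotalSpace F E) := t2Space_totalSpace F E
  have : T2Space (Fiber E p) := (fiberHomeomorph F E p).symm.t2Space
  (descends_restrictHom I F E p).isRelated_onField L (isConstantAlong_pullback I F E)
    (fiberFibredAtlas F E p) (isConstantAlong_empty F E p) X

/-- Existence and uniqueness of the restriction of a vertical multivector field. -/
theorem isFieldRestriction_iff_eq {X : VerticalField I F E k} {Y : FiberField F E p k} :
    IsFieldRestriction p X Y ↔ Y = fieldRestriction F L p k X := by
  have : T2Space (Fiber E p) := (fiberHomeomorph F E p).symm.t2Space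
  refine isFieldRestriction_iff.trans ⟨fun hY => evalCochain_injective ?_,
    fun hY => hY ▸ isRelated_fieldRestriction L X⟩
  exact hY.unique (restrictHom_surjective I F p) (isRelated_fieldRestriction L X)

/-- The square of HKR maps and restrictions commutes on the level of cochains. -/
theorem onCochain_verticalHKR (X : VerticalField I F E k) :
    (descends_restrictHom I F E p).onCochain k (verticalHKR I F E k X).1 =
      (fiberHKR F E p k (fieldRestriction F L p k X)).1 :=
  ((descends_restrictHom I F E p).isRelated_iff.1
    ((isRelated_fieldRestriction L X).smul _)).symm

/-- The Gerstenhaber algebra of vertical multivector fields. -/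
def verticalGerstenhaber : GerstenhaberAlgebra fun k => VerticalField I F E k :=
  have : T2Space (TotalSpace F E) := t2Space_totalSpace F E
  L.schoutenGerstenhaber (isConstantAlong_pullback I F E)

theorem isSchoutenGerstenhaber_verticalGerstenhaber :
    IsSchoutenGerstenhaber (verticalGerstenhaber L) :=
  have : T2Space (TotalSpace F E) := t2Space_totalSpace F E
  L.isSchoutenGerstenhaber (isConstantAlong_pullback I F E)

theorem isGerstenhaberHom_verticalHKRClass : IsGerstenhaberHom (verticalGerstenhaber L)
    (hochschildGerstenhaber _ _) (verticalHKRClass I F E) :=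
  have : T2Space (TotalSpace F E) := t2Space_totalSpace F E
  L.isGerstenhaberHom_hkr (isConstantAlong_pullback I F E)

variable (F E) in
/-- The Gerstenhaber algebra of multivector fields on the fiber `E_p`. -/
def fiberGerstenhaber (p : M) : GerstenhaberAlgebra fun k => FiberField F E p k :=
  have : T2Space (Fiber E p) := (fiberHomeomorph F E p).symm.t2Space
  (fiberFibredAtlas F E p).schoutenGerstenhaber (isConstantAlong_empty F E p)

variable (F E) in
theorem isSchoutenGerstenhaber_fiberGerstenhaber (p : M) :
    IsSchoutenGerstenhaber (fiberGerstenhaber F E p) :=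
  have : T2Space (Fiber E p) := (fiberHomeomorph F E p).symm.t2Space
  (fiberFibredAtlas F E p).isSchoutenGerstenhaber (isConstantAlong_empty F E p)

variable (F E) in
theorem isGerstenhaberHom_fiberHKRClass (p : M) : IsGerstenhaberHom (fiberGerstenhaber F E p)
    (hochschildGerstenhaber _ _) (fiberHKRClass F E p) :=
  have : T2Space (Fiber E p) := (fiberHomeomorph F E p).symm.t2Space
  (fiberFibredAtlas F E p).isGerstenhaberHom_hkr (isConstantAlong_empty F E p)

theorem isGerstenhaberHom_fieldRestriction (p : M) :
    IsGerstenhaberHom (verticalGerstenhaber L) (fiberGerstenhaber F E p) (fieldRestriction F L p) :=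
  have : T2Space (TotalSpace F E) := t2Space_totalSpace F E
  have : T2Space (Fiber E p) := (fiberHomeomorph F E p).symm.t2Space
  (descends_restrictHom I F E p).isGerstenhaberHom_onField L (isConstantAlong_pullback I F E)
    (fiberFibredAtlas F E p) (isConstantAlong_empty F E p)

variable (I F E) in
theorem verticalHKRClass_bijective [SecondCountableTopology M] (k : ℕ) :
    Function.Bijective (verticalHKRClass I F E k) := by
  have : T2Space (TotalSpace F E) := t2Space_totalSpace F E
  obtain ⟨L⟩ := nonempty_fibredAtlas_totalSpace I F E
  exact L.hkr_bijective (isConstantAlong_pullback I F E)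

end Fiber

end VerticalHKR

end

open VerticalHKR Bundle in
theorem mainTheorem3 {B : Type*} [NormedAddCommGroup B] [NormedSpace ℝ B] [FiniteDimensional ℝ B]
    {H : Type*} [TopologicalSpace H] (I : ModelWithCorners ℝ B H) [I.Boundaryless]
    {M : Type*} [TopologicalSpace M] [ChartedSpace H M] [IsManifold I ∞ M]
    [T2Space M] [SecondCountableTopology M]
    (F : Type*) [NormedAddCommGroup F] [NormedSpace ℝ F] [FiniteDimensional ℝ F]
    (E : M → Type*) [∀ x, AddCommGroup (E x)] [∀ x, Module ℝ (E x)]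
    [∀ x, TopologicalSpace (E x)] [TopologicalSpace (TotalSpace F E)] [FiberBundle F E]
    [VectorBundle ℝ F E] [ContMDiffVectorBundle ∞ F E I] :
    ∃ (GE : GerstenhaberAlgebra fun k => VerticalField I F E k)
      (HE : GerstenhaberAlgebra fun k => VerticalHH I F E k),
      IsSchoutenGerstenhaber GE ∧ IsHochschildGerstenhaber HE ∧
      -- the vertical HKR map is an isomorphism of Gerstenhaber algebras
      IsGerstenhaberHom GE HE (verticalHKRClass I F E) ∧
      (∀ k, Function.Bijective (verticalHKRClass I F E k)) ∧
      ∀ p : M, ∃ (GF : GerstenhaberAlgebra fun k => FiberField F E p k)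
        (HF : GerstenhaberAlgebra fun k => FiberHH F E p k),
        IsSchoutenGerstenhaber GF ∧ IsHochschildGerstenhaber HF ∧
        -- the restriction maps to the fiber over `p`: of vertical multivector fields, of vertical
        -- cochains and of vertical cohomology classes
        ∃ (rX : ∀ k, VerticalField I F E k →ₗ[ℝ] FiberField F E p k)
          (rC : ∀ k, VerticalCochain I F E k →ₗ[ℝ] FiberCochain F E p k)
          (rH : ∀ k, VerticalHH I F E k →ₗ[ℝ] FiberHH F E p k),
          (∀ k X Y, IsFieldRestriction p X Y ↔ Y = rX k X) ∧
          (∀ k φ χ, IsCochainRestriction p φ χ ↔ χ = rC k φ) ∧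
          (∀ k φ, rC (k + 1) (diffCochain.d k φ) = diffCochain.d k (rC k φ)) ∧
          (∀ (m n q : ℕ) (h : m + n = q) φ ψ,
            rC q (diffCochain.cup h φ ψ) = diffCochain.cup h (rC m φ) (rC n ψ)) ∧
          (∀ (m n q : ℕ) (h : m + n = q + 1) φ ψ,
            rC q (diffCochain.bracket h φ ψ) = diffCochain.bracket h (rC m φ) (rC n ψ)) ∧
          (∀ k (φ : Cocycle (SmoothFun (I.prod 𝓘(ℝ, F)) (TotalSpace F E))
              (Set.range (pullback I F E)) k),
            ∃ c : Cocycle (SmoothFun 𝓘(ℝ, F) (Fiber E p)) ∅ k,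
              c.1 = rC k φ.1 ∧ rH k (HH.mk k φ) = HH.mk k c) ∧
          -- the square commutes, for cochains and in cohomology
          (∀ k X, rC k (verticalHKR I F E k X).1 = (fiberHKR F E p k (rX k X)).1) ∧
          (∀ k X, rH k (verticalHKRClass I F E k X) = fiberHKRClass F E p k (rX k X)) ∧
          -- all maps are homomorphisms of Gerstenhaber algebras
          IsGerstenhaberHom GE GF rX ∧
          IsGerstenhaberHom HE HF rH ∧
          IsGerstenhaberHom GF HF (fiberHKRClass F E p) := by
  have L := (nonempty_fibredAtlas_totalSpace I F E).some
  refine ⟨verticalGerstenhaber L, hochschildGerstenhaber _ _, ?_⟩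
  refine ⟨isSchoutenGerstenhaber_verticalGerstenhaber L, ?_⟩
  refine ⟨isHochschildGerstenhaber, ?_⟩
  refine ⟨isGerstenhaberHom_verticalHKRClass L, ?_⟩
  refine ⟨verticalHKRClass_bijective I F E, fun p => ?_⟩
  refine ⟨fiberGerstenhaber F E p, hochschildGerstenhaber _ _, ?_⟩
  refine ⟨isSchoutenGerstenhaber_fiberGerstenhaber F E p, ?_⟩
  refine ⟨isHochschildGerstenhaber, ?_⟩
  have h := descends_restrictHom I F E p
  refine ⟨fieldRestriction F L p, h.onCochain, h.onHH, ?_⟩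
  refine ⟨fun k X Y => isFieldRestriction_iff_eq L, ?_⟩
  refine ⟨fun k φ χ => h.isRelated_iff, ?_⟩
  refine ⟨fun k φ => h.onCochain_d φ, ?_⟩
  refine ⟨fun m n q hq φ ψ => h.onCochain_cup hq φ ψ, ?_⟩
  refine ⟨fun m n q hq φ ψ => h.onCochain_bracket hq φ ψ, ?_⟩
  refine ⟨fun k φ => ⟨h.onCocycle k φ, rfl, rfl⟩, ?_⟩
  refine ⟨fun k X => onCochain_verticalHKR L X, ?_⟩
  refine ⟨fun k X => (fiberHKRClass_fieldRestriction L X).symm, ?_⟩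
  refine ⟨isGerstenhaberHom_fieldRestriction L p, ?_⟩
  exact ⟨h.isGerstenhaberHom_onHH, isGerstenhaberHom_fiberHKRClass F E p⟩
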